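/- **Model.** Let $p\ge 1$ and let $(\Omega,\mathcal F,\mathrm P)$ be a probability space. A multitype branching process with random migration (MBPM) is a sequence of $\mathbb Z_+^p$-valued random vectors given by $$\boldsymbol Z_{k+1}=\sum_{i=1}^p\ \sum_{j=1}^{Z_{k,i}+M_{k,i}(\boldsymbol Z_k)}\boldsymbol X_{k,j,i},\qquad k\in\mathbb Z_+ ,$$ where $\boldsymbol Z_0$, $\boldsymbol X_{k,j,i}$ and $\boldsymbol M_k(\boldsymbol z)$ ($k\in\mathbb Z_+$, $j\ge1$, $1\le i\le p$, $\boldsymbol z\in\mathbb Z_+^p$) are independent random vectors; the $\boldsymbol X_{k,j,i}$ are $\mathbb Z_+^p$-valued with a law that depends only on $i$; and the $\boldsymbol M_k(\boldsymbol z)$ are $\mathbb Z^p$-valued with a law that depends only on $\boldsymbol z$, where $M_{k,i}(\boldsymbol z)$ equals $0$, $I_{k,i}(\boldsymbol z)$ or $-D_{k,i}(\boldsymbol z)$ with probabilities $p_i(\boldsymbol z)$, $q_i(\boldsymbol z)$, $r_i(\boldsymbol z)$ (with sum $1$, and $r_i(\boldsymbol z)=0$ if $z_i=0$), the choice being independent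 of $(I_{k,i}(\boldsymbol z),D_{k,i}(\boldsymbol z))$. Here $\boldsymbol I_k(\boldsymbol z)$ and $\boldsymbol D_k(\boldsymbol z)$ are $\mathbb Z_+^p$-valued with laws that do not depend on $k$, and $D_{k,i}(\boldsymbol z)=0$ if $z_i=0$, $1\le D_{k,i}(\boldsymbol z)\le z_i$ if $z_i>0$. The $\boldsymbol X_{0,1,i}$ and $\boldsymbol M_0(\boldsymbol z)$ have finite second moments. Put $\mathsf m=(\mathrm E\boldsymbol X_{0,1,1},\dots,\mathrm E\boldsymbol X_{0,1,p})$ (as columns), $\boldsymbol h(\boldsymbol z)=\mathrm E\boldsymbol M_0(\boldsymbol z)$ and $\sigma^2(\boldsymbol z)=\mathrm{Var}(\boldsymbol u^\top\boldsymbol Z_{n+1}\mid\boldsymbol Z_n=\boldsymbol z)$, with $\boldsymbol u$ as follows. **Standing assumptions.** (A) $\mathsf m$ is primitive with Perron–Frobenius eigenvalue $1$; $\boldsymbol u,\boldsymbol v$ are its left and right eigenvectors for the eigenvalue $1$ with positive coordinates, $\sum_iu_i=1$ and $\boldsymbol u^\top\boldsymbol v=1$. (B) $h_i(\boldsymbol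 z)=\mathrm o(\|\boldsymbol z\|)$ for each $i$ as $\|\boldsymbol z\|\to\infty$. (C) For every $\boldsymbol z\neq\boldsymbol 0$, with positive probability one has, for all $i$ with $z_i>0$, that $I_{0,i}(\boldsymbol z)>0$ and $\boldsymbol X_{0,j,i}\ne\boldsymbol 0$ for $1\le j\le z_i+I_{0,i}(\boldsymbol z)$. The process is not almost surely identically $\boldsymbol 0$. There is a positive $C^2$ function $\overline h$ on $(0,\infty)$ with $\boldsymbol u^\top\boldsymbol h(\boldsymbol z)=\overline h(\boldsymbol u^\top\boldsymbol z)$ for all $\boldsymbol z\ne\boldsymbol 0$; let $a_0=1$, $a_{n+1}=a_n+\overline h(a_n)$. **Theorem.** Suppose that, as $\|\boldsymbol z\|\to\infty$: (i) $h_i(\boldsymbol z)=c_i(\boldsymbol u^\top\boldsymbol z)^\alpha+\mathrm o((\boldsymbol u^\top\boldsymbol z)^\alpha)$ for each $i$, where $\alpha<1$ and $\boldsymbol c\in\mathbb R^p$ with $\boldsymbol u^\top\boldsymbol c>0$; (ii) $\sigma^2(\boldsymbol z)=\nu(\boldsymbol u^\top\boldsymbol z)^\beta+\mathrm o((\boldsymbol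 u^\top\boldsymbol z)^\beta)$, where $\beta\le1+\alpha$ and $\nu>0$; (iii) $\max_i\{\mathrm E|z_i+M_{0,i}(\boldsymbol z)|^{1+\delta/2},\ \mathrm E|M_{0,i}(\boldsymbol z)-h_i(\boldsymbol z)|^{2+\delta}\}=\mathrm O((\sigma^2(\boldsymbol z))^{1+\delta/2})$ for some $\delta\in(0,1]$; (iv) $\max_i|h_i(\boldsymbol z)|=\mathrm O((\boldsymbol u^\top\boldsymbol z)^{\delta_1})$, where $\delta_1<1$; (v) $\max_i\{z_i+h_i(\boldsymbol z),\ \mathrm E|M_{0,i}(\boldsymbol z)-h_i(\boldsymbol z)|^{\tilde\alpha}\}=\mathrm O((\boldsymbol u^\top\boldsymbol z)^{\delta_2\tilde\alpha})$, where $1<\tilde\alpha\le2$ and $\delta_2<1$. Then: a) If $\beta=1+\alpha$ and $\nu<2\boldsymbol u^\top\boldsymbol c$, then $\mathrm P(\|\boldsymbol Z_n\|\to\infty)>0$ and, for every $\boldsymbol x\in\mathbb R^p$ (with componentwise inequalities), $$\lim_{n\to\infty}\mathrm P\left(\frac{\boldsymbol Z_n}{n^{1/(1-\alpha)}}\le\boldsymbol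 x\ \Big|\ \|\boldsymbol Z_n\|\to\infty\right)=F_{\boldsymbol vZ}(\boldsymbol x),$$ where $F_{\boldsymbol vZ}$ is the distribution function of $\boldsymbol vZ$ and $Z\ge0$ is a random variable such that $Z^{1-\alpha}$ has the gamma distribution with shape $\frac{2\boldsymbol u^\top\boldsymbol c-\nu\alpha}{\nu(1-\alpha)}$ and scale $\frac{\nu(1-\alpha)^2}2$. b) If $0<\alpha<1$ and $\beta<1+\alpha$, then $\mathrm P(\|\boldsymbol Z_n\|\to\infty)>0$ and, provided $\mathrm E\|\boldsymbol Z_0\|<\infty$, on $\{\|\boldsymbol Z_n\|\to\infty\}$ the sequence $n^{1/(\alpha-1)}\boldsymbol Z_n$ converges in $L^1$ to $((\boldsymbol u^\top\boldsymbol c)(1-\alpha))^{1/(1-\alpha)}\boldsymbol v$. Moreover, if $\overline h''(x)=\mathrm O(x^{\alpha-2})$ as $x\to\infty$, $\beta\ge3\alpha-1$ and $\max\{\delta_1,\delta_2\}\le(\beta-\alpha+1)/2$, then for every $\boldsymbol x\in\mathbb R^p$ $$\lim_{n\to\infty}\mathrm P\left(\frac{\boldsymbol Z_n-\boldsymbol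 va_n}{\Lambda_n}\le\boldsymbol x\ \Big|\ \|\boldsymbol Z_n\|\to\infty\right)=F_{\boldsymbol vU}(\boldsymbol x),$$ where $F_{\boldsymbol vU}$ is the distribution function of $\boldsymbol vU$, $U$ is standard normal and $$\Lambda_n=\begin{cases}\nu^{1/2}((\boldsymbol u^\top\boldsymbol c)(1-\alpha))^{(3\alpha-1)/(2(1-\alpha))}\,n^{\alpha/(1-\alpha)}(\log n)^{1/2}&\text{if }\beta=3\alpha-1,\\[2pt] \left(\nu(\beta-3\alpha+1)^{-1}(\boldsymbol u^\top\boldsymbol c)^{\beta/(1-\alpha)}((1-\alpha)n)^{(\beta-\alpha+1)/(1-\alpha)}\right)^{1/2}&\text{if }\beta>3\alpha-1.\end{cases}$$ -/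

import Mathlib

open MeasureTheory ProbabilityTheory Filter Topology Asymptotics

/-- What the migration does to one type in one generation. -/
inductive MigrationKind where
  | noMigration
  | immigration
  | emigration

instance : MeasurableSpace MigrationKind := ⊤

/-- The migration of one type, given its kind, the number `a` of potential immigrants and the
number `d` of potential emigrants. -/
def migrationValue (κ : MigrationKind) (a d : ℕ) : ℤ :=
  match κ with
  | .noMigration => 0
  | .immigration => (a : ℤ)
  | .emigration => -(d : ℤ)

/-- Index set of the family of independent random vectors which drive the process: the initial
generation, the offspring vectors `X k j i` and the migration vectors `M k z`. -/
inductive SourceIndex (p : ℕ) where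
  | start : SourceIndex p
  | offspring (k j : ℕ) (i : Fin p) : SourceIndex p
  | migration (k : ℕ) (z : Fin p → ℕ) : SourceIndex p

/-- The `ℤ^p`-valued random vector attached to an index. -/
def sourceVector {Ω : Type*} {p : ℕ} (Z₀ : Ω → Fin p → ℕ) (X : ℕ → ℕ → Fin p → Ω → Fin p → ℕ)
    (M : ℕ → (Fin p → ℕ) → Ω → Fin p → ℤ) : SourceIndex p → Ω → Fin p → ℤ
  | .start => fun ω a => (Z₀ ω a : ℤ)
  | .offspring k j i => fun ω a => (X k j i ω a : ℤ)
  | .migration k z => M k z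

/-- Multitype branching process with random migration, with `p` types, on the probability space
`(Ω, P)`. Individuals are numbered from `0`. -/
structure MBPM {Ω : Type*} [MeasurableSpace Ω] (P : Measure Ω) (p : ℕ) where
  /-- `X k j i` is the vector of offspring of the `j`-th individual of type `i` in generation
  `k`. -/
  X : ℕ → ℕ → Fin p → Ω → Fin p → ℕ
  /-- `I k z` is the vector of the numbers of potential immigrants in generation `k`, when the
  state is `z`. -/
  I : ℕ → (Fin p → ℕ) → Ω → Fin p → ℕ
  /-- `D k z` is the vector of the numbers of potential emigrants in generation `k`, when the
  state is `z`. -/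
  D : ℕ → (Fin p → ℕ) → Ω → Fin p → ℕ
  /-- `kind k z ω i` says which of the three cases occurs for type `i`. -/
  kind : ℕ → (Fin p → ℕ) → Ω → Fin p → MigrationKind
  /-- the migration vectors -/
  M : ℕ → (Fin p → ℕ) → Ω → Fin p → ℤ
  /-- the probabilities of no migration, of immigration, and of emigration -/
  probNone : (Fin p → ℕ) → Fin p → ℝ
  probImm : (Fin p → ℕ) → Fin p → ℝ
  probEmi : (Fin p → ℕ) → Fin p → ℝ
  /-- the process -/
  Z : ℕ → Ω → Fin p → ℕ
  measurable_X : ∀ k j i, Measurable (X k j i)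
  measurable_I : ∀ k z, Measurable (I k z)
  measurable_D : ∀ k z, Measurable (D k z)
  measurable_kind : ∀ k z i, Measurable fun ω => kind k z ω i
  measurable_Z_zero : Measurable (Z 0)
  identDistrib_X : ∀ k j i, IdentDistrib (X k j i) (X 0 0 i) P P
  identDistrib_I : ∀ k z, IdentDistrib (I k z) (I 0 z) P P
  identDistrib_D : ∀ k z, IdentDistrib (D k z) (D 0 z) P P
  identDistrib_M : ∀ k z, IdentDistrib (M k z) (M 0 z) P P
  D_eq_zero : ∀ k z ω i, z i = 0 → D k z ω i = 0
  one_le_D : ∀ k z ω i, 0 < z i → 1 ≤ D k z ω i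
  D_le : ∀ k z ω i, D k z ω i ≤ z i
  M_eq : ∀ k z ω i, M k z ω i = migrationValue (kind k z ω i) (I k z ω i) (D k z ω i)
  prob_none : ∀ k z i, P.real {ω | kind k z ω i = .noMigration} = probNone z i
  prob_imm : ∀ k z i, P.real {ω | kind k z ω i = .immigration} = probImm z i
  prob_emi : ∀ k z i, P.real {ω | kind k z ω i = .emigration} = probEmi z i
  probEmi_eq_zero : ∀ z i, z i = 0 → probEmi z i = 0
  /-- which case occurs is chosen independently of the numbers of potential migrants -/
  indep_kind : ∀ k z i,
    IndepFun (fun ω => kind k z ω i) (fun ω => (I k z ω i, D k z ω i)) P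
  /-- the initial generation, the offspring vectors and the migration vectors are independent -/
  indep : iIndepFun (sourceVector (Z 0) X M) P
  /-- the recursion; `z i + M k z ω i` is never negative -/
  Z_succ : ∀ k ω, Z (k + 1) ω =
    ∑ i, ∑ j ∈ Finset.range ((Z k ω i : ℤ) + M k (Z k ω) ω i).toNat, X k j i ω

/-- A population vector as a real vector. -/
def realVec {p : ℕ} (z : Fin p → ℕ) : Fin p → ℝ := fun i => (z i : ℝ)

/-- The filter of `‖z‖ → ∞` on population vectors. -/
noncomputable def growing (p : ℕ) : Filter (Fin p → ℕ) :=
  comap (fun z => ‖realVec z‖) atTop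

namespace MBPM

variable {Ω : Type*} [MeasurableSpace Ω] {P : Measure Ω} {p : ℕ}

/-- The offspring mean matrix; its `i`-th column is the mean of the offspring vector of an
individual of type `i`. -/
noncomputable def meanMatrix (W : MBPM P p) : Matrix (Fin p) (Fin p) ℝ :=
  Matrix.of fun a i => ∫ ω, (W.X 0 0 i ω a : ℝ) ∂P

/-- The mean of the migration vector in state `z`. -/
noncomputable def h (W : MBPM P p) (z : Fin p → ℕ) : Fin p → ℝ :=
  fun i => ∫ ω, (W.M 0 z ω i : ℝ) ∂P

/-- The next generation when the current state is `z`; its law is the law of `Z (k + 1)` given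
`Z k = z`, for every `k`. -/
def next (W : MBPM P p) (z : Fin p → ℕ) (ω : Ω) : Fin p → ℕ :=
  ∑ i, ∑ j ∈ Finset.range ((z i : ℤ) + W.M 0 z ω i).toNat, W.X 0 j i ω

/-- The conditional variance of `uᵀ Z (k + 1)` given `Z k = z`. -/
noncomputable def sigmaSq (W : MBPM P p) (u : Fin p → ℝ) (z : Fin p → ℕ) : ℝ :=
  variance (fun ω => u ⬝ᵥ realVec (W.next z ω)) P

/-- The offspring vectors and the migration vectors have finite second moments. -/
def FiniteSecondMoments (W : MBPM P p) : Prop :=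
  (∀ i a, MemLp (fun ω => (W.X 0 0 i ω a : ℝ)) 2 P) ∧
    ∀ z i, MemLp (fun ω => (W.M 0 z ω i : ℝ)) 2 P

/-- The process is critical: the mean matrix is primitive, with Perron-Frobenius eigenvalue `1`. -/
def HypothesisA (W : MBPM P p) : Prop :=
  W.meanMatrix.IsPrimitive ∧ spectralRadius ℂ (W.meanMatrix.map (fun x : ℝ => (x : ℂ))) = 1

/-- `u` and `v` are the normalized positive left and right eigenvectors of the mean matrix, for the
eigenvalue `1`. -/
def PerronVectors (W : MBPM P p) (u v : Fin p → ℝ) : Prop :=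
  Matrix.vecMul u W.meanMatrix = u ∧ W.meanMatrix.mulVec v = v ∧
    (∀ i, 0 < u i) ∧ (∀ i, 0 < v i) ∧ ∑ i, u i = 1 ∧ u ⬝ᵥ v = 1

/-- The mean migration is of smaller order than the population size. -/
def HypothesisB (W : MBPM P p) : Prop :=
  ∀ i, (fun z => W.h z i) =o[growing p] fun z => ‖realVec z‖

/-- From every non-null state, with positive probability, there are immigrants of each type that
is present and all individuals of these types have offspring. -/
def CanGrow (W : MBPM P p) : Prop :=
  ∀ z : Fin p → ℕ, z ≠ 0 →
    0 < P {ω | ∀ i, 0 < z i →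
      0 < W.I 0 z ω i ∧ ∀ j < z i + W.I 0 z ω i, W.X 0 j i ω ≠ 0}

/-- The event of unlimited growth. -/
def Unlimited (W : MBPM P p) : Set Ω :=
  {ω | Tendsto (fun n => ‖realVec (W.Z n ω)‖) atTop atTop}

end MBPM

/-- The solution of `a 0 = 1`, `a (n + 1) = a n + g (a n)`. -/
noncomputable def driftSeq (g : ℝ → ℝ) : ℕ → ℝ
  | 0 => 1
  | n + 1 => driftSeq g n + g (driftSeq g n)

/-- The law of the non-negative random variable whose `s`-th power has the gamma distribution with
shape `k` and scale `θ` (Mathlib's gamma distribution takes the rate `θ⁻¹`). -/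
noncomputable def gammaRootLaw (s k θ : ℝ) : Measure ℝ :=
  (gammaMeasure k θ⁻¹).map fun y => y ^ (1 / s)

/-- The distribution function, on `ℝ^p` with the componentwise order, of the random vector `R v`,
where the real random variable `R` has law `μ`. -/
noncomputable def cdfAlong {p : ℕ} (μ : Measure ℝ) (v x : Fin p → ℝ) : ℝ :=
  μ.real {t | ∀ i, t * v i ≤ x i}

/-- The normalizing sequence, with `C` for the inner product of `u` and `c`. -/
noncomputable def Lam (α β ν C : ℝ) (n : ℕ) : ℝ :=
  if β = 3 * α - 1 then
    ν ^ (1 / 2 : ℝ) * (C * (1 - α)) ^ ((3 * α - 1) / (2 * (1 - α))) *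
      (n : ℝ) ^ (α / (1 - α)) * (Real.log n) ^ (1 / 2 : ℝ)
  else
    (ν * (β - 3 * α + 1)⁻¹ * C ^ (β / (1 - α)) *
      ((1 - α) * n) ^ ((β - α + 1) / (1 - α))) ^ (1 / 2 : ℝ)

section

open ENNReal (ofReal ofReal_mul ofReal_le_ofReal ofReal_add ofReal_ne_top ofReal_sum_of_nonneg
  toReal_ofReal tendsto_nhds_zero toReal_mul one_le_ofReal tendsto_toReal tendsto_ofReal
  ofReal_lt_top ofReal_natCast toReal_mono)
open Real (exp rpow_mul rpow_nonneg mul_rpow rpow_one rpow_sub exp_pos norm_of_nonneg rpow_natCast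
  norm_eq_abs rpow_add exp_le_one_iff rpow_pos_of_pos rpow_le_rpow_of_exponent_le rpow_le_rpow
  rpow_neg rpow_le_rpow_of_nonpos dist_eq log rpow_two one_le_rpow exp_add div_rpow sqrt
  rpow_sub_one rpow_le_one sqrt_eq_rpow inv_rpow exp_le_exp one_rpow Gamma)
open Finset (range sum_nonneg sum_le_sum sum_congr sum_range_succ mul_sum sum_mul single_le_sum
  mem_univ univ sum_add_distrib Ico sum_sub_distrib mem_range abs_sum_le_sum_abs sum_range_sub
  sum_comm sum_const mem_Ico)
open Nat (cast_nonneg cast_pos le_succ)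
open Set (indicator mem_ofPred_eq Iic indicator_of_mem indicator_of_notMem Ioi Iio Ici Icc)

/-- The size of a population vector in a direction. -/
local notation:72 u:73 " ⊙ " z:73 => dotProduct u (realVec z)

namespace MBPM

set_option linter.unusedSectionVars false

variable {Ω : Type*} [mΩ : MeasurableSpace Ω] {P : Measure Ω} {p : ℕ} [IsProbabilityMeasure P]
  {W : MBPM P p} {u v : Fin p → ℝ} {C α β ν θ γ δ K x₀ : ℝ} {f H H₁ : ℝ → ℝ}

/-- The state of a population with `p` types. -/
local notation "Pop" => Fin p → ℕ

/-- Real vectors indexed by the types. -/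
local notation "Vec" => Fin p → ℝ

local notation "✓" => by positivity

/-- The point of the unit circle with a given angle. -/
local notation "cis" t:max => Complex.exp ((t : ℝ) * Complex.I)

/-- The deviation of the size of the next generation from its mean. -/
local notation "fluct" W:max u:max z:max o:max =>
  (dotProduct u (realVec (MBPM.next W z o)) - (dotProduct u (realVec z) + dotProduct u (MBPM.h W z)))

theorem mul_le_left {a b c : ℝ} (h : b ≤ c) (ha : 0 ≤ a := by positivity) : a * b ≤ a * c :=
  mul_le_mul_of_nonneg_left h ha

theorem mul_le_right {a b c : ℝ} (h : b ≤ c) (ha : 0 ≤ a := by positivity) : b * a ≤ c * a :=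
  mul_le_mul_of_nonneg_right h ha

theorem measurable_random_index {Ω ι E : Type*} {m : MeasurableSpace Ω} [MeasurableSpace ι]
  [Countable ι] [MeasurableSingletonClass ι] [MeasurableSpace E] {N : Ω → ι} (hN : Measurable N)
  {G : ι → Ω → E} (hG : ∀ n, Measurable (G n)) : Measurable fun o => G (N o) o := by
  have h : Measurable (fun q : ι × Ω => G q.1 q.2) := measurable_from_prod_countable_right hG
  exact h.comp (hN.prodMk measurable_id)

theorem lintegral_random_index {Ω ι : Type*} {m₁ m₂ mΩ : MeasurableSpace Ω} {P : Measure Ω}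
  [MeasurableSpace ι] [Countable ι] [MeasurableSingletonClass ι] (h₁ : m₁ ≤ mΩ)
  (h₂ : m₂ ≤ mΩ) (hind : Indep m₁ m₂ P)
  {N : Ω → ι} (hN : Measurable[m₁] N) {g : Ω → ENNReal} (hg : Measurable[m₁] g)
  {G : ι → Ω → ENNReal} (hG : ∀ n, Measurable[m₂] (G n)) :
  ∫⁻ o, g o * G (N o) o ∂P = ∫⁻ o, g o * (∫⁻ o', G (N o) o' ∂P) ∂P := by
  have hNm : ∀ n, MeasurableSet[m₁] (N ⁻¹' {n}) := fun n => hN (measurableSet_singleton n)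
  have key : ∀ F : ι → Ω → ENNReal, (∀ n, Measurable (F n)) →
    ∫⁻ o, g o * F (N o) o ∂P = ∑' n, ∫⁻ o, (N ⁻¹' {n}).indicator g o * F n o ∂P := by
    intro F hF
    rw [← lintegral_tsum]
    · refine lintegral_congr fun o => ?_
      rw [tsum_eq_single (N o)]
      · simp
      · intro n hn
        simp [indicator, hn.symm]
    · intro n
      exact (((hg.mono h₁ le_rfl).indicator (h₁ _ (hNm n))).mul (hF n)).aemeasurable
  rw [key G fun n => (hG n).mono h₂ le_rfl,
    key (fun n _ => ∫⁻ o', G n o' ∂P) fun n => measurable_const]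
  refine tsum_congr fun n => ?_
  rw [lintegral_mul_eq_lintegral_mul_lintegral_of_independent_measurableSpace h₁ h₂ hind
    (hg.indicator (hNm n)) (hG n), lintegral_mul_const _
    ((hg.mono h₁ le_rfl).indicator (h₁ _ (hNm n)))]

theorem condExp_random_index {Ω ι E : Type*} {m₁ m₂ mΩ : MeasurableSpace Ω} {P : Measure Ω}
  [IsFiniteMeasure P] [NormedAddCommGroup E] [NormedSpace ℝ E] [CompleteSpace E]
  [MeasurableSpace ι] [Countable ι] [MeasurableSingletonClass ι]
  (h₁ : m₁ ≤ mΩ) (h₂ : m₂ ≤ mΩ) (hind : Indep m₁ m₂ P)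
  {N : Ω → ι} (hN : Measurable[m₁] N) {G : ι → Ω → E} (hG : ∀ n, StronglyMeasurable[m₂] (G n))
  (hint : ∀ n, Integrable (G n) P) (hint' : Integrable (fun o => G (N o) o) P) :
  P[fun o => G (N o) o | m₁] =ᵐ[P] fun o => ∫ o', G (N o) o' ∂P := by
  have hNm : ∀ n, MeasurableSet[m₁] (N ⁻¹' {n}) := fun n => hN (measurableSet_singleton n)
  have h1 : ∀ n, P[(N ⁻¹' {n}).indicator (fun o => G (N o) o) | m₁] =ᵐ[P]
    (N ⁻¹' {n}).indicator (fun _ => ∫ o', G n o' ∂P) := by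
    intro n
    have e : (N ⁻¹' {n}).indicator (fun o => G (N o) o) = (N ⁻¹' {n}).indicator (G n) := by
      ext o
      by_cases h : N o = n <;> simp [indicator, h]
    rw [e]
    refine (condExp_indicator (hint n) (hNm n)).trans ?_
    filter_upwards [condExp_indep_eq h₂ h₁ (hG n) hind.symm] with o ho
    simp [indicator, ho]
  have h2 : ∀ n, P[(N ⁻¹' {n}).indicator (fun o => G (N o) o) | m₁] =ᵐ[P]
    (N ⁻¹' {n}).indicator (P[fun o => G (N o) o | m₁]) :=
    fun n => condExp_indicator hint' (hNm n)
  filter_upwards [ae_all_iff.2 h1, ae_all_iff.2 h2] with o a b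
  have := (b (N o)).symm.trans (a (N o))
  simpa [indicator] using this

theorem measurable_sum_random_index {Ω : Type*} {m : MeasurableSpace Ω} (z : Pop)
  {M : Ω → Fin p → ℤ} (hM : Measurable M) {X : ℕ → Fin p → Ω → Pop}
  (hX : ∀ j i, Measurable (X j i)) :
  Measurable fun o => ∑ i, ∑ j ∈ range ((z i : ℤ) + M o i).toNat, X j i o := by
  refine Finset.measurable_fun_sum _ fun i _ => ?_
  refine measurable_random_index (N := fun o => ((z i : ℤ) + M o i).toNat)
    (G := fun n o => ∑ j ∈ range n, X j i o) ?_ fun n => ?_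
  · fun_prop
  · fun_prop

instance : Countable MigrationKind := by
  refine Function.Injective.countable (f := fun κ => match κ with
    | .noMigration => (0 : ℕ) | .immigration => 1 | .emigration => 2) ?_
  intro a b h
  cases a <;> cases b <;> simp_all

instance : MeasurableSingletonClass MigrationKind := ⟨fun _ => trivial⟩

variable (W)

theorem measurable_M (k : ℕ) (z : Pop) : Measurable (W.M k z) := by
  refine measurable_pi_lambda _ fun i => ?_
  have h : Measurable fun q : MigrationKind × ℕ × ℕ => migrationValue q.1 q.2.1 q.2.2 := by fun_prop
  have := h.comp ((W.measurable_kind k z i).prodMk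
    (((measurable_pi_apply i).comp (W.measurable_I k z)).prodMk
      ((measurable_pi_apply i).comp (W.measurable_D k z))))
  simp only [W.M_eq]
  exact this

theorem measurable_sourceVector (i : SourceIndex p) :
  Measurable (sourceVector (W.Z 0) W.X W.M i) := by
  cases i with
  | start =>
    refine measurable_pi_lambda _ fun a => ?_
    exact measurable_from_top.comp ((measurable_pi_apply a).comp W.measurable_Z_zero)
  | offspring k j i =>
    refine measurable_pi_lambda _ fun a => ?_
    exact measurable_from_top.comp ((measurable_pi_apply a).comp (W.measurable_X k j i))
  | migration k z => exact W.measurable_M k z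

/-- The σ-algebra generated by the sources with index in `S`. -/
abbrev sourceSigma (W : MBPM P p) (S : Set (SourceIndex p)) : MeasurableSpace Ω :=
  ⨆ i ∈ S, MeasurableSpace.comap (sourceVector (W.Z 0) W.X W.M i) inferInstance

theorem sourceSigma_le (S : Set (SourceIndex p)) : W.sourceSigma S ≤ mΩ :=
  iSup₂_le fun i _ => (W.measurable_sourceVector i).comap_le

theorem sourceSigma_mono {S T : Set (SourceIndex p)} (h : S ⊆ T) :
  W.sourceSigma S ≤ W.sourceSigma T :=
  biSup_mono h

theorem indep_sourceSigma {S T : Set (SourceIndex p)} (h : Disjoint S T) :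
  Indep (W.sourceSigma S) (W.sourceSigma T) P :=
  indep_iSup_of_disjoint (fun i => (W.measurable_sourceVector i).comap_le) W.indep.iIndep h

theorem measurable_sourceVector_sourceSigma {S : Set (SourceIndex p)}
  {i : SourceIndex p} (hi : i ∈ S) :
  Measurable[W.sourceSigma S] (sourceVector (W.Z 0) W.X W.M i) :=
  Measurable.of_comap_le (le_iSup₂_of_le i hi le_rfl)

theorem measurable_X_sourceSigma {S : Set (SourceIndex p)} {k j : ℕ} {i : Fin p}
  (hi : SourceIndex.offspring k j i ∈ S) : Measurable[W.sourceSigma S] (W.X k j i) := by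
  refine @measurable_pi_lambda _ _ _ (W.sourceSigma S) _ _ fun a => ?_
  have h := W.measurable_sourceVector_sourceSigma hi
  have h2 : Measurable fun f : Fin p → ℤ => (f a).toNat := by fun_prop
  exact h2.comp h

theorem measurable_M_sourceSigma {S : Set (SourceIndex p)} {k : ℕ} {z : Pop}
  (hi : SourceIndex.migration k z ∈ S) : Measurable[W.sourceSigma S] (W.M k z) :=
  W.measurable_sourceVector_sourceSigma hi

theorem measurable_Z_zero_sourceSigma {S : Set (SourceIndex p)}
  (hi : SourceIndex.start ∈ S) : Measurable[W.sourceSigma S] (W.Z 0) := by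
  refine @measurable_pi_lambda _ _ _ (W.sourceSigma S) _ _ fun a => ?_
  have h := W.measurable_sourceVector_sourceSigma hi
  have h2 : Measurable fun f : Fin p → ℤ => (f a).toNat := by fun_prop
  exact h2.comp h

variable {W}

/-- The sources used before generation `k`. -/
def past (p k : ℕ) : Set (SourceIndex p) := {i | match i with
  | .start => True
  | .offspring l _ _ => l < k
  | .migration l _ => l < k}

/-- The sources used in generation `k`. -/
def present (p k : ℕ) : Set (SourceIndex p) := {i | match i with
  | .start => False
  | .offspring l _ _ => l = k
  | .migration l _ => l = k}

theorem disjoint_past_present (p k : ℕ) : Disjoint (past p k) (present p k) := by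
  rw [Set.disjoint_left]
  rintro (_ | _ | _) h1 h2 <;> simp_all [past, present]

variable (W)

/-- The natural filtration of the driving sources. -/
def history : Filtration ℕ mΩ where
  seq k := W.sourceSigma (past p k)
  mono' k l h := W.sourceSigma_mono (by rintro (_ | _ | _) h1 <;> simp_all [past] <;> omega)
  le' k := W.sourceSigma_le _

/-- The generation after a generation `k` in state `z`. -/
def nextAt (k : ℕ) (z : Pop) (o : Ω) : Pop :=
  ∑ i, ∑ j ∈ range ((z i : ℤ) + W.M k z o i).toNat, W.X k j i o

theorem Z_succ_eq (k : ℕ) (o : Ω) : W.Z (k + 1) o = W.nextAt k (W.Z k o) o := W.Z_succ k o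

theorem measurable_nextAt_present (k : ℕ) (z : Pop) :
  Measurable[W.sourceSigma (present p k)] (W.nextAt k z) :=
  measurable_sum_random_index z (W.measurable_M_sourceSigma (show k = k from rfl))
    fun _ _ => W.measurable_X_sourceSigma (show k = k from rfl)

theorem measurable_nextAt (k : ℕ) (z : Pop) : Measurable (W.nextAt k z) :=
  (W.measurable_nextAt_present k z).mono (W.sourceSigma_le _) le_rfl

theorem measurable_next (z : Pop) : Measurable (W.next z) := W.measurable_nextAt 0 z

theorem measurable_Z_history (k : ℕ) : Measurable[W.history k] (W.Z k) := by
  induction k with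
  | zero => exact W.measurable_Z_zero_sourceSigma trivial
  | succ k ih =>
    have h : W.Z (k + 1) = fun o => W.nextAt k (W.Z k o) o := funext fun o => W.Z_succ_eq k o
    rw [h]
    refine measurable_random_index (m := W.history (k + 1)) (N := W.Z k) (G := W.nextAt k)
      (ih.mono (W.history.mono (le_succ k)) le_rfl) fun z => ?_
    exact measurable_sum_random_index z (W.measurable_M_sourceSigma (show k < k + 1 by omega))
      fun _ _ => W.measurable_X_sourceSigma (show k < k + 1 by omega)

theorem measurable_Z (k : ℕ) : Measurable (W.Z k) :=
  (W.measurable_Z_history k).mono (W.history.le k) le_rfl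

variable {W}

/-- The sources used in generation `k` in state `z`, as one family. -/
def stepIndex (p k : ℕ) (z : Fin p → ℕ) : Option (ℕ × Fin p) → SourceIndex p
  | none => .migration k z
  | some (j, i) => .offspring k j i

theorem stepIndex_injective (k : ℕ) (z : Pop) : Function.Injective (stepIndex p k z) := by
  rintro (_ | ⟨j, i⟩) (_ | ⟨j', i'⟩) h <;> simp_all [stepIndex]

variable (W)

theorem map_stepIndex (k : ℕ) (z : Pop) :
  P.map (fun o t => sourceVector (W.Z 0) W.X W.M (stepIndex p k z t) o) =
    P.map (fun o t => sourceVector (W.Z 0) W.X W.M (stepIndex p 0 z t) o) := by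
  have h : ∀ k, P.map (fun o t => sourceVector (W.Z 0) W.X W.M (stepIndex p k z t) o) =
    Measure.infinitePi fun t => P.map (sourceVector (W.Z 0) W.X W.M (stepIndex p k z t)) :=
    fun k => (W.indep.precomp (stepIndex_injective k z)).map_fun_eq_infinitePi_map
      fun t => W.measurable_sourceVector _
  rw [h, h]
  congr 1
  ext1 t
  rcases t with _ | ⟨j, i⟩
  · exact (W.identDistrib_M k z).map_eq
  · have hc : Measurable fun f : Pop => fun a => (f a : ℤ) := by fun_prop
    have := ((W.identDistrib_X k j i).trans (W.identDistrib_X 0 j i).symm).comp hc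
    exact this.map_eq

theorem identDistrib_nextAt (k : ℕ) (z : Pop) : IdentDistrib (W.nextAt k z) (W.next z) P P := by
  have hid : IdentDistrib (fun o t => sourceVector (W.Z 0) W.X W.M (stepIndex p k z t) o)
    (fun o t => sourceVector (W.Z 0) W.X W.M (stepIndex p 0 z t) o) P P :=
    ⟨(measurable_pi_lambda _ fun t => W.measurable_sourceVector _).aemeasurable,
      (measurable_pi_lambda _ fun t => W.measurable_sourceVector _).aemeasurable,
      W.map_stepIndex k z⟩
  have hF : Measurable fun (f : Option (ℕ × Fin p) → Fin p → ℤ) (a : Fin p) => ∑ i,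
    ∑ j ∈ range ((z i : ℤ) + f none i).toNat, (f (some (j, i)) a).toNat := by
    refine measurable_pi_lambda _ fun a => Finset.measurable_fun_sum _ fun i _ => ?_
    refine measurable_random_index
      (N := fun f : Option (ℕ × Fin p) → Fin p → ℤ => ((z i : ℤ) + f none i).toNat)
      (G := fun n f => ∑ j ∈ range n, (f (some (j, i)) a).toNat) ?_ fun n => ?_
    · fun_prop
    · fun_prop
  have h := hid.comp hF
  have e : ∀ k, ((fun (f : Option (ℕ × Fin p) → Fin p → ℤ) (a : Fin p) => ∑ i,
    ∑ j ∈ range ((z i : ℤ) + f none i).toNat, (f (some (j, i)) a).toNat) ∘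
    fun o t => sourceVector (W.Z 0) W.X W.M (stepIndex p k z t) o) = W.nextAt k z := by
    intro k
    ext o a
    simp [nextAt, sourceVector, stepIndex, Finset.sum_apply]
  rw [e, e] at h
  exact h

theorem lintegral_next (k : ℕ) {g : Ω → ENNReal}
  (hg : Measurable[W.history k] g) (f : Pop → ENNReal) :
  ∫⁻ o, g o * f (W.Z (k + 1) o) ∂P = ∫⁻ o, g o * (∫⁻ o', f (W.next (W.Z k o) o') ∂P) ∂P := by
  have h := lintegral_random_index (P := P) (W.history.le k) (W.sourceSigma_le (present p k))
    (W.indep_sourceSigma (disjoint_past_present p k)) (W.measurable_Z_history k) hg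
    (G := fun z o => f (W.nextAt k z o))
    fun z => (measurable_of_countable f).comp (W.measurable_nextAt_present k z)
  have e : ∀ z, ∫⁻ o', f (W.nextAt k z o') ∂P = ∫⁻ o', f (W.next z o') ∂P := fun z =>
    ((W.identDistrib_nextAt k z).comp (measurable_of_countable f)).lintegral_eq
  simp only [W.Z_succ_eq, h, e]

theorem condExp_next (k : ℕ) {E : Type*}
  [NormedAddCommGroup E] [NormedSpace ℝ E] [CompleteSpace E] (f : Pop → E)
  (hf : ∀ z, Integrable (fun o => f (W.next z o)) P)
  (hf' : Integrable (fun o => f (W.Z (k + 1) o)) P) :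
  P[fun o => f (W.Z (k + 1) o) | W.history k] =ᵐ[P]
    fun o => ∫ o', f (W.next (W.Z k o) o') ∂P := by
  borelize E
  have id : ∀ z, IdentDistrib (fun o => f (W.nextAt k z o)) (fun o => f (W.next z o)) P P :=
    fun z => (W.identDistrib_nextAt k z).comp (measurable_of_countable f)
  have h := condExp_random_index (P := P) (W.history.le k) (W.sourceSigma_le (present p k))
    (W.indep_sourceSigma (disjoint_past_present p k)) (W.measurable_Z_history k)
    (G := fun z o => f (W.nextAt k z o))
    (fun z => (StronglyMeasurable.of_discrete (f := f)).comp_measurable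
      (W.measurable_nextAt_present k z))
    (fun z => (id z).integrable_iff.2 (hf z)) (by simpa only [W.Z_succ_eq] using hf')
  simp only [W.Z_succ_eq]
  refine h.trans (ae_of_all _ fun o => ?_)
  exact (id _).integral_eq

theorem integral_mul_next (k : ℕ) {𝕜 : Type*} [RCLike 𝕜]
  {g : Ω → 𝕜} (hg : StronglyMeasurable[W.history k] g) {A : ℝ} (hgA : ∀ o, ‖g o‖ ≤ A)
  (f : Pop → 𝕜) {B : ℝ} (hfB : ∀ z, ‖f z‖ ≤ B) :
  ∫ o, g o * f (W.Z (k + 1) o) ∂P = ∫ o, g o * (∫ o', f (W.next (W.Z k o) o') ∂P) ∂P := by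
  have hfi : ∀ Y : Ω → Pop, Measurable Y → Integrable (fun o => f (Y o)) P := fun Y hY =>
    Integrable.of_bound (((StronglyMeasurable.of_discrete (f := f)).comp_measurable
      hY).aestronglyMeasurable) B (ae_of_all _ fun o => hfB _)
  have h := W.condExp_next k f (fun z => hfi _ (W.measurable_next z)) (hfi _ (W.measurable_Z _))
  rw [← integral_condExp (W.history.le k)]
  have h2 : P[fun o => g o * f (W.Z (k + 1) o) | W.history k] =ᵐ[P]
    fun o => g o * P[fun o => f (W.Z (k + 1) o) | W.history k] o := by
    exact condExp_stronglyMeasurable_bilin_of_bound (ContinuousLinearMap.mul ℝ 𝕜)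
      (W.history.le k) hg (hfi _ (W.measurable_Z _)) A (ae_of_all _ hgA)
  refine integral_congr_ae (h2.trans ?_)
  filter_upwards [h] with o ho
  rw [ho]

/-- The sum of a function of the offspring vectors of the first `n` individuals of type `i`. -/
noncomputable def offspringSum (i : Fin p) (φ : Pop → ℝ) (n : ℕ) (o : Ω) : ℝ :=
  ∑ j ∈ range n, φ (W.X 0 j i o)

theorem offspringSum_succ (i : Fin p) (φ : Pop → ℝ) (n : ℕ) (o : Ω) :
  W.offspringSum i φ (n + 1) o = W.offspringSum i φ n o + φ (W.X 0 n i o) :=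
  sum_range_succ _ _

theorem identDistrib_offspring (i : Fin p) (φ : Pop → ℝ) (j : ℕ) :
  IdentDistrib (fun o => φ (W.X 0 j i o)) (fun o => φ (W.X 0 0 i o)) P P :=
  (W.identDistrib_X 0 j i).comp (measurable_of_countable φ)

theorem measurable_offspringSum_sourceSigma (i : Fin p) (φ : Pop → ℝ)
  (n : ℕ) {S : Set (SourceIndex p)} (hS : ∀ j < n, SourceIndex.offspring 0 j i ∈ S) :
  Measurable[W.sourceSigma S] (W.offspringSum i φ n) := by
  unfold offspringSum
  refine Finset.measurable_fun_sum _ fun j hj => ?_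
  exact (measurable_of_countable φ).comp (W.measurable_X_sourceSigma (hS j (mem_range.1 hj)))

theorem measurable_offspringSum (i : Fin p) (φ : Pop → ℝ) (n : ℕ) :
  Measurable (W.offspringSum i φ n) :=
  (W.measurable_offspringSum_sourceSigma i φ n (S := Set.univ) fun _ _ => trivial).mono
    (W.sourceSigma_le _) le_rfl

theorem indepFun_offspringSum (i : Fin p) (φ : Pop → ℝ) (n : ℕ) :
  IndepFun (W.offspringSum i φ n) (fun o => φ (W.X 0 n i o)) P := by
  have hd : Disjoint {k : SourceIndex p | ∃ j < n, k = .offspring 0 j i}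
    {k : SourceIndex p | k = .offspring 0 n i} := by simp
  have h := W.indep_sourceSigma hd
  have h1 := W.measurable_offspringSum_sourceSigma i φ n
    (S := {k : SourceIndex p | ∃ j < n, k = .offspring 0 j i}) fun j hj => ⟨j, hj, rfl⟩
  have h2 : Measurable[W.sourceSigma {k : SourceIndex p | k = .offspring 0 n i}]
    fun o => φ (W.X 0 n i o) :=
    (measurable_of_countable φ).comp (W.measurable_X_sourceSigma rfl)
  rw [IndepFun_iff_Indep]
  exact indep_of_indep_of_le_left (indep_of_indep_of_le_right h h2.comap_le) h1.comap_le

theorem integral_offspringSum_sq (i : Fin p) (φ : Pop → ℝ)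
  (hφ : MemLp (fun o => φ (W.X 0 0 i o)) 2 P) (h0 : ∫ o, φ (W.X 0 0 i o) ∂P = 0) (n : ℕ) :
  MemLp (W.offspringSum i φ n) 2 P ∧
    ∫ o, W.offspringSum i φ n o ^ 2 ∂P = n * ∫ o, φ (W.X 0 0 i o) ^ 2 ∂P := by
  induction n with
  | zero =>
    have : W.offspringSum i φ 0 = fun _ => 0 := funext fun o => by simp [offspringSum]
    simp [this]
  | succ n ih =>
    obtain ⟨hm, hi⟩ := ih
    have hx : MemLp (fun o => φ (W.X 0 n i o)) 2 P :=
      (W.identDistrib_offspring i φ n).memLp_iff.2 hφ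
    have hsq : ∫ o, φ (W.X 0 n i o) ^ 2 ∂P = ∫ o, φ (W.X 0 0 i o) ^ 2 ∂P :=
      (W.identDistrib_offspring i (fun z => φ z ^ 2) n).integral_eq
    have hz : ∫ o, φ (W.X 0 n i o) ∂P = 0 := by
      rw [(W.identDistrib_offspring i φ n).integral_eq, h0]
    have hmul : ∫ o, W.offspringSum i φ n o * φ (W.X 0 n i o) ∂P = 0 := by
      have := (W.indepFun_offspringSum i φ n).integral_mul_eq_mul_integral
        hm.aestronglyMeasurable hx.aestronglyMeasurable
      simpa [hz] using this
    have hfun : W.offspringSum i φ (n + 1) = fun o => W.offspringSum i φ n o + φ (W.X 0 n i o) :=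
      funext fun o => W.offspringSum_succ i φ n o
    refine ⟨by rw [hfun]; exact hm.add hx, ?_⟩
    have e : ∀ o, W.offspringSum i φ (n + 1) o ^ 2 = W.offspringSum i φ n o ^ 2 +
      2 * (W.offspringSum i φ n o * φ (W.X 0 n i o)) + φ (W.X 0 n i o) ^ 2 := by grind
    have i1 := hm.integrable_sq
    have i2 := (hm.integrable_mul hx).const_mul 2
    have i3 := hx.integrable_sq
    simp only [Pi.mul_apply] at i2
    have i12 : Integrable (fun o => W.offspringSum i φ n o ^ 2 +
      2 * (W.offspringSum i φ n o * φ (W.X 0 n i o))) P := i1.add i2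
    simp_rw [e]
    rw [integral_add i12 i3, integral_add i1 i2, integral_const_mul, hmul, hi, hsq]
    push_cast
    ring

theorem integral_offspringSum_pow_four_le (i : Fin p) (φ : Pop → ℝ)
  {K : ℝ} (hφ : ∀ z, |φ z| ≤ K) (h0 : ∫ o, φ (W.X 0 0 i o) ∂P = 0) (n : ℕ) :
  ∫ o, W.offspringSum i φ n o ^ 4 ∂P ≤ 7 * K ^ 4 * n ^ 2 := by
  have hK : 0 ≤ K := (abs_nonneg _).trans (hφ 0)
  have hbd : ∀ n o, |W.offspringSum i φ n o| ≤ n * K := by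
    intro n o
    refine (abs_sum_le_sum_abs _ _).trans ?_
    refine (sum_le_sum fun j _ => hφ (W.X 0 j i o)).trans ?_
    simp
  have hmX : ∀ j, Measurable fun o => φ (W.X 0 j i o) := fun j =>
    (measurable_of_countable φ).comp (W.measurable_X 0 j i)
  have hmem : MemLp (fun o => φ (W.X 0 0 i o)) 2 P :=
    MemLp.of_bound (hmX 0).aestronglyMeasurable K (ae_of_all _ fun o => hφ _)
  induction n with
  | zero => simp [offspringSum]
  | succ n ih =>
    have hint : ∀ (c : ℝ) (a b : ℕ), Integrable
      (fun o => c * (W.offspringSum i φ n o ^ a * φ (W.X 0 n i o) ^ b)) P := by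
      intro c a b
      refine Integrable.const_mul (Integrable.of_bound
        (((W.measurable_offspringSum i φ n).pow_const a).mul
        ((hmX n).pow_const b)).aestronglyMeasurable ((n * K) ^ a * K ^ b)
        (ae_of_all _ fun o => ?_)) c
      rw [Pi.mul_apply, norm_mul, norm_pow, norm_pow]
      gcongr
      · exact hbd n o
      · exact hφ _
    have hsplit : ∀ (c : ℝ) (a b : ℕ),
      ∫ o, c * (W.offspringSum i φ n o ^ a * φ (W.X 0 n i o) ^ b) ∂P =
      c * ((∫ o, W.offspringSum i φ n o ^ a ∂P) * ∫ o, φ (W.X 0 n i o) ^ b ∂P) := by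
      intro c a b
      rw [integral_const_mul]
      congr 1
      exact ((W.indepFun_offspringSum i φ n).comp (φ := fun x => x ^ a) (ψ := fun x => x ^ b)
        (by fun_prop) (by fun_prop)).integral_mul_eq_mul_integral
          ((W.measurable_offspringSum i φ n).pow_const a).aestronglyMeasurable
          ((hmX n).pow_const b).aestronglyMeasurable
    have hz : ∫ o, φ (W.X 0 n i o) ∂P = 0 := by
      rw [(W.identDistrib_offspring i φ n).integral_eq, h0]
    have hS := (W.integral_offspringSum_sq i φ hmem h0 n).2
    have hS1 : ∫ o, W.offspringSum i φ n o ∂P = 0 := by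
      unfold offspringSum
      rw [integral_finsetSum _ fun j _ => Integrable.of_bound (hmX j).aestronglyMeasurable K
        (ae_of_all _ fun o => hφ _)]
      exact Finset.sum_eq_zero fun j _ => by rw [(W.identDistrib_offspring i φ j).integral_eq, h0]
    have hb : ∀ (b : ℕ) (j : ℕ), ∫ o, φ (W.X 0 j i o) ^ b ∂P ≤ K ^ b := by
      intro b j
      have : ∫ o, φ (W.X 0 j i o) ^ b ∂P ≤ ∫ _, K ^ b ∂P := by
        refine integral_mono (by simpa using (Integrable.of_bound (μ := P)
          ((hmX j).pow_const b).aestronglyMeasurable (K ^ b) (ae_of_all _ fun o => by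
            rw [norm_pow]; exact pow_le_pow_left₀ (norm_nonneg _) (hφ _) b)))
          (integrable_const _) fun o => ?_
        exact (le_abs_self _).trans (by
          rw [abs_pow]; exact pow_le_pow_left₀ (abs_nonneg _) (hφ _) b)
      simpa using this
    have e : ∀ o, W.offspringSum i φ (n + 1) o ^ 4 =
      1 * (W.offspringSum i φ n o ^ 4 * φ (W.X 0 n i o) ^ 0) +
      (4 * (W.offspringSum i φ n o ^ 3 * φ (W.X 0 n i o) ^ 1) +
      (6 * (W.offspringSum i φ n o ^ 2 * φ (W.X 0 n i o) ^ 2) +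
      (4 * (W.offspringSum i φ n o ^ 1 * φ (W.X 0 n i o) ^ 3) +
      1 * (W.offspringSum i φ n o ^ 0 * φ (W.X 0 n i o) ^ 4)))) := by
      intro o
      rw [W.offspringSum_succ]
      ring
    have i4 := (hint 4 1 3).fun_add (hint 1 0 4)
    have i3 := (hint 6 2 2).fun_add i4
    have i2 := (hint 4 3 1).fun_add i3
    simp_rw [e]
    rw [integral_add (hint _ _ _) i2, integral_add (hint _ _ _) i3, integral_add (hint _ _ _) i4,
      integral_add (hint _ _ _) (hint _ _ _)]
    rw [hsplit, hsplit, hsplit, hsplit, hsplit]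
    simp only [pow_zero, pow_one, hz, hS, hS1, integral_const, smul_eq_mul]
    have h2 := hb 2 0
    have h2' := hb 2 n
    have h4 := hb 4 n
    have h20 : 0 ≤ ∫ o, φ (W.X 0 n i o) ^ 2 ∂P := ✓
    have hprod : (∫ o, φ (W.X 0 0 i o) ^ 2 ∂P) * ∫ o, φ (W.X 0 n i o) ^ 2 ∂P ≤ K ^ 2 * K ^ 2 :=
      by gcongr
    have hprod' := mul_le_left hprod (cast_nonneg (α := ℝ) n)
    have hnn : 0 ≤ (n : ℝ) * K ^ 4 := ✓
    have hK4 : 0 ≤ K ^ 4 := ✓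
    simp only [probReal_univ]
    push_cast
    nlinarith

/-- The number of individuals of type `i` which reproduce, in state `z`. -/
def parents (z : Pop) (i : Fin p) (o : Ω) : ℕ := ((z i : ℤ) + W.M 0 z o i).toNat

theorem neg_le_M (k : ℕ) (z : Pop) (o : Ω) (i : Fin p) : 0 ≤ (z i : ℤ) + W.M k z o i := by
  have h := W.D_le k z o i
  rw [W.M_eq]
  unfold migrationValue
  split <;> omega

theorem parents_cast (z : Pop) (i : Fin p) (o : Ω) : (W.parents z i o : ℝ) = z i + W.M 0 z o i := by
  have h : ((W.parents z i o : ℕ) : ℤ) = (z i : ℤ) + W.M 0 z o i :=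
    Int.toNat_of_nonneg (W.neg_le_M 0 z o i)
  exact_mod_cast congrArg (Int.cast (R := ℝ)) h

theorem measurable_parents_sourceSigma (z : Pop) (i : Fin p) :
  Measurable[W.sourceSigma {SourceIndex.migration 0 z}] (W.parents z i) := by
  have h1 := W.measurable_M_sourceSigma (S := {SourceIndex.migration 0 z}) rfl
  have h2 : Measurable fun f : Fin p → ℤ => ((z i : ℤ) + f i).toNat := by fun_prop
  exact h2.comp h1

theorem measurable_parents (z : Pop) (i : Fin p) : Measurable (W.parents z i) :=
  (W.measurable_parents_sourceSigma z i).mono (W.sourceSigma_le _) le_rfl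

theorem measurable_parents_cast (z : Pop) (i : Fin p) : Measurable fun o => (W.parents z i o : ℝ) :=
  (measurable_of_countable fun n : ℕ => (n : ℝ)).comp (W.measurable_parents z i)

theorem measurable_offspringSum_next (z : Pop) (i : Fin p)
  (φ : Pop → ℝ) : Measurable fun o => W.offspringSum i φ (W.parents z i o) o :=
  measurable_random_index (W.measurable_parents z i) fun n => W.measurable_offspringSum i φ n

theorem lintegral_offspringSum_parents (z : Pop) (i : Fin p)
  (φ : Pop → ℝ) {F : ℝ → ENNReal} (hF : Measurable F) :
  ∫⁻ o, F (W.offspringSum i φ (W.parents z i o) o) ∂P =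
    ∫⁻ o, (∫⁻ o', F (W.offspringSum i φ (W.parents z i o) o') ∂P) ∂P := by
  have hd : Disjoint {SourceIndex.migration 0 z}
    {k : SourceIndex p | ∃ j i, k = .offspring 0 j i} := by simp
  have := lintegral_random_index (P := P) (W.sourceSigma_le _) (W.sourceSigma_le _)
    (W.indep_sourceSigma hd) (W.measurable_parents_sourceSigma z i) (g := fun _ => 1)
    measurable_const (G := fun n o => F (W.offspringSum i φ n o))
    fun n => hF.comp (W.measurable_offspringSum_sourceSigma i φ n fun j _ => ⟨j, i, rfl⟩)
  simpa using this

theorem integrable_M (hmom : W.FiniteSecondMoments) (z : Pop) (i : Fin p) :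
  Integrable (fun o => (W.M 0 z o i : ℝ)) P :=
  (hmom.2 z i).integrable (by norm_num)

theorem integral_parents (hmom : W.FiniteSecondMoments) (z : Pop)
  (i : Fin p) : Integrable (fun o => (W.parents z i o : ℝ)) P ∧
    ∫ o, (W.parents z i o : ℝ) ∂P = z i + W.h z i := by
  simp only [W.parents_cast]
  refine ⟨(integrable_const _).add (W.integrable_M hmom z i), ?_⟩
  rw [integral_add (integrable_const _) (W.integrable_M hmom z i)]
  simp [h]

theorem lintegral_parents (hmom : W.FiniteSecondMoments) (z : Pop)
  (i : Fin p) : ∫⁻ o, ofReal (W.parents z i o) ∂P = ofReal (z i + W.h z i) := by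
  rw [← (W.integral_parents hmom z i).2,
    ofReal_integral_eq_lintegral_ofReal (W.integral_parents hmom z i).1
      (ae_of_all _ fun o => cast_nonneg _)]

theorem parents_mean_nonneg (hmom : W.FiniteSecondMoments) (z : Pop)
  (i : Fin p) : 0 ≤ z i + W.h z i := by
  rw [← (W.integral_parents hmom z i).2]
  exact integral_nonneg fun o => cast_nonneg _

theorem lintegral_offspringSum_sq (hmom : W.FiniteSecondMoments) (z : Pop)
  (i : Fin p) (φ : Pop → ℝ) (hφ : MemLp (fun o => φ (W.X 0 0 i o)) 2 P)
  (h0 : ∫ o, φ (W.X 0 0 i o) ∂P = 0) :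
  ∫⁻ o, ofReal (W.offspringSum i φ (W.parents z i o) o ^ 2) ∂P =
    ofReal ((z i + W.h z i) * ∫ o, φ (W.X 0 0 i o) ^ 2 ∂P) := by
  have e : ∀ n : ℕ, ∫⁻ o, ofReal (W.offspringSum i φ n o ^ 2) ∂P =
    ofReal n * ofReal (∫ o, φ (W.X 0 0 i o) ^ 2 ∂P) := by
    intro n
    have h := W.integral_offspringSum_sq i φ hφ h0 n
    rw [← ofReal_integral_eq_lintegral_ofReal h.1.integrable_sq
      (ae_of_all _ fun o => sq_nonneg _), h.2, ofReal_mul (cast_nonneg _)]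
  rw [W.lintegral_offspringSum_parents z i φ (F := fun x => ofReal (x ^ 2)) (by fun_prop)]
  simp only [e]
  rw [lintegral_mul_const _ (W.measurable_parents_cast z i).ennreal_ofReal,
    W.lintegral_parents hmom, ofReal_mul (W.parents_mean_nonneg hmom z i)]

theorem lintegral_offspringSum (hmom : W.FiniteSecondMoments) (z : Pop)
  (i : Fin p) (φ : Pop → ℝ) (hpos : ∀ z, 0 ≤ φ z)
  (hφ : Integrable (fun o => φ (W.X 0 0 i o)) P) :
  ∫⁻ o, ofReal (W.offspringSum i φ (W.parents z i o) o) ∂P =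
    ofReal ((z i + W.h z i) * ∫ o, φ (W.X 0 0 i o) ∂P) := by
  have e : ∀ n : ℕ, ∫⁻ o, ofReal (W.offspringSum i φ n o) ∂P =
    ofReal n * ofReal (∫ o, φ (W.X 0 0 i o) ∂P) := by
    intro n
    have hint : ∀ j, Integrable (fun o => φ (W.X 0 j i o)) P := fun j =>
      (W.identDistrib_offspring i φ j).integrable_iff.2 hφ
    unfold offspringSum
    rw [← ofReal_integral_eq_lintegral_ofReal (integrable_finsetSum _ fun j _ => hint j)
      (ae_of_all _ fun o => sum_nonneg fun j _ => hpos _),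
      integral_finsetSum _ fun j _ => hint j]
    simp only [(W.identDistrib_offspring i φ _).integral_eq]
    rw [← ofReal_mul (cast_nonneg _)]
    simp
  rw [W.lintegral_offspringSum_parents z i φ (F := fun x => ofReal x) (by fun_prop)]
  simp only [e]
  rw [lintegral_mul_const _ (W.measurable_parents_cast z i).ennreal_ofReal,
    W.lintegral_parents hmom, ofReal_mul (W.parents_mean_nonneg hmom z i)]

theorem lintegral_offspringSum_rpow_le (z : Pop)
  (i : Fin p) (φ : Pop → ℝ) {K : ℝ} (hφ : ∀ z, |φ z| ≤ K)
  (h0 : ∫ o, φ (W.X 0 0 i o) ∂P = 0) {δ : ℝ} (hδ : 0 < δ) (hδ' : δ ≤ 1) :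
  ∫⁻ o, ofReal (|W.offspringSum i φ (W.parents z i o) o| ^ (2 + δ)) ∂P ≤ ofReal (1 + 7 * K ^ 4) *
    ∫⁻ o, ofReal (|(z i : ℝ) + W.M 0 z o i| ^ (1 + δ / 2)) ∂P := by
  have hK : 0 ≤ K := (abs_nonneg _).trans (hφ 0)
  have e : ∀ n : ℕ, ∫⁻ o, ofReal (|W.offspringSum i φ n o| ^ (2 + δ)) ∂P ≤
    ofReal (1 + 7 * K ^ 4) * ofReal ((n : ℝ) ^ (1 + δ / 2)) := by
    intro n
    rcases Nat.eq_zero_or_pos n with rfl | hn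
    · simp [offspringSum, Real.zero_rpow (by linarith : (2 + δ) ≠ 0)]
    have hn' : (0 : ℝ) < n := ✓
    have hbd : ∀ o, |W.offspringSum i φ n o| ≤ n * K := by
      intro o
      refine (abs_sum_le_sum_abs _ _).trans ?_
      refine (sum_le_sum fun j _ => hφ (W.X 0 j i o)).trans ?_
      simp
    have hint : Integrable (fun o => W.offspringSum i φ n o ^ 4) P := by
      refine Integrable.of_bound ((W.measurable_offspringSum i φ n).pow_const 4).aestronglyMeasurable
        ((n * K) ^ 4) (ae_of_all _ fun o => ?_)
      rw [norm_pow]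
      exact pow_le_pow_left₀ (norm_nonneg _) (hbd o) 4
    have hpt : ∀ o, |W.offspringSum i φ n o| ^ (2 + δ) ≤
      (n : ℝ) ^ (1 + δ / 2) * (1 + W.offspringSum i φ n o ^ 4 / n ^ 2) := by
      intro o
      set t := |W.offspringSum i φ n o| / sqrt n with ht
      have hs : 0 < sqrt n := ✓
      have ht0 : 0 ≤ t := ✓
      have h1 : t ^ (2 + δ) ≤ 1 + t ^ 4 := by
        rcases le_total t 1 with h | h
        · have := rpow_le_one ht0 h (by linarith : 0 ≤ 2 + δ)
          have : 0 ≤ t ^ 4 := ✓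
          linarith
        · have := rpow_le_rpow_of_exponent_le h (by push_cast; linarith : 2 + δ ≤ (4 : ℕ))
          rw [rpow_natCast] at this
          linarith
      have h2 : |W.offspringSum i φ n o| = t * sqrt n := by grind
      have h4 : W.offspringSum i φ n o ^ 4 = (t * sqrt n) ^ 4 := by grind
      have h5 : (t * sqrt n) ^ 4 / n ^ 2 = t ^ 4 := by grind
      have h6 : (sqrt n) ^ (2 + δ) = (n : ℝ) ^ (1 + δ / 2) := by
        rw [sqrt_eq_rpow, ← rpow_mul hn'.le]
        congr 1
        ring
      rw [h4, h5, h2, mul_rpow ht0 hs.le, h6, mul_comm]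
      gcongr
    calc ∫⁻ o, ofReal (|W.offspringSum i φ n o| ^ (2 + δ)) ∂P
        ≤ ∫⁻ o, ofReal ((n : ℝ) ^ (1 + δ / 2) * (1 + W.offspringSum i φ n o ^ 4 / n ^ 2)) ∂P :=
          lintegral_mono fun o => ofReal_le_ofReal (hpt o)
      _ = ofReal (∫ o, (n : ℝ) ^ (1 + δ / 2) * (1 + W.offspringSum i φ n o ^ 4 / n ^ 2) ∂P) := by
        rw [ofReal_integral_eq_lintegral_ofReal]
        · fun_prop
        · refine ae_of_all _ fun o => ?_
          have : 0 ≤ W.offspringSum i φ n o ^ 4 := Even.pow_nonneg ⟨2, rfl⟩ _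
          show 0 ≤ _
          positivity
      _ ≤ _ := by
        rw [← ofReal_mul ✓]
        refine ofReal_le_ofReal ?_
        rw [integral_const_mul, integral_add (integrable_const _) (hint.div_const _),
          integral_div, mul_comm]
        have := W.integral_offspringSum_pow_four_le i φ hφ h0 n
        have h3 : (∫ o, W.offspringSum i φ n o ^ 4 ∂P) / n ^ 2 ≤ 7 * K ^ 4 := by
          rw [div_le_iff₀ ✓]
          exact this
        simp only [integral_const, probReal_univ, smul_eq_mul, mul_one]
        gcongr
  rw [W.lintegral_offspringSum_parents z i φ (F := fun x => ofReal (|x| ^ (2 + δ))) (by fun_prop)]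
  refine (lintegral_mono fun o => e _).trans ?_
  rw [lintegral_const_mul]
  · simp only [W.parents_cast]
    gcongr with o
    · have := W.parents_cast z i o
      rw [← this]
      exact cast_nonneg _
    · exact le_abs_self _
  · exact ((W.measurable_parents_cast z i).pow_const _).ennreal_ofReal

variable {W}

theorem sq_sum_add_le (a b : Vec) :
  (∑ i, a i + ∑ i, b i) ^ 2 ≤ 2 * p * ∑ i, (a i ^ 2 + b i ^ 2) := by
  rw [← sum_add_distrib]
  have h1 : (∑ i, (a i + b i)) ^ 2 ≤ p * ∑ i, (a i + b i) ^ 2 := by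
    simpa using sq_sum_le_card_mul_sum_sq (s := (univ : Finset (Fin p))) (f := fun i => a i + b i)
  have h2 : ∑ i, (a i + b i) ^ 2 ≤ ∑ i, 2 * (a i ^ 2 + b i ^ 2) :=
    sum_le_sum fun i _ => by nlinarith [sq_nonneg (a i - b i)]
  rw [← mul_sum] at h2
  have := mul_le_left h2 (cast_nonneg (α := ℝ) p)
  linarith

variable (W)

theorem dot_next (w : Vec) (z : Pop) (o : Ω) : w ⊙ W.next z o =
  ∑ i, W.offspringSum i (fun x => w ⊙ x) (W.parents z i o) o := by
  unfold offspringSum next realVec dotProduct parents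
  simp only [Finset.sum_apply, Nat.cast_sum, mul_sum]
  rw [sum_comm]
  refine sum_congr rfl fun i _ => ?_
  rw [sum_comm]

theorem offspringSum_sub_const (i : Fin p) (φ : Pop → ℝ) (c : ℝ) (n : ℕ)
  (o : Ω) : W.offspringSum i (fun x => φ x - c) n o = W.offspringSum i φ n o - n * c := by
  simp [offspringSum, sum_sub_distrib]

theorem memLp_dot_offspring (hmom : W.FiniteSecondMoments) (w : Vec)
  (i : Fin p) : MemLp (fun o => w ⊙ W.X 0 0 i o) 2 P := by
  unfold dotProduct realVec
  exact memLp_finsetSum _ fun a _ => (hmom.1 i a).const_mul (w a)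

theorem integral_dot_offspring (hmom : W.FiniteSecondMoments) (w : Vec)
  (i : Fin p) : ∫ o, w ⊙ W.X 0 0 i o ∂P = Matrix.vecMul w W.meanMatrix i := by
  unfold dotProduct realVec Matrix.vecMul meanMatrix dotProduct
  rw [integral_finsetSum _ fun a _ => ((hmom.1 i a).integrable (by norm_num)).const_mul (w a)]
  simp [integral_const_mul]

/-- The variance of the offspring of an individual of type `i`, weighted by `w`. -/
noncomputable def offspringVar (w : Vec) (i : Fin p) : ℝ :=
  ∫ o, (w ⊙ W.X 0 0 i o - Matrix.vecMul w W.meanMatrix i) ^ 2 ∂P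

/-- The variance of the migration of type `i` in state `z`. -/
noncomputable def migrationVar (z : Pop) (i : Fin p) : ℝ :=
  ∫ o, ((W.M 0 z o i : ℝ) - W.h z i) ^ 2 ∂P

theorem dot_next_sub (w : Vec) (z : Pop) (o : Ω) :
  w ⊙ W.next z o - Matrix.vecMul w W.meanMatrix ⬝ᵥ (realVec z + W.h z) =
    ∑ i, W.offspringSum i (fun x => w ⊙ x - Matrix.vecMul w W.meanMatrix i) (W.parents z i o) o +
    ∑ i, Matrix.vecMul w W.meanMatrix i * ((W.M 0 z o i : ℝ) - W.h z i) := by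
  rw [dot_next]
  simp only [offspringSum_sub_const, W.parents_cast, dotProduct, Pi.add_apply, realVec]
  rw [← sum_sub_distrib, ← sum_add_distrib]
  exact sum_congr rfl fun i _ => by ring

theorem lintegral_sq_dot_next_sub_le (hmom : W.FiniteSecondMoments) (w : Vec) (z : Pop) :
  ∫⁻ o, ofReal ((w ⊙ W.next z o - Matrix.vecMul w W.meanMatrix ⬝ᵥ (realVec z + W.h z)) ^ 2) ∂P ≤
  ofReal (2 * p * ∑ i, ((z i + W.h z i) * W.offspringVar w i +
    Matrix.vecMul w W.meanMatrix i ^ 2 * W.migrationVar z i)) := by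
  have hφ : ∀ i, MemLp (fun o => w ⊙ W.X 0 0 i o - Matrix.vecMul w W.meanMatrix i) 2 P :=
    fun i => (W.memLp_dot_offspring hmom w i).sub (memLp_const _)
  have h0 : ∀ i, ∫ o, (w ⊙ W.X 0 0 i o - Matrix.vecMul w W.meanMatrix i) ∂P = 0 := by
    intro i
    rw [integral_sub ((W.memLp_dot_offspring hmom w i).integrable (by norm_num))
      (integrable_const _), W.integral_dot_offspring hmom]
    simp
  have hM : ∀ i, MemLp (fun o => (W.M 0 z o i : ℝ) - W.h z i) 2 P :=
    fun i => (hmom.2 z i).sub (memLp_const _)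
  have hS : ∀ i, Measurable fun o => ofReal (W.offspringSum i
    (fun x => w ⊙ x - Matrix.vecMul w W.meanMatrix i) (W.parents z i o) o ^ 2) :=
    fun i => ((W.measurable_offspringSum_next z i _).pow_const 2).ennreal_ofReal
  have hMm : ∀ i, AEMeasurable (fun o => ofReal
    ((Matrix.vecMul w W.meanMatrix i * ((W.M 0 z o i : ℝ) - W.h z i)) ^ 2)) P := fun i =>
    (((hM i).aestronglyMeasurable.aemeasurable.const_mul _).pow_const 2).ennreal_ofReal
  calc _ ≤ ∫⁻ o, ofReal (2 * p) * ∑ i, (ofReal (W.offspringSum i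
        (fun x => w ⊙ x - Matrix.vecMul w W.meanMatrix i) (W.parents z i o) o ^ 2) +
        ofReal ((Matrix.vecMul w W.meanMatrix i * ((W.M 0 z o i : ℝ) - W.h z i)) ^ 2)) ∂P := by
        refine lintegral_mono fun o => ?_
        simp only [← ofReal_add (sq_nonneg _) (sq_nonneg _)]
        rw [← ofReal_sum_of_nonneg fun i _ => ✓, ← ofReal_mul ✓, W.dot_next_sub]
        exact ofReal_le_ofReal (sq_sum_add_le _ _)
    _ = _ := by
      rw [lintegral_const_mul' _ _ ofReal_ne_top,
        lintegral_finsetSum' _ fun i _ => (hS i).aemeasurable.fun_add (hMm i)]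
      simp only [lintegral_add_left (hS _)]
      rw [ofReal_mul (p := 2 * (p : ℝ)) ✓, ofReal_sum_of_nonneg]
      · congr 1
        refine sum_congr rfl fun i _ => ?_
        rw [W.lintegral_offspringSum_sq hmom z i _ (hφ i) (h0 i), ofReal_add]
        · congr 1
          rw [← ofReal_integral_eq_lintegral_ofReal]
          · simp only [mul_pow, integral_const_mul]
            rfl
          · exact ((hM i).const_mul _).integrable_sq
          · exact ae_of_all _ fun o => sq_nonneg _
        · exact mul_nonneg (W.parents_mean_nonneg hmom z i) (integral_nonneg fun o => sq_nonneg _)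
        · exact mul_nonneg (sq_nonneg _) (integral_nonneg fun o => sq_nonneg _)
      · intro i _
        exact add_nonneg (mul_nonneg (W.parents_mean_nonneg hmom z i)
          (integral_nonneg fun o => sq_nonneg _))
          (mul_nonneg (sq_nonneg _) (integral_nonneg fun o => sq_nonneg _))

theorem measurable_dot_next (w : Vec) (z : Pop) : Measurable fun o => w ⊙ W.next z o :=
  (measurable_of_countable fun x : Pop => w ⊙ x).comp (W.measurable_next z)

theorem memLp_dot_next (hmom : W.FiniteSecondMoments)
  (w : Vec) (z : Pop) : MemLp (fun o => w ⊙ W.next z o) 2 P := by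
  set c := Matrix.vecMul w W.meanMatrix ⬝ᵥ (realVec z + W.h z)
  have hm : Measurable fun o => w ⊙ W.next z o - c := (W.measurable_dot_next w z).sub_const _
  have h : MemLp (fun o => w ⊙ W.next z o - c) 2 P := by
    rw [memLp_two_iff_integrable_sq hm.aestronglyMeasurable]
    refine ⟨(hm.pow_const 2).aestronglyMeasurable, ?_⟩
    rw [hasFiniteIntegral_iff_ofReal (ae_of_all _ fun o => sq_nonneg _)]
    exact (W.lintegral_sq_dot_next_sub_le hmom w z).trans_lt ofReal_lt_top
  have h' := h.add (memLp_const c)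
  have e : ((fun o => w ⊙ W.next z o - c) + fun _ => c) = fun o => w ⊙ W.next z o := by
    ext o
    simp
  rwa [e] at h'

theorem integral_sq_dot_next_sub_le (hmom : W.FiniteSecondMoments) (w : Vec) (z : Pop) :
  ∫ o, (w ⊙ W.next z o - Matrix.vecMul w W.meanMatrix ⬝ᵥ (realVec z + W.h z)) ^ 2 ∂P ≤
  2 * p * ∑ i, ((z i + W.h z i) * W.offspringVar w i +
    Matrix.vecMul w W.meanMatrix i ^ 2 * W.migrationVar z i) := by
  have h := W.lintegral_sq_dot_next_sub_le hmom w z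
  have hm : MemLp (fun o => w ⊙ W.next z o -
    Matrix.vecMul w W.meanMatrix ⬝ᵥ (realVec z + W.h z)) 2 P :=
    (W.memLp_dot_next hmom w z).sub (memLp_const _)
  rw [← ofReal_integral_eq_lintegral_ofReal hm.integrable_sq
    (ae_of_all _ fun o => sq_nonneg _)] at h
  refine (ENNReal.ofReal_le_ofReal_iff ?_).1 h
  refine mul_nonneg ✓ (sum_nonneg fun i _ => ?_)
  exact add_nonneg (mul_nonneg (W.parents_mean_nonneg hmom z i)
    (integral_nonneg fun o => sq_nonneg _))
    (mul_nonneg (sq_nonneg _) (integral_nonneg fun o => sq_nonneg _))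

theorem integral_dot_next (hmom : W.FiniteSecondMoments) (w : Vec) (hw : ∀ i, 0 ≤ w i) (z : Pop) :
  ∫ o, w ⊙ W.next z o ∂P = Matrix.vecMul w W.meanMatrix ⬝ᵥ (realVec z + W.h z) := by
  have hpos : ∀ x : Pop, 0 ≤ w ⊙ x := fun x =>
    sum_nonneg fun i _ => mul_nonneg (hw i) (cast_nonneg _)
  have hnn : ∀ i, 0 ≤ (z i + W.h z i) * Matrix.vecMul w W.meanMatrix i := fun i =>
    mul_nonneg (W.parents_mean_nonneg hmom z i) (by
      rw [← W.integral_dot_offspring hmom]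
      exact integral_nonneg fun o => hpos _)
  have h : ∫⁻ o, ofReal (w ⊙ W.next z o) ∂P = ofReal
    (Matrix.vecMul w W.meanMatrix ⬝ᵥ (realVec z + W.h z)) := by
    have e : Matrix.vecMul w W.meanMatrix ⬝ᵥ (realVec z + W.h z) =
      ∑ i, (z i + W.h z i) * Matrix.vecMul w W.meanMatrix i := by
      simp [dotProduct, realVec, mul_comm]
    rw [e, ofReal_sum_of_nonneg fun i _ => hnn i]
    simp only [dot_next]
    have e2 : ∀ o, ofReal (∑ i, W.offspringSum i (fun x => w ⊙ x)
      (W.parents z i o) o) = ∑ i, ofReal (W.offspringSum i (fun x => w ⊙ x)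
      (W.parents z i o) o) := fun o =>
      ofReal_sum_of_nonneg fun i _ => sum_nonneg fun j _ => hpos _
    simp only [e2]
    rw [lintegral_finsetSum _ fun i _ => (W.measurable_offspringSum_next z i _).ennreal_ofReal]
    refine sum_congr rfl fun i _ => ?_
    rw [W.lintegral_offspringSum hmom z i _ hpos
      ((W.memLp_dot_offspring hmom w i).integrable (by norm_num)), W.integral_dot_offspring hmom]
  rw [← ofReal_integral_eq_lintegral_ofReal ((W.memLp_dot_next hmom w z).integrable (by norm_num))
    (ae_of_all _ fun o => hpos _)] at h
  refine (ENNReal.ofReal_eq_ofReal_iff (integral_nonneg fun o => hpos _) ?_).1 h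
  simpa [dotProduct, realVec, mul_comm] using sum_nonneg fun i _ => hnn i

variable {W}

theorem dot_realVec_nonneg {w : Vec} (hw : ∀ i, 0 ≤ w i) (x : Pop) : 0 ≤ w ⊙ x :=
  sum_nonneg fun i _ => mul_nonneg (hw i) (cast_nonneg _)

variable (W)

/-- The part of the weighted offspring below the level `K`. -/
noncomputable def truncMean (w : Vec) (K : ℝ) (i : Fin p) : ℝ := ∫ o, min (w ⊙ W.X 0 0 i o) K ∂P

theorem measurable_dot_offspring (w : Vec) (i : Fin p) : Measurable fun o => w ⊙ W.X 0 0 i o :=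
  (measurable_of_countable fun x : Pop => w ⊙ x).comp (W.measurable_X 0 0 i)

theorem integrable_trunc (w : Vec) (hw : ∀ i, 0 ≤ w i) {K : ℝ} (hK : 0 ≤ K)
  (i : Fin p) : Integrable (fun o => min (w ⊙ W.X 0 0 i o) K) P := by
  refine Integrable.of_bound ((W.measurable_dot_offspring w i).min
    measurable_const).aestronglyMeasurable K (ae_of_all _ fun o => ?_)
  rw [norm_of_nonneg (le_min (dot_realVec_nonneg hw _) hK)]
  exact min_le_right _ _

theorem tendsto_truncMean (hmom : W.FiniteSecondMoments) (w : Vec) (hw : ∀ i, 0 ≤ w i) (i : Fin p) :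
  Tendsto (fun K : ℕ => W.truncMean w K i) atTop (𝓝 (Matrix.vecMul w W.meanMatrix i)) := by
  rw [← W.integral_dot_offspring hmom]
  refine tendsto_integral_of_dominated_convergence (fun o => w ⊙ W.X 0 0 i o)
    (fun K => (W.integrable_trunc w hw (cast_nonneg K) i).aestronglyMeasurable)
    ((W.memLp_dot_offspring hmom w i).integrable (by norm_num))
    (fun K => ae_of_all _ fun o => ?_) (ae_of_all _ fun o => ?_)
  · rw [norm_of_nonneg (le_min (dot_realVec_nonneg hw _) (cast_nonneg _))]
    exact min_le_left _ _
  · refine tendsto_const_nhds.congr' ?_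
    filter_upwards [tendsto_natCast_atTop_atTop.eventually_ge_atTop (w ⊙ W.X 0 0 i o)] with K hK
    exact (min_eq_left hK).symm

theorem tendsto_trunc_var (hmom : W.FiniteSecondMoments) (w : Vec) (hw : ∀ i, 0 ≤ w i) (i : Fin p) :
  Tendsto (fun K : ℕ => ∫ o, (w ⊙ W.X 0 0 i o - min (w ⊙ W.X 0 0 i o) K) ^ 2 ∂P) atTop (𝓝 0) := by
  have : (0 : ℝ) = ∫ _, 0 ∂P := by simp
  rw [this]
  refine tendsto_integral_of_dominated_convergence (fun o => (w ⊙ W.X 0 0 i o) ^ 2)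
    (fun K => (((W.measurable_dot_offspring w i).sub
      ((W.measurable_dot_offspring w i).min measurable_const)).pow_const 2).aestronglyMeasurable)
    (W.memLp_dot_offspring hmom w i).integrable_sq
    (fun K => ae_of_all _ fun o => ?_) (ae_of_all _ fun o => ?_)
  · rw [norm_of_nonneg (sq_nonneg _)]
    have h1 := dot_realVec_nonneg hw (W.X 0 0 i o)
    have h2 : 0 ≤ min (w ⊙ W.X 0 0 i o) K := ✓
    have h3 : min (w ⊙ W.X 0 0 i o) K ≤ w ⊙ W.X 0 0 i o := by simp
    nlinarith
  · refine tendsto_const_nhds.congr' ?_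
    filter_upwards [tendsto_natCast_atTop_atTop.eventually_ge_atTop (w ⊙ W.X 0 0 i o)] with K hK
    rw [min_eq_left hK]
    simp

theorem lintegral_abs_sum_rpow_le {q : ℕ} {a : Fin q → Ω → ℝ} (ha : ∀ i, Measurable (a i))
  (hδ : 0 < δ) (hδ' : δ ≤ 1) : ∫⁻ o, ofReal (|∑ i, a i o| ^ (2 + δ)) ∂P ≤
    ofReal ((q : ℝ) ^ 2) * ∑ i, ∫⁻ o, ofReal (|a i o| ^ (2 + δ)) ∂P := by
  rw [← lintegral_finsetSum _ fun i _ => ((ha i).abs.pow_const _).ennreal_ofReal,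
    ← lintegral_const_mul' _ _ ofReal_ne_top]
  refine lintegral_mono fun o => ?_
  rw [← ofReal_sum_of_nonneg fun i _ => ✓, ← ofReal_mul ✓]
  refine ofReal_le_ofReal ((rpow_le_rpow (abs_nonneg _) (abs_sum_le_sum_abs _ _)
    (by linarith)).trans ((Real.rpow_sum_le_const_mul_sum_rpow univ _ (by linarith)).trans
    (mul_le_right ?_ (sum_nonneg fun i _ => ✓))))
  rcases q.eq_zero_or_pos with rfl | hq
  · simp [Real.zero_rpow (by linarith : (2 + δ - 1) ≠ 0)]
  · have := rpow_le_rpow_of_exponent_le (by exact_mod_cast hq : (1 : ℝ) ≤ q)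
      (by push_cast; linarith : 2 + δ - 1 ≤ (2 : ℕ))
    rw [rpow_natCast] at this
    simpa using this

/-- Splits the centred next generation, in direction `u`, into the contribution of truncated
offspring, the contribution of migration, and a remainder which is small in `L²`. -/
theorem exists_decomposition (hmom : W.FiniteSecondMoments) {u : Vec}
  (hu : Matrix.vecMul u W.meanMatrix = u) (hpos : ∀ i, 0 < u i) {η : ℝ} (hη : 0 < η) :
  ∃ K : ℝ, 0 ≤ K ∧ ∀ z : Pop, ∃ e₁ e₃ : Ω → ℝ, Measurable e₁ ∧ Measurable e₃ ∧
    (∀ o, u ⊙ W.next z o - u ⬝ᵥ (realVec z + W.h z) =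
      e₁ o + ∑ i, u i * ((W.M 0 z o i : ℝ) - W.h z i) + e₃ o) ∧
    (∀ o, 3 / 4 * (u ⬝ᵥ (realVec z + W.h z) + ∑ i, u i * ((W.M 0 z o i : ℝ) - W.h z i)) + e₁ o ≤
      u ⊙ W.next z o) ∧
    (∀ δ : ℝ, 0 < δ → δ ≤ 1 → ∫⁻ o, ofReal (|e₁ o| ^ (2 + δ)) ∂P ≤ ofReal K * ∑ i,
      ∫⁻ o, ofReal (|(z i : ℝ) + W.M 0 z o i| ^ (1 + δ / 2)) ∂P) ∧
    ∫⁻ o, ofReal (e₃ o ^ 2) ∂P ≤ ofReal (η * ∑ i, (z i + W.h z i)) := by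
  have hu0 : ∀ i, 0 ≤ u i := by grind
  have ev1 : ∀ i, ∀ᶠ K : ℕ in atTop, 3 / 4 * u i < W.truncMean u K i := by
    intro i
    have := W.tendsto_truncMean hmom u hu0 i
    rw [hu] at this
    exact this.eventually (lt_mem_nhds (by linarith [hpos i]))
  have ev2 : ∀ i, ∀ᶠ K : ℕ in atTop, ∫ o, (u ⊙ W.X 0 0 i o -
    min (u ⊙ W.X 0 0 i o) K) ^ 2 ∂P < η / (p + 1) := fun i =>
    (W.tendsto_trunc_var hmom u hu0 i).eventually (gt_mem_nhds ✓)
  obtain ⟨K, hK1, hK2⟩ := ((eventually_all.2 ev1).and (eventually_all.2 ev2)).exists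
  set t := W.truncMean u K with ht
  have hX : ∀ i, Integrable (fun o => u ⊙ W.X 0 0 i o) P := fun i =>
    (W.memLp_dot_offspring hmom u i).integrable (by norm_num)
  have hXt : ∀ i, Integrable (fun o => min (u ⊙ W.X 0 0 i o) K) P := fun i =>
    W.integrable_trunc u hu0 (cast_nonneg K) i
  have ht0 : ∀ i, 0 ≤ t i := by grind
  have htK : ∀ i, t i ≤ K := by
    intro i
    have : t i ≤ ∫ _, (K : ℝ) ∂P :=
      integral_mono (hXt i) (integrable_const _) fun o => min_le_right _ _
    simpa using this
  let φ : Fin p → Pop → ℝ := fun i x => min (u ⊙ x) K - t i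
  let ψ : Fin p → Pop → ℝ := fun i x => (u ⊙ x - min (u ⊙ x) K) - (u i - t i)
  have hφK : ∀ i x, |φ i x| ≤ K := by
    intro i x
    have h1 : 0 ≤ min (u ⊙ x) K := le_min (dot_realVec_nonneg hu0 _) (cast_nonneg _)
    have h2 : min (u ⊙ x) K ≤ (K : ℝ) := by simp
    rw [abs_le]
    constructor <;> simp only [φ] <;> linarith [ht0 i, htK i]
  have hφ0 : ∀ i, ∫ o, φ i (W.X 0 0 i o) ∂P = 0 := by
    intro i
    simp only [φ]
    rw [integral_sub (hXt i) (integrable_const _)]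
    simp [ht, truncMean]
  have hψ0 : ∀ i, ∫ o, ψ i (W.X 0 0 i o) ∂P = 0 := by
    intro i
    have hd : Integrable (fun o => u ⊙ W.X 0 0 i o - min (u ⊙ W.X 0 0 i o) K) P := by fun_prop
    simp only [ψ]
    rw [integral_sub hd (integrable_const _), integral_sub (hX i) (hXt i),
      W.integral_dot_offspring hmom, hu]
    simp [ht, truncMean]
  have hXt2 : ∀ i, MemLp (fun o => min (u ⊙ W.X 0 0 i o) K) 2 P := by
    intro i
    refine MemLp.of_bound (hXt i).aestronglyMeasurable K (ae_of_all _ fun o => ?_)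
    rw [norm_of_nonneg (le_min (dot_realVec_nonneg hu0 _) (cast_nonneg _))]
    exact min_le_right _ _
  have hd2 : ∀ i, MemLp (fun o => u ⊙ W.X 0 0 i o - min (u ⊙ W.X 0 0 i o) K) 2 P := fun i =>
    (W.memLp_dot_offspring hmom u i).sub (hXt2 i)
  have hψ2 : ∀ i, MemLp (fun o => ψ i (W.X 0 0 i o)) 2 P := fun i => (hd2 i).sub (memLp_const _)
  have hψv : ∀ i, ∫ o, ψ i (W.X 0 0 i o) ^ 2 ∂P ≤ η / (p + 1) := by
    intro i
    have e : ∫ o, ψ i (W.X 0 0 i o) ^ 2 ∂P = ∫ o, (u ⊙ W.X 0 0 i o -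
      min (u ⊙ W.X 0 0 i o) K) ^ 2 ∂P - (u i - t i) ^ 2 := by
      have e1 : ∀ o, ψ i (W.X 0 0 i o) ^ 2 = (u ⊙ W.X 0 0 i o - min (u ⊙ W.X 0 0 i o) K) ^ 2 -
        (2 * (u i - t i) * ψ i (W.X 0 0 i o) + (u i - t i) ^ 2) := by
        intro o
        simp only [ψ]
        ring
      have i1 : Integrable (fun o => 2 * (u i - t i) * ψ i (W.X 0 0 i o)) P :=
        ((hψ2 i).integrable (by norm_num)).const_mul _
      simp_rw [e1]
      rw [integral_sub (hd2 i).integrable_sq (i1.fun_add (integrable_const _)),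
        integral_add i1 (integrable_const _), integral_const_mul, hψ0 i]
      simp
    rw [e]
    linarith [hK2 i, sq_nonneg (u i - t i)]
  refine ⟨(p : ℝ) ^ 2 * (1 + 7 * (K : ℝ) ^ 4), ✓, fun z =>
    ⟨fun o => ∑ i, W.offspringSum i (φ i) (W.parents z i o) o,
    fun o => ∑ i, W.offspringSum i (ψ i) (W.parents z i o) o,
    Finset.measurable_fun_sum _ fun i _ => W.measurable_offspringSum_next z i _,
    Finset.measurable_fun_sum _ fun i _ => W.measurable_offspringSum_next z i _, ?_, ?_, ?_, ?_⟩⟩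
  · intro o
    have h := W.dot_next_sub u z o
    rw [hu] at h
    rw [h]
    have : ∀ i, W.offspringSum i (fun x => u ⊙ x - u i) (W.parents z i o) o =
      W.offspringSum i (φ i) (W.parents z i o) o + W.offspringSum i (ψ i) (W.parents z i o) o := by
      intro i
      unfold offspringSum
      rw [← sum_add_distrib]
      exact sum_congr rfl fun j _ => by simp only [φ, ψ]; ring
    simp only [this, sum_add_distrib]
    ring
  · intro o
    have e : u ⬝ᵥ (realVec z + W.h z) + ∑ i, u i * ((W.M 0 z o i : ℝ) - W.h z i) =
      ∑ i, u i * (W.parents z i o : ℝ) := by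
      simp only [dotProduct, Pi.add_apply, realVec, W.parents_cast]
      rw [← sum_add_distrib]
      exact sum_congr rfl fun i _ => by ring
    rw [e, W.dot_next, mul_sum, ← sum_add_distrib]
    refine sum_le_sum fun i _ => ?_
    simp only [φ, W.offspringSum_sub_const]
    have h1 : W.offspringSum i (fun x => min (u ⊙ x) K) (W.parents z i o) o ≤
      W.offspringSum i (fun x => u ⊙ x) (W.parents z i o) o :=
      sum_le_sum fun j _ => min_le_left _ _
    have h2 := mul_le_left (hK1 i).le (cast_nonneg (α := ℝ) (W.parents z i o))
    linarith
  · intro δ hδ hδ'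
    refine (lintegral_abs_sum_rpow_le (fun i => W.measurable_offspringSum_next z i _) hδ
      hδ').trans ?_
    rw [ofReal_mul ✓, mul_assoc, mul_sum (a := ofReal (1 + 7 * (K : ℝ) ^ 4))]
    gcongr with i
    exact W.lintegral_offspringSum_rpow_le z i (φ i) (hφK i) (hφ0 i) hδ hδ'
  · calc _ ≤ ∫⁻ o, ofReal p * ∑ i, ofReal (W.offspringSum i (ψ i) (W.parents z i o) o ^ 2) ∂P := by
          refine lintegral_mono fun o => ?_
          rw [← ofReal_sum_of_nonneg fun i _ => ✓, ← ofReal_mul ✓]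
          refine ofReal_le_ofReal ?_
          simpa using sq_sum_le_card_mul_sum_sq (s := (univ : Finset (Fin p)))
            (f := fun i => W.offspringSum i (ψ i) (W.parents z i o) o)
      _ = ofReal p * ∑ i, ofReal ((z i + W.h z i) * ∫ o, ψ i (W.X 0 0 i o) ^ 2 ∂P) := by
        rw [lintegral_const_mul' _ _ ofReal_ne_top, lintegral_finsetSum]
        · congr 1
          exact sum_congr rfl fun i _ => W.lintegral_offspringSum_sq hmom z i _ (hψ2 i) (hψ0 i)
        · exact fun i _ => ((W.measurable_offspringSum_next z i _).pow_const _).ennreal_ofReal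
      _ ≤ _ := by
        have hn := fun i => W.parents_mean_nonneg hmom z i
        rw [← ofReal_sum_of_nonneg fun i _ => mul_nonneg (hn i)
          (integral_nonneg fun o => sq_nonneg _), ← ofReal_mul ✓]
        refine ofReal_le_ofReal ?_
        have h1 : ∑ i, (z i + W.h z i) * ∫ o, ψ i (W.X 0 0 i o) ^ 2 ∂P ≤
          ∑ i, (z i + W.h z i) * (η / (p + 1)) :=
          sum_le_sum fun i _ => mul_le_left (hψv i) (hn i)
        rw [← sum_mul] at h1
        have h2 := mul_le_left h1 (cast_nonneg (α := ℝ) p)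
        refine h2.trans ?_
        have h3 : (p : ℝ) * (η / (p + 1)) ≤ η := by
          rw [mul_div_assoc', div_le_iff₀ ✓]
          nlinarith
        have h4 := mul_le_right h3 (sum_nonneg fun i (_ : i ∈ univ) => hn i)
        linarith

variable {W}

theorem dot_nonneg (hu : ∀ i, 0 < u i) (z : Pop) : 0 ≤ u ⊙ z :=
  sum_nonneg fun i _ => mul_nonneg (hu i).le (cast_nonneg _)

theorem coord_le_dot (hu : ∀ i, 0 < u i) (z : Pop) (i : Fin p) :
  (z i : ℝ) ≤ (∑ j, (u j)⁻¹) * (u ⊙ z) := by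
  have h1 : u i * z i ≤ u ⊙ z := single_le_sum (f := fun j => u j * realVec z j)
    (fun j _ => mul_nonneg (hu j).le (cast_nonneg _)) (mem_univ i)
  have h2 : (u i)⁻¹ ≤ ∑ j, (u j)⁻¹ :=
    single_le_sum (f := fun j => (u j)⁻¹) (fun j _ => (inv_pos.2 (hu j)).le) (mem_univ i)
  calc (z i : ℝ) = (u i)⁻¹ * (u i * z i) := by field_simp [(hu i).ne']
    _ ≤ _ := mul_le_mul h2 h1 (mul_nonneg (hu i).le (cast_nonneg _))
      (sum_nonneg fun j _ => (inv_pos.2 (hu j)).le)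

theorem norm_realVec_le_dot (hu : ∀ i, 0 < u i) (z : Pop) :
  ‖realVec z‖ ≤ (∑ j, (u j)⁻¹) * (u ⊙ z) := by
  refine (pi_norm_le_iff_of_nonneg (mul_nonneg
    (sum_nonneg fun j _ => (inv_pos.2 (hu j)).le) (dot_nonneg hu z))).2
    fun i => ?_
  rw [realVec, norm_of_nonneg (cast_nonneg _)]
  exact coord_le_dot hu z i

theorem dot_le_norm_realVec (hu : ∀ i, 0 < u i) (z : Pop) : u ⊙ z ≤ (∑ j, u j) * ‖realVec z‖ := by
  rw [sum_mul]
  refine sum_le_sum fun i _ => mul_le_left ?_ (hu i).le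
  exact (le_abs_self _).trans (norm_le_pi_norm (realVec z) i)

theorem tendsto_dot_iff_norm {ι : Type*} {l : Filter ι} (hu : ∀ i, 0 < u i) (f : ι → Pop) :
  Tendsto (fun n => u ⊙ (f n)) l atTop ↔ Tendsto (fun n => ‖realVec (f n)‖) l atTop := by
  constructor
  · intro h
    refine tendsto_atTop_mono' l ?_ (h.const_mul_atTop (r := (∑ j, u j + 1)⁻¹) ?_)
    · refine Eventually.of_forall fun n => ?_
      have hs : 0 ≤ ∑ j, u j := sum_nonneg fun j _ => (hu j).le
      rw [inv_mul_le_iff₀ (by linarith)]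
      have := dot_le_norm_realVec hu (f n)
      nlinarith [norm_nonneg (realVec (f n))]
    · have hs : 0 ≤ ∑ j, u j := sum_nonneg fun j _ => (hu j).le
      positivity
  · intro h
    have hs : 0 ≤ ∑ j, (u j)⁻¹ := sum_nonneg fun j _ => (inv_pos.2 (hu j)).le
    refine tendsto_atTop_mono' l ?_ (h.const_mul_atTop (r := (∑ j, (u j)⁻¹ + 1)⁻¹) ✓)
    refine Eventually.of_forall fun n => ?_
    rw [inv_mul_le_iff₀ (by linarith)]
    have := norm_realVec_le_dot hu (f n)
    nlinarith [dot_nonneg hu (f n)]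

theorem growing_eq_comap (hu : ∀ i, 0 < u i) : growing p = comap (fun z => u ⊙ z) atTop := by
  refine le_antisymm (map_le_iff_le_comap.1 ?_) (map_le_iff_le_comap.1 ?_)
  · exact (tendsto_dot_iff_norm hu id).2 tendsto_comap
  · exact (tendsto_dot_iff_norm hu id).1 tendsto_comap

theorem tendsto_dot_growing (hu : ∀ i, 0 < u i) : Tendsto (fun z => u ⊙ z) (growing p) atTop := by
  rw [growing_eq_comap hu]
  exact tendsto_comap

theorem eventually_growing (hu : ∀ i, 0 < u i) {Q : Pop → Prop} :
  (∀ᶠ z in growing p, Q z) ↔ ∃ K : ℝ, 1 ≤ K ∧ ∀ z, K ≤ u ⊙ z → Q z := by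
  rw [growing_eq_comap hu, eventually_comap]
  constructor
  · intro h
    obtain ⟨K, hK⟩ := eventually_atTop.1 h
    exact ⟨max K 1, le_max_right _ _, fun z hz => hK _ ((le_max_left _ _).trans hz) z rfl⟩
  · rintro ⟨K, -, hK⟩
    filter_upwards [eventually_ge_atTop K] with b hb z hz
    exact hK z (hz ▸ hb)

theorem finite_dot_le (hu : ∀ i, 0 < u i) (K : ℝ) : {z : Pop | u ⊙ z ≤ K}.Finite := by
  refine (Set.finite_Iic (fun _ : Fin p => ⌊(∑ j, (u j)⁻¹) * K⌋₊)).subset fun z hz i => ?_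
  refine Nat.le_floor ((coord_le_dot hu z i).trans ?_)
  exact mul_le_left hz (sum_nonneg fun j _ => (inv_pos.2 (hu j)).le)

theorem growing_neBot [NeZero p] (hu : ∀ i, 0 < u i) : (growing p).NeBot := by
  rw [growing_eq_comap hu, comap_neBot_iff_frequently, frequently_atTop]
  intro K
  obtain ⟨n, hn⟩ := exists_nat_gt (K / u 0)
  refine ⟨u ⊙ (fun _ => n), ?_, _, rfl⟩
  have h1 : u 0 * n ≤ u ⊙ (fun _ => n) :=
    single_le_sum (f := fun j => u j * realVec (fun _ : Fin p => n) j)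
      (fun j _ => mul_nonneg (hu j).le (cast_nonneg _)) (mem_univ 0)
  rw [div_lt_iff₀ (hu 0)] at hn
  linarith

theorem exists_bound_of_eventually (hu : ∀ i, 0 < u i) {f g : Pop → ℝ} {C : ℝ}
  (h : ∀ᶠ z in growing p, f z ≤ C * g z) (hg : ∀ z, 0 ≤ g z) :
  ∃ C' : ℝ, 0 < C' ∧ ∀ z, f z ≤ C' * (1 + g z) := by
  obtain ⟨K, -, hK⟩ := (eventually_growing hu).1 h
  obtain ⟨B, hB⟩ := ((finite_dot_le hu K).image f).bddAbove
  refine ⟨max 1 (max B C), ✓, fun z => ?_⟩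
  have h1 := le_max_left B C
  have h2 := le_max_right B C
  have h3 := le_max_right 1 (max B C)
  have h4 := le_max_left 1 (max B C)
  rcases le_total (u ⊙ z) K with hz | hz
  · have := hB (Set.mem_image_of_mem f hz)
    nlinarith [hg z]
  · have := hK z hz
    nlinarith [hg z]

theorem rpow_le_add_rpow {y T a b : ℝ} (hy : 0 ≤ y) (hT : 0 < T) (ha : 0 < a) (hab : a ≤ b) :
  y ^ a ≤ T ^ a + y ^ b * T ^ (a - b) := by
  rcases le_total y T with h | h
  · have h1 := rpow_le_rpow hy h ha.le
    have : 0 ≤ y ^ b * T ^ (a - b) := ✓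
    linarith
  · have hy' : 0 < y := hT.trans_le h
    have h1 : y ^ (a - b) ≤ T ^ (a - b) := rpow_le_rpow_of_nonpos hT h (by linarith)
    have h2 : y ^ a = y ^ b * y ^ (a - b) := by rw [← rpow_add hy']; congr 1; ring
    have h3 : 0 ≤ T ^ a := ✓
    have h4 := mul_le_left h1 (rpow_nonneg hy b)
    linarith

/-- Lyapunov's inequality, with an explicit scale. -/
theorem integral_rpow_le {Ω : Type*} [MeasurableSpace Ω] {P : Measure Ω}
  [IsProbabilityMeasure P] {f : Ω → ℝ} {T K a b : ℝ} (hf : ∀ o, 0 ≤ f o) (hT : 0 < T) (ha : 0 < a)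
  (hab : a ≤ b) (hb : Integrable (fun o => f o ^ b) P) (h : ∫ o, f o ^ b ∂P ≤ K * T ^ b) :
  ∫ o, f o ^ a ∂P ≤ (1 + K) * T ^ a := by
  have h1 : ∫ o, f o ^ a ∂P ≤ ∫ o, (T ^ a + f o ^ b * T ^ (a - b)) ∂P := by
    refine integral_mono_of_nonneg (ae_of_all _ fun o => rpow_nonneg (hf o) _)
      ((integrable_const _).add (hb.mul_const _)) (ae_of_all _ fun o => ?_)
    exact rpow_le_add_rpow (hf o) hT ha hab
  rw [integral_add (integrable_const _) (hb.mul_const _), integral_mul_const] at h1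
  have h2 := mul_le_right h (rpow_nonneg hT.le (a - b))
  rw [mul_assoc, ← rpow_add hT] at h2
  simp only [integral_const, probReal_univ, one_smul, add_sub_cancel] at h1 h2
  linarith

theorem IsLittleO.tendsto_div_of_sub {ι : Type*} {l : Filter ι} {f g : ι → ℝ} {c : ℝ}
  (hg : ∀ᶠ z in l, 0 < g z) (h : (fun z => f z - c * g z) =o[l] g) :
  Tendsto (fun z => f z / g z) l (𝓝 c) := by
  have h1 := h.tendsto_div_nhds_zero.add_const c
  rw [zero_add] at h1
  refine h1.congr' ?_
  filter_upwards [hg] with z hz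
  field_simp
  ring

theorem exists_common_bound {ι α : Type*} [Fintype ι] {l : Filter α} {f : ι → α → ℝ} {g : α → ℝ}
  (h : ∀ i, f i =O[l] g) : ∃ K : ℝ, 0 < K ∧ ∀ᶠ z in l, ∀ i, |f i z| ≤ K * |g z| := by
  choose K hK hKb using fun i => (h i).exists_pos
  have h0 : 0 ≤ ∑ i, K i := sum_nonneg fun i _ => (hK i).le
  refine ⟨∑ i, K i + 1, by linarith, ?_⟩
  filter_upwards [eventually_all.2 fun i => (hKb i).bound] with z hz i
  refine (hz i).trans (mul_le_right ?_ (norm_nonneg _))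
  have := single_le_sum (f := K) (fun j _ => (hK j).le) (mem_univ i)
  linarith

/-- Moment bounds for the migration in state `z`, of the order of magnitude `‖z‖ ^ β`. -/
structure MigrationBounds (W : MBPM P p) (u : Vec) (β δ K : ℝ) (z : Pop) : Prop where
  one_le : 1 ≤ u ⊙ z
  size : ∀ i, ∫ o, |(z i : ℝ) + (W.M 0 z o i : ℝ)| ^ (1 + δ / 2) ∂P ≤
    K * ((u ⊙ z) ^ β) ^ (1 + δ / 2)
  int : ∀ i, Integrable (fun o => |(W.M 0 z o i : ℝ) - W.h z i| ^ (2 + δ)) P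
  dev : ∀ i, ∫ o, |(W.M 0 z o i : ℝ) - W.h z i| ^ (2 + δ) ∂P ≤ K * ((u ⊙ z) ^ (β / 2)) ^ (2 + δ)

theorem eventually_migrationBounds (W : MBPM P p) {u : Vec} (hpos : ∀ i, 0 < u i)
  {β ν δ : ℝ} (hδ : 0 < δ)
  (hii : (fun z => W.sigmaSq u z - ν * (u ⊙ z) ^ β)
    =o[growing p] fun z => (u ⊙ z) ^ β)
  (hint : ∀ i, ∀ᶠ z in growing p, Integrable (fun o => |(W.M 0 z o i : ℝ) - W.h z i| ^ (2 + δ)) P)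
  (hsize : ∀ i, (fun z => ∫ o, |(z i : ℝ) + (W.M 0 z o i : ℝ)| ^ (1 + δ / 2) ∂P)
    =O[growing p] fun z => (W.sigmaSq u z) ^ (1 + δ / 2))
  (hdev : ∀ i, (fun z => ∫ o, |(W.M 0 z o i : ℝ) - W.h z i| ^ (2 + δ) ∂P)
    =O[growing p] fun z => (W.sigmaSq u z) ^ (1 + δ / 2)) :
  ∃ K : ℝ, 0 < K ∧ ∀ᶠ z in growing p, W.MigrationBounds u β δ K z := by
  have h1 : (fun z => W.sigmaSq u z) =O[growing p] fun z => (u ⊙ z) ^ β := by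
    have h := hii.isBigO.add (isBigO_const_mul_self ν (fun z => (u ⊙ z) ^ β) (growing p))
    simpa using h
  have h2 : (fun z => (W.sigmaSq u z) ^ (1 + δ / 2)) =O[growing p]
    fun z => ((u ⊙ z) ^ β) ^ (1 + δ / 2) := by
    refine h1.rpow (by linarith) (Eventually.of_forall fun z => ?_)
    exact rpow_nonneg (dot_nonneg hpos z) _
  obtain ⟨K1, hK1, e1⟩ := exists_common_bound fun i => (hsize i).trans h2
  obtain ⟨K2, hK2, e2⟩ := exists_common_bound fun i => (hdev i).trans h2
  refine ⟨K1 + K2, ✓, ?_⟩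
  filter_upwards [e1, e2, eventually_all.2 hint,
    (tendsto_dot_growing hpos).eventually_ge_atTop 1] with z a1 a2 a3 a4
  have hx : 0 < u ⊙ z := by linarith
  have hn : 0 ≤ ((u ⊙ z) ^ β) ^ (1 + δ / 2) := ✓
  refine ⟨a4, fun i => ?_, a3, fun i => ?_⟩
  · have := (le_abs_self _).trans (a1 i)
    rw [abs_of_nonneg hn] at this
    exact this.trans (mul_le_right (by linarith) hn)
  · have := (le_abs_self _).trans (a2 i)
    rw [abs_of_nonneg hn] at this
    have e : ((u ⊙ z) ^ (β / 2)) ^ (2 + δ) = ((u ⊙ z) ^ β) ^ (1 + δ / 2) := by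
      rw [← rpow_mul hx.le, ← rpow_mul hx.le]
      congr 1
      ring
    rw [e]
    exact this.trans (mul_le_right (by linarith) hn)

theorem integrable_size_rpow (W : MBPM P p) (hmom : W.FiniteSecondMoments) {δ : ℝ} (hδ : 0 < δ)
  (hδ' : δ ≤ 1) (z : Pop) (i : Fin p) :
  Integrable (fun o => |(z i : ℝ) + (W.M 0 z o i : ℝ)| ^ (1 + δ / 2)) P := by
  have hm : MemLp (fun o => (z i : ℝ) + (W.M 0 z o i : ℝ)) 2 P :=
    (memLp_const (μ := P) (z i : ℝ)).add (hmom.2 z i)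
  refine ((integrable_const 1).add hm.integrable_sq).mono'
    ((hm.aestronglyMeasurable.aemeasurable.abs.pow_const _).aestronglyMeasurable)
    (ae_of_all _ fun o => ?_)
  rw [norm_of_nonneg ✓]
  have := rpow_le_add_rpow (abs_nonneg ((z i : ℝ) + (W.M 0 z o i : ℝ))) one_pos
    (by linarith : 0 < 1 + δ / 2) (by push_cast; linarith : 1 + δ / 2 ≤ (2 : ℕ))
  rw [rpow_natCast, sq_abs] at this
  simpa using this

namespace MigrationBounds

theorem parents_mean_le (h : W.MigrationBounds u β δ K z) (hmom : W.FiniteSecondMoments)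
  (hδ : 0 < δ) (hδ' : δ ≤ 1) (i : Fin p) :
  z i + W.h z i ≤ (1 + K) * (u ⊙ z) ^ β := by
  have hx : 0 < u ⊙ z := by linarith [h.one_le]
  have := integral_rpow_le (P := P) (a := 1) (T := (u ⊙ z) ^ β)
    (fun o => abs_nonneg _) ✓ one_pos (by linarith : 1 ≤ 1 + δ / 2)
    (W.integrable_size_rpow hmom hδ hδ' z i) (h.size i)
  simp only [rpow_one] at this
  rw [← (W.integral_parents hmom z i).2]
  simp only [W.parents_cast]
  refine le_trans (integral_mono ?_ ?_ fun o => le_abs_self _) this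
  · simpa only [W.parents_cast] using (W.integral_parents hmom z i).1
  · simpa only [W.parents_cast] using (W.integral_parents hmom z i).1.abs

theorem migrationVar_le (h : W.MigrationBounds u β δ K z) (hδ : 0 < δ) (i : Fin p) :
  W.migrationVar z i ≤ (1 + K) * (u ⊙ z) ^ β := by
  have hx : 0 < u ⊙ z := by linarith [h.one_le]
  have := integral_rpow_le (P := P) (a := (2 : ℕ)) (T := (u ⊙ z) ^ (β / 2))
    (fun o => abs_nonneg _) ✓ (by norm_num) (by push_cast; linarith)
    (h.int i) (h.dev i)
  simp only [rpow_natCast, sq_abs] at this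
  refine this.trans (le_of_eq ?_)
  rw [← rpow_natCast, ← rpow_mul hx.le]
  congr 2
  push_cast
  ring

end MigrationBounds

/-- The one-step behaviour of the process in the direction of the left eigenvector, and transversal
to it. -/
structure OneStep (W : MBPM P p) (u : Vec) (C α β ν : ℝ) : Prop where
  u_pos : ∀ i, 0 < u i
  p_pos : NeZero p
  C_pos : 0 < C
  ν_pos : 0 < ν
  α_nonneg : 0 ≤ α
  α_lt : α < 1
  one_le_β : 1 ≤ β
  β_le : β ≤ 1 + α
  memLp : ∀ z, MemLp (fun o => u ⊙ W.next z o) 2 P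
  mean : ∀ z, ∫ o, u ⊙ W.next z o ∂P = u ⊙ z + u ⬝ᵥ W.h z
  drift_pos : ∀ z, z ≠ 0 → 0 < u ⬝ᵥ W.h z
  drift : Tendsto (fun z => (u ⬝ᵥ W.h z) / (u ⊙ z) ^ α) (growing p) (𝓝 C)
  var : Tendsto (fun z => (∫ o, fluct W u z o ^ 2 ∂P) / (u ⊙ z) ^ β) (growing p) (𝓝 ν)
  lindeberg : ∀ η > 0, ∃ L > 0, ∀ᶠ z in growing p, ∫ o in {o | L * (u ⊙ z) ^ (β / 2) <
    |fluct W u z o|},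
    fluct W u z o ^ 2 ∂P ≤
    η * (u ⊙ z) ^ β
  lower : ∃ γ > 1 - α, ∃ K : ℝ, ∀ᶠ z in growing p,
    P.real {o | u ⊙ W.next z o ≤ (u ⊙ z) / 2} ≤ K * (u ⊙ z) ^ (-γ)
  integrable_coord : ∀ z a, Integrable (fun o => (W.next z o a : ℝ)) P
  dev : ∃ K > 0, ∀ z a, ∫ o, |(W.next z o a : ℝ) - (W.meanMatrix.mulVec (realVec z + W.h z)) a| ∂P ≤
    K * (1 + (u ⊙ z) ^ (β / 2))
  h_bound : ∃ K > 0, ∀ z i, |W.h z i| ≤ K * (1 + (u ⊙ z) ^ α)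

theorem lintegral_migration_rpow_le (hδ : 0 < δ) (hδ' : δ ≤ 1)
  (hpos : ∀ i, 0 < u i) (hu1 : ∀ i, u i ≤ 1) {z : Pop} (h : W.MigrationBounds u β δ K z) :
  ∫⁻ o, ofReal (|∑ i, u i * ((W.M 0 z o i : ℝ) - W.h z i)| ^ (2 + δ)) ∂P ≤
    ofReal ((p : ℝ) ^ 3 * (K * ((u ⊙ z) ^ (β / 2)) ^ (2 + δ))) := by
  have hm : ∀ i, Measurable fun o => u i * ((W.M 0 z o i : ℝ) - W.h z i) := fun i =>
    (((measurable_of_countable fun n : ℤ => (n : ℝ)).comp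
      ((measurable_pi_apply i).comp (W.measurable_M 0 z))).sub_const _).const_mul _
  calc _ ≤ _ := lintegral_abs_sum_rpow_le hm hδ hδ'
    _ ≤ ofReal ((p : ℝ) ^ 2) * ∑ i : Fin p, ofReal (K * ((u ⊙ z) ^ (β / 2)) ^ (2 + δ)) := by
      gcongr with i
      refine le_trans (lintegral_mono fun o => ofReal_le_ofReal ?_)
        ((ofReal_integral_eq_lintegral_ofReal (h.int i) (ae_of_all _ fun o => ✓)).symm.trans_le
        (ofReal_le_ofReal (h.dev i)))
      refine rpow_le_rpow (abs_nonneg _) ?_ (by linarith)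
      rw [abs_mul, abs_of_pos (hpos i)]
      exact mul_le_of_le_one_left (abs_nonneg _) (hu1 i)
    _ = _ := by
      rw [sum_const, Finset.card_univ, Fintype.card_fin, nsmul_eq_mul, ← ofReal_natCast,
        ← ofReal_mul ✓, ← ofReal_mul ✓]
      congr 1
      ring

/-- The decomposition with moments of the order of magnitude given by the migration. -/
theorem exists_decomposition_bounds (hmom : W.FiniteSecondMoments)
  (hu : Matrix.vecMul u W.meanMatrix = u) (hpos : ∀ i, 0 < u i) (hu1 : ∀ i, u i ≤ 1)
  (hδ : 0 < δ) (hδ' : δ ≤ 1) (hK : 0 < K) {η : ℝ} (hη : 0 < η) :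
  ∃ B : ℝ, 0 < B ∧ ∀ z, W.MigrationBounds u β δ K z → ∃ e e₃ : Ω → ℝ, Measurable e ∧
    Measurable e₃ ∧ (∀ o, 0 ≤ e o) ∧
    (∀ o, |fluct W u z o| ≤ e o + |e₃ o|) ∧
    (∀ o, 3 / 4 * (u ⊙ z + u ⬝ᵥ W.h z) - e o ≤ u ⊙ W.next z o) ∧
    (∫⁻ o, ofReal (e o ^ (2 + δ)) ∂P ≤ ofReal (B * ((u ⊙ z) ^ (β / 2)) ^ (2 + δ))) ∧
    ∫⁻ o, ofReal (e₃ o ^ 2) ∂P ≤ ofReal (η * (u ⊙ z) ^ β) := by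
  obtain ⟨B, hB, hdec⟩ := W.exists_decomposition hmom hu hpos (η := η / (p * (1 + K) + 1)) ✓
  refine ⟨4 * (B * p * K + (p : ℝ) ^ 3 * K) + 1, ✓, fun z hz => ?_⟩
  obtain ⟨e₁, e₃, m1, m3, hsum, hlow, hmo1, hmo3⟩ := hdec z
  have hx : 0 < u ⊙ z := by linarith [hz.one_le]
  set e₂ : Ω → ℝ := fun o => ∑ i, u i * ((W.M 0 z o i : ℝ) - W.h z i) with he₂
  have m2 : Measurable e₂ := by
    refine Finset.measurable_fun_sum _ fun i _ => Measurable.const_mul (Measurable.sub_const ?_ _) _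
    exact (measurable_of_countable fun n : ℤ => (n : ℝ)).comp
      ((measurable_pi_apply i).comp (W.measurable_M 0 z))
  set A := ((u ⊙ z) ^ (β / 2)) ^ (2 + δ) with hA
  have hA0 : 0 ≤ A := ✓
  have eA : ((u ⊙ z) ^ β) ^ (1 + δ / 2) = A := by
    rw [hA, ← rpow_mul hx.le, ← rpow_mul hx.le]
    congr 1
    ring
  refine ⟨fun o => |e₁ o| + |e₂ o|, e₃, m1.abs.add m2.abs, m3, fun o => ✓,
    fun o => ?_, fun o => ?_, ?_, ?_⟩
  · have := hsum o
    rw [dotProduct_add] at this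
    rw [this]
    exact (abs_add_le _ _).trans (add_le_add_left (abs_add_le _ _) _)
  · have := hlow o
    rw [dotProduct_add] at this
    have h1 := neg_abs_le (e₁ o)
    have h2 := neg_abs_le (e₂ o)
    have h3 := abs_nonneg (e₂ o)
    simp only [he₂] at h2 h3 ⊢
    linarith
  · calc _ ≤ ofReal 4 * (∫⁻ o, ofReal (|e₁ o| ^ (2 + δ)) ∂P +
            ∫⁻ o, ofReal (|e₂ o| ^ (2 + δ)) ∂P) := by
          have := lintegral_abs_sum_rpow_le (P := P) (a := ![fun o => |e₁ o|, fun o => |e₂ o|])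
            (by simp [Fin.forall_fin_two, m1.abs, m2.abs]) hδ hδ'
          have e (o) : |(|e₁ o| + |e₂ o|)| = |e₁ o| + |e₂ o| := abs_of_nonneg ✓
          norm_num [Fin.sum_univ_two, e] at this ⊢
          exact this
      _ ≤ ofReal 4 * (ofReal (B * (p * (K * A))) + ofReal ((p : ℝ) ^ 3 * (K * A))) := by
        gcongr
        · refine (hmo1 δ hδ hδ').trans ?_
          rw [ofReal_mul hB]
          gcongr
          calc _ ≤ ∑ i : Fin p, ofReal (K * A) := by
                refine sum_le_sum fun i _ => ?_
                rw [← ofReal_integral_eq_lintegral_ofReal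
                  (W.integrable_size_rpow hmom hδ hδ' z i) (ae_of_all _ fun o => ✓)]
                refine ofReal_le_ofReal ?_
                rw [← eA]
                exact hz.size i
            _ = _ := by simp
        · exact lintegral_migration_rpow_le hδ hδ' hpos hu1 hz
      _ ≤ _ := by
        rw [← ofReal_add ✓ ✓, ← ofReal_mul (by norm_num)]
        refine ofReal_le_ofReal ?_
        nlinarith
  · refine hmo3.trans (ofReal_le_ofReal ?_)
    have h1 : ∑ i, ((z i : ℝ) + W.h z i) ≤ p * ((1 + K) * (u ⊙ z) ^ β) := by
      calc _ ≤ ∑ i : Fin p, (1 + K) * (u ⊙ z) ^ β :=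
            sum_le_sum fun i _ => hz.parents_mean_le hmom hδ hδ' i
        _ = _ := by simp
    have h2 : (0 : ℝ) < p * (1 + K) + 1 := ✓
    have h3 : 0 ≤ (u ⊙ z) ^ β := ✓
    calc _ ≤ η / (p * (1 + K) + 1) * (p * ((1 + K) * (u ⊙ z) ^ β)) := by gcongr
      _ = η * (u ⊙ z) ^ β * ((p * (1 + K)) / (p * (1 + K) + 1)) := by field_simp
      _ ≤ η * (u ⊙ z) ^ β * 1 := by
        gcongr
        rw [div_le_one h2]
        linarith
      _ = _ := mul_one _

theorem lindeberg_of_decomposition {ε e e₃ : Ω → ℝ} (hε : MemLp ε 2 P) (hεm : Measurable ε)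
  (he₃ : Measurable e₃) (hle : ∀ o, |ε o| ≤ e o + |e₃ o|)
  (he0 : ∀ o, 0 ≤ e o)
  {δ A₁ A₃ T : ℝ} (hT : 0 < T) (hδ : 0 < δ) (hA₁ : 0 ≤ A₁) (hA₃ : 0 ≤ A₃)
  (h1 : ∫⁻ o, ofReal (e o ^ (2 + δ)) ∂P ≤ ofReal A₁)
  (h3 : ∫⁻ o, ofReal (e₃ o ^ 2) ∂P ≤ ofReal A₃) :
  ∫ o in {o | T < |ε o|}, ε o ^ 2 ∂P ≤ 4 * (A₃ + (T / 2) ^ (-δ) * A₁) := by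
  have hpt : ∀ o, T < |ε o| → ε o ^ 2 ≤ 4 * (e₃ o ^ 2 + (T / 2) ^ (-δ) * e o ^ (2 + δ)) := by
    intro o ho
    have hp : 0 ≤ (T / 2) ^ (-δ) * e o ^ (2 + δ) := mul_nonneg ✓ (rpow_nonneg (he0 o) _)
    have hl := hle o
    have ha := abs_nonneg (ε o)
    rcases le_total (e o) (|e₃ o|) with h | h
    · have : |ε o| ≤ 2 * |e₃ o| := by linarith
      have h4 : |ε o| ^ 2 ≤ (2 * |e₃ o|) ^ 2 := by gcongr
      rw [mul_pow, sq_abs, sq_abs] at h4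
      linarith
    · have h2 : |ε o| ≤ 2 * e o := by linarith
      have h4 : |ε o| ^ 2 ≤ (2 * e o) ^ 2 := by gcongr
      rw [sq_abs, mul_pow] at h4
      have h5 : T / 2 ≤ e o := by linarith
      have h6 : e o ^ (-δ) ≤ (T / 2) ^ (-δ) := rpow_le_rpow_of_nonpos (by linarith) h5 (by linarith)
      have he' : 0 < e o := by linarith
      have h7 : e o ^ 2 = e o ^ (-δ) * e o ^ (2 + δ) := by
        rw [← rpow_add he', ← rpow_natCast]
        congr 1
        push_cast
        ring
      have h8 := mul_le_right h6 (rpow_nonneg (he0 o) (2 + δ))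
      have := sq_nonneg (e₃ o)
      linarith
  have hS : MeasurableSet {o | T < |ε o|} := measurableSet_lt measurable_const hεm.abs
  refine (ENNReal.ofReal_le_ofReal_iff ✓).1 ?_
  rw [ofReal_integral_eq_lintegral_ofReal hε.integrable_sq.integrableOn
    (ae_of_all _ fun o => sq_nonneg _)]
  calc _ ≤ ∫⁻ o, ofReal 4 * (ofReal (e₃ o ^ 2) +
        ofReal ((T / 2) ^ (-δ)) * ofReal (e o ^ (2 + δ))) ∂P := by
        refine (setLIntegral_mono' hS fun o ho => ?_).trans (setLIntegral_le_lintegral _ _)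
        have := rpow_nonneg (he0 o) (2 + δ)
        rw [← ofReal_mul ✓, ← ofReal_add ✓ ✓, ← ofReal_mul (by norm_num)]
        exact ofReal_le_ofReal (hpt o ho)
    _ = ofReal 4 * (∫⁻ o, ofReal (e₃ o ^ 2) ∂P +
      ofReal ((T / 2) ^ (-δ)) * ∫⁻ o, ofReal (e o ^ (2 + δ)) ∂P) := by
      rw [lintegral_const_mul' _ _ ofReal_ne_top,
        lintegral_add_left (he₃.pow_const 2).ennreal_ofReal,
        lintegral_const_mul' _ _ ofReal_ne_top]
    _ ≤ ofReal 4 * (ofReal A₃ + ofReal ((T / 2) ^ (-δ)) * ofReal A₁) := by gcongr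
    _ = _ := by
      rw [← ofReal_mul ✓, ← ofReal_add ✓
        ✓, ← ofReal_mul (by norm_num)]

theorem measureReal_ge_le_of_lintegral_rpow {e : Ω → ℝ} (he : Measurable e)
  {r A T : ℝ} (hr : 0 < r) (hT : 0 < T) (hA : 0 ≤ A)
  (h : ∫⁻ o, ofReal (e o ^ r) ∂P ≤ ofReal A) :
  P.real {o | T ≤ e o} ≤ A * T ^ (-r) := by
  have h1 := mul_meas_ge_le_lintegral (μ := P) (he.pow_const r).ennreal_ofReal (ofReal (T ^ r))
  have h2 : {o | T ≤ e o} ⊆ {o | ofReal (T ^ r) ≤ ofReal (e o ^ r)} :=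
    fun o ho => ofReal_le_ofReal (rpow_le_rpow hT.le ho hr.le)
  have h3 : ofReal (T ^ r) * P {o | T ≤ e o} ≤ ofReal A :=
    (mul_le_mul_right (measure_mono h2) _).trans (h1.trans h)
  have h4 := toReal_mono ofReal_ne_top h3
  rw [toReal_mul, toReal_ofReal ✓, toReal_ofReal hA] at h4
  have hTr : 0 < T ^ r := ✓
  rw [rpow_neg hT.le, ← div_eq_mul_inv, le_div_iff₀ hTr, mul_comm]
  exact h4

theorem PerronVectors.le_one {v : Vec} (huv : W.PerronVectors u v) (i : Fin p) : u i ≤ 1 := by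
  rw [← huv.2.2.2.2.1]
  exact single_le_sum (fun j _ => (huv.2.2.1 j).le) (mem_univ i)

theorem PerronVectors.neZero {v : Vec} (huv : W.PerronVectors u v) : NeZero p := by
  refine ⟨?_⟩
  rintro rfl
  have := huv.2.2.2.2.1
  simp at this

theorem tendsto_drift (hpos : ∀ i, 0 < u i) {α : ℝ} {c : Vec}
  (hi : ∀ i, (fun z => W.h z i - c i * (u ⊙ z) ^ α)
    =o[growing p] fun z => (u ⊙ z) ^ α) :
  Tendsto (fun z => (u ⬝ᵥ W.h z) / (u ⊙ z) ^ α) (growing p) (𝓝 (u ⬝ᵥ c)) := by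
  refine IsLittleO.tendsto_div_of_sub ?_ ?_
  · filter_upwards [(tendsto_dot_growing hpos).eventually_gt_atTop 0] with z hz
    positivity
  · have h : (fun z => ∑ i, u i * (W.h z i - c i * (u ⊙ z) ^ α)) =o[growing p]
      fun z => (u ⊙ z) ^ α :=
      IsLittleO.fun_sum fun i _ => (hi i).const_mul_left (u i)
    refine h.congr_left fun z => ?_
    simp only [mul_sub, sum_sub_distrib, dotProduct, sum_mul, mul_assoc]

theorem exists_h_bound (hpos : ∀ i, 0 < u i) {α : ℝ} {c : Vec}
  (hi : ∀ i, (fun z => W.h z i - c i * (u ⊙ z) ^ α)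
    =o[growing p] fun z => (u ⊙ z) ^ α) :
  ∃ K > 0, ∀ z i, |W.h z i| ≤ K * (1 + (u ⊙ z) ^ α) := by
  have h1 : ∀ i, (fun z => W.h z i) =O[growing p] fun z => (u ⊙ z) ^ α := by
    intro i
    have h := (hi i).isBigO.add (isBigO_const_mul_self (c i) (fun z => (u ⊙ z) ^ α) (growing p))
    simpa using h
  obtain ⟨K, hK, hb⟩ := exists_common_bound h1
  have hnn : ∀ z : Pop, 0 ≤ (u ⊙ z) ^ α := fun z => rpow_nonneg (dot_nonneg hpos z) _
  have hb' : ∀ᶠ z in growing p, (∑ i, |W.h z i|) ≤ (p * K) * (u ⊙ z) ^ α := by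
    filter_upwards [hb] with z hz
    calc _ ≤ ∑ i : Fin p, K * (u ⊙ z) ^ α := sum_le_sum fun i _ => by
          have := hz i
          rwa [abs_of_nonneg (hnn z)] at this
      _ = _ := by simp [mul_assoc]
  obtain ⟨C, hC, hCb⟩ := exists_bound_of_eventually hpos hb' hnn
  exact ⟨C, hC, fun z i => (single_le_sum (f := fun i => |W.h z i|)
    (fun j _ => abs_nonneg _) (mem_univ i)).trans (hCb z)⟩

theorem single_dot_realVec (a : Fin p) (x : Vec) : (Pi.single a (1 : ℝ) : Vec) ⬝ᵥ x = x a := by simp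

theorem exists_dev_bound (hmom : W.FiniteSecondMoments) (hpos : ∀ i, 0 < u i) {β δ K : ℝ}
  (hδ : 0 < δ) (hδ' : δ ≤ 1) (hK : 0 < K)
  (hb : ∀ᶠ z in growing p, W.MigrationBounds u β δ K z) :
  ∃ K' > 0, ∀ z a, ∫ o, |(W.next z o a : ℝ) -
    (W.meanMatrix.mulVec (realVec z + W.h z)) a| ∂P ≤ K' * (1 + (u ⊙ z) ^ (β / 2)) := by
  have e1 : ∀ z a o, (Pi.single a (1 : ℝ) : Vec) ⊙ W.next z o =
    (W.next z o a : ℝ) := fun z a o => by rw [single_dot_realVec]; rfl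
  have e2 : ∀ z a, Matrix.vecMul (Pi.single a (1 : ℝ)) W.meanMatrix ⬝ᵥ (realVec z + W.h z) =
    (W.meanMatrix.mulVec (realVec z + W.h z)) a := fun z a => by
    rw [← Matrix.dotProduct_mulVec, single_dot_realVec]
  have hnn : ∀ z : Pop, 0 ≤ (u ⊙ z) ^ (β / 2) := fun z => rpow_nonneg (dot_nonneg hpos z) _
  let B : Vec := fun a => 2 * p * ∑ i, ((1 + K) * W.offspringVar (Pi.single a 1) i +
    Matrix.vecMul (Pi.single a (1 : ℝ)) W.meanMatrix i ^ 2 * (1 + K))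
  have hev : ∀ᶠ z in growing p, (∑ a, ∫ o, |(W.next z o a : ℝ) -
    (W.meanMatrix.mulVec (realVec z + W.h z)) a| ∂P) ≤
    (∑ a, (1 + B a)) * (u ⊙ z) ^ (β / 2) := by
    filter_upwards [hb] with z hz
    have hx : 0 < u ⊙ z := by linarith [hz.one_le]
    rw [sum_mul]
    refine sum_le_sum fun a _ => ?_
    have h1 := W.integral_sq_dot_next_sub_le hmom (Pi.single a 1) z
    have hm : MemLp (fun o => (Pi.single a (1 : ℝ) : Vec) ⊙ W.next z o -
      Matrix.vecMul (Pi.single a (1 : ℝ)) W.meanMatrix ⬝ᵥ (realVec z + W.h z)) 2 P :=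
      (W.memLp_dot_next hmom _ z).sub (memLp_const _)
    simp only [e1, e2] at h1 hm
    have hxx : ((u ⊙ z) ^ (β / 2)) ^ ((2 : ℕ) : ℝ) = (u ⊙ z) ^ β := by
      rw [← rpow_mul hx.le]
      congr 1
      push_cast
      ring
    have h2 : ∫ o, |(W.next z o a : ℝ) - (W.meanMatrix.mulVec (realVec z + W.h z)) a| ^
      ((2 : ℕ) : ℝ) ∂P ≤ B a * ((u ⊙ z) ^ (β / 2)) ^ ((2 : ℕ) : ℝ) := by
      simp only [rpow_natCast _ 2, sq_abs] at hxx ⊢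
      rw [hxx]
      refine h1.trans ?_
      simp only [B]
      rw [mul_assoc (2 * (p : ℝ)), sum_mul]
      gcongr with i
      rw [add_mul]
      have hv : 0 ≤ W.offspringVar (Pi.single a 1) i := integral_nonneg fun o => sq_nonneg _
      have := mul_le_right (hz.parents_mean_le hmom hδ hδ' i) hv
      have h4 := mul_le_left (hz.migrationVar_le hδ i)
        (sq_nonneg (Matrix.vecMul (Pi.single a (1 : ℝ)) W.meanMatrix i))
      linarith
    have h3 := integral_rpow_le (P := P) (a := 1) (b := ((2 : ℕ) : ℝ))
      (T := (u ⊙ z) ^ (β / 2)) (fun o => abs_nonneg _) ✓ one_pos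
      (by norm_num) (by simpa only [rpow_natCast _ 2, sq_abs] using hm.integrable_sq) h2
    simpa only [rpow_one] using h3
  obtain ⟨C, hC, hCb⟩ := exists_bound_of_eventually hpos hev hnn
  refine ⟨C, hC, fun z a => (single_le_sum (f := fun a => ∫ o, |(W.next z o a : ℝ) -
    (W.meanMatrix.mulVec (realVec z + W.h z)) a| ∂P)
    (fun j _ => integral_nonneg fun o => abs_nonneg _) (mem_univ a)).trans (hCb z)⟩

theorem oneStep {v : Vec} (hmom : W.FiniteSecondMoments) (huv : W.PerronVectors u v)
  (hdrift : ∀ z : Pop, z ≠ 0 → 0 < u ⬝ᵥ W.h z)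
  {α : ℝ} (hα : α < 1) {c : Vec} (hc : 0 < u ⬝ᵥ c)
  (hi : ∀ i, (fun z => W.h z i - c i * (u ⊙ z) ^ α)
    =o[growing p] fun z => (u ⊙ z) ^ α)
  {β ν : ℝ} (hβ : β ≤ 1 + α) (hν : 0 < ν)
  (hii : (fun z => W.sigmaSq u z - ν * (u ⊙ z) ^ β)
    =o[growing p] fun z => (u ⊙ z) ^ β)
  {δ : ℝ} (hδ : 0 < δ) (hδ' : δ ≤ 1)
  (hb : ∃ K > 0, ∀ᶠ z in growing p, W.MigrationBounds u β δ K z) :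
  W.OneStep u (u ⬝ᵥ c) α β ν := by
  have hpos := huv.2.2.1
  have hu := huv.1
  have hp : NeZero p := huv.neZero
  have hne : (growing p).NeBot := growing_neBot hpos
  have hx := tendsto_dot_growing hpos
  obtain ⟨K, hK, hb⟩ := hb
  have hd : ∀ᶠ z in growing p, 0 < u ⬝ᵥ W.h z := by
    filter_upwards [hx.eventually_gt_atTop 0] with z hz
    refine hdrift z ?_
    rintro rfl
    simp [realVec, dotProduct] at hz
  have hβ1 : 1 ≤ β := by
    by_contra hlt
    push Not at hlt
    have h1 : ∀ᶠ z in growing p, (u ⊙ z) ^ (1 - β) ≤ 1 + K := by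
      filter_upwards [hb, hd] with z hz hdz
      have hz0 : 0 < u ⊙ z := by linarith [hz.one_le]
      have h2 : u ⊙ z + u ⬝ᵥ W.h z ≤ (1 + K) * (u ⊙ z) ^ β := by
        rw [← dotProduct_add]
        calc _ ≤ ∑ i, u i * ((1 + K) * (u ⊙ z) ^ β) := sum_le_sum fun i _ => mul_le_left
                (hz.parents_mean_le hmom hδ hδ' i) (hpos i).le
          _ = _ := by rw [← sum_mul, huv.2.2.2.2.1, one_mul]
      have h3 : u ⊙ z ≤ (1 + K) * (u ⊙ z) ^ β := by linarith
      rw [rpow_sub hz0, rpow_one, div_le_iff₀ ✓]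
      exact h3
    have h4 := ((tendsto_rpow_atTop (by linarith : 0 < 1 - β)).comp hx).eventually_gt_atTop (1 + K)
    obtain ⟨z, h5, h6⟩ := (h1.and h4).exists
    exact absurd h5 (not_le.2 h6)
  have hmean : ∀ z, ∫ o, u ⊙ W.next z o ∂P = u ⊙ z + u ⬝ᵥ W.h z := by
    intro z
    rw [W.integral_dot_next hmom u (fun i => (hpos i).le), hu, dotProduct_add]
  have hεL : ∀ z, MemLp (fun o => fluct W u z o) 2 P :=
    fun z => (W.memLp_dot_next hmom u z).sub (memLp_const _)
  refine ⟨hpos, hp, hc, hν, by linarith, hα, hβ1, hβ, W.memLp_dot_next hmom u, hmean, hdrift,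
    tendsto_drift hpos hi, ?_, ?_, ?_, ?_, exists_dev_bound hmom hpos hδ hδ' hK hb,
    exists_h_bound hpos hi⟩
  · have h1 : Tendsto (fun z => W.sigmaSq u z / (u ⊙ z) ^ β) (growing p) (𝓝 ν) := by
      refine IsLittleO.tendsto_div_of_sub ?_ hii
      filter_upwards [hx.eventually_gt_atTop 0] with z hz
      positivity
    refine h1.congr fun z => ?_
    rw [sigmaSq, variance_eq_integral (W.measurable_dot_next u z).aemeasurable, hmean]
  · intro η hη
    obtain ⟨B, hB, hdec⟩ := exists_decomposition_bounds (β := β) hmom hu hpos huv.le_one hδ hδ' hK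
      (η := η / 8) ✓
    have ht : Tendsto (fun L : ℝ => B * (L / 2) ^ (-δ)) atTop (𝓝 0) := by
      have := ((tendsto_rpow_neg_atTop hδ).comp
        (tendsto_id.atTop_div_const (by norm_num : (0 : ℝ) < 2))).const_mul B
      simpa using this
    obtain ⟨L, hL1, hL0⟩ := ((ht.eventually (gt_mem_nhds (✓ : 0 < η / 8))).and
      (eventually_gt_atTop 0)).exists
    refine ⟨L, hL0, ?_⟩
    filter_upwards [hb] with z hz
    obtain ⟨e, e₃, m1, m3, h0, hle, -, hl1, hl3⟩ := hdec z hz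
    have hz0 : 0 < u ⊙ z := by linarith [hz.one_le]
    refine (lindeberg_of_decomposition (hεL z) ((W.measurable_dot_next u z).sub_const _) m3 hle h0
      (T := L * (u ⊙ z) ^ (β / 2)) ✓ hδ ✓ ✓
      hl1 hl3).trans ?_
    have e1 : (L * (u ⊙ z) ^ (β / 2) / 2) ^ (-δ) * (B * ((u ⊙ z) ^ (β / 2)) ^ (2 + δ)) =
      B * (L / 2) ^ (-δ) * (u ⊙ z) ^ β := by
      have e2 : (u ⊙ z) ^ β = ((u ⊙ z) ^ (β / 2)) ^ (-δ) * ((u ⊙ z) ^ (β / 2)) ^ (2 + δ) := by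
        rw [← rpow_add ✓, ← rpow_mul hz0.le]
        congr 1
        ring
      rw [e2, mul_div_right_comm, mul_rpow ✓ ✓]
      ring
    rw [e1]
    have : 0 ≤ (u ⊙ z) ^ β := ✓
    nlinarith
  · obtain ⟨B, hB, hdec⟩ := exists_decomposition_bounds (β := β) hmom hu hpos huv.le_one hδ hδ' hK
      one_pos
    refine ⟨(1 + δ / 2) * (1 - α), by nlinarith, B * 4 ^ (2 + δ), ?_⟩
    filter_upwards [hb, hd] with z hz hdz
    obtain ⟨e, e₃, m1, m3, h0, -, hlow, hl1, -⟩ := hdec z hz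
    have hz0 : 0 < u ⊙ z := by linarith [hz.one_le]
    have h1 := measureReal_ge_le_of_lintegral_rpow m1 (r := 2 + δ) (T := (u ⊙ z) / 4)
      (by linarith) (by linarith) ✓ hl1
    have h2 : P.real {o | u ⊙ W.next z o ≤ (u ⊙ z) / 2} ≤ P.real {o | (u ⊙ z) / 4 ≤ e o} := by
      refine measureReal_mono fun o ho => ?_
      have := hlow o
      simp only [mem_ofPred_eq] at ho ⊢
      linarith
    refine h2.trans (h1.trans ?_)
    have e1 : B * ((u ⊙ z) ^ (β / 2)) ^ (2 + δ) * (u ⊙ z / 4) ^ (-(2 + δ)) =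
      B * 4 ^ (2 + δ) * (u ⊙ z) ^ (-((1 + δ / 2) * (2 - β))) := by
      rw [div_eq_mul_inv (u ⊙ z) 4, mul_rpow hz0.le (by norm_num), inv_rpow (by norm_num),
        rpow_neg (by norm_num : (0 : ℝ) ≤ 4), inv_inv, ← rpow_mul hz0.le]
      have : (u ⊙ z) ^ (-((1 + δ / 2) * (2 - β))) =
        (u ⊙ z) ^ (β / 2 * (2 + δ)) * (u ⊙ z) ^ (-(2 + δ)) := by
        rw [← rpow_add hz0]
        congr 1
        ring
      rw [this]
      ring
    rw [e1]
    refine mul_le_left (rpow_le_rpow_of_exponent_le hz.one_le ?_)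
    nlinarith
  · intro z a
    have h := (W.memLp_dot_next hmom (Pi.single a 1) z).integrable (by norm_num)
    simp only [single_dot_realVec] at h
    exact h

variable (W)

/-- The relative increment, in direction `u`, of one generation in state `z`. -/
noncomputable def rel (u : Vec) (z : Pop) (o : Ω) : ℝ := (u ⊙ W.next z o - u ⊙ z) / (u ⊙ z)

theorem measurable_rel (u : Vec) (z : Pop) : Measurable (W.rel u z) :=
  ((W.measurable_dot_next u z).sub_const _).div_const _

theorem dot_next_eq_rel {u : Vec} {z : Pop} (hz : 0 < u ⊙ z)
  (o : Ω) : u ⊙ W.next z o = u ⊙ z * (1 + W.rel u z o) := by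
  unfold rel
  field_simp
  ring

theorem neg_one_le_rel {u : Vec} (hu : ∀ i, 0 < u i) {z : Pop}
  (hz : 0 < u ⊙ z) (o : Ω) : -1 ≤ W.rel u z o := by
  unfold rel
  rw [le_div_iff₀ hz]
  linarith [dot_nonneg hu (W.next z o)]

variable {W}

/-- The relative increments have the asymptotics of a diffusion with drift `C x ^ α` and variance
`θ x ^ (1 + α)`. -/
structure Diffusive (W : MBPM P p) (u : Vec) (C α θ : ℝ) : Prop where
  memLp : ∀ z, MemLp (W.rel u z) 2 P
  mean : Tendsto (fun z => (u ⊙ z) ^ (1 - α) * ∫ o, W.rel u z o ∂P) (growing p) (𝓝 C)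
  sq : Tendsto (fun z => (u ⊙ z) ^ (1 - α) * ∫ o, W.rel u z o ^ 2 ∂P) (growing p) (𝓝 θ)
  tail : ∀ η > 0, Tendsto (fun z => (u ⊙ z) ^ (1 - α) *
    ∫ o, {o | η < |W.rel u z o|}.indicator (fun o => W.rel u z o ^ 2) o ∂P) (growing p) (𝓝 0)

theorem measurableSet_rel_tail (W : MBPM P p) (u : Vec) (z : Pop) (η : ℝ) :
  MeasurableSet {o | η < |W.rel u z o|} :=
  measurableSet_lt measurable_const (W.measurable_rel u z).abs

namespace OneStep

theorem eventually_pos (h : W.OneStep u C α β ν) : ∀ᶠ z in growing p, 0 < u ⊙ z :=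
  (tendsto_dot_growing h.u_pos).eventually_gt_atTop 0

theorem memLp_rel (h : W.OneStep u C α β ν) (z : Pop) : MemLp (W.rel u z) 2 P := by
  have h1 : MemLp (fun o => u ⊙ W.next z o - u ⊙ z) 2 P := (h.memLp z).sub (memLp_const _)
  have h2 := h1.mul_const (u ⊙ z)⁻¹
  exact h2

theorem integral_rel (h : W.OneStep u C α β ν) (z : Pop) :
  ∫ o, W.rel u z o ∂P = (u ⬝ᵥ W.h z) / (u ⊙ z) := by
  unfold rel
  rw [integral_div, integral_sub ((h.memLp z).integrable (by norm_num)) (integrable_const _), h.mean]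
  simp

theorem integral_rel_sq (h : W.OneStep u C α β ν) (z : Pop) : ∫ o, W.rel u z o ^ 2 ∂P =
  (∫ o, fluct W u z o ^ 2 ∂P + (u ⬝ᵥ W.h z) ^ 2) / (u ⊙ z) ^ 2 := by
  have hm : MemLp (fun o => fluct W u z o) 2 P := (h.memLp z).sub (memLp_const _)
  have h0 : ∫ o, fluct W u z o ∂P = 0 := by
    rw [integral_sub ((h.memLp z).integrable (by norm_num)) (integrable_const _), h.mean]
    simp
  have e : ∀ o, W.rel u z o ^ 2 = (fluct W u z o ^ 2 + (2 * (u ⬝ᵥ W.h z) * fluct W u z o +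
    (u ⬝ᵥ W.h z) ^ 2)) / (u ⊙ z) ^ 2 := by
    intro o
    unfold rel
    rw [div_pow]
    congr 1
    ring
  have i1 : Integrable (fun o => 2 * (u ⬝ᵥ W.h z) * fluct W u z o) P :=
    (hm.integrable (by norm_num)).const_mul _
  simp_rw [e]
  rw [integral_div, integral_add hm.integrable_sq (i1.fun_add (integrable_const _)),
    integral_add i1 (integrable_const _), integral_const_mul, h0]
  simp

theorem tendsto_drift_sq (h : W.OneStep u C α β ν) :
  Tendsto (fun z => (u ⬝ᵥ W.h z) ^ 2 / (u ⊙ z) ^ (1 + α)) (growing p) (𝓝 0) := by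
  have h1 := (h.drift.pow 2).mul ((tendsto_rpow_neg_atTop (by linarith [h.α_lt] : 0 < 1 - α)).comp
    (tendsto_dot_growing h.u_pos))
  rw [mul_zero] at h1
  refine h1.congr' ?_
  filter_upwards [h.eventually_pos] with z hz
  have e : (u ⊙ z) ^ (1 + α) * (u ⊙ z) ^ (-(1 - α)) = ((u ⊙ z) ^ α) ^ 2 := by
    rw [← rpow_add hz, ← rpow_natCast, ← rpow_mul hz.le]
    congr 1
    push_cast
    ring
  have hp1 : 0 < (u ⊙ z) ^ (1 + α) := ✓
  have hp2 : 0 < (u ⊙ z) ^ α := ✓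
  simp only [Function.comp]
  rw [div_pow, ← e]
  have hp3 : 0 < (u ⊙ z) ^ (-(1 - α)) := ✓
  field_simp

theorem rpow_one_sub_div_sq {x : ℝ} (hx : 0 < x) : x ^ (1 - α) / x ^ 2 = (x ^ (1 + α))⁻¹ := by
  rw [← rpow_natCast, ← rpow_sub hx, ← rpow_neg hx.le]
  congr 1
  push_cast
  ring

theorem tail_bound (h : W.OneStep u C α β ν) {η : ℝ} (hη : 0 < η) :
  Tendsto (fun z => (u ⊙ z) ^ (1 - α) *
    ∫ o, {o | η < |W.rel u z o|}.indicator (fun o => W.rel u z o ^ 2) o ∂P)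
    (growing p) (𝓝 0) := by
  have hx := tendsto_dot_growing h.u_pos
  rw [Metric.tendsto_nhds]
  intro κ hκ
  obtain ⟨L, hL, hLb⟩ := h.lindeberg (κ / 8) ✓
  have c1 : ∀ᶠ z in growing p, (u ⬝ᵥ W.h z) ^ 2 / (u ⊙ z) ^ (1 + α) < κ / 8 :=
    h.tendsto_drift_sq.eventually (gt_mem_nhds ✓)
  have c2 : ∀ᶠ z in growing p, (u ⬝ᵥ W.h z) / (u ⊙ z) < η / 2 := by
    have h1 := h.drift.mul ((tendsto_rpow_neg_atTop (by linarith [h.α_lt] : 0 < 1 - α)).comp hx)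
    rw [mul_zero] at h1
    filter_upwards [h1.eventually (gt_mem_nhds (✓ : 0 < η / 2)), h.eventually_pos]
      with z hz hz0
    refine lt_of_eq_of_lt ?_ hz
    simp only [Function.comp]
    rw [neg_sub, rpow_sub hz0, rpow_one]
    have : 0 < (u ⊙ z) ^ α := ✓
    field_simp
  have c3 : ∀ᶠ z in growing p, L * (u ⊙ z) ^ (β / 2) < η / 2 * (u ⊙ z) := by
    have h1 := ((tendsto_rpow_neg_atTop
      (by linarith [h.α_lt, h.β_le] : 0 < 1 - β / 2)).comp hx).const_mul L
    rw [mul_zero] at h1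
    filter_upwards [h1.eventually (gt_mem_nhds (✓ : 0 < η / 2)), h.eventually_pos]
      with z hz hz0
    simp only [Function.comp] at hz
    rw [neg_sub, rpow_sub hz0, rpow_one, mul_div_assoc', div_lt_iff₀ hz0] at hz
    exact hz
  filter_upwards [hLb, c1, c2, c3, hx.eventually_ge_atTop 1] with z b1 b2 b3 b4 b5
  have hz0 : 0 < u ⊙ z := by linarith
  have hS : MeasurableSet {o | L * (u ⊙ z) ^ (β / 2) <
    |fluct W u z o|} :=
    measurableSet_lt measurable_const ((W.measurable_dot_next u z).sub_const _).abs
  have hm : MemLp (fun o => fluct W u z o) 2 P := (h.memLp z).sub (memLp_const _)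
  have hdn : 0 ≤ u ⬝ᵥ W.h z := (h.drift_pos z (by rintro rfl; simp [realVec, dotProduct] at hz0)).le
  set S := {o | L * (u ⊙ z) ^ (β / 2) <
    |fluct W u z o|}
  have hpt : ∀ o, {o | η < |W.rel u z o|}.indicator (fun o => W.rel u z o ^ 2) o ≤
    (2 * S.indicator (fun o => fluct W u z o ^ 2) o + 2 * (u ⬝ᵥ W.h z) ^ 2) / (u ⊙ z) ^ 2 := by
    intro o
    by_cases ho : η < |W.rel u z o|
    · have hmem : o ∈ S := by
        simp only [S, mem_ofPred_eq]
        unfold rel at ho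
        rw [abs_div, abs_of_pos hz0, lt_div_iff₀ hz0] at ho
        rw [div_lt_iff₀ hz0] at b3
        have e : u ⊙ W.next z o - u ⊙ z = fluct W u z o + u ⬝ᵥ W.h z := by ring
        rw [e] at ho
        have := abs_add_le (fluct W u z o) (u ⬝ᵥ W.h z)
        rw [abs_of_nonneg hdn] at this
        linarith
      rw [indicator_of_mem (show o ∈ {o | η < |W.rel u z o|} from ho), indicator_of_mem hmem]
      unfold rel
      rw [div_pow]
      gcongr
      nlinarith [sq_nonneg (fluct W u z o - u ⬝ᵥ W.h z)]
    · rw [indicator_of_notMem (show o ∉ {o | η < |W.rel u z o|} from ho)]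
      have : 0 ≤ S.indicator (fun o => fluct W u z o ^ 2) o :=
        Set.indicator_nonneg (fun _ _ => sq_nonneg _) _
      positivity
  have hI := hm.integrable_sq.indicator hS
  have h1 : ∫ o, {o | η < |W.rel u z o|}.indicator (fun o => W.rel u z o ^ 2) o ∂P ≤
    (2 * (κ / 8 * (u ⊙ z) ^ β) + 2 * (u ⬝ᵥ W.h z) ^ 2) / (u ⊙ z) ^ 2 := by
    refine (integral_mono ((h.memLp_rel z).integrable_sq.indicator
      (W.measurableSet_rel_tail u z η)) (((hI.const_mul 2).fun_add (integrable_const _)).div_const _)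
      hpt).trans ?_
    rw [integral_div, integral_add (hI.const_mul 2) (integrable_const _), integral_const_mul,
      integral_indicator hS]
    simp only [integral_const, probReal_univ, one_smul]
    gcongr
  have h0 : 0 ≤ ∫ o, {o | η < |W.rel u z o|}.indicator (fun o => W.rel u z o ^ 2) o ∂P :=
    integral_nonneg fun o => Set.indicator_nonneg (fun _ _ => sq_nonneg _) _
  rw [dist_eq, sub_zero, abs_of_nonneg ✓]
  have hβx : (u ⊙ z) ^ β ≤ (u ⊙ z) ^ (1 + α) := rpow_le_rpow_of_exponent_le b5 h.β_le
  have hp1 : 0 < (u ⊙ z) ^ (1 + α) := ✓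
  rw [div_lt_iff₀ hp1] at b2
  calc _ ≤ (u ⊙ z) ^ (1 - α) * ((2 * (κ / 8 * (u ⊙ z) ^ β) +
        2 * (u ⬝ᵥ W.h z) ^ 2) / (u ⊙ z) ^ 2) := by gcongr
    _ = (2 * (κ / 8 * (u ⊙ z) ^ β) + 2 * (u ⬝ᵥ W.h z) ^ 2) *
      ((u ⊙ z) ^ (1 - α) / (u ⊙ z) ^ 2) := by ring
    _ = (2 * (κ / 8 * (u ⊙ z) ^ β) + 2 * (u ⬝ᵥ W.h z) ^ 2) / (u ⊙ z) ^ (1 + α) := by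
      rw [rpow_one_sub_div_sq hz0, ← div_eq_mul_inv]
    _ < κ := by
      rw [div_lt_iff₀ hp1]
      nlinarith

theorem diffusive (h : W.OneStep u C α β ν) : W.Diffusive u C α (if β = 1 + α then ν else 0) := by
  have hx := tendsto_dot_growing h.u_pos
  refine ⟨h.memLp_rel, ?_, ?_, fun η hη => h.tail_bound hη⟩
  · refine h.drift.congr' ?_
    filter_upwards [h.eventually_pos] with z hz
    rw [h.integral_rel, rpow_sub hz, rpow_one]
    have : 0 < (u ⊙ z) ^ α := ✓
    field_simp
  · have h1 : Tendsto (fun z => (u ⊙ z) ^ (β - (1 + α))) (growing p)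
      (𝓝 (if β = 1 + α then 1 else 0)) := by
      split_ifs with hβ
      · simp only [hβ, sub_self, Real.rpow_zero]
        exact tendsto_const_nhds
      · have := (tendsto_rpow_neg_atTop (y := 1 + α - β)
          (sub_pos.2 (lt_of_le_of_ne h.β_le hβ))).comp hx
        simpa [Function.comp_def] using this
    have h2 := (h.var.mul h1).add h.tendsto_drift_sq
    have e : (ν * if β = 1 + α then 1 else 0) + 0 = if β = 1 + α then ν else 0 := by simp
    rw [e] at h2
    refine h2.congr' ?_
    filter_upwards [h.eventually_pos] with z hz
    have e2 : ∀ A : ℝ, (u ⊙ z) ^ (1 - α) * (A / (u ⊙ z) ^ 2) = A / (u ⊙ z) ^ (1 + α) := fun A => by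
      rw [div_eq_mul_inv A (_ ^ (1 + α)), ← rpow_one_sub_div_sq hz]
      ring
    rw [h.integral_rel_sq, e2, rpow_sub hz]
    have : 0 < (u ⊙ z) ^ β := ✓
    have : 0 < (u ⊙ z) ^ (1 + α) := ✓
    field_simp

end OneStep

theorem abs_log_one_add_sub_le {d η : ℝ} (hη : η ≤ 1 / 2) (hd : |d| ≤ η) :
  |log (1 + d) - (d - d ^ 2 / 2)| ≤ 2 * η * d ^ 2 := by
  have h := Real.abs_log_sub_add_sum_range_le (x := -d) (by rw [abs_neg]; linarith) 2
  simp only [sum_range_succ, Finset.sum_range_zero, abs_neg, sub_neg_eq_add] at h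
  have e : (0 + (-d) ^ (0 + 1) / (((0 : ℕ) : ℝ) + 1) + (-d) ^ (1 + 1) / (((1 : ℕ) : ℝ) + 1) +
    log (1 + d)) = log (1 + d) - (d - d ^ 2 / 2) := by linarith
  rw [e] at h
  refine h.trans ?_
  have h1 : (1 : ℝ) / 2 ≤ 1 - |d| := by linarith
  rw [div_le_iff₀ (by linarith)]
  have h2 : |d| ^ (2 + 1) = |d| * d ^ 2 := by rw [pow_succ, sq_abs]; ring
  rw [h2]
  have h3 : |d| * d ^ 2 ≤ η * d ^ 2 := by gcongr
  have h4 : 0 ≤ η * d ^ 2 := mul_nonneg ((abs_nonneg d).trans hd) (sq_nonneg d)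
  nlinarith

theorem one_add_rpow_neg_le_of_abs_le {ε η d : ℝ} (hε : 0 < ε) (hε1 : ε ≤ 1) (hη : η ≤ 1 / 2)
  (hd : |d| ≤ η) : (1 + d) ^ (-ε) ≤ 1 - ε * d + ε * (1 / 2 + 2 * η + 4 * ε) * d ^ 2 := by
  have hd' := abs_le.1 hd
  have hpos : 0 < 1 + d := by linarith
  have hl := abs_le.1 (abs_log_one_add_sub_le hη hd)
  have hη0 : 0 ≤ η := by linarith
  have hdd : d ^ 2 ≤ |d| / 2 := by rw [← sq_abs]; nlinarith [abs_nonneg d]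
  set l := log (1 + d)
  have h2 : |l| ≤ 2 * |d| := by
    have h3 : 2 * η * d ^ 2 ≤ d ^ 2 := by nlinarith [sq_nonneg d]
    rw [abs_le]
    constructor <;> cases abs_cases d <;> linarith
  have hl2 : l ^ 2 ≤ 4 * d ^ 2 := by
    rw [← sq_abs l, ← sq_abs d]
    nlinarith [abs_nonneg l, abs_nonneg d]
  have hsmall : |l * -ε| ≤ 1 := by
    rw [abs_mul, abs_neg, abs_of_pos hε]
    nlinarith [abs_nonneg l]
  have h4 := abs_le.1 (Real.abs_exp_sub_one_sub_id_le hsmall)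
  rw [Real.rpow_def_of_pos hpos]
  have h5 : (l * -ε) ^ 2 ≤ ε ^ 2 * (4 * d ^ 2) := by
    have : (l * -ε) ^ 2 = ε ^ 2 * l ^ 2 := by ring
    rw [this]
    exact mul_le_left hl2 (sq_nonneg _)
  have h6 : l * -ε ≤ -ε * d + ε * (1 / 2 + 2 * η) * d ^ 2 := by nlinarith
  nlinarith

theorem one_add_rpow_neg_le {ε η d : ℝ} (hε : 0 < ε) (hε1 : ε ≤ 1) (hη0 : 0 < η) (hη : η ≤ 1 / 2)
  (hd : -(1 / 2) ≤ d) :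
  (1 + d) ^ (-ε) ≤ 1 - ε * d + ε * (1 / 2 + 2 * η + 4 * ε) * d ^ 2 +
    2 / η ^ 2 * (if η < |d| then d ^ 2 else 0) := by
  split_ifs with h
  · have h1 : (1 + d) ^ (-ε) ≤ 2 := by
      have h2 : (1 + d) ^ (-ε) ≤ (1 / 2 : ℝ) ^ (-ε) :=
        rpow_le_rpow_of_nonpos (by norm_num) (by linarith) (by linarith)
      refine h2.trans ?_
      rw [one_div, inv_rpow (by norm_num), rpow_neg (by norm_num), inv_inv]
      calc (2 : ℝ) ^ ε ≤ 2 ^ (1 : ℝ) := rpow_le_rpow_of_exponent_le (by norm_num) hε1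
        _ = 2 := rpow_one 2
    have h3 : 2 ≤ 2 / η ^ 2 * d ^ 2 := by
      rw [div_mul_eq_mul_div, le_div_iff₀ ✓]
      have : η ^ 2 ≤ d ^ 2 := by rw [← sq_abs d]; gcongr
      linarith
    have h4 : 0 ≤ 1 - ε * d + ε * (1 / 2) * d ^ 2 := by nlinarith [sq_nonneg (d - 1)]
    have h5 : ε * (1 / 2) * d ^ 2 ≤ ε * (1 / 2 + 2 * η + 4 * ε) * d ^ 2 := by
      gcongr
      linarith
    linarith
  · have := one_add_rpow_neg_le_of_abs_le hε hε1 hη (not_lt.1 h)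
    linarith

namespace OneStep

theorem integral_rpow_neg_next_le (h : W.OneStep u C α β ν) {ε η x : ℝ} (hε : 0 < ε) (hε1 : ε ≤ 1)
  (hη0 : 0 < η) (hη : η ≤ 1 / 2) {z : Pop} (hxz : u ⊙ z = x) (hx : 2 ≤ x) :
  ∫ o, (max (u ⊙ W.next z o) 1) ^ (-ε) ∂P ≤ x ^ (-ε) * (1 - ε * ∫ o, W.rel u z o ∂P +
    ε * (1 / 2 + 2 * η + 4 * ε) * ∫ o, W.rel u z o ^ 2 ∂P + 2 / η ^ 2 *
    ∫ o, {o | η < |W.rel u z o|}.indicator (fun o => W.rel u z o ^ 2) o ∂P) +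
    P.real {o | u ⊙ W.next z o ≤ x / 2} := by
  have hx0 : 0 < u ⊙ z := by linarith
  have hxp : 0 < x := by linarith
  have hm := h.memLp_rel z
  have i1 : Integrable (fun o => W.rel u z o) P := hm.integrable (by norm_num)
  have i2 : Integrable (fun o => W.rel u z o ^ 2) P := hm.integrable_sq
  have i3 := i2.indicator (W.measurableSet_rel_tail u z η)
  have hS : MeasurableSet {o | u ⊙ W.next z o ≤ x / 2} :=
    measurableSet_le (W.measurable_dot_next u z) measurable_const
  have j1 : Integrable (fun o => 1 - ε * W.rel u z o) P := by fun_prop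
  have j2 := j1.fun_add (i2.const_mul (ε * (1 / 2 + 2 * η + 4 * ε)))
  have j3 := j2.fun_add (i3.const_mul (2 / η ^ 2))
  have j4 : Integrable ({o | u ⊙ W.next z o ≤ x / 2}.indicator fun _ => (1 : ℝ)) P := by fun_prop
  have e : x ^ (-ε) * (1 - ε * ∫ o, W.rel u z o ∂P +
    ε * (1 / 2 + 2 * η + 4 * ε) * ∫ o, W.rel u z o ^ 2 ∂P + 2 / η ^ 2 *
    ∫ o, {o | η < |W.rel u z o|}.indicator (fun o => W.rel u z o ^ 2) o ∂P) +
    P.real {o | u ⊙ W.next z o ≤ x / 2} =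
    ∫ o, (x ^ (-ε) * (1 - ε * W.rel u z o + ε * (1 / 2 + 2 * η + 4 * ε) * W.rel u z o ^ 2 +
      2 / η ^ 2 * {o | η < |W.rel u z o|}.indicator (fun o => W.rel u z o ^ 2) o) +
      {o | u ⊙ W.next z o ≤ x / 2}.indicator (fun _ => (1 : ℝ)) o) ∂P := by
    rw [integral_add (j3.const_mul _) j4, integral_const_mul, integral_add j2 (i3.const_mul _),
      integral_add j1 (i2.const_mul _), integral_sub (integrable_const _) (i1.const_mul _),
      integral_const_mul, integral_const_mul, integral_const_mul, integral_indicator_const _ hS]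
    simp
  rw [e]
  refine integral_mono_of_nonneg (ae_of_all _ fun o => ✓)
    ((j3.const_mul _).fun_add j4) (ae_of_all _ fun o => ?_)
  have hpos : 0 ≤ 1 - ε * W.rel u z o + ε * (1 / 2 + 2 * η + 4 * ε) * W.rel u z o ^ 2 +
    2 / η ^ 2 * {o | η < |W.rel u z o|}.indicator (fun o => W.rel u z o ^ 2) o := by
    have h4 : 0 ≤ 1 - ε * W.rel u z o + ε * (1 / 2) * W.rel u z o ^ 2 := by
      nlinarith [sq_nonneg (W.rel u z o - 1)]
    have h5 : ε * (1 / 2) * W.rel u z o ^ 2 ≤ ε * (1 / 2 + 2 * η + 4 * ε) * W.rel u z o ^ 2 := by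
      gcongr
      linarith
    have h6 : 0 ≤ 2 / η ^ 2 * {o | η < |W.rel u z o|}.indicator (fun o => W.rel u z o ^ 2) o :=
      mul_nonneg ✓ (Set.indicator_nonneg (fun _ _ => sq_nonneg _) _)
    linarith
  by_cases ho : u ⊙ W.next z o ≤ x / 2
  · dsimp only
    rw [indicator_of_mem (show o ∈ {o | u ⊙ W.next z o ≤ x / 2} from ho)]
    have h1 : (max (u ⊙ W.next z o) 1) ^ (-ε) ≤ 1 :=
      Real.rpow_le_one_of_one_le_of_nonpos (le_max_right _ _) (by linarith)
    have := mul_nonneg (rpow_nonneg hxp.le (-ε)) hpos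
    linarith
  · dsimp only
    rw [indicator_of_notMem (show o ∉ {o | u ⊙ W.next z o ≤ x / 2} from ho), add_zero]
    have hY := W.dot_next_eq_rel hx0 o
    rw [not_le] at ho
    have hd : -(1 / 2) ≤ W.rel u z o := by
      rw [hY, hxz] at ho
      nlinarith
    rw [max_eq_left (by linarith), hY, hxz, mul_rpow hxp.le (by linarith)]
    refine mul_le_left ?_ (rpow_nonneg hxp.le _)
    refine (one_add_rpow_neg_le hε hε1 hη0 hη hd).trans (le_of_eq ?_)
    simp only [indicator, mem_ofPred_eq]

/-- A negative power of the size is a strict supermartingale, far from the origin. -/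
theorem exists_supermartingale (h : W.OneStep u C α β ν)
  (hd : W.Diffusive u C α θ) (hθ : θ < 2 * C) :
  ∃ ε : ℝ, 0 < ε ∧ ∃ ρ : ℝ → ℝ, (∀ K, ∃ r > 0, ∀ t, 0 < t → t ≤ K → r ≤ ρ t) ∧
    ∃ x₁ ≥ 1, ∀ z : Pop, x₁ ≤ u ⊙ z → 0 ≤ ρ (u ⊙ z) ∧
      ∫ o, (max (u ⊙ W.next z o) 1) ^ (-ε) ∂P + ρ (u ⊙ z) ≤ (u ⊙ z) ^ (-ε) := by
  have hx := tendsto_dot_growing h.u_pos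
  obtain ⟨γ, hγ, K, hK⟩ := h.lower
  obtain ⟨ε, hε, hε1, hε2, hε3⟩ : ∃ ε > 0, ε ≤ 1 / 2 ∧ ε < γ - (1 - α) ∧
    (1 / 2 + 6 * ε) * θ < C := by
    have t1 : Tendsto (fun ε : ℝ => (1 / 2 + 6 * ε) * θ) (𝓝[>] 0) (𝓝 ((1 / 2 + 6 * 0) * θ)) :=
      (Continuous.tendsto (by fun_prop) 0).mono_left nhdsWithin_le_nhds
    have t2 : Tendsto (fun ε : ℝ => ε) (𝓝[>] 0) (𝓝 0) :=
      (Continuous.tendsto (by fun_prop) 0).mono_left nhdsWithin_le_nhds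
    obtain ⟨ε, h1, h2, h3, h4⟩ := ((t1.eventually (gt_mem_nhds (by linarith : _ < C))).and
      ((t2.eventually (gt_mem_nhds (by norm_num : (0 : ℝ) < 1 / 2))).and
      ((t2.eventually (gt_mem_nhds (by linarith : (0 : ℝ) < γ - (1 - α)))).and
      self_mem_nhdsWithin))).exists
    exact ⟨ε, h4, h2.le, h3, h1⟩
  set a := 1 / 2 + 6 * ε with ha
  have hr : 0 < ε * (C - a * θ) := ✓
  set r := ε * (C - a * θ) / 2 with hrdef
  have hlim := ((hd.mean.const_mul (-ε)).add (hd.sq.const_mul (ε * a))).add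
    ((hd.tail ε hε).const_mul (2 / ε ^ 2))
  have hlim2 := ((tendsto_rpow_neg_atTop (by linarith : 0 < γ - (1 - α) - ε)).comp hx).const_mul K
  have hlim3 := hlim.add hlim2
  have hev := hlim3.eventually (gt_mem_nhds (show -ε * C + ε * a * θ + 2 / ε ^ 2 * 0 + K * 0 < -r by
    rw [hrdef]; linarith))
  refine ⟨ε, hε, fun t => r * t ^ (-ε - (1 - α)), fun K' => ?_, ?_⟩
  · refine ⟨r * (max K' 1) ^ (-ε - (1 - α)), ✓, fun t ht htK => ?_⟩
    refine mul_le_left ?_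
    exact rpow_le_rpow_of_nonpos ht (htK.trans (le_max_left _ _)) (by linarith [h.α_lt])
  · obtain ⟨x₁, hx₁, hb⟩ := (eventually_growing h.u_pos).1 ((hev.and hK).and
      (hx.eventually_ge_atTop 2))
    refine ⟨x₁, hx₁, fun z hz => ?_⟩
    obtain ⟨⟨b1, b2⟩, b3⟩ := hb z hz
    set x := u ⊙ z with hxdef
    have hx0 : 0 < x := by linarith
    refine ⟨✓, ?_⟩
    have main := h.integral_rpow_neg_next_le hε (by linarith) hε hε1 hxdef.symm b3
    have e1 : 1 / 2 + 2 * ε + 4 * ε = a := by linarith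
    rw [e1] at main
    have e2 : x ^ (-γ) = x ^ (-ε - (1 - α)) * x ^ (-(γ - (1 - α) - ε)) := by
      rw [← rpow_add hx0]; congr 1; ring
    have e3 : x ^ (-ε) = x ^ (-ε - (1 - α)) * x ^ (1 - α) := by rw [← rpow_add hx0]; congr 1; ring
    have hq : 0 < x ^ (-ε - (1 - α)) := ✓
    simp only [Function.comp] at b1
    rw [e2] at b2
    rw [e3] at main ⊢
    have b4 := mul_lt_mul_of_pos_left b1 hq
    set A1 := ∫ o, W.rel u z o ∂P
    set A2 := ∫ o, W.rel u z o ^ 2 ∂P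
    set A3 := ∫ o, {o | ε < |W.rel u z o|}.indicator (fun o => W.rel u z o ^ 2) o ∂P
    have e4 : x ^ (-ε - (1 - α)) * x ^ (1 - α) * (1 - ε * A1 + ε * a * A2 + 2 / ε ^ 2 * A3) =
      x ^ (-ε - (1 - α)) * x ^ (1 - α) + x ^ (-ε - (1 - α)) * (-ε * (x ^ (1 - α) * A1) +
        ε * a * (x ^ (1 - α) * A2) + 2 / ε ^ 2 * (x ^ (1 - α) * A3)) := by ring
    rw [e4] at main
    linarith

end OneStep

theorem measurable_indicator_one {Ω : Type*} {m : MeasurableSpace Ω} {s : Set Ω}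
  (hs : MeasurableSet[m] s) : Measurable[m] (s.indicator (1 : Ω → ENNReal)) :=
  by fun_prop

theorem measurableSet_Z (W : MBPM P p) (n : ℕ) (s : Set Pop) :
  MeasurableSet[W.history n] {o | W.Z n o ∈ s} :=
  W.measurable_Z_history n (Set.to_countable s).measurableSet

theorem measure_next_pos (W : MBPM P p) {n : ℕ} {z z' : Pop} (h : 0 < P {o | W.Z n o = z})
  (h' : 0 < P {o | W.next z o = z'}) : 0 < P {o | W.Z (n + 1) o = z'} := by
  have m1 : MeasurableSet[W.history n] {o | W.Z n o = z} := W.measurableSet_Z n {z}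
  have key := W.lintegral_next n (g := {o | W.Z n o = z}.indicator 1)
    (measurable_indicator_one m1) (({z'} : Set Pop).indicator 1)
  have e1 : ∀ x, ∫⁻ o', ({z'} : Set Pop).indicator 1 (W.next x o') ∂P =
    P {o | W.next x o = z'} := fun x => by
    have m2 : MeasurableSet {o | W.next x o = z'} :=
      W.measurable_next x (measurableSet_singleton z')
    rw [← lintegral_indicator_one m2]
    rfl
  simp only [e1] at key
  have e2 : ∫⁻ o, {o | W.Z n o = z}.indicator 1 o * P {o' | W.next (W.Z n o) o' = z'} ∂P =
    P {o | W.next z o = z'} * P {o | W.Z n o = z} := by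
    rw [← lintegral_indicator_const (W.history.le n _ m1)]
    refine lintegral_congr fun o => ?_
    by_cases ho : W.Z n o = z <;> simp [indicator, ho]
  rw [e2] at key
  have h3 : ∫⁻ o, {o | W.Z n o = z}.indicator 1 o *
    ({z'} : Set Pop).indicator 1 (W.Z (n + 1) o) ∂P ≤ P {o | W.Z (n + 1) o = z'} := by
    have m2 : MeasurableSet {o | W.Z (n + 1) o = z'} :=
      W.measurable_Z (n + 1) (measurableSet_singleton z')
    rw [← lintegral_indicator_one m2]
    refine lintegral_mono fun o => ?_
    by_cases ho : W.Z n o = z <;> simp [indicator, ho]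
  rw [key] at h3
  exact (ENNReal.mul_pos h'.ne' h.ne').trans_le h3

namespace OneStep

theorem exists_next_gt (h : W.OneStep u C α β ν) {z : Pop} (hz : z ≠ 0) :
  ∃ z', u ⊙ z < u ⊙ z' ∧ 0 < P {o | W.next z o = z'} := by
  by_contra hcon
  push Not at hcon
  have h1 : ∀ᵐ o ∂P, u ⊙ W.next z o ≤ u ⊙ z := by
    have h2 : {o | ¬ u ⊙ W.next z o ≤ u ⊙ z} ⊆
      ⋃ z' : {z' : Pop // u ⊙ z < u ⊙ z'}, {o | W.next z o = z'} := by
      intro o ho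
      exact Set.mem_iUnion.2 ⟨⟨W.next z o, not_le.1 ho⟩, rfl⟩
    refine measure_mono_null h2 (measure_iUnion_null fun z' => ?_)
    exact le_antisymm (hcon z'.1 z'.2) bot_le
  have h3 := integral_mono_ae ((h.memLp z).integrable (by norm_num)) (integrable_const _) h1
  rw [h.mean] at h3
  simp only [integral_const, probReal_univ, one_smul] at h3
  linarith [h.drift_pos z hz]

theorem exists_measure_ge_pos (h : W.OneStep u C α β ν)
  (hnt : ¬ ∀ᵐ o ∂P, ∀ n, W.Z n o = 0) (K : ℝ) :
  ∃ n, 0 < P {o | K ≤ u ⊙ W.Z n o} := by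
  by_contra hcon
  push Not at hcon
  have hR : ∀ n z, 0 < P {o | W.Z n o = z} → u ⊙ z ≤ K := by
    intro n z hz
    by_contra hlt
    have : P {o | W.Z n o = z} ≤ P {o | K ≤ u ⊙ W.Z n o} := measure_mono fun o ho => by
      have ho : W.Z n o = z := ho
      simp only [mem_ofPred_eq, ho]
      exact (not_le.1 hlt).le
    exact absurd (hz.trans_le (this.trans (hcon n))) (lt_irrefl _)
  set R : Set Pop := {z | z ≠ 0 ∧ ∃ n, 0 < P {o | W.Z n o = z}}
  have hfin : R.Finite := (finite_dot_le h.u_pos K).subset fun z hz => by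
    obtain ⟨_, n, hn⟩ := hz
    exact hR n z hn
  have hne : R.Nonempty := by
    by_contra hemp
    refine hnt (ae_all_iff.2 fun n => ?_)
    have h2 : {o | ¬ W.Z n o = 0} ⊆ ⋃ z : {z : Pop // z ≠ 0}, {o | W.Z n o = z} :=
      fun o ho => Set.mem_iUnion.2 ⟨⟨W.Z n o, ho⟩, rfl⟩
    refine measure_mono_null h2 (measure_iUnion_null fun z => ?_)
    by_contra hpos
    exact hemp ⟨z.1, z.2, n, pos_iff_ne_zero.2 hpos⟩
  obtain ⟨z, ⟨hz0, n, hn⟩, hmax⟩ := hfin.exists_maximalFor (fun z => u ⊙ z) R hne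
  obtain ⟨z', hlt, hz'⟩ := h.exists_next_gt hz0
  have hz'0 : z' ≠ 0 := by
    rintro rfl
    have := dot_nonneg h.u_pos z
    have e : u ⊙ (0 : Pop) = 0 := by simp [realVec, dotProduct]
    rw [e] at hlt
    linarith
  have := hmax ⟨hz'0, n + 1, W.measure_next_pos hn hz'⟩ hlt.le
  exact absurd hlt (not_lt.2 this)

end OneStep

variable (W)

/-- The size in direction `u` stays above `x₁` from generation `n` to generation `n + j`. -/
def staysAbove (u : Vec) (K x₁ : ℝ) (n j : ℕ) : Set Ω :=
  {o | K ≤ u ⊙ W.Z n o ∧ ∀ l ≤ j, x₁ ≤ u ⊙ W.Z (n + l) o}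

theorem measurableSet_staysAbove (u : Vec) (K x₁ : ℝ) (n j : ℕ) :
  MeasurableSet[W.history (n + j)] (W.staysAbove u K x₁ n j) := by
  have h1 : ∀ K l, l ≤ j → MeasurableSet[W.history (n + j)]
    {o | K ≤ u ⊙ W.Z (n + l) o} := fun K l hl =>
    W.history.mono (by omega : n + l ≤ n + j) _ (W.measurableSet_Z (n + l) {z | K ≤ u ⊙ z})
  have e : W.staysAbove u K x₁ n j = {o | K ≤ u ⊙ W.Z (n + 0) o} ∩
    ⋂ l ∈ range (j + 1), {o | x₁ ≤ u ⊙ W.Z (n + l) o} := by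
    ext o
    simp [staysAbove]
  rw [e]
  refine MeasurableSet.inter (h1 K 0 (by omega)) (Finset.measurableSet_biInter _ fun l hl => ?_)
  exact h1 x₁ l (by simpa [Nat.lt_succ_iff] using hl)

theorem staysAbove_anti (u : Vec) (K x₁ : ℝ) (n : ℕ) : Antitone (W.staysAbove u K x₁ n) :=
  fun _ _ hij _ ho => ⟨ho.1, fun l hl => ho.2 l (hl.trans hij)⟩

/-- A state function which is a strict supermartingale far from the origin and small at infinity
forces unlimited growth with positive probability. -/
theorem measure_unlimited_pos (hu : ∀ i, 0 < u i) {V : Pop → ENNReal}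
  {ρ : ℝ → ℝ} {x₁ K : ℝ} {V₁ V₂ : ENNReal} {n : ℕ}
  (hρ : ∀ K, ∃ r > 0, ∀ t, 0 < t → t ≤ K → r ≤ ρ t) (hx₁ : 0 < x₁)
  (hV : ∀ z, x₁ ≤ u ⊙ z → ∫⁻ o, V (W.next z o) ∂P + ofReal (ρ (u ⊙ z)) ≤ V z)
  (hV₁ : ∀ z, u ⊙ z < x₁ → V₁ ≤ V z) (hV₂ : ∀ z, K ≤ u ⊙ z → V z ≤ V₂)
  (hV₁₂ : V₂ < V₁) (hV₁_top : V₁ ≠ ⊤) (hK : x₁ ≤ K)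
  (hn : 0 < P {o | K ≤ u ⊙ W.Z n o}) : 0 < P W.Unlimited := by
  set S := W.staysAbove u K x₁ n with hS
  have hSm' := W.measurableSet_staysAbove u K x₁ n
  have hSm : ∀ j, MeasurableSet (S j) := fun j => W.history.le _ _ (hSm' j)
  have hanti := W.staysAbove_anti u K x₁ n
  have hZm : ∀ (f : Pop → ENNReal) j, Measurable fun o => f (W.Z (n + j) o) := fun f j =>
    (measurable_of_countable f).comp (W.measurable_Z _)
  set R : ℕ → ENNReal := fun j =>
    ∫⁻ o, (S j).indicator (fun o => ofReal (ρ (u ⊙ W.Z (n + j) o))) o ∂P with hR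
  set v : ℕ → ENNReal := fun j => ∫⁻ o, (S j).indicator (fun o => V (W.Z (n + j) o)) o ∂P with hv
  have hRm : ∀ j, Measurable ((S j).indicator fun o => ofReal (ρ (u ⊙ W.Z (n + j) o))) := fun j =>
    (hZm (fun z => ofReal (ρ (u ⊙ z))) j).indicator (hSm j)
  have step : ∀ j, v (j + 1) + V₁ * P (S j \ S (j + 1)) + R j ≤ v j := by
    intro j
    have h1 : v (j + 1) + V₁ * P (S j \ S (j + 1)) ≤
      ∫⁻ o, (S j).indicator 1 o * V (W.Z (n + j + 1) o) ∂P := by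
      rw [← lintegral_indicator_const ((hSm j).diff (hSm (j + 1))), hv]
      dsimp only
      rw [← lintegral_add_left ((hZm V (j + 1)).indicator (hSm (j + 1)))]
      refine lintegral_mono fun o => ?_
      by_cases hj : o ∈ S j
      · by_cases hj1 : o ∈ S (j + 1)
        · simp [indicator, hj, hj1, add_assoc]
        · have hlt : u ⊙ W.Z (n + j + 1) o < x₁ := by
            by_contra hge
            refine hj1 ⟨hj.1, fun l hl => ?_⟩
            rcases Nat.lt_or_ge l (j + 1) with hl' | hl'
            · exact hj.2 l (by omega)
            · have : l = j + 1 := by omega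
              rw [this, ← add_assoc]
              exact not_lt.1 hge
          simpa [indicator, hj, hj1] using hV₁ _ hlt
      · have hj1 : o ∉ S (j + 1) := fun h => hj (hanti (le_succ j) h)
        simp [indicator, hj, hj1]
    rw [W.lintegral_next (n + j) (measurable_indicator_one (hSm' j)) V, ← hS] at h1
    refine (add_le_add_left h1 (R j)).trans ?_
    rw [hR, hv]
    dsimp only
    rw [← lintegral_add_right _ (hRm j)]
    refine lintegral_mono fun o => ?_
    by_cases hj : o ∈ S j
    · simpa [indicator, hj] using hV _ (hj.2 j le_rfl)
    · simp [indicator, hj]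
  have total : ∀ J, v J + V₁ * P (S 0 \ S J) + ∑ j ∈ range J, R j ≤ v 0 := by
    intro J
    induction J with
    | zero => simp
    | succ J ih =>
      have h1 : P (S 0 \ S (J + 1)) ≤ P (S 0 \ S J) + P (S J \ S (J + 1)) := by
        refine (measure_mono fun o ho => ?_).trans (measure_union_le _ _)
        by_cases hJ : o ∈ S J
        · exact Or.inr ⟨hJ, ho.2⟩
        · exact Or.inl ⟨ho.1, hJ⟩
      calc v (J + 1) + V₁ * P (S 0 \ S (J + 1)) + ∑ j ∈ range (J + 1), R j
          ≤ v (J + 1) + V₁ * (P (S 0 \ S J) + P (S J \ S (J + 1))) +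
            ∑ j ∈ range (J + 1), R j := by gcongr
        _ = (v (J + 1) + V₁ * P (S J \ S (J + 1)) + R J) + V₁ * P (S 0 \ S J) +
          ∑ j ∈ range J, R j := by
          rw [sum_range_succ]
          ring
        _ ≤ v J + V₁ * P (S 0 \ S J) + ∑ j ∈ range J, R j := by gcongr; exact step J
        _ ≤ v 0 := ih
  have hS0 : P (S 0) = P {o | K ≤ u ⊙ W.Z n o} := by
    congr 1
    ext o
    constructor
    · exact fun ho => ho.1
    · intro ho
      refine ⟨ho, fun l hl => ?_⟩
      have : l = 0 := by omega
      rw [this]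
      exact hK.trans ho
  have hv0 : v 0 ≤ V₂ * P (S 0) := by
    rw [← lintegral_indicator_const (hSm 0)]
    refine lintegral_mono fun o => ?_
    by_cases h0 : o ∈ S 0
    · simpa [indicator, h0] using hV₂ _ h0.1
    · simp [indicator, h0]
  have hV₂_top : V₂ ≠ ⊤ := by grind
  set T := ⋂ j, S j with hT
  have hTm : MeasurableSet T := MeasurableSet.iInter hSm
  have hTpos : 0 < P T := by
    rw [pos_iff_ne_zero]
    intro hT0
    have h1 : Tendsto (fun J => V₁ * P (S 0 \ S J)) atTop (𝓝 (V₁ * P (S 0 \ T))) := by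
      refine ENNReal.Tendsto.const_mul ?_ (Or.inr hV₁_top)
      have : S 0 \ T = ⋃ J, S 0 \ S J := by rw [hT, Set.sdiff_iInter]
      rw [this]
      exact tendsto_measure_iUnion_atTop fun i j hij => Set.sdiff_subset_sdiff_right (hanti hij)
    have h2 : V₁ * P (S 0 \ T) ≤ V₂ * P (S 0) := by
      refine le_of_tendsto h1 (Eventually.of_forall fun J => ?_)
      exact (le_add_left le_rfl).trans ((le_add_right le_rfl).trans ((total J).trans hv0))
    have h3 : P (S 0) ≤ P (S 0 \ T) := by
      have := measure_le_inter_add_sdiff P (S 0) T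
      have h4 : P (S 0 ∩ T) = 0 := measure_mono_null Set.inter_subset_right hT0
      rwa [h4, zero_add] at this
    have h5 : V₁ * P (S 0) ≤ V₂ * P (S 0) := (mul_le_mul_right h3 _).trans h2
    rw [hS0] at h5
    exact absurd (ENNReal.mul_lt_mul_left hn.ne' (measure_ne_top _ _) hV₁₂) (not_lt.2 h5)
  have hsum : ∑' j, R j ≤ V₂ * P (S 0) := by
    refine ENNReal.tsum_le_of_sum_range_le fun J => ?_
    exact (le_add_left le_rfl).trans ((total J).trans hv0)
  have hsum' : ∫⁻ o, ∑' j, (S j).indicator (fun o => ofReal (ρ (u ⊙ W.Z (n + j) o))) o ∂P ≠ ⊤ := by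
    rw [lintegral_tsum fun j => (hRm j).aemeasurable]
    exact (hsum.trans_lt (ENNReal.mul_lt_top hV₂_top.lt_top (measure_lt_top _ _))).ne
  have hae := ae_lt_top (Measurable.tsum hRm) hsum'
  refine hTpos.trans_le (measure_mono_ae ?_)
  filter_upwards [hae] with o ho hoT
  have hoS : ∀ j, o ∈ S j := Set.mem_iInter.1 hoT
  have h1 := ENNReal.tendsto_atTop_zero_of_tsum_ne_top ho.ne
  have h2 : Tendsto (fun j => u ⊙ W.Z (n + j) o) atTop atTop := by
    rw [tendsto_atTop]
    intro b
    obtain ⟨r, hr, hrb⟩ := hρ b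
    have h3 := (tendsto_order.1 h1).2 (ofReal r) (by simpa using hr)
    filter_upwards [h3] with j hj
    by_contra hb
    push Not at hb
    rw [indicator_of_mem (hoS j)] at hj
    have hx : x₁ ≤ u ⊙ W.Z (n + j) o := (hoS j).2 j le_rfl
    exact absurd (ofReal_le_ofReal (hrb _ (by linarith) hb.le)) (not_le.2 hj)
  have h4 : Tendsto (fun j => u ⊙ W.Z j o) atTop atTop := by
    rw [← tendsto_add_atTop_iff_nat n]
    simpa only [add_comm] using h2
  exact (tendsto_dot_iff_norm hu _).1 h4

variable {W}

theorem OneStep.measure_unlimited_pos (h : W.OneStep u C α β ν)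
  (hd : W.Diffusive u C α θ) (hθ : θ < 2 * C)
  (hnt : ¬ ∀ᵐ o ∂P, ∀ n, W.Z n o = 0) :
  0 < P W.Unlimited := by
  obtain ⟨ε, hε, ρ, hρ, x₁, hx₁, hV⟩ := h.exists_supermartingale hd hθ
  obtain ⟨n, hn⟩ := h.exists_measure_ge_pos hnt (x₁ + 1)
  have hx0 : 0 < x₁ := by linarith
  refine W.measure_unlimited_pos h.u_pos
    (V := fun z => ofReal ((max (u ⊙ z) 1) ^ (-ε))) (K := x₁ + 1)
    (V₁ := ofReal (x₁ ^ (-ε))) (V₂ := ofReal ((x₁ + 1) ^ (-ε))) hρ hx0 ?_ ?_ ?_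
    ?_ ofReal_ne_top (by linarith) hn
  · intro z hz
    obtain ⟨h1, h2⟩ := hV z hz
    have hi : Integrable (fun o => (max (u ⊙ W.next z o) 1) ^ (-ε)) P := by
      refine Integrable.of_bound (C := 1)
        (((W.measurable_dot_next u z).max measurable_const).pow_const _).aestronglyMeasurable
        (ae_of_all _ fun o => ?_)
      rw [norm_of_nonneg ✓]
      exact Real.rpow_le_one_of_one_le_of_nonpos (le_max_right _ _) (by linarith)
    rw [← ofReal_integral_eq_lintegral_ofReal hi (ae_of_all _ fun o => ✓),
      ← ofReal_add (integral_nonneg fun o => ✓) h1]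
    refine ofReal_le_ofReal (h2.trans (le_of_eq ?_))
    rw [max_eq_left (by linarith)]
  · intro z hz
    refine ofReal_le_ofReal (rpow_le_rpow_of_nonpos ✓ ?_ (by linarith))
    exact max_le hz.le hx₁
  · intro z hz
    refine ofReal_le_ofReal (rpow_le_rpow_of_nonpos ✓ ?_ (by linarith))
    exact hz.trans (le_max_left _ _)
  · refine (ENNReal.ofReal_lt_ofReal_iff ✓).2 ?_
    exact Real.rpow_lt_rpow_of_neg hx0 (by linarith) (by linarith)

theorem rpow_le_mul_add_rpow {t T r : ℝ} (ht : 0 ≤ t) (hT : 0 < T) (hr0 : 0 ≤ r) (hr : r ≤ 1) :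
  t ^ r ≤ t * T ^ (r - 1) + T ^ r := by
  rcases le_or_gt t T with h | h
  · have h1 := rpow_le_rpow ht h hr0
    have h2 : 0 ≤ t * T ^ (r - 1) := ✓
    linarith
  · have ht0 : 0 < t := hT.trans h
    have h1 : t ^ r = t * t ^ (r - 1) := by rw [rpow_sub ht0, rpow_one]; field_simp
    have h2 : t ^ (r - 1) ≤ T ^ (r - 1) := rpow_le_rpow_of_nonpos hT h.le (by linarith)
    have h3 := mul_le_left h2 ht
    have h4 : 0 < T ^ r := ✓
    linarith

theorem rpow_le_one_add_rpow {t a b : ℝ} (ht : 0 ≤ t) (ha : 0 ≤ a) (hab : a ≤ b) :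
  t ^ a ≤ 1 + t ^ b := by
  rcases le_or_gt t 1 with h | h
  · have := rpow_le_one ht h ha
    have := rpow_nonneg ht b
    linarith
  · have := rpow_le_rpow_of_exponent_le h.le hab
    linarith

variable (W)

theorem lintegral_next_pair (k : ℕ) {g : Ω → ENNReal}
  (hg : Measurable[W.history k] g) (f : Pop → Pop → ENNReal) :
  ∫⁻ o, g o * f (W.Z k o) (W.Z (k + 1) o) ∂P =
    ∫⁻ o, g o * (∫⁻ o', f (W.Z k o) (W.next (W.Z k o) o') ∂P) ∂P := by
  have h := lintegral_random_index (P := P) (W.history.le k) (W.sourceSigma_le (present p k))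
    (W.indep_sourceSigma (disjoint_past_present p k)) (W.measurable_Z_history k) hg
    (G := fun z o => f z (W.nextAt k z o))
    fun z => (measurable_of_countable (f z)).comp (W.measurable_nextAt_present k z)
  have e : ∀ z, ∫⁻ o', f z (W.nextAt k z o') ∂P = ∫⁻ o', f z (W.next z o') ∂P := fun z =>
    ((W.identDistrib_nextAt k z).comp (measurable_of_countable (f z))).lintegral_eq
  simp only [W.Z_succ_eq, h, e]

/-- The integral over `B` of a function of the state of generation `k`. -/
theorem setLIntegral_next (k : ℕ) {B : Set Ω} (hB : MeasurableSet[W.history k] B)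
  (f : Pop → Pop → ENNReal) :
  ∫⁻ o in B, f (W.Z k o) (W.Z (k + 1) o) ∂P =
    ∫⁻ o in B, (∫⁻ o', f (W.Z k o) (W.next (W.Z k o) o') ∂P) ∂P := by
  have hB' : MeasurableSet B := W.history.le k _ hB
  rw [← lintegral_indicator hB', ← lintegral_indicator hB']
  have := W.lintegral_next_pair k (measurable_indicator_one hB) f
  simpa only [indicator, Pi.one_apply, ite_mul, one_mul, zero_mul] using this

theorem measurable_history_zero (k : ℕ) {B : Set Ω}
  (hB : MeasurableSet[W.history 0] B) : MeasurableSet[W.history k] B :=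
  W.history.mono (Nat.zero_le k) _ hB

/-- If the one-step increase of the mean of `f` is at most of order `f ^ r`, then the mean of `f`
grows at most like `n ^ (1 / (1 - r))`. -/
theorem setLIntegral_le_of_growth {f : Pop → ℝ} (hf : ∀ z, 0 ≤ f z)
  {C r : ℝ} (hC : 0 ≤ C) (hr0 : 0 ≤ r) (hr : r < 1)
  (hstep : ∀ z, ∫⁻ o, ofReal (f (W.next z o)) ∂P ≤ ofReal (f z + C * (1 + f z ^ r)))
  {B : Set Ω} (hB : MeasurableSet[W.history 0] B) {n k : ℕ} (hk : k ≤ n) (hn : 1 ≤ n) :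
  ∫⁻ o in B, ofReal (f (W.Z k o)) ∂P ≤ ofReal (exp C) * (∫⁻ o in B, ofReal (f (W.Z 0 o)) ∂P +
    ofReal (2 * C * (n : ℝ) ^ (1 / (1 - r))) * P B) := by
  have hn0 : (0 : ℝ) < n := ✓
  have hn1 : (1 : ℝ) ≤ n := by exact_mod_cast hn
  have hr1 : 0 < 1 - r := by linarith
  set D : ℝ := 2 * C * (n : ℝ) ^ (r / (1 - r)) with hD
  have hD0 : 0 ≤ D := ✓
  have h1 : ∀ z, ∫⁻ o, ofReal (f (W.next z o)) ∂P ≤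
    ofReal (1 + C / n) * ofReal (f z) + ofReal D := by
    intro z
    rw [← ofReal_mul ✓, ← ofReal_add (mul_nonneg ✓ (hf z)) hD0]
    refine (hstep z).trans (ofReal_le_ofReal ?_)
    have h2 := rpow_le_mul_add_rpow (hf z) (T := (n : ℝ) ^ (1 / (1 - r))) ✓ hr0 hr.le
    rw [← rpow_mul hn0.le, ← rpow_mul hn0.le] at h2
    have e1 : 1 / (1 - r) * (r - 1) = -1 := by field_simp; ring
    have e2 : 1 / (1 - r) * r = r / (1 - r) := by field_simp
    rw [e1, e2, Real.rpow_neg_one] at h2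
    have h3 : 1 ≤ (n : ℝ) ^ (r / (1 - r)) := one_le_rpow hn1 ✓
    have h4 : C * (1 + f z ^ r) ≤ C * (1 + (f z * (n : ℝ)⁻¹ + (n : ℝ) ^ (r / (1 - r)))) := by gcongr
    have h5 : C * 1 ≤ C * (n : ℝ) ^ (r / (1 - r)) := by gcongr
    rw [hD, div_eq_mul_inv]
    linarith
  have h6 : ∀ k : ℕ, ∫⁻ o in B, ofReal (f (W.Z k o)) ∂P ≤
    ofReal (1 + C / n) ^ k * (∫⁻ o in B, ofReal (f (W.Z 0 o)) ∂P + k * (ofReal D * P B)) := by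
    intro k
    induction k with
    | zero => simp
    | succ k ih =>
      have hm : Measurable fun o => ofReal (f (W.Z k o)) :=
        (measurable_of_countable fun z => ofReal (f z)).comp (W.measurable_Z k)
      rw [W.setLIntegral_next k (W.measurable_history_zero k hB) fun _ z => ofReal (f z)]
      have hone : (1 : ENNReal) ≤ ofReal (1 + C / n) := by
        rw [one_le_ofReal]
        have : 0 ≤ C / n := ✓
        linarith
      calc ∫⁻ o in B, (∫⁻ o', ofReal (f (W.next (W.Z k o) o')) ∂P) ∂P
          ≤ ∫⁻ o in B, (ofReal (1 + C / n) * ofReal (f (W.Z k o)) +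
            ofReal D) ∂P := lintegral_mono fun o => h1 _
        _ = ofReal (1 + C / n) * ∫⁻ o in B, ofReal (f (W.Z k o)) ∂P + ofReal D * P B := by
          rw [lintegral_add_left (hm.const_mul _), lintegral_const_mul _ hm]
          simp
        _ ≤ ofReal (1 + C / n) * (ofReal (1 + C / n) ^ k *
          (∫⁻ o in B, ofReal (f (W.Z 0 o)) ∂P + k * (ofReal D * P B))) +
          ofReal (1 + C / n) ^ (k + 1) * (ofReal D * P B) := by
          exact add_le_add (mul_le_mul' le_rfl ih) (le_mul_of_one_le_left bot_le (one_le_pow₀ hone))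
        _ = _ := by push_cast; ring
  refine (h6 k).trans ?_
  have h7 : ofReal (1 + C / n) ^ k ≤ ofReal (exp C) := by
    rw [← ENNReal.ofReal_pow ✓]
    refine ofReal_le_ofReal ?_
    have h8 : 1 + C / n ≤ exp (C / n) := by linarith [Real.add_one_le_exp (C / n)]
    have h9 : (1 + C / n) ^ k ≤ (1 + C / n) ^ n :=
      pow_le_pow_right₀ (by linarith [(✓ : 0 ≤ C / n)]) hk
    calc (1 + C / n) ^ k ≤ (1 + C / n) ^ n := h9
      _ ≤ exp (C / n) ^ n := by gcongr
      _ = exp C := by rw [← Real.exp_nat_mul]; congr 1; field_simp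
  refine mul_le_mul' h7 (add_le_add le_rfl ?_)
  rw [← mul_assoc]
  gcongr
  calc (k : ENNReal) * ofReal D ≤ (n : ENNReal) * ofReal D := by gcongr
    _ = ofReal (n * D) := by simp
    _ = _ := by
      congr 1
      have e : (n : ℝ) ^ (1 / (1 - r)) = n * (n : ℝ) ^ (r / (1 - r)) := by
        have e3 : 1 / (1 - r) = 1 + r / (1 - r) := by field_simp; ring
        rw [e3, rpow_add hn0, rpow_one]
      rw [e, hD]
      ring

variable {W}

theorem OneStep.exists_drift_bound (h : W.OneStep u C α β ν) :
  ∃ K > 0, ∀ z, u ⬝ᵥ W.h z ≤ K * (1 + (u ⊙ z) ^ α) := by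
  obtain ⟨K, hK, hb⟩ := h.h_bound
  have hs : 0 ≤ ∑ i, u i := sum_nonneg fun i _ => (h.u_pos i).le
  refine ⟨(∑ i, u i + 1) * K, ✓, fun z => ?_⟩
  have hx := rpow_nonneg (dot_nonneg h.u_pos z) α
  calc u ⬝ᵥ W.h z ≤ ∑ i, u i * (K * (1 + (u ⊙ z) ^ α)) := sum_le_sum fun i _ => mul_le_left
          ((le_abs_self _).trans (hb z i)) (h.u_pos i).le
    _ = (∑ i, u i) * (K * (1 + (u ⊙ z) ^ α)) := by rw [sum_mul]
    _ ≤ (∑ i, u i + 1) * (K * (1 + (u ⊙ z) ^ α)) := by gcongr; linarith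
    _ = _ := by ring

theorem OneStep.exists_growth_first (h : W.OneStep u C α β ν) :
  ∃ K > 0, ∀ z, ∫⁻ o, ofReal (u ⊙ W.next z o) ∂P ≤ ofReal (u ⊙ z + K * (1 + (u ⊙ z) ^ α)) := by
  obtain ⟨K, hK, hb⟩ := h.exists_drift_bound
  refine ⟨K, hK, fun z => ?_⟩
  rw [← ofReal_integral_eq_lintegral_ofReal ((h.memLp z).integrable (by norm_num))
    (ae_of_all _ fun o => dot_nonneg h.u_pos _), h.mean]
  exact ofReal_le_ofReal (by linarith [hb z])

theorem OneStep.exists_var_bound (h : W.OneStep u C α β ν) : ∃ K > 0, ∀ z,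
  ∫ o, fluct W u z o ^ 2 ∂P ≤ K * (1 + (u ⊙ z) ^ β) := by
  refine exists_bound_of_eventually h.u_pos (C := ν + 1) ?_
    fun z => rpow_nonneg (dot_nonneg h.u_pos z) _
  filter_upwards [h.var.eventually (gt_mem_nhds (lt_add_one ν)), h.eventually_pos] with z hz hz0
  rw [div_lt_iff₀ ✓] at hz
  exact hz.le

theorem OneStep.integral_sq_next (h : W.OneStep u C α β ν) (z : Pop) :
  ∫ o, (u ⊙ W.next z o) ^ 2 ∂P = (u ⊙ z + u ⬝ᵥ W.h z) ^ 2 + ∫ o, fluct W u z o ^ 2 ∂P := by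
  have i1 : Integrable (fun o => u ⊙ W.next z o) P := (h.memLp z).integrable (by norm_num)
  have i2 : Integrable (fun o => (u ⊙ W.next z o) ^ 2) P := (h.memLp z).integrable_sq
  have i3 : Integrable (fun o => 2 * (u ⊙ z + u ⬝ᵥ W.h z) *
    (u ⊙ W.next z o) - (u ⊙ z + u ⬝ᵥ W.h z) ^ 2) P :=
    by fun_prop
  have e : ∀ o, fluct W u z o ^ 2 = (u ⊙ W.next z o) ^ 2 - (2 * (u ⊙ z + u ⬝ᵥ W.h z) *
    (u ⊙ W.next z o) - (u ⊙ z + u ⬝ᵥ W.h z) ^ 2) := fun o => by ring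
  simp_rw [e]
  rw [integral_sub i2 i3, integral_sub (i1.const_mul _) (integrable_const _), integral_const_mul,
    h.mean]
  simp
  ring

theorem OneStep.exists_growth_second (h : W.OneStep u C α β ν) :
  ∃ K > 0, ∀ z, ∫⁻ o, ofReal ((u ⊙ W.next z o) ^ 2) ∂P ≤ ofReal ((u ⊙ z) ^ 2 +
    K * (1 + ((u ⊙ z) ^ 2) ^ ((1 + α) / 2))) := by
  obtain ⟨K, hK, hb⟩ := h.exists_drift_bound
  obtain ⟨K', hK', hb'⟩ := h.exists_var_bound
  refine ⟨8 * K + 16 * K ^ 2 + 4 * K', ✓, fun z => ?_⟩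
  rw [← ofReal_integral_eq_lintegral_ofReal (h.memLp z).integrable_sq
    (ae_of_all _ fun o => sq_nonneg _), h.integral_sq_next]
  refine ofReal_le_ofReal ?_
  set x := u ⊙ z with hxdef
  have hx : 0 ≤ x := dot_nonneg h.u_pos z
  have hα := h.α_nonneg
  have hα1 := h.α_lt
  have e1 : (x ^ 2) ^ ((1 + α) / 2) = x ^ (1 + α) := by
    rw [← rpow_natCast, ← rpow_mul hx]
    congr 1
    push_cast
    ring
  have hd : 0 ≤ u ⬝ᵥ W.h z := by
    by_cases hz : z = 0
    · have := h.mean z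
      have h0 : 0 ≤ ∫ o, u ⊙ W.next z o ∂P :=
        integral_nonneg fun o => dot_nonneg h.u_pos (W.next z o)
      have hx0 : u ⊙ z = 0 := by rw [hz]; simp [realVec, dotProduct]
      rw [this, hx0] at h0
      linarith
    · exact (h.drift_pos z hz).le
  have b1 := hb z
  have b2 := hb' z
  have c1 : x * x ^ α = x ^ (1 + α) := by rw [Real.rpow_add_of_nonneg hx zero_le_one hα, rpow_one]
  have c2 : x ≤ 1 + x ^ (1 + α) := by
    have := rpow_le_one_add_rpow hx zero_le_one (by linarith : 1 ≤ 1 + α)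
    rwa [rpow_one] at this
  have c3 : (x ^ α) ^ 2 ≤ 1 + x ^ (1 + α) := by
    rw [← rpow_natCast, ← rpow_mul hx]
    exact rpow_le_one_add_rpow hx ✓ (by push_cast; linarith)
  have c4 : x ^ β ≤ 1 + x ^ (1 + α) := rpow_le_one_add_rpow hx (by linarith [h.one_le_β]) h.β_le
  have hY : 0 ≤ x ^ (1 + α) := ✓
  rw [e1]
  set d := u ⬝ᵥ W.h z
  set Y := x ^ (1 + α)
  have d1 : x * d ≤ K * (2 + 2 * Y) := by
    calc x * d ≤ x * (K * (1 + x ^ α)) := by gcongr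
      _ = K * (x + x * x ^ α) := by ring
      _ ≤ K * (2 + 2 * Y) := by
        rw [c1]
        exact mul_le_left (by linarith) hK.le
  have d2 : d ^ 2 ≤ K ^ 2 * (4 + 2 * Y) := by
    calc d ^ 2 ≤ (K * (1 + x ^ α)) ^ 2 := by gcongr
      _ = K ^ 2 * (1 + x ^ α) ^ 2 := by ring
      _ ≤ K ^ 2 * (4 + 2 * Y) := by
        gcongr
        nlinarith [sq_nonneg (1 - x ^ α)]
  have d3 : K' * (1 + x ^ β) ≤ K' * (2 + 2 * Y) := mul_le_left (by linarith) hK'.le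
  have hKY : 0 ≤ K * Y := ✓
  have hKY2 : 0 ≤ K ^ 2 * Y := ✓
  have hKY' : 0 ≤ K' * Y := ✓
  nlinarith [sq_nonneg K]

theorem OneStep.exists_first_moment (h : W.OneStep u C α β ν) :
  ∃ K > 0, ∀ (B : Set Ω), MeasurableSet[W.history 0] B → ∀ n k : ℕ, k ≤ n → 1 ≤ n →
    ∫⁻ o in B, ofReal (u ⊙ W.Z k o) ∂P ≤ ofReal K * (∫⁻ o in B, ofReal (u ⊙ W.Z 0 o) ∂P +
      ofReal ((n : ℝ) ^ (1 / (1 - α))) * P B) := by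
  obtain ⟨K, hK, hb⟩ := h.exists_growth_first
  refine ⟨exp K * (1 + 2 * K), ✓, fun B hB n k hk hn => ?_⟩
  refine (W.setLIntegral_le_of_growth (fun z => dot_nonneg h.u_pos z) hK.le
    h.α_nonneg h.α_lt hb hB hk hn).trans ?_
  rw [ofReal_mul (exp_pos K).le, mul_assoc (ofReal _)]
  refine mul_le_mul' le_rfl ?_
  rw [mul_add]
  refine add_le_add ?_ ?_
  · exact le_mul_of_one_le_left bot_le (one_le_ofReal.2 (by linarith))
  · rw [← mul_assoc, ← ofReal_mul ✓]
    gcongr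
    linarith

theorem OneStep.exists_second_moment (h : W.OneStep u C α β ν) :
  ∃ K > 0, ∀ (B : Set Ω), MeasurableSet[W.history 0] B → ∀ n k : ℕ, k ≤ n → 1 ≤ n →
    ∫⁻ o in B, ofReal ((u ⊙ W.Z k o) ^ 2) ∂P ≤ ofReal K *
      (∫⁻ o in B, ofReal ((u ⊙ W.Z 0 o) ^ 2) ∂P + ofReal ((n : ℝ) ^ (2 / (1 - α))) * P B) := by
  obtain ⟨K, hK, hb⟩ := h.exists_growth_second
  refine ⟨exp K * (1 + 2 * K), ✓, fun B hB n k hk hn => ?_⟩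
  refine (W.setLIntegral_le_of_growth (f := fun z => (u ⊙ z) ^ 2)
    (fun z => sq_nonneg _) hK.le (by linarith [h.α_nonneg])
    (by linarith [h.α_lt]) hb hB hk hn).trans ?_
  have e : 1 / (1 - (1 + α) / 2) = 2 / (1 - α) := by
    have := h.α_lt
    have h1 : 1 - α ≠ 0 := by linarith
    have h2 : 1 - (1 + α) / 2 ≠ 0 := by linarith
    rw [div_eq_div_iff h2 h1]
    ring
  rw [e, ofReal_mul (exp_pos K).le, mul_assoc (ofReal _)]
  refine mul_le_mul' le_rfl ?_
  rw [mul_add]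
  refine add_le_add ?_ ?_
  · exact le_mul_of_one_le_left bot_le (one_le_ofReal.2 (by linarith))
  · rw [← mul_assoc, ← ofReal_mul ✓]
    gcongr
    linarith

/-- The `ℓ¹` norm with weights `u`. -/
def weightedNorm (u w : Vec) : ℝ := ∑ i, u i * |w i|

theorem weightedNorm_nonneg (hu : ∀ i, 0 < u i) (w : Vec) : 0 ≤ weightedNorm u w :=
  sum_nonneg fun i _ => mul_nonneg (hu i).le (abs_nonneg _)

theorem weightedNorm_add_le (hu : ∀ i, 0 < u i) (w w' : Vec) :
  weightedNorm u (w + w') ≤ weightedNorm u w + weightedNorm u w' := by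
  unfold weightedNorm
  rw [← sum_add_distrib]
  refine sum_le_sum fun i _ => ?_
  rw [← mul_add]
  exact mul_le_left (abs_add_le _ _) (hu i).le

theorem weightedNorm_sum_le (hu : ∀ i, 0 < u i) {ι : Type*} (s : Finset ι) (w : ι → Vec) :
  weightedNorm u (∑ j ∈ s, w j) ≤ ∑ j ∈ s, weightedNorm u (w j) := by
  classical
  induction s using Finset.induction_on with
  | empty => simp [weightedNorm]
  | insert a s ha ih =>
    rw [Finset.sum_insert ha, Finset.sum_insert ha]
    exact (weightedNorm_add_le hu _ _).trans (by linarith)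

theorem abs_dotProduct_le_weightedNorm (hu : ∀ i, 0 < u i) (w : Vec) :
  |u ⬝ᵥ w| ≤ weightedNorm u w := by
  refine (abs_sum_le_sum_abs _ _).trans (le_of_eq (sum_congr rfl fun i _ => ?_))
  rw [abs_mul, abs_of_pos (hu i)]

theorem weightedNorm_mulVec_le (hu : ∀ i, 0 < u i) {m : Matrix (Fin p) (Fin p) ℝ}
  (hm : ∀ i j, 0 ≤ m i j) (w : Vec) :
  weightedNorm u (m.mulVec w) ≤ ∑ j, Matrix.vecMul u m j * |w j| := by
  have h1 : ∀ i, |m.mulVec w i| ≤ ∑ j, m i j * |w j| := fun i => by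
    have h := abs_sum_le_sum_abs (fun j => m i j * w j) univ
    simp only [abs_mul, abs_of_nonneg (hm i _)] at h
    exact h
  calc weightedNorm u (m.mulVec w) ≤ ∑ i, u i * ∑ j, m i j * |w j| :=
        sum_le_sum fun i _ => mul_le_left (h1 i) (hu i).le
    _ = _ := by
      simp only [Matrix.vecMul, dotProduct, mul_sum, sum_mul]
      rw [sum_comm]
      simp only [mul_assoc]

theorem exists_weightedNorm_contraction {m : Matrix (Fin p) (Fin p) ℝ} (hu : ∀ i, 0 < u i)
  (hum : Matrix.vecMul u m = u) (huv : u ⬝ᵥ v = 1) {k : ℕ} (hk : ∀ i j, 0 < (m ^ k) i j) :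
  ∃ η > 0, η ≤ 1 ∧ ∀ w, u ⬝ᵥ w = 0 →
    weightedNorm u ((m ^ k).mulVec w) ≤ (1 - η) * weightedNorm u w := by
  obtain ⟨η, hη, hη1, hηb⟩ : ∃ η : ℝ, 0 < η ∧ η ≤ 1 ∧ ∀ i j, η * (v i * u j) ≤ (m ^ k) i j := by
    have h : ∀ᶠ η : ℝ in 𝓝[>] 0, ∀ i j, η * (v i * u j) ≤ (m ^ k) i j := by
      refine eventually_all.2 fun i => eventually_all.2 fun j => ?_
      have t : Tendsto (fun η : ℝ => η * (v i * u j)) (𝓝[>] 0) (𝓝 (0 * (v i * u j))) :=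
        (Continuous.tendsto (by fun_prop) 0).mono_left nhdsWithin_le_nhds
      rw [zero_mul] at t
      filter_upwards [t.eventually (gt_mem_nhds (hk i j))] with η h using h.le
    have t2 : Tendsto (fun η : ℝ => η) (𝓝[>] 0) (𝓝 0) :=
      (Continuous.tendsto (by fun_prop) 0).mono_left nhdsWithin_le_nhds
    obtain ⟨η, ⟨h1, h2⟩, h3⟩ := ((h.and self_mem_nhdsWithin).and
      (t2.eventually (gt_mem_nhds (zero_lt_one)))).exists
    exact ⟨η, h2, h3.le, h1⟩
  have humk : ∀ n : ℕ, Matrix.vecMul u (m ^ n) = u := fun n => by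
    induction n with
    | zero => simp
    | succ n ih => rw [pow_succ, ← Matrix.vecMul_vecMul, ih, hum]
  refine ⟨η, hη, hη1, fun w hw => ?_⟩
  set q : Matrix (Fin p) (Fin p) ℝ := m ^ k - η • Matrix.vecMulVec v u with hq
  have e1 : (m ^ k).mulVec w = q.mulVec w := by
    rw [hq, Matrix.sub_mulVec, Matrix.smul_mulVec, Matrix.vecMulVec_mulVec, hw]
    simp
  have hq0 : ∀ i j, 0 ≤ q i j := fun i j => by
    simp only [hq, Matrix.sub_apply, Matrix.smul_apply, Matrix.vecMulVec_apply, smul_eq_mul]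
    linarith [hηb i j]
  have e2 : Matrix.vecMul u q = (1 - η) • u := by
    rw [hq, Matrix.vecMul_sub, humk, Matrix.vecMul_smul, Matrix.vecMul_vecMulVec, huv]
    ext i
    simp
    ring
  rw [e1]
  refine (weightedNorm_mulVec_le hu hq0 w).trans (le_of_eq ?_)
  rw [e2, weightedNorm, mul_sum]
  simp [mul_assoc]

theorem summable_pow_div {r : ℝ} (hr0 : 0 ≤ r) (hr : r < 1) {k : ℕ} (hk : 0 < k) :
  Summable fun j : ℕ => r ^ (j / k) := by
  have h := (summable_geometric_of_lt_one hr0 hr)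
  refine summable_of_sum_range_le (c := k * ∑' j, r ^ j) (fun j => ✓) fun n => ?_
  have h1 : ∑ j ∈ range n, r ^ (j / k) ≤ ∑ j ∈ range (n * k), r ^ (j / k) :=
    Finset.sum_le_sum_of_subset_of_nonneg (Finset.range_mono (Nat.le_mul_of_pos_right n hk))
      fun _ _ _ => ✓
  have h2 : ∀ n, ∑ j ∈ range (n * k), r ^ (j / k) = k * ∑ j ∈ range n, r ^ j := by
    intro n
    induction n with
    | zero => simp
    | succ n ih =>
      rw [add_mul, one_mul, Finset.sum_range_add, ih, sum_range_succ, mul_add]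
      congr 1
      rw [sum_congr rfl (g := fun _ => r ^ n)]
      · simp
      · intro x hx
        rw [Nat.mul_comm n k, Nat.mul_add_div hk, Nat.div_eq_of_lt (mem_range.1 hx), add_zero]
  rw [h2] at h1
  exact h1.trans (mul_le_left (h.sum_le_tsum _ fun _ _ => ✓) (cast_nonneg k))

theorem exists_weightedNorm_decay {m : Matrix (Fin p) (Fin p) ℝ} (hu : ∀ i, 0 < u i)
  (hum : Matrix.vecMul u m = u) (huv : u ⬝ᵥ v = 1) (hm : m.IsPrimitive) :
  ∃ a : ℕ → ℝ, (∀ j, 0 ≤ a j) ∧ Summable a ∧ ∀ w, u ⬝ᵥ w = 0 → ∀ j,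
    weightedNorm u ((m ^ j).mulVec w) ≤ a j * weightedNorm u w := by
  obtain ⟨k, hk0, hk⟩ := hm.exists_pos_pow
  obtain ⟨η, hη, hη1, hc⟩ := exists_weightedNorm_contraction hu hum huv hk
  refine ⟨fun j => (1 - η) ^ (j / k), fun j => by
    have : 0 ≤ 1 - η := by linarith
    positivity, summable_pow_div (by linarith) (by linarith) hk0, fun w hw j => ?_⟩
  have hperp : ∀ n : ℕ, u ⬝ᵥ (m ^ n).mulVec w = 0 := fun n => by
    rw [Matrix.dotProduct_mulVec]
    have : Matrix.vecMul u (m ^ n) = u := by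
      induction n with
      | zero => simp
      | succ n ih => rw [pow_succ, ← Matrix.vecMul_vecMul, ih, hum]
    rw [this, hw]
  have h1 : ∀ q : ℕ, weightedNorm u ((m ^ (k * q)).mulVec w) ≤ (1 - η) ^ q * weightedNorm u w := by
    intro q
    induction q with
    | zero => simp
    | succ q ih =>
      have : m ^ (k * (q + 1)) = m ^ k * m ^ (k * q) := by rw [← pow_add]; congr 1; ring
      rw [this, ← Matrix.mulVec_mulVec]
      refine (hc _ (hperp _)).trans ?_
      rw [pow_succ, mul_comm ((1 - η) ^ q), mul_assoc]
      exact mul_le_left ih (by linarith)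
  have h2 : ∀ n, weightedNorm u ((m ^ (k * (j / k) + n)).mulVec w) ≤
    (1 - η) ^ (j / k) * weightedNorm u w := by
    intro n
    induction n with
    | zero => simpa using h1 (j / k)
    | succ n ih =>
      rw [← add_assoc, pow_succ', ← Matrix.mulVec_mulVec]
      refine (weightedNorm_mulVec_le hu hm.nonneg _).trans ?_
      rw [hum]
      exact ih
  have h3 := h2 (j % k)
  rwa [Nat.div_add_mod] at h3

/-- The component of a population vector transversal to `v`. -/
noncomputable def transversal (u v : Vec) (z : Pop) : Vec := realVec z - (u ⊙ z) • v

theorem dot_transversal {u v : Vec} (huv : u ⬝ᵥ v = 1) (z : Pop) : u ⬝ᵥ transversal u v z = 0 := by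
  rw [transversal, dotProduct_sub, dotProduct_smul, huv]
  simp

theorem weightedNorm_smul (u w : Vec) (c : ℝ) :
  weightedNorm u (c • w) = |c| * weightedNorm u w := by
  simp only [weightedNorm, Pi.smul_apply, smul_eq_mul, abs_mul, mul_sum]
  exact sum_congr rfl fun i _ => by ring

theorem weightedNorm_of_nonneg (u : Vec) {w : Vec} (hw : ∀ i, 0 ≤ w i) :
  weightedNorm u w = u ⬝ᵥ w :=
  sum_congr rfl fun i _ => by rw [abs_of_nonneg (hw i)]

/-- The innovation of the transversal component in one generation, from `z` to `z'`. -/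
noncomputable def innovation (W : MBPM P p) (u v : Vec) (z z' : Pop) : Vec :=
  transversal u v z' - W.meanMatrix.mulVec (transversal u v z)

theorem PerronVectors.dot_innovation (huv : W.PerronVectors u v) (z z' : Pop) :
  u ⬝ᵥ W.innovation u v z z' = 0 := by
  obtain ⟨hu, -, -, -, -, h1⟩ := huv
  rw [innovation, dotProduct_sub, Matrix.dotProduct_mulVec, hu, dot_transversal h1,
    dot_transversal h1, sub_zero]

theorem transversal_eq_sum (W : MBPM P p) (u v : Vec) (n : ℕ) (o : Ω) :
  transversal u v (W.Z n o) = (W.meanMatrix ^ n).mulVec (transversal u v (W.Z 0 o)) +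
    ∑ j ∈ range n, (W.meanMatrix ^ (n - 1 - j)).mulVec
      (W.innovation u v (W.Z j o) (W.Z (j + 1) o)) := by
  induction n with
  | zero => simp
  | succ n ih =>
    have e : transversal u v (W.Z (n + 1) o) = W.meanMatrix.mulVec (transversal u v (W.Z n o)) +
      W.innovation u v (W.Z n o) (W.Z (n + 1) o) := by simp [innovation]
    rw [e, ih, sum_range_succ, Matrix.mulVec_add, Matrix.mulVec_mulVec, ← pow_succ',
      Matrix.mulVec_sum]
    have e2 : ∀ j ∈ range n, W.meanMatrix.mulVec ((W.meanMatrix ^ (n - 1 - j)).mulVec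
      (W.innovation u v (W.Z j o) (W.Z (j + 1) o))) =
      (W.meanMatrix ^ (n + 1 - 1 - j)).mulVec
      (W.innovation u v (W.Z j o) (W.Z (j + 1) o)) := fun j hj => by
      have := mem_range.1 hj
      rw [Matrix.mulVec_mulVec, ← pow_succ']
      congr 2
      omega
    rw [sum_congr rfl e2]
    simp [add_assoc]

theorem meanMatrix_nonneg (W : MBPM P p) (i j : Fin p) : 0 ≤ W.meanMatrix i j :=
  integral_nonneg fun _ => cast_nonneg _

theorem PerronVectors.weightedNorm_innovation_le (huv : W.PerronVectors u v) (z z' : Pop) :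
  weightedNorm u (W.innovation u v z z') ≤
    2 * weightedNorm u (realVec z' - W.meanMatrix.mulVec (realVec z + W.h z)) +
    2 * weightedNorm u (W.h z) := by
  obtain ⟨hu, hv, hu0, hv0, -, h1⟩ := huv
  set ζ := realVec z' - W.meanMatrix.mulVec (realVec z + W.h z) with hζ
  have e1 : u ⊙ z' - u ⊙ z = u ⬝ᵥ ζ + u ⬝ᵥ W.h z := by
    rw [hζ, dotProduct_sub, Matrix.dotProduct_mulVec, hu, dotProduct_add]
    ring
  have e2 : W.innovation u v z z' =
    ζ + (W.meanMatrix.mulVec (W.h z) + (-(u ⬝ᵥ ζ + u ⬝ᵥ W.h z)) • v) := by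
    rw [innovation, transversal, transversal, Matrix.mulVec_sub, Matrix.mulVec_smul, hv, ← e1, hζ,
      Matrix.mulVec_add]
    ext i
    simp
    ring
  have h2 : weightedNorm u (W.meanMatrix.mulVec (W.h z)) ≤ weightedNorm u (W.h z) := by
    refine (weightedNorm_mulVec_le hu0 W.meanMatrix_nonneg _).trans ?_
    rw [hu]
    exact le_rfl
  have h3 : weightedNorm u ((-(u ⬝ᵥ ζ + u ⬝ᵥ W.h z)) • v) ≤
    weightedNorm u ζ + weightedNorm u (W.h z) := by
    rw [weightedNorm_smul, weightedNorm_of_nonneg u fun i => (hv0 i).le, h1, mul_one, abs_neg]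
    refine (abs_add_le _ _).trans ?_
    exact add_le_add (abs_dotProduct_le_weightedNorm hu0 _) (abs_dotProduct_le_weightedNorm hu0 _)
  have h4 := weightedNorm_add_le hu0 ζ (W.meanMatrix.mulVec (W.h z) + (-(u ⬝ᵥ ζ + u ⬝ᵥ W.h z)) • v)
  have h5 := weightedNorm_add_le hu0 (W.meanMatrix.mulVec (W.h z)) ((-(u ⬝ᵥ ζ + u ⬝ᵥ W.h z)) • v)
  rw [e2]
  linarith

theorem OneStep.exists_innovation_bound (h : W.OneStep u C α β ν) (huv : W.PerronVectors u v) :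
  ∃ K > 0, ∀ z, ∫⁻ o, ofReal (weightedNorm u (W.innovation u v z (W.next z o))) ∂P ≤
    ofReal (K * (1 + (u ⊙ z) ^ max α (β / 2))) := by
  obtain ⟨K₁, hK₁, b₁⟩ := h.dev
  obtain ⟨K₂, hK₂, b₂⟩ := h.h_bound
  have hs : ∑ i, u i = 1 := huv.2.2.2.2.1
  refine ⟨4 * K₁ + 4 * K₂, ✓, fun z => ?_⟩
  have hx := dot_nonneg h.u_pos z
  have hi : ∀ a, Integrable (fun o => |(W.next z o a : ℝ) -
    (W.meanMatrix.mulVec (realVec z + W.h z)) a|) P := fun a =>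
    ((h.integrable_coord z a).sub (integrable_const _)).abs
  have hw : Integrable (fun o => weightedNorm u (realVec (W.next z o) -
    W.meanMatrix.mulVec (realVec z + W.h z))) P :=
    integrable_finsetSum _ fun a _ => (hi a).const_mul _
  have hI : Integrable (fun o => 2 * weightedNorm u (realVec (W.next z o) -
    W.meanMatrix.mulVec (realVec z + W.h z)) + 2 * weightedNorm u (W.h z)) P := by fun_prop
  refine (lintegral_mono fun o => ofReal_le_ofReal (huv.weightedNorm_innovation_le z _)).trans ?_
  rw [← ofReal_integral_eq_lintegral_ofReal hI (ae_of_all _ fun o => by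
    have := weightedNorm_nonneg h.u_pos (realVec (W.next z o) -
      W.meanMatrix.mulVec (realVec z + W.h z))
    have := weightedNorm_nonneg h.u_pos (W.h z)
    positivity)]
  refine ofReal_le_ofReal ?_
  have hτ1 := rpow_le_one_add_rpow hx h.α_nonneg (le_max_left α (β / 2))
  have hτ2 := rpow_le_one_add_rpow hx (by linarith [h.one_le_β]) (le_max_right α (β / 2))
  have c1 : ∫ o, weightedNorm u (realVec (W.next z o) -
    W.meanMatrix.mulVec (realVec z + W.h z)) ∂P ≤ K₁ * (1 + (u ⊙ z) ^ (β / 2)) := by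
    have e := integral_finsetSum univ (μ := P) fun a _ => (hi a).const_mul (u a)
    refine (le_of_eq e).trans ?_
    calc _ ≤ ∑ a, u a * (K₁ * (1 + (u ⊙ z) ^ (β / 2))) := by
          refine sum_le_sum fun a _ => ?_
          rw [integral_const_mul]
          exact mul_le_left (b₁ z a) (h.u_pos a).le
      _ = _ := by rw [← sum_mul, hs, one_mul]
  have c2 : weightedNorm u (W.h z) ≤ K₂ * (1 + (u ⊙ z) ^ α) := by
    calc _ ≤ ∑ a, u a * (K₂ * (1 + (u ⊙ z) ^ α)) :=
          sum_le_sum fun a _ => mul_le_left (b₂ z a) (h.u_pos a).le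
      _ = _ := by rw [← sum_mul, hs, one_mul]
  rw [integral_add (hw.const_mul _) (integrable_const _), integral_const_mul]
  simp only [integral_const, probReal_univ, one_smul]
  have hτ : 0 ≤ (u ⊙ z) ^ max α (β / 2) := ✓
  have c3 : K₁ * (1 + (u ⊙ z) ^ (β / 2)) ≤ K₁ * (2 + 2 * (u ⊙ z) ^ max α (β / 2)) :=
    mul_le_left (by linarith) hK₁.le
  have c4 : K₂ * (1 + (u ⊙ z) ^ α) ≤ K₂ * (2 + 2 * (u ⊙ z) ^ max α (β / 2)) :=
    mul_le_left (by linarith) hK₂.le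
  linarith

theorem OneStep.max_lt_one (h : W.OneStep u C α β ν) : max α (β / 2) < 1 :=
  max_lt h.α_lt (by linarith [h.α_lt, h.β_le])

/-- Mean size of the transversal component. -/
theorem OneStep.exists_transversal_bound (h : W.OneStep u C α β ν) (huv : W.PerronVectors u v)
  (hm : W.meanMatrix.IsPrimitive) :
  ∃ K > 0, ∀ (B : Set Ω), MeasurableSet[W.history 0] B → ∀ n : ℕ, 1 ≤ n →
    ∫⁻ o in B, ofReal (weightedNorm u (transversal u v (W.Z n o))) ∂P ≤
      ofReal (K * (n : ℝ) ^ (max α (β / 2) / (1 - α))) *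
      (1 + ∫⁻ o in B, ofReal (u ⊙ W.Z 0 o) ∂P) := by
  obtain ⟨K₁, hK₁, b₁⟩ := h.exists_first_moment
  obtain ⟨K₂, hK₂, b₂⟩ := h.exists_innovation_bound huv
  obtain ⟨a, ha0, hasum, hadec⟩ := exists_weightedNorm_decay h.u_pos huv.1 huv.2.2.2.2.2 hm
  set τ := max α (β / 2) with hτ
  have hτ0 : 0 ≤ τ := h.α_nonneg.trans (le_max_left _ _)
  have hτ1 : τ < 1 := h.max_lt_one
  set S := ∑' j, a j with hS
  have hS0 : 0 ≤ S := tsum_nonneg ha0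
  refine ⟨S * (2 + K₂ * (2 + 2 * K₁)) + 1, ✓, fun B hB n hn => ?_⟩
  have hn1 : (1 : ℝ) ≤ n := by exact_mod_cast hn
  have hn0 : (0 : ℝ) < n := by linarith
  set X := ∫⁻ o in B, ofReal (u ⊙ W.Z 0 o) ∂P with hX
  set N := (n : ℝ) ^ (τ / (1 - α)) with hN
  have hα1 : 0 < 1 - α := by grind
  have hN1 : 1 ≤ N := one_le_rpow hn1 ✓
  have hmeas : ∀ (f : Pop → Pop → ℝ) j,
    Measurable fun o => ofReal (f (W.Z j o) (W.Z (j + 1) o)) := fun f j =>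
    (measurable_of_countable fun q : Pop × Pop => ofReal (f q.1 q.2)).comp
      ((W.measurable_Z j).prodMk (W.measurable_Z (j + 1)))
  have hinn : ∀ j < n, ∫⁻ o in B, ofReal (weightedNorm u
    (W.innovation u v (W.Z j o) (W.Z (j + 1) o))) ∂P ≤
    ofReal (K₂ * (2 + 2 * K₁) * N) * (1 + X) := by
    intro j hj
    rw [W.setLIntegral_next j (W.measurable_history_zero j hB)
      fun z z' => ofReal (weightedNorm u (W.innovation u v z z'))]
    have e1 : ∀ z, K₂ * (1 + (u ⊙ z) ^ τ) ≤
      K₂ * (2 * N) + (K₂ * (n : ℝ) ^ ((τ - 1) / (1 - α))) * (u ⊙ z) := by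
      intro z
      have h1 := rpow_le_mul_add_rpow (dot_nonneg h.u_pos z)
        (T := (n : ℝ) ^ (1 / (1 - α))) ✓ hτ0 hτ1.le
      rw [← rpow_mul hn0.le, ← rpow_mul hn0.le, div_mul_eq_mul_div, one_mul,
        div_mul_eq_mul_div, one_mul, ← hN] at h1
      have h2 : K₂ * (1 + (u ⊙ z) ^ τ) ≤ K₂ * (N + ((u ⊙ z) *
        (n : ℝ) ^ ((τ - 1) / (1 - α)) + N)) := by gcongr
      linarith
    have hxm : Measurable fun o => ofReal (u ⊙ W.Z j o) := hmeas (fun z _ => u ⊙ z) j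
    calc _ ≤ ∫⁻ o in B, (ofReal (K₂ * (2 * N)) + ofReal (K₂ * (n : ℝ) ^ ((τ - 1) / (1 - α))) *
                ofReal (u ⊙ W.Z j o)) ∂P := by
          refine lintegral_mono fun o => (b₂ _).trans ?_
          rw [← ofReal_mul ✓, ← ofReal_add ✓ (mul_nonneg ✓ (dot_nonneg h.u_pos _))]
          exact ofReal_le_ofReal (e1 _)
      _ = ofReal (K₂ * (2 * N)) * P B + ofReal (K₂ * (n : ℝ) ^ ((τ - 1) / (1 - α))) *
        ∫⁻ o in B, ofReal (u ⊙ W.Z j o) ∂P := by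
        rw [lintegral_add_left measurable_const, lintegral_const_mul _ hxm]
        simp
      _ ≤ ofReal (K₂ * (2 * N)) * 1 + ofReal (K₂ * (n : ℝ) ^ ((τ - 1) / (1 - α))) *
        (ofReal K₁ * (X + ofReal ((n : ℝ) ^ (1 / (1 - α))) * 1)) := by
        refine add_le_add (mul_le_mul' le_rfl prob_le_one) (mul_le_mul' le_rfl ?_)
        exact (b₁ B hB n j hj.le hn).trans (mul_le_mul' le_rfl (add_le_add le_rfl
          (mul_le_mul' le_rfl prob_le_one)))
      _ ≤ ofReal (K₂ * (2 * N)) * (1 + X) + ofReal (K₂ * (n : ℝ) ^ ((τ - 1) / (1 - α))) *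
        (ofReal K₁ * (ofReal (2 * (n : ℝ) ^ (1 / (1 - α))) * (1 + X))) := by
        refine add_le_add (mul_le_mul' le_rfl (le_add_right le_rfl))
          (mul_le_mul' le_rfl (mul_le_mul' le_rfl ?_))
        have hq : 1 ≤ (n : ℝ) ^ (1 / (1 - α)) := one_le_rpow hn1 ✓
        rw [mul_add, add_comm]
        refine add_le_add (mul_le_mul' (ofReal_le_ofReal (by linarith)) le_rfl) ?_
        exact le_mul_of_one_le_left bot_le (one_le_ofReal.2 (by linarith))
      _ = _ := by
        rw [← mul_assoc (ofReal K₁), ← mul_assoc (ofReal (_ * _)),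
          ← ofReal_mul hK₁.le, ← ofReal_mul ✓, ← add_mul, ← ofReal_add ✓
          ✓]
        congr 2
        have e2 : (n : ℝ) ^ ((τ - 1) / (1 - α)) * (n : ℝ) ^ (1 / (1 - α)) = N := by
          rw [← rpow_add hn0, hN]
          congr 1
          rw [← add_div]
          congr 1
          ring
        rw [← e2]
        ring
  have hstart : ∫⁻ o in B, ofReal (weightedNorm u (transversal u v (W.Z 0 o))) ∂P ≤
    ofReal 2 * X := by
    have hxm : Measurable fun o => ofReal (u ⊙ W.Z 0 o) := hmeas (fun z _ => u ⊙ z) 0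
    rw [hX, ← lintegral_const_mul _ hxm]
    refine lintegral_mono fun o => ?_
    rw [← ofReal_mul (by norm_num)]
    refine ofReal_le_ofReal ?_
    have h1 := weightedNorm_add_le h.u_pos (realVec (W.Z 0 o)) ((-(u ⊙ W.Z 0 o)) • v)
    rw [weightedNorm_smul, weightedNorm_of_nonneg u (w := v) fun i => (huv.2.2.2.1 i).le,
      huv.2.2.2.2.2, weightedNorm_of_nonneg u (w := realVec _) fun i => cast_nonneg _, abs_neg,
      abs_of_nonneg (dot_nonneg h.u_pos _), neg_smul, ← sub_eq_add_neg] at h1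
    rw [transversal]
    linarith
  have hpath : ∀ o, ofReal (weightedNorm u (transversal u v (W.Z n o))) ≤
    ofReal (a n) * ofReal (weightedNorm u (transversal u v (W.Z 0 o))) +
    ∑ j ∈ range n, ofReal (a (n - 1 - j)) * ofReal (weightedNorm u
      (W.innovation u v (W.Z j o) (W.Z (j + 1) o))) := by
    intro o
    have h1 : ∀ j, 0 ≤ a (n - 1 - j) * weightedNorm u
      (W.innovation u v (W.Z j o) (W.Z (j + 1) o)) := fun j =>
      mul_nonneg (ha0 _) (weightedNorm_nonneg h.u_pos _)
    simp_rw [← ofReal_mul (ha0 _)]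
    rw [← ofReal_sum_of_nonneg fun j _ => h1 j, ← ofReal_add
      (mul_nonneg (ha0 _) (weightedNorm_nonneg h.u_pos _)) (sum_nonneg fun j _ => h1 j)]
    refine ofReal_le_ofReal ?_
    rw [W.transversal_eq_sum]
    refine (weightedNorm_add_le h.u_pos _ _).trans (add_le_add
      (hadec _ (dot_transversal huv.2.2.2.2.2 _) n) ?_)
    refine (weightedNorm_sum_le h.u_pos _ _).trans (sum_le_sum fun j _ => ?_)
    exact hadec _ (huv.dot_innovation _ _) _
  have hm0 : Measurable fun o => ofReal (weightedNorm u (transversal u v (W.Z 0 o))) :=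
    hmeas (fun z _ => weightedNorm u (transversal u v z)) 0
  have hmj : ∀ j, Measurable fun o => ofReal (weightedNorm u
    (W.innovation u v (W.Z j o) (W.Z (j + 1) o))) :=
    fun j => hmeas (fun z z' => weightedNorm u (W.innovation u v z z')) j
  refine (lintegral_mono hpath).trans ?_
  rw [lintegral_add_left (hm0.const_mul _), lintegral_const_mul _ hm0,
    lintegral_finsetSum _ fun j _ => (hmj j).const_mul _]
  have han : ∀ j, a j ≤ S := fun j => hasum.le_tsum j fun i _ => ha0 i
  have hsum : ∑ j ∈ range n, a (n - 1 - j) ≤ S := by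
    rw [Finset.sum_range_reflect]
    exact hasum.sum_le_tsum _ fun i _ => ha0 i
  calc _ ≤ ofReal S * (ofReal 2 * X) + ∑ j ∈ range n, ofReal (a (n - 1 - j)) *
              (ofReal (K₂ * (2 + 2 * K₁) * N) * (1 + X)) := by
        refine add_le_add (mul_le_mul' (ofReal_le_ofReal (han n)) hstart) (sum_le_sum fun j hj => ?_)
        rw [lintegral_const_mul _ (hmj j)]
        exact mul_le_mul' le_rfl (hinn j (mem_range.1 hj))
    _ ≤ ofReal S * (ofReal (2 * N) * (1 + X)) +
      ofReal S * (ofReal (K₂ * (2 + 2 * K₁) * N) * (1 + X)) := by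
      refine add_le_add (mul_le_mul' le_rfl (mul_le_mul' (ofReal_le_ofReal (by linarith))
        (le_add_left le_rfl))) ?_
      rw [← sum_mul, ← ofReal_sum_of_nonneg fun j _ => ha0 _]
      exact mul_le_mul' (ofReal_le_ofReal hsum) le_rfl
    _ = ofReal (S * (2 + K₂ * (2 + 2 * K₁)) * N) * (1 + X) := by
      rw [← mul_assoc, ← mul_assoc, ← add_mul, ← ofReal_mul hS0, ← ofReal_mul hS0, ← ofReal_add ✓ ✓]
      congr 2
      ring
    _ ≤ _ := by
      refine mul_le_mul' (ofReal_le_ofReal ?_) le_rfl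
      exact mul_le_right (by linarith) (by linarith)

theorem abs_exp_sub_sum_le (x : ℝ) (n : ℕ) :
  |exp x - ∑ m ∈ range n, x ^ m / (m.factorial : ℝ)| ≤ |x| ^ n * exp |x| := by
  have h := Complex.norm_exp_sub_sum_le_norm_mul_exp (x : ℂ) n
  rw [Complex.norm_real, norm_eq_abs] at h
  refine le_trans (le_of_eq ?_) h
  rw [← norm_eq_abs, ← Complex.norm_real]
  congr 1
  push_cast
  rfl

theorem abs_exp_sub_one_sub_le (x : ℝ) : |exp x - (1 + x)| ≤ x ^ 2 * exp |x| := by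
  have h := abs_exp_sub_sum_le x 2
  rw [sq_abs] at h
  simpa [sum_range_succ] using h

theorem abs_exp_sub_quadratic_le (x : ℝ) :
  |exp x - (1 + x + x ^ 2 / 2)| ≤ |x| ^ 3 * exp |x| := by
  have h := abs_exp_sub_sum_le x 3
  simpa [sum_range_succ] using h

theorem mul_exp_neg_le_one (w : ℝ) : w * exp (-w) ≤ 1 := by
  have h := Real.add_one_le_exp w
  rw [Real.exp_neg, ← div_eq_mul_inv, div_le_one (exp_pos w)]
  linarith

theorem sq_mul_exp_neg_half_le {w : ℝ} (hw : 0 ≤ w) : w ^ 2 * exp (-(w / 2)) ≤ 8 := by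
  have h := Real.quadratic_le_exp_of_nonneg (by linarith : 0 ≤ w / 2)
  rw [Real.exp_neg, ← div_eq_mul_inv, div_le_iff₀ (exp_pos _)]
  nlinarith

theorem abs_one_add_rpow_sub_one_le {s d : ℝ} (hs0 : 0 ≤ s) (hs : s ≤ 1) (hd : -1 ≤ d) :
  |(1 + d) ^ s - 1| ≤ |d| := by
  have h1 := rpow_one_add_le_one_add_mul_self hd hs0 hs
  rcases le_or_gt 0 d with h | h
  · have h2 : 1 ≤ (1 + d) ^ s := one_le_rpow (by linarith) hs0
    rw [abs_of_nonneg (by linarith), abs_of_nonneg h]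
    nlinarith
  · have h2 : (1 + d) ^ s ≤ 1 := rpow_le_one (by linarith) (by linarith) hs0
    have h3 : 1 + d ≤ (1 + d) ^ s := by
      rcases eq_or_lt_of_le hd with h4 | h4
      · rw [← h4]; simp; positivity
      · have := Real.rpow_le_rpow_of_exponent_ge (by linarith : 0 < 1 + d) (by linarith) hs
        rwa [rpow_one] at this
    rw [abs_of_nonpos (by linarith), abs_of_neg h]
    linarith

theorem abs_one_add_rpow_sub_le {s d : ℝ} (hs0 : 0 ≤ s) (hs : s ≤ 1) (hd : |d| ≤ 1 / 2) :
  |(1 + d) ^ s - (1 + s * d - s * (1 - s) / 2 * d ^ 2)| ≤ 40 * |d| ^ 3 := by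
  have hd' := abs_le.1 hd
  have hl0 := abs_log_one_add_sub_le hd le_rfl
  set L := log (1 + d) with hL
  have e3 : 2 * |d| * d ^ 2 = 2 * |d| ^ 3 := by grind
  rw [e3] at hl0
  have hd0 := abs_nonneg d
  have hd3 : |d| ^ 3 ≤ |d| / 4 := by nlinarith [mul_nonneg hd0 (sq_nonneg d), sq_abs d]
  have hd2 : d ^ 2 ≤ |d| / 2 := by nlinarith [sq_abs d]
  have hl := abs_le.1 hl0
  have hL2 : |L| ≤ 2 * |d| := by
    rw [abs_le]
    constructor <;> cases abs_cases d <;> nlinarith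
  have hL1 : |L| ≤ 1 := by linarith
  have hsL : |s * L| ≤ |L| := by
    rw [abs_mul, abs_of_nonneg hs0]
    nlinarith [abs_nonneg L]
  have h1 := abs_exp_sub_quadratic_le (s * L)
  have hexp : exp |s * L| ≤ 3 := by
    have := exp_le_exp.2 (hsL.trans hL1)
    linarith [Real.exp_one_lt_d9]
  have h2 : |s * L| ^ 3 * exp |s * L| ≤ 24 * |d| ^ 3 := by
    have h3 : |s * L| ^ 3 ≤ (2 * |d|) ^ 3 := pow_le_pow_left₀ (abs_nonneg _) (hsL.trans hL2) 3
    calc _ ≤ (2 * |d|) ^ 3 * 3 := by gcongr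
      _ = _ := by ring
  have h4 : |L ^ 2 - d ^ 2| ≤ 6 * |d| ^ 3 := by
    have e : L ^ 2 - d ^ 2 = (L - d) * (L + d) := by ring
    have a1 : |L - d| ≤ 2 * d ^ 2 := by
      have e4 : |d| ^ 3 = |d| * d ^ 2 := by linarith
      have : |d| * d ^ 2 ≤ 1 / 2 * d ^ 2 := by gcongr
      rw [abs_le]
      constructor <;> linarith
    have a2 : |L + d| ≤ 3 * |d| := (abs_add_le _ _).trans (by linarith)
    rw [e, abs_mul]
    calc _ ≤ (2 * d ^ 2) * (3 * |d|) := by gcongr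
      _ = _ := by linarith
  rw [Real.rpow_def_of_pos (by linarith), ← hL, mul_comm L s]
  have e : exp (s * L) - (1 + s * d - s * (1 - s) / 2 * d ^ 2) =
    (exp (s * L) - (1 + s * L + (s * L) ^ 2 / 2)) + s * (L - (d - d ^ 2 / 2)) +
    s ^ 2 / 2 * (L ^ 2 - d ^ 2) := by ring
  rw [e]
  refine (abs_add_le _ _).trans ((add_le_add (abs_add_le _ _) le_rfl).trans ?_)
  have b1 : |s * (L - (d - d ^ 2 / 2))| ≤ 2 * |d| ^ 3 := by
    rw [abs_mul, abs_of_nonneg hs0]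
    calc _ ≤ 1 * (2 * |d| ^ 3) := by gcongr
      _ = _ := one_mul _
  have b2 : |s ^ 2 / 2 * (L ^ 2 - d ^ 2)| ≤ 6 * |d| ^ 3 := by
    rw [abs_mul, abs_of_nonneg ✓]
    calc _ ≤ 1 * (6 * |d| ^ 3) := mul_le_mul (by nlinarith) h4 (abs_nonneg _) zero_le_one
      _ = _ := one_mul _
  have hnn : 0 ≤ |d| ^ 3 := ✓
  linarith

/-- Second order expansion of `e ^ (-w (1 + d) ^ s)`, uniform in `w`. -/
theorem abs_exp_neg_mul_rpow_sub_le_of_small {s d w η : ℝ} (hs0 : 0 ≤ s) (hs : s ≤ 1)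
  (hw : 0 ≤ w) (hη : η ≤ 1 / 4) (hd : |d| ≤ η) :
  |exp (-w * (1 + d) ^ s) - exp (-w) * (1 - w * s * d +
    (w * s * (1 - s) + w ^ 2 * s ^ 2) / 2 * d ^ 2)| ≤ 300 * (w * (η * d ^ 2)) := by
  have hd0 := abs_nonneg d
  have h1 := abs_one_add_rpow_sub_le hs0 hs (by linarith : |d| ≤ 1 / 2)
  have hq := abs_one_add_rpow_sub_one_le hs0 hs (by linarith [(abs_le.1 hd).1] : -1 ≤ d)
  set q := (1 + d) ^ s - 1 with hqdef
  have hE : exp (-w * (1 + d) ^ s) = exp (-w) * exp (-w * q) := by rw [← exp_add]; congr 1; ring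
  have h1' : |q - (s * d - s * (1 - s) / 2 * d ^ 2)| ≤ 40 * |d| ^ 3 := by grind
  have hd3 : |d| ^ 3 ≤ η * d ^ 2 := by
    calc |d| ^ 3 = |d| * d ^ 2 := by rw [← sq_abs]; ring
      _ ≤ _ := by gcongr
  have hηd : 0 ≤ η * d ^ 2 := by grind
  have e0 : exp (-w * (1 + d) ^ s) - exp (-w) * (1 - w * s * d +
    (w * s * (1 - s) + w ^ 2 * s ^ 2) / 2 * d ^ 2) =
    exp (-w) * (exp (-w * q) - (1 + (-w * q) + (-w * q) ^ 2 / 2)) +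
    (-(w * exp (-w))) * (q - (s * d - s * (1 - s) / 2 * d ^ 2)) +
    (w ^ 2 * exp (-w)) / 2 * (q ^ 2 - s ^ 2 * d ^ 2) := by linarith
  have hew : 0 < exp (-w) := exp_pos _
  have hew1 : exp (-w) ≤ 1 := exp_le_one_iff.2 (by linarith)
  have b1 : |exp (-w) * (exp (-w * q) - (1 + (-w * q) + (-w * q) ^ 2 / 2))| ≤
    8 * (w * (η * d ^ 2)) := by
    have h2 := abs_exp_sub_quadratic_le (-w * q)
    have e1 : |-w * q| = w * |q| := by rw [abs_mul, abs_neg, abs_of_nonneg hw]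
    rw [e1] at h2
    have h3 : exp (w * |q|) ≤ exp (w / 2) := exp_le_exp.2 (by nlinarith)
    have h5 : exp (-w) * exp (w / 2) = exp (-(w / 2)) := by rw [← exp_add]; congr 1; ring
    rw [abs_mul, abs_of_pos hew]
    calc _ ≤ exp (-w) * ((w * |q|) ^ 3 * exp (w * |q|)) := by gcongr
      _ ≤ exp (-w) * ((w * |d|) ^ 3 * exp (w / 2)) := by gcongr
      _ = (w * |d| ^ 3) * (w ^ 2 * (exp (-w) * exp (w / 2))) := by ring
      _ ≤ (w * (η * d ^ 2)) * 8 := by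
        rw [h5]
        exact mul_le_mul (mul_le_left hd3 hw) (sq_mul_exp_neg_half_le hw)
          ✓ ✓
      _ = _ := by ring
  have b2 : |(-(w * exp (-w))) * (q - (s * d - s * (1 - s) / 2 * d ^ 2))| ≤
    40 * (w * (η * d ^ 2)) := by
    rw [abs_mul, abs_neg, abs_of_nonneg ✓]
    calc _ ≤ (w * 1) * (40 * (η * d ^ 2)) :=
          mul_le_mul (mul_le_left hew1 hw) (h1'.trans (by linarith)) (abs_nonneg _) ✓
      _ = _ := by ring
  have b3 : |(w ^ 2 * exp (-w)) / 2 * (q ^ 2 - s ^ 2 * d ^ 2)| ≤ 200 * (w * (η * d ^ 2)) := by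
    have hsd : |s * d| ≤ |d| := by rw [abs_mul, abs_of_nonneg hs0]; nlinarith
    have c1 : |q - s * d| ≤ 12 * d ^ 2 := by
      have e : q - s * d = (q - (s * d - s * (1 - s) / 2 * d ^ 2)) + (- (s * (1 - s) / 2 * d ^ 2)) := by
        linarith
      rw [e]
      refine (abs_add_le _ _).trans ?_
      have hs1 : 0 ≤ 1 - s := by linarith
      rw [abs_neg, abs_of_nonneg (✓ : 0 ≤ s * (1 - s) / 2 * d ^ 2)]
      have c2 : s * (1 - s) / 2 * d ^ 2 ≤ 1 * d ^ 2 := mul_le_right (by nlinarith) (sq_nonneg d)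
      have c3 : η * d ^ 2 ≤ 1 / 4 * d ^ 2 := by gcongr
      linarith
    have c4 : |q ^ 2 - s ^ 2 * d ^ 2| ≤ 24 * (η * d ^ 2) := by
      have e : q ^ 2 - s ^ 2 * d ^ 2 = (q - s * d) * (q + s * d) := by ring
      rw [e, abs_mul]
      calc _ ≤ (12 * d ^ 2) * (2 * η) := by
            refine mul_le_mul c1 ((abs_add_le _ _).trans (by linarith)) (abs_nonneg _)
              ✓
        _ = _ := by ring
    have c5 : w * exp (-w) ≤ 1 := mul_exp_neg_le_one w
    rw [abs_mul, abs_of_nonneg ✓]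
    calc _ ≤ (w ^ 2 * exp (-w)) / 2 * (24 * (η * d ^ 2)) := by gcongr
      _ = (w * exp (-w)) * (12 * (w * (η * d ^ 2))) := by ring
      _ ≤ 1 * (12 * (w * (η * d ^ 2))) := by gcongr
      _ ≤ _ := by grind
  rw [e0]
  refine (abs_add_le _ _).trans ((add_le_add (abs_add_le _ _) le_rfl).trans ?_)
  nlinarith [mul_nonneg hw hηd]

theorem abs_exp_neg_sub_exp_neg_le {a b : ℝ} (ha : 0 ≤ a) (hb : 0 ≤ b) :
  |exp (-a) - exp (-b)| ≤ |a - b| := by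
  rcases le_total a b with h | h
  · have h1 : exp (-b) ≤ exp (-a) := by gcongr
    rw [abs_of_nonneg (by linarith), abs_of_nonpos (by linarith)]
    have h2 : exp (-b) = exp (-a) * exp (-(b - a)) := by rw [← exp_add]; congr 1; ring
    have h3 := Real.add_one_le_exp (-(b - a))
    have h4 : exp (-a) ≤ 1 := exp_le_one_iff.2 (by linarith)
    have h5 := exp_pos (-a)
    have h6 : exp (-(b - a)) ≤ 1 := exp_le_one_iff.2 (by linarith)
    nlinarith
  · have h1 : exp (-a) ≤ exp (-b) := by gcongr
    rw [abs_of_nonpos (by linarith), abs_of_nonneg (by linarith)]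
    have h2 : exp (-a) = exp (-b) * exp (-(a - b)) := by rw [← exp_add]; congr 1; ring
    have h3 := Real.add_one_le_exp (-(a - b))
    have h4 : exp (-b) ≤ 1 := exp_le_one_iff.2 (by linarith)
    have h5 := exp_pos (-b)
    have h6 : exp (-(a - b)) ≤ 1 := exp_le_one_iff.2 (by linarith)
    nlinarith

theorem abs_exp_neg_mul_rpow_sub_le {s d w η : ℝ} (hs0 : 0 ≤ s) (hs : s ≤ 1)
  (hw : 0 ≤ w) (hη0 : 0 < η) (hη : η ≤ 1 / 4) (hd : -1 ≤ d) :
  |exp (-w * (1 + d) ^ s) - exp (-w) * (1 - w * s * d +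
    (w * s * (1 - s) + w ^ 2 * s ^ 2) / 2 * d ^ 2)| ≤
    300 * (w * (η * d ^ 2)) + (2 / η + 1) * w * (if η < |d| then d ^ 2 else 0) := by
  split_ifs with h
  · have hη2 : |d| ≤ d ^ 2 / η := by
      rw [le_div_iff₀ hη0, ← sq_abs, sq]
      exact mul_le_left h.le (abs_nonneg d)
    have hb : 0 ≤ (1 + d) ^ s := rpow_nonneg (by linarith) _
    have h1 : |exp (-w * (1 + d) ^ s) - exp (-w)| ≤ w * (d ^ 2 / η) := by
      rw [neg_mul]
      refine (abs_exp_neg_sub_exp_neg_le ✓ hw).trans ?_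
      have e : w * (1 + d) ^ s - w = w * ((1 + d) ^ s - 1) := by ring
      rw [e, abs_mul, abs_of_nonneg hw]
      exact mul_le_left ((abs_one_add_rpow_sub_one_le hs0 hs hd).trans hη2) hw
    have hew : 0 < exp (-w) := exp_pos _
    have hew1 : exp (-w) ≤ 1 := exp_le_one_iff.2 (by linarith)
    have h2 : |(w * exp (-w)) * s * d| ≤ w * (d ^ 2 / η) := by
      rw [abs_mul, abs_of_nonneg ✓]
      refine mul_le_mul ?_ hη2 (abs_nonneg _) hw
      calc w * exp (-w) * s ≤ w * 1 * 1 := by gcongr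
        _ = w := by ring
    have h3 : |exp (-w) * ((w * s * (1 - s) + w ^ 2 * s ^ 2) / 2 * d ^ 2)| ≤ w * d ^ 2 := by
      have hs1 : 0 ≤ 1 - s := by linarith
      rw [abs_of_nonneg ✓]
      have c1 : w * exp (-w) ≤ 1 := mul_exp_neg_le_one w
      have c2 : exp (-w) * (w * s * (1 - s)) ≤ 1 * (w * 1) := by
        refine mul_le_mul hew1 ?_ ✓ zero_le_one
        rw [mul_assoc]
        exact mul_le_left (by nlinarith) hw
      have c3 : (w * exp (-w)) * (w * s ^ 2) ≤ 1 * (w * 1) := by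
        refine mul_le_mul c1 ?_ ✓ zero_le_one
        exact mul_le_left (by nlinarith) hw
      have c4 : exp (-w) * ((w * s * (1 - s) + w ^ 2 * s ^ 2) / 2) ≤ w := by nlinarith
      calc _ = (exp (-w) * ((w * s * (1 - s) + w ^ 2 * s ^ 2) / 2)) * d ^ 2 := by ring
        _ ≤ _ := by gcongr
    have e : exp (-w * (1 + d) ^ s) - exp (-w) * (1 - w * s * d +
      (w * s * (1 - s) + w ^ 2 * s ^ 2) / 2 * d ^ 2) =
      (exp (-w * (1 + d) ^ s) - exp (-w)) + (w * exp (-w)) * s * d +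
      (- (exp (-w) * ((w * s * (1 - s) + w ^ 2 * s ^ 2) / 2 * d ^ 2))) := by ring
    rw [e]
    refine (abs_add_le _ _).trans ((add_le_add (abs_add_le _ _) le_rfl).trans ?_)
    rw [abs_neg]
    have h5 : (2 / η + 1) * w * d ^ 2 = w * (d ^ 2 / η) + w * (d ^ 2 / η) + w * d ^ 2 := by grind
    have : 0 ≤ 300 * (w * (η * d ^ 2)) := ✓
    linarith
  · have := abs_exp_neg_mul_rpow_sub_le_of_small hs0 hs hw hη (not_lt.1 h)
    simpa using this

/-- The Laplace transform of the limit diffusion over a short time, to second order. -/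
theorem abs_laplace_step_le {k τ w : ℝ} (hk : 0 ≤ k) (hτ0 : 0 ≤ τ) (hτ : τ ≤ 1) (hkτ : k * τ ≤ 1)
  (hw : 0 ≤ w) :
  |(1 + τ) ^ (-k) * exp (-(w / (1 + τ))) - exp (-w) * (1 - k * τ + τ * w)| ≤
    (k ^ 2 + 3 * k + 10) * τ ^ 2 := by
  have hτ1 : 0 < 1 + τ := by linarith
  set t := τ / (1 + τ) with ht
  have ht0 : 0 ≤ t := ✓
  have htτ : t ≤ τ := div_le_self hτ0 (by linarith)
  have ht2 : t ≤ 1 / 2 := by rw [ht, div_le_iff₀ hτ1]; linarith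
  have htd : τ - t ≤ τ ^ 2 := by
    have : τ - t = τ ^ 2 / (1 + τ) := by rw [ht]; field_simp; ring
    rw [this]
    exact div_le_self (sq_nonneg _) (by linarith)
  have hew : 0 < exp (-w) := exp_pos _
  have hwe := mul_exp_neg_le_one w
  have hwe0 : 0 ≤ w * exp (-w) := ✓
  set E := exp (-(w / (1 + τ))) with hE
  have hEw : E = exp (-w) * exp (w * t) := by
    rw [hE, ← exp_add]
    congr 1
    rw [ht]
    field_simp
    ring
  have hE0 : 0 < E := exp_pos _
  have hE1 : E ≤ 1 := exp_le_one_iff.2 (by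
    have : 0 ≤ w / (1 + τ) := ✓
    linarith)
  have a1 : |E - exp (-w) * (1 + τ * w)| ≤ 9 * τ ^ 2 := by
    have h1 := abs_exp_sub_one_sub_le (w * t)
    rw [abs_of_nonneg (✓ : 0 ≤ w * t)] at h1
    have h2 : exp (-w) * exp (w * t) ≤ exp (-(w / 2)) := by
      rw [← exp_add]
      exact exp_le_exp.2 (by nlinarith)
    have e : E - exp (-w) * (1 + τ * w) =
      exp (-w) * (exp (w * t) - (1 + w * t)) + (-(w * exp (-w) * (τ - t))) := by linarith
    rw [e]
    refine (abs_add_le _ _).trans ?_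
    rw [abs_neg, abs_mul, abs_of_pos hew, abs_of_nonneg (mul_nonneg hwe0 (by linarith))]
    have h3 : exp (-w) * |exp (w * t) - (1 + w * t)| ≤ 8 * τ ^ 2 := by
      calc _ ≤ exp (-w) * ((w * t) ^ 2 * exp (w * t)) := by gcongr
        _ = t ^ 2 * (w ^ 2 * (exp (-w) * exp (w * t))) := by ring
        _ ≤ t ^ 2 * (w ^ 2 * exp (-(w / 2))) := by gcongr
        _ ≤ τ ^ 2 * 8 := mul_le_mul (pow_le_pow_left₀ ht0 htτ 2) (sq_mul_exp_neg_half_le hw)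
          ✓ ✓
        _ = _ := by ring
    have h4 : w * exp (-w) * (τ - t) ≤ 1 * τ ^ 2 := by gcongr
    linarith
  have a2 : |(1 + τ) ^ (-k) - (1 - k * τ)| ≤ (k ^ 2 + k) * τ ^ 2 := by
    rw [Real.rpow_def_of_pos hτ1]
    set L := log (1 + τ)
    have l1 : L ≤ τ := by have := Real.log_le_sub_one_of_pos hτ1; linarith
    have l0 : 0 ≤ L := Real.log_nonneg (by linarith)
    have l2 : τ - τ ^ 2 ≤ L := by
      have h := Real.one_sub_inv_le_log_of_pos hτ1
      have : 1 - (1 + τ)⁻¹ = t := by rw [ht]; field_simp; ring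
      linarith
    have hb : |L * -k| ≤ 1 := by
      rw [abs_mul, abs_neg, abs_of_nonneg l0, abs_of_nonneg hk]
      nlinarith
    have h1 := Real.abs_exp_sub_one_sub_id_le hb
    have e : exp (L * -k) - (1 - k * τ) = (exp (L * -k) - 1 - L * -k) + k * (τ - L) := by ring
    rw [e]
    refine (abs_add_le _ _).trans ?_
    rw [abs_mul, abs_of_nonneg hk, abs_of_nonneg (show 0 ≤ τ - L by linarith)]
    have h2 : (L * -k) ^ 2 ≤ k ^ 2 * τ ^ 2 := by
      have : (L * -k) ^ 2 = k ^ 2 * L ^ 2 := by ring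
      rw [this]
      gcongr
    have h3 : k * (τ - L) ≤ k * τ ^ 2 := mul_le_left (by linarith) hk
    linarith
  have e : (1 + τ) ^ (-k) * E - exp (-w) * (1 - k * τ + τ * w) =
    ((1 + τ) ^ (-k) - (1 - k * τ)) * E + (1 - k * τ) * (E - exp (-w) * (1 + τ * w)) +
    (-(k * τ ^ 2 * (w * exp (-w)))) := by ring
  rw [e]
  refine (abs_add_le _ _).trans ((add_le_add (abs_add_le _ _) le_rfl).trans ?_)
  have hkτ0 : 0 ≤ k * τ := ✓
  rw [abs_mul, abs_mul, abs_neg, abs_of_pos hE0, abs_of_nonneg (by linarith : 0 ≤ 1 - k * τ),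
    abs_of_nonneg (✓ : 0 ≤ k * τ ^ 2 * (w * exp (-w)))]
  have c1 : |(1 + τ) ^ (-k) - (1 - k * τ)| * E ≤ (k ^ 2 + k) * τ ^ 2 * 1 := by gcongr
  have c2 : (1 - k * τ) * |E - exp (-w) * (1 + τ * w)| ≤ 1 * (9 * τ ^ 2) :=
    mul_le_mul (by linarith) a1 (abs_nonneg _) zero_le_one
  have c3 : k * τ ^ 2 * (w * exp (-w)) ≤ k * τ ^ 2 * 1 := by gcongr
  nlinarith [sq_nonneg τ, mul_nonneg hk (sq_nonneg τ)]

/-- A set which is measurable with respect to a filtration can be approximated by sets which are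
measurable at a finite time. -/
theorem exists_measurableSet_filtration_approx {Ω : Type*} {mΩ : MeasurableSpace Ω} {P : Measure Ω}
  [IsProbabilityMeasure P] (ℱ : Filtration ℕ mΩ) {A : Set Ω} (hA : MeasurableSet[⨆ n, ℱ n] A)
  {ε : ℝ} (hε : 0 < ε) :
  ∃ N, ∃ B, MeasurableSet[ℱ N] B ∧ P.real (symmDiff A B) ≤ ε := by
  have hle : ⨆ n, ℱ n ≤ mΩ := iSup_le fun n => ℱ.le n
  have hA' : MeasurableSet A := hle A hA
  have hg : Integrable (A.indicator fun _ => (1 : ℝ)) P := by fun_prop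
  have hgm : StronglyMeasurable[⨆ n, ℱ n] (A.indicator fun _ => (1 : ℝ)) := by fun_prop
  have h := hg.tendsto_eLpNorm_condExp (ℱ := ℱ) hgm
  obtain ⟨N, hN⟩ := ((tendsto_order.1 h).2 (ofReal (ε / 2)) (by simpa using hε)).exists
  set q := P[A.indicator fun _ => (1 : ℝ) | ℱ N] with hq
  refine ⟨N, {o | 1 / 2 < q o}, ?_, ?_⟩
  · have hqm : Measurable[ℱ N] q := by fun_prop
    exact hqm measurableSet_Ioi
  · have hqm : Measurable q := (stronglyMeasurable_condExp.mono (ℱ.le N)).measurable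
    have hsub : symmDiff A {o | 1 / 2 < q o} ⊆
      {o | ofReal (1 / 2) ≤ ‖(q - A.indicator fun _ => (1 : ℝ)) o‖ₑ} := by
      intro o ho
      simp only [mem_ofPred_eq, ← ofReal_norm]
      refine ofReal_le_ofReal ?_
      rw [Pi.sub_apply, norm_eq_abs]
      rcases ho with ⟨h1, h2⟩ | ⟨h1, h2⟩
      · have h2 : q o ≤ 1 / 2 := not_lt.1 h2
        rw [indicator_of_mem h1, abs_of_nonpos (by linarith)]
        linarith
      · have h1 : 1 / 2 < q o := h1
        rw [indicator_of_notMem h2, sub_zero, abs_of_pos (by linarith)]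
        exact h1.le
    have h1 := mul_meas_ge_le_lintegral (μ := P)
      (f := fun o => ‖(q - A.indicator fun _ => (1 : ℝ)) o‖ₑ)
      ((hqm.sub (measurable_const.indicator hA')).enorm) (ofReal (1 / 2))
    rw [← eLpNorm_one_eq_lintegral_enorm] at h1
    have h2 := (mul_le_mul_right (measure_mono (μ := P) hsub) _).trans (h1.trans hN.le)
    have h3 := toReal_mono ofReal_ne_top h2
    rw [toReal_mul, toReal_ofReal (by norm_num), toReal_ofReal ✓]
      at h3
    have h3 : 1 / 2 * P.real (symmDiff A {o | 1 / 2 < q o}) ≤ ε / 2 := h3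
    linarith

theorem norm_setIntegral_sub_le {Ω E : Type*} [MeasurableSpace Ω] {P : Measure Ω}
  [IsFiniteMeasure P] [NormedAddCommGroup E] [NormedSpace ℝ E] {A B : Set Ω}
  (hA : MeasurableSet A) (hB : MeasurableSet B) {f : Ω → E} (hf : Integrable f P)
  (hf1 : ∀ o, ‖f o‖ ≤ 1) :
  ‖∫ o in A, f o ∂P - ∫ o in B, f o ∂P‖ ≤ P.real (symmDiff A B) := by
  have h1 := integral_inter_add_sdiff hB hf.integrableOn (s := A)
  have h2 := integral_inter_add_sdiff hA hf.integrableOn (s := B)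
  rw [← h1, ← h2, Set.inter_comm B A, add_sub_add_left_eq_sub]
  refine (norm_sub_le _ _).trans ?_
  have h3 := norm_setIntegral_le_of_norm_le_const (measure_lt_top P (A \ B)) fun o _ => hf1 o
  have h4 := norm_setIntegral_le_of_norm_le_const (measure_lt_top P (B \ A)) fun o _ => hf1 o
  have h5 : P.real (symmDiff A B) = P.real (A \ B) + P.real (B \ A) := measureReal_symmDiff_eq hA hB
  linarith

theorem abs_laplace_coeff_sub_le {s b y A₁ A₂ C θ ε : ℝ} (hs0 : 0 ≤ s) (hs1 : s ≤ 1) (hb : 0 < b)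
  (hy : 0 ≤ y) (h₁ : |y * A₁ - C| ≤ ε) (h₂ : |y * A₂ - θ| ≤ ε) :
  |exp (-(b * y)) * (1 - b * y * s * A₁ + (b * y * s * (1 - s) + (b * y) ^ 2 * s ^ 2) / 2 * A₂) -
    exp (-(b * y)) * (1 - b * (s * (C - (1 - s) * θ / 2)) + s ^ 2 * θ / 2 * b ^ 2 * y)| ≤
    2 * (b * ε) := by
  have hw : 0 ≤ b * y := ✓
  have e : exp (-(b * y)) *
    (1 - b * y * s * A₁ + (b * y * s * (1 - s) + (b * y) ^ 2 * s ^ 2) / 2 * A₂) -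
    exp (-(b * y)) * (1 - b * (s * (C - (1 - s) * θ / 2)) + s ^ 2 * θ / 2 * b ^ 2 * y) =
    (exp (-(b * y)) * s) * (-b * (y * A₁ - C)) + ((exp (-(b * y)) * (s * (1 - s)) +
      (b * y * exp (-(b * y))) * s ^ 2) / 2) * (b * (y * A₂ - θ)) := by ring
  have hew : 0 < exp (-(b * y)) := exp_pos _
  have hew1 : exp (-(b * y)) ≤ 1 := exp_le_one_iff.2 (by linarith)
  rw [e]
  refine ((abs_add_le _ _).trans (add_le_add (abs_mul _ _).le (abs_mul _ _).le)).trans ?_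
  have f1 : |exp (-(b * y)) * s| ≤ 1 := by
    rw [abs_of_nonneg ✓]
    exact mul_le_one₀ hew1 hs0 hs1
  have f2 : |(exp (-(b * y)) * (s * (1 - s)) + (b * y * exp (-(b * y))) * s ^ 2) / 2| ≤ 1 := by
    have hs2 : 0 ≤ 1 - s := by linarith
    rw [abs_of_nonneg ✓]
    have g1 : exp (-(b * y)) * (s * (1 - s)) ≤ 1 * 1 := mul_le_mul hew1 (by nlinarith) ✓ zero_le_one
    have g2 : (b * y * exp (-(b * y))) * s ^ 2 ≤ 1 * 1 :=
      mul_le_mul (mul_exp_neg_le_one _) (by nlinarith) ✓ zero_le_one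
    linarith
  have f3 : |-b * (y * A₁ - C)| ≤ b * ε := by
    rw [abs_mul, abs_neg, abs_of_pos hb]
    exact mul_le_left h₁ hb.le
  have f4 : |b * (y * A₂ - θ)| ≤ b * ε := by
    rw [abs_mul, abs_of_pos hb]
    exact mul_le_left h₂ hb.le
  have f5 := mul_le_mul f1 f3 (abs_nonneg _) zero_le_one
  have f6 := mul_le_mul f2 f4 (abs_nonneg _) zero_le_one
  linarith

variable (W)

theorem measurableSet_unlimited_iSup : MeasurableSet[⨆ n, W.history n] W.Unlimited := by
  refine @measurableSet_tendsto _ _ _ (⨆ n, W.history n) _ _ _ _ atTop _ _ _ fun n => ?_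
  have h : Measurable[⨆ n, W.history n] (W.Z n) :=
    (W.measurable_Z_history n).mono (le_iSup (fun n => (W.history n : MeasurableSpace Ω)) n) le_rfl
  exact (measurable_of_countable fun z : Pop => ‖realVec z‖).comp h

theorem measurableSet_unlimited : MeasurableSet W.Unlimited :=
  (iSup_le fun n => W.history.le n) _ W.measurableSet_unlimited_iSup

theorem exists_unlimited_approx {ε : ℝ} (hε : 0 < ε) :
  ∃ N, ∃ B, MeasurableSet[W.history N] B ∧ P.real (symmDiff W.Unlimited B) ≤ ε :=
  exists_measurableSet_filtration_approx W.history W.measurableSet_unlimited_iSup hε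

theorem tendsto_measureReal_unlimited_inter_lt (hu : ∀ i, 0 < u i) (K : ℝ) :
  Tendsto (fun n => P.real (W.Unlimited ∩ {o | u ⊙ W.Z n o < K})) atTop (𝓝 0) := by
  have h1 : Tendsto (fun n => ∫ o, (W.Unlimited ∩ {o | u ⊙ W.Z n o < K}).indicator
    (fun _ => (1 : ℝ)) o ∂P) atTop (𝓝 (∫ _, (0 : ℝ) ∂P)) := by
    refine tendsto_integral_of_dominated_convergence (fun _ => 1) (fun n => ?_)
      (integrable_const _) (fun n => ae_of_all _ fun o => ?_) (ae_of_all _ fun o => ?_)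
    · exact (measurable_const.indicator (W.measurableSet_unlimited.inter
        (W.history.le n _ (W.measurableSet_Z n {z | u ⊙ z < K})))).aestronglyMeasurable
    · exact (norm_indicator_le_norm_self _ _).trans (by simp)
    · by_cases ho : o ∈ W.Unlimited
      · have h2 := ((tendsto_dot_iff_norm hu fun n => W.Z n o).2 ho).eventually_ge_atTop K
        refine tendsto_const_nhds.congr' ?_
        filter_upwards [h2] with n hn
        rw [indicator_of_notMem]
        exact fun h => absurd h.2 (not_lt.2 hn)
      · refine tendsto_const_nhds.congr fun n => ?_
        rw [indicator_of_notMem]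
        exact fun h => ho h.1
  rw [integral_zero] at h1
  refine h1.congr fun n => ?_
  have hm : MeasurableSet (W.Unlimited ∩ {o | u ⊙ W.Z n o < K}) := W.measurableSet_unlimited.inter
    (W.history.le n _ (W.measurableSet_Z n {z | u ⊙ z < K}))
  rw [integral_indicator_const _ hm]
  simp

theorem setIntegral_next (k : ℕ) {𝕜 : Type*} [RCLike 𝕜] {B : Set Ω}
  (hB : MeasurableSet[W.history k] B) (f : Pop → 𝕜) {D : ℝ} (hf : ∀ z, ‖f z‖ ≤ D) :
  ∫ o in B, f (W.Z (k + 1) o) ∂P = ∫ o in B, (∫ o', f (W.next (W.Z k o) o') ∂P) ∂P := by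
  have hB' : MeasurableSet B := W.history.le k _ hB
  have h := W.integral_mul_next k (g := B.indicator fun _ => (1 : 𝕜)) (A := 1)
    ((@stronglyMeasurable_const _ _ (W.history k) _ _).indicator hB)
    (fun o => (norm_indicator_le_norm_self _ _).trans (by simp)) f hf
  rw [← integral_indicator hB', ← integral_indicator hB']
  simpa only [indicator, ite_mul, one_mul, zero_mul] using h

theorem integrable_comp_Z (n : ℕ) {E : Type*} [NormedAddCommGroup E]
  (f : Pop → E) {D : ℝ} (hf : ∀ z, ‖f z‖ ≤ D) :
  Integrable (fun o => f (W.Z n o)) P :=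
  Integrable.of_bound ((StronglyMeasurable.of_discrete (f := f)).comp_measurable
    (W.measurable_Z n)).aestronglyMeasurable D (ae_of_all _ fun _ => hf _)

variable {W}

theorem Diffusive.laplace_eventually (hd : W.Diffusive u C α θ) (hu : ∀ i, 0 < u i) (hα0 : 0 ≤ α)
  (hα : α < 1) {ε : ℝ} (hε : 0 < ε) :
  ∀ᶠ z in growing p, ∀ b : ℝ, 0 < b →
    |∫ o, exp (-(b * (u ⊙ W.next z o) ^ (1 - α))) ∂P -
      exp (-(b * (u ⊙ z) ^ (1 - α))) * (1 - b * ((1 - α) * (C - α * θ / 2)) +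
        (1 - α) ^ 2 * θ / 2 * b ^ 2 * (u ⊙ z) ^ (1 - α))| ≤ b * ε := by
  obtain ⟨η, hη0, hη1, hη2⟩ : ∃ η : ℝ, 0 < η ∧ η ≤ 1 / 4 ∧ 300 * η * (|θ| + 1) ≤ ε / 4 := by
    refine ⟨min (1 / 4) (ε / (1200 * (|θ| + 1))), ✓, min_le_left _ _, ?_⟩
    have h : min (1 / 4) (ε / (1200 * (|θ| + 1))) ≤ ε / (1200 * (|θ| + 1)) := by simp
    rw [le_div_iff₀ ✓] at h
    linarith
  have t1 := (hd.mean.sub_const C).abs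
  have t2 := (hd.sq.sub_const θ).abs
  have t3 := (hd.tail η hη0).const_mul (2 / η + 1)
  rw [sub_self, abs_zero] at t1 t2
  rw [mul_zero] at t3
  filter_upwards [t1.eventually (gt_mem_nhds (✓ : 0 < ε / 4)),
    t2.eventually (gt_mem_nhds (✓ : 0 < min (ε / 4) 1)),
    t3.eventually (gt_mem_nhds (✓ : 0 < ε / 4)),
    (tendsto_dot_growing hu).eventually_gt_atTop 0] with z c1 c2 c3 hz b hb
  set s := 1 - α with hs
  have hs0 : 0 ≤ s := by linarith
  have hs1 : s ≤ 1 := by linarith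
  have hα_s : α = 1 - s := by linarith
  set x := u ⊙ z with hx
  set y := x ^ s with hy
  have hy0 : 0 < y := ✓
  set w := b * y with hw
  have hw0 : 0 < w := ✓
  set A1 := ∫ o, W.rel u z o ∂P with hA1
  set A2 := ∫ o, W.rel u z o ^ 2 ∂P with hA2
  set A3 := ∫ o, {o | η < |W.rel u z o|}.indicator (fun o => W.rel u z o ^ 2) o ∂P with hA3
  have hm := hd.memLp z
  have i1 : Integrable (fun o => W.rel u z o) P := hm.integrable (by norm_num)
  have i2 : Integrable (fun o => W.rel u z o ^ 2) P := hm.integrable_sq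
  have i3 := i2.indicator (W.measurableSet_rel_tail u z η)
  have hlow := fun o => W.neg_one_le_rel hu hz o
  have hpt : ∀ o, |exp (-(b * (u ⊙ W.next z o) ^ s)) - exp (-w) * (1 - w * s * W.rel u z o +
    (w * s * (1 - s) + w ^ 2 * s ^ 2) / 2 * W.rel u z o ^ 2)| ≤
    300 * w * η * W.rel u z o ^ 2 + (2 / η + 1) * w *
      {o | η < |W.rel u z o|}.indicator (fun o => W.rel u z o ^ 2) o := by
    intro o
    have h := abs_exp_neg_mul_rpow_sub_le hs0 hs1 hw0.le hη0 hη1 (hlow o)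
    have e : b * (u ⊙ W.next z o) ^ s = w * (1 + W.rel u z o) ^ s := by
      rw [W.dot_next_eq_rel hz, mul_rpow hz.le (by linarith [hlow o]), hw, hy]
      ring
    rw [e, ← neg_mul]
    refine h.trans (le_of_eq ?_)
    simp only [indicator, mem_ofPred_eq]
    ring
  have ie : Integrable (fun o => exp (-(b * (u ⊙ W.next z o) ^ s))) P := by
    refine Integrable.of_bound (C := 1) ((((W.measurable_dot_next u z).pow_const
      s).const_mul b).neg.exp).aestronglyMeasurable (ae_of_all _ fun o => ?_)
    rw [norm_of_nonneg (exp_pos _).le]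
    refine exp_le_one_iff.2 ?_
    have := rpow_nonneg (dot_nonneg hu (W.next z o)) s
    have : 0 ≤ b * (u ⊙ W.next z o) ^ s := ✓
    linarith
  have j1 : Integrable (fun o => 1 - w * s * W.rel u z o) P := by fun_prop
  have j2 := j1.fun_add (i2.const_mul ((w * s * (1 - s) + w ^ 2 * s ^ 2) / 2))
  have j3 := j2.const_mul (exp (-w))
  have k1 := (i2.const_mul (300 * w * η)).fun_add (i3.const_mul ((2 / η + 1) * w))
  have main : |∫ o, exp (-(b * (u ⊙ W.next z o) ^ s)) ∂P -
    exp (-w) * (1 - w * s * A1 + (w * s * (1 - s) + w ^ 2 * s ^ 2) / 2 * A2)| ≤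
    300 * w * η * A2 + (2 / η + 1) * w * A3 := by
    have e1 : exp (-w) * (1 - w * s * A1 + (w * s * (1 - s) + w ^ 2 * s ^ 2) / 2 * A2) =
      ∫ o, exp (-w) * (1 - w * s * W.rel u z o +
      (w * s * (1 - s) + w ^ 2 * s ^ 2) / 2 * W.rel u z o ^ 2) ∂P := by
      rw [integral_const_mul, integral_add j1 (i2.const_mul _),
        integral_sub (integrable_const _) (i1.const_mul _), integral_const_mul, integral_const_mul]
      simp [hA1, hA2]
    have e2 : 300 * w * η * A2 + (2 / η + 1) * w * A3 = ∫ o, (300 * w * η * W.rel u z o ^ 2 +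
      (2 / η + 1) * w *
      {o | η < |W.rel u z o|}.indicator (fun o => W.rel u z o ^ 2) o) ∂P := by
      rw [integral_add (i2.const_mul _) (i3.const_mul _), integral_const_mul, integral_const_mul]
    rw [e1, e2, ← integral_sub ie j3]
    exact abs_integral_le_integral_abs.trans (integral_mono (ie.sub j3).abs k1 hpt)
  have hA2n : 0 ≤ A2 := ✓
  have d1 : 300 * w * η * A2 ≤ b * (ε / 4) := by
    have h1 : y * A2 ≤ |θ| + 1 := by
      have h2 := (abs_lt.1 c2).2
      have h3 : min (ε / 4) 1 ≤ 1 := by simp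
      have := le_abs_self θ
      linarith
    calc 300 * w * η * A2 = b * (300 * η * (y * A2)) := by linarith
      _ ≤ b * (300 * η * (|θ| + 1)) := by gcongr
      _ ≤ b * (ε / 4) := by gcongr
  have d2 : (2 / η + 1) * w * A3 ≤ b * (ε / 4) := by
    calc (2 / η + 1) * w * A3 = b * ((2 / η + 1) * (y * A3)) := by linarith
      _ ≤ b * (ε / 4) := by gcongr
  have d3 := abs_laplace_coeff_sub_le hs0 hs1 hb hy0.le c1.le (c2.le.trans (min_le_left _ _))
  rw [← hα_s, ← hw] at d3
  rw [abs_le] at main d3 ⊢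
  constructor <;> linarith [main.1, main.2, d3.1, d3.2]

theorem exists_laplace_bound (hu : ∀ i, 0 < u i) (hα0 : 0 ≤ α)
  (hα : α < 1) (hint : ∀ z, Integrable (fun o => u ⊙ W.next z o) P)
  (hd : W.Diffusive u C α θ) :
  ∃ D : ℝ, 0 < D ∧ ∀ z, ∀ b : ℝ, 0 < b →
    |∫ o, exp (-(b * (u ⊙ W.next z o) ^ (1 - α))) ∂P -
      exp (-(b * (u ⊙ z) ^ (1 - α))) * (1 - b * ((1 - α) * (C - α * θ / 2)) +
        (1 - α) ^ 2 * θ / 2 * b ^ 2 * (u ⊙ z) ^ (1 - α))| ≤ b * D := by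
  obtain ⟨K, hK, hb⟩ := (eventually_growing hu).1 (hd.laplace_eventually hu hα0 hα one_pos)
  have hs0 : 0 < 1 - α := by linarith
  set μ := (1 - α) * (C - α * θ / 2)
  set Θ := (1 - α) ^ 2 * θ / 2
  set E : Pop → ℝ := fun z => ∫ o, (1 + u ⊙ W.next z o) ∂P + (u ⊙ z) ^ (1 - α) with hE
  have hE0 : ∀ z, 0 ≤ E z := fun z => add_nonneg (integral_nonneg fun o => by
    have := dot_nonneg hu (W.next z o)
    positivity) (rpow_nonneg (dot_nonneg hu z) _)
  refine ⟨1 + ∑ z ∈ (finite_dot_le hu K).toFinset, E z + |μ| + |Θ|, ?_, fun z b hb0 => ?_⟩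
  · have := sum_nonneg fun z (_ : z ∈ (finite_dot_le hu K).toFinset) => hE0 z
    positivity
  · have hsum := sum_nonneg fun z (_ : z ∈ (finite_dot_le hu K).toFinset) => hE0 z
    rcases le_or_gt K (u ⊙ z) with hz | hz
    · refine (hb z hz b hb0).trans (mul_le_left ?_ hb0.le)
      have := abs_nonneg μ
      have := abs_nonneg Θ
      linarith
    · have hx := dot_nonneg hu z
      set y := (u ⊙ z) ^ (1 - α) with hy
      have hy0 : 0 ≤ y := ✓
      have hYs : ∀ o, 0 ≤ (u ⊙ W.next z o) ^ (1 - α) := fun o => rpow_nonneg (dot_nonneg hu _) _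
      have iE : Integrable (fun o => 1 + u ⊙ W.next z o) P := by fun_prop
      have ie : Integrable (fun o => exp (-(b * (u ⊙ W.next z o) ^ (1 - α)))) P := by
        refine Integrable.of_bound (C := 1) ((((W.measurable_dot_next u z).pow_const
          _).const_mul b).neg.exp).aestronglyMeasurable (ae_of_all _ fun o => ?_)
        rw [norm_of_nonneg (exp_pos _).le]
        refine exp_le_one_iff.2 ?_
        have := mul_nonneg hb0.le (hYs o)
        linarith
      have h1 : |∫ o, exp (-(b * (u ⊙ W.next z o) ^ (1 - α))) ∂P - exp (-(b * y))| ≤ b * E z := by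
        have e : ∫ o, exp (-(b * (u ⊙ W.next z o) ^ (1 - α))) ∂P -
          exp (-(b * y)) = ∫ o, (exp (-(b * (u ⊙ W.next z o) ^ (1 - α))) -
          exp (-(b * y))) ∂P := by
          rw [integral_sub ie (integrable_const _)]
          simp
        have e2 : b * E z = ∫ o, (b * (1 + u ⊙ W.next z o) + b * y) ∂P := by
          rw [integral_add (iE.const_mul _) (integrable_const _), integral_const_mul]
          simp [hE, hy, mul_add]
        rw [e, e2]
        refine abs_integral_le_integral_abs.trans (integral_mono
          (ie.sub (integrable_const _)).abs ((iE.const_mul _).fun_add (integrable_const _)) fun o => ?_)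
        refine (abs_exp_neg_sub_exp_neg_le (mul_nonneg hb0.le (hYs o))
          (mul_nonneg hb0.le hy0)).trans ?_
        have h2 := rpow_le_one_add_rpow (dot_nonneg hu (W.next z o)) hs0.le
          (by linarith : 1 - α ≤ 1)
        rw [rpow_one] at h2
        have h3 := mul_le_left h2 hb0.le
        have h4 := mul_nonneg hb0.le hy0
        have h5 := mul_nonneg hb0.le (hYs o)
        rw [abs_le]
        constructor <;> linarith
      have h2 : |exp (-(b * y)) - exp (-(b * y)) * (1 - b * μ + Θ * b ^ 2 * y)| ≤
        b * (|μ| + |Θ|) := by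
        have e : exp (-(b * y)) - exp (-(b * y)) * (1 - b * μ + Θ * b ^ 2 * y) =
          exp (-(b * y)) * (b * μ) + (b * y * exp (-(b * y))) * (-(b * Θ)) := by ring
        rw [e]
        refine ((abs_add_le _ _).trans (add_le_add (abs_mul _ _).le (abs_mul _ _).le)).trans ?_
        have hew : 0 < exp (-(b * y)) := exp_pos _
        have hew1 : exp (-(b * y)) ≤ 1 := exp_le_one_iff.2 (by linarith [mul_nonneg hb0.le hy0])
        have hby : 0 ≤ b * y * exp (-(b * y)) := ✓
        rw [abs_of_pos hew, abs_of_nonneg hby, abs_neg, abs_mul b μ, abs_mul b Θ, abs_of_pos hb0]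
        have f1 := mul_le_right hew1 (✓ : 0 ≤ b * |μ|)
        have f2 := mul_le_right (mul_exp_neg_le_one (b * y)) (✓ : 0 ≤ b * |Θ|)
        linarith
      have h3 : E z ≤ ∑ z ∈ (finite_dot_le hu K).toFinset, E z :=
        single_le_sum (fun z _ => hE0 z) (by simpa using hz.le)
      have h4 := mul_le_left h3 hb0.le
      have h5 := abs_sub_le (∫ o, exp (-(b * (u ⊙ W.next z o) ^ (1 - α))) ∂P)
        (exp (-(b * y))) (exp (-(b * y)) * (1 - b * μ + Θ * b ^ 2 * y))
      linarith

/-- The solution at generation `j` of the backward equation for Laplace transforms which ends in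
`e ^ (-y / r)` at generation `n`. -/
noncomputable def laplaceKernel (k Θ r : ℝ) (m : ℝ) (y : ℝ) : ℝ :=
  (r / (r + Θ * m)) ^ k * exp (-(1 / (r + Θ * m) * y))

theorem laplaceKernel_mem {k Θ r m y : ℝ} (hk : 0 ≤ k) (hΘ : 0 ≤ Θ) (hr : 0 < r) (hm : 0 ≤ m)
  (hy : 0 ≤ y) : 0 ≤ laplaceKernel k Θ r m y ∧ laplaceKernel k Θ r m y ≤ 1 := by
  have h0 : 0 < r + Θ * m := ✓
  unfold laplaceKernel
  refine ⟨✓, mul_le_one₀ (rpow_le_one ✓ ?_ hk) (exp_pos _).le (exp_le_one_iff.2 ?_)⟩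
  · rw [div_le_one h0]
    have : 0 ≤ Θ * m := ✓
    linarith
  · have : 0 ≤ 1 / (r + Θ * m) * y := ✓
    linarith

/-- One step of the backward equation. -/
theorem abs_integral_laplaceKernel_next_sub_le {k Θ r m y e D L : ℝ} (hk : 0 ≤ k) (hΘ : 0 ≤ Θ)
  (hr : 0 < r) (hm : 0 ≤ m) (hy : 0 ≤ y) (hΘr : Θ ≤ r) (hkr : k * Θ ≤ r) (hD : 0 ≤ D)
  (hL : |L - exp (-(1 / (r + Θ * m) * y)) * (1 - 1 / (r + Θ * m) * (k * Θ) +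
    Θ * (1 / (r + Θ * m)) ^ 2 * y)| ≤ 1 / (r + Θ * m) * D)
  (he : e = (r / (r + Θ * m)) ^ k * L) :
  |e - laplaceKernel k Θ r (m + 1) y| ≤ D / r + (k ^ 2 + 3 * k + 10) * Θ ^ 2 / r ^ 2 := by
  have h0 : 0 < r + Θ * m := ✓
  have hle : r ≤ r + Θ * m := by
    have : 0 ≤ Θ * m := ✓
    linarith
  set q := r + Θ * m with hq
  have hτ := abs_laplace_step_le hk (τ := Θ / q) (w := 1 / q * y) ✓
    (by rw [div_le_one h0]; linarith)
    (by rw [← mul_div_assoc, div_le_one h0]; linarith) ✓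
  have h1 : 1 + Θ / q = (r + Θ * (m + 1)) / q := by grind
  have hq' : 0 < r + Θ * (m + 1) := ✓
  have e1 : laplaceKernel k Θ r (m + 1) y = (r / q) ^ k * ((1 + Θ / q) ^ (-k) *
    exp (-(1 / q * y / (1 + Θ / q)))) := by
    unfold laplaceKernel
    rw [← mul_assoc]
    congr 1
    · rw [h1, rpow_neg ✓, ← inv_rpow ✓, ← mul_rpow ✓ ✓]
      congr 1
      field_simp
    · congr 2
      rw [h1]
      field_simp
  have hrq : 0 ≤ (r / q) ^ k := ✓
  have hrq1 : (r / q) ^ k ≤ 1 := rpow_le_one ✓ (by rw [div_le_one h0]; exact hle) hk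
  rw [e1, he, ← mul_sub, abs_mul, abs_of_nonneg hrq]
  have e2 : 1 - k * (Θ / q) + Θ / q * (1 / q * y) = 1 - 1 / q * (k * Θ) + Θ * (1 / q) ^ 2 * y := by
    field_simp
  rw [e2, abs_sub_comm] at hτ
  have h3 := abs_sub_le L (exp (-(1 / q * y)) * (1 - 1 / q * (k * Θ) + Θ * (1 / q) ^ 2 * y))
    ((1 + Θ / q) ^ (-k) * exp (-(1 / q * y / (1 + Θ / q))))
  have h4 : 1 / q * D ≤ D / r := by
    rw [one_div_mul_eq_div]
    exact div_le_div_of_nonneg_left hD hr hle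
  have h5 : (k ^ 2 + 3 * k + 10) * (Θ / q) ^ 2 ≤ (k ^ 2 + 3 * k + 10) * Θ ^ 2 / r ^ 2 := by
    rw [div_pow, ← mul_div_assoc]
    exact div_le_div_of_nonneg_left ✓ ✓ (pow_le_pow_left₀ hr.le hle 2)
  calc _ ≤ 1 * |L - (1 + Θ / q) ^ (-k) * exp (-(1 / q * y / (1 + Θ / q)))| := by gcongr
    _ ≤ _ := by linarith

/-- Laplace transforms of the rescaled size on the event of unlimited growth. -/
theorem tendsto_setIntegral_laplace (hu : ∀ i, 0 < u i) (hα0 : 0 ≤ α) (hα : α < 1)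
  (hint : ∀ z, Integrable (fun o => u ⊙ W.next z o) P) (hd : W.Diffusive u C α θ)
  {k : ℝ} (hk : 0 ≤ k) (hθ : 0 ≤ θ)
  (hkθ : (1 - α) * (C - α * θ / 2) = k * ((1 - α) ^ 2 * θ / 2)) {l : ℝ} (hl : 0 < l) :
  Tendsto (fun n : ℕ => ∫ o in W.Unlimited, exp (-(l / n * (u ⊙ W.Z n o) ^ (1 - α))) ∂P) atTop
    (𝓝 ((1 + (1 - α) ^ 2 * θ / 2 * l) ^ (-k) * P.real W.Unlimited)) := by
  obtain ⟨D, hD, hDb⟩ := exists_laplace_bound hu hα0 hα hint hd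
  set Θ := (1 - α) ^ 2 * θ / 2 with hΘdef
  have hΘ : 0 ≤ Θ := ✓
  have hy0 : ∀ z : Pop, 0 ≤ (u ⊙ z) ^ (1 - α) := fun z => rpow_nonneg (dot_nonneg hu z) _
  set A := W.Unlimited with hA
  have hAm : MeasurableSet A := W.measurableSet_unlimited
  have hL1 : (1 + Θ * l) ^ (-k) ≤ 1 :=
    Real.rpow_le_one_of_one_le_of_nonpos (by linarith [mul_nonneg hΘ hl.le]) (by linarith)
  have hL0 : 0 ≤ (1 + Θ * l) ^ (-k) := ✓
  rw [Metric.tendsto_nhds]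
  intro κ hκ
  set ε := κ / (2 * (2 + l + l * D)) with hε
  have hε0 : 0 < ε := ✓
  have hεκ : ε * (2 + l + l * D) = κ / 2 := by rw [hε]; field_simp
  obtain ⟨K, hK, hKb⟩ := (eventually_growing hu).1 (hd.laplace_eventually hu hα0 hα hε0)
  obtain ⟨N, B, hB, hAB⟩ := W.exists_unlimited_approx hε0
  have hBm : MeasurableSet B := W.history.le N _ hB
  let J : ℝ → ℝ → Pop → ℝ := fun r m z => laplaceKernel k Θ r m ((u ⊙ z) ^ (1 - α))
  set F : ℕ → ℕ → ℝ := fun n j => ∫ o in B, J (n / l) (n - j) (W.Z j o) ∂P with hF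
  have hkb : ∀ (r m : ℝ) (z : Pop), 0 < r → 0 ≤ m → ‖J r m z‖ ≤ 1 := fun r m z hr hm => by
    obtain ⟨h1, h2⟩ := laplaceKernel_mem hk hΘ hr hm (hy0 z)
    rwa [norm_of_nonneg h1]
  have hlow : ∀ j, MeasurableSet {o | u ⊙ W.Z j o < K} := fun j =>
    W.history.le j _ (W.measurableSet_Z j {z | u ⊙ z < K})
  set T : ℕ → ℝ := fun j => P.real (A ∩ {o | u ⊙ W.Z j o < K}) with hT
  have hT0 : Tendsto T atTop (𝓝 0) := W.tendsto_measureReal_unlimited_inter_lt hu K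
  set R := (k ^ 2 + 3 * k + 10) * Θ ^ 2 with hR
  have hR0 : 0 ≤ R := ✓
  have step : ∀ n j : ℕ, N ≤ j → j < n → l * Θ ≤ n → l * (k * Θ) ≤ n →
    |F n j - F n (j + 1)| ≤ l / n * (ε + D * (T j + ε)) + R * l ^ 2 / (n : ℝ) ^ 2 := by
    intro n j hNj hjn hn1 hn2
    have hn0 : (0 : ℝ) < n := by exact_mod_cast (Nat.zero_le j).trans_lt hjn
    have hr : 0 < (n : ℝ) / l := ✓
    have hm : 0 ≤ (n : ℝ) - (j + 1 : ℕ) := by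
      have : ((j + 1 : ℕ) : ℝ) ≤ n := by exact_mod_cast hjn
      linarith
    have hBj : MeasurableSet[W.history j] B := W.history.mono hNj _ hB
    have e1 : F n (j + 1) =
      ∫ o in B, (∫ o', J (n / l) (n - (j + 1 : ℕ)) (W.next (W.Z j o) o') ∂P) ∂P :=
      W.setIntegral_next j hBj (J (n / l) (n - (j + 1 : ℕ))) fun z => hkb _ _ z hr hm
    have i1 : Integrable (fun o => J (n / l) (n - j) (W.Z j o)) P :=
      W.integrable_comp_Z j (J (n / l) (n - j)) fun z => hkb _ _ z hr (by push_cast at hm; linarith)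
    have i2 : Integrable (fun o => ∫ o', J (n / l) (n - (j + 1 : ℕ)) (W.next (W.Z j o) o') ∂P) P := by
      refine W.integrable_comp_Z j (fun z => ∫ o', J (n / l) (n - (j + 1 : ℕ)) (W.next z o') ∂P)
        (D := 1) fun z => ?_
      have := norm_integral_le_of_norm_le_const (μ := P)
        (ae_of_all _ fun o' => hkb (n / l) ((n : ℝ) - (j + 1 : ℕ)) (W.next z o') hr hm)
      simpa using this
    have hpt : ∀ z, |(∫ o', J (n / l) (n - (j + 1 : ℕ)) (W.next z o') ∂P) - J (n / l) (n - j) z| ≤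
      (ε + D * (if u ⊙ z < K then 1 else 0)) / (n / l) +
      R / ((n : ℝ) / l) ^ 2 := by
      intro z
      have e2 : (n : ℝ) - j = (n : ℝ) - (j + 1 : ℕ) + 1 := by push_cast; ring
      have hb : 0 < 1 / ((n : ℝ) / l + Θ * ((n : ℝ) - (j + 1 : ℕ))) := ✓
      rw [e2]
      refine abs_integral_laplaceKernel_next_sub_le (L := ∫ o',
        exp (-(1 / ((n : ℝ) / l + Θ * ((n : ℝ) - (j + 1 : ℕ))) *
          (u ⊙ (W.next z o')) ^ (1 - α))) ∂P) hk hΘ hr hm (hy0 z) ?_ ?_ ?_ ?_ ?_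
      · rw [le_div_iff₀ hl]; linarith
      · rw [le_div_iff₀ hl]; linarith
      · positivity
      · split_ifs with hz
        · have := hDb z _ hb
          rw [hkθ] at this
          refine this.trans (mul_le_left (by linarith) hb.le)
        · have := hKb z (not_lt.1 hz) _ hb
          rw [hkθ] at this
          refine this.trans (mul_le_left (by linarith) hb.le)
      · rw [← integral_const_mul]
        rfl
    have hTB : P.real (B ∩ {o | u ⊙ W.Z j o < K}) ≤ T j + ε := by
      have h1 : P.real (B ∩ {o | u ⊙ W.Z j o < K}) ≤ T j + P.real (symmDiff A B) := by
        refine (measureReal_mono ?_).trans (measureReal_union_le _ _)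
        intro o ho
        by_cases hoA : o ∈ A
        · exact Or.inl ⟨hoA, ho.2⟩
        · exact Or.inr (Or.inr ⟨ho.1, hoA⟩)
      linarith
    have hI : Integrable (fun o => (ε + D * (if u ⊙ W.Z j o < K then 1 else 0)) /
      ((n : ℝ) / l) + R / ((n : ℝ) / l) ^ 2) P :=
      W.integrable_comp_Z j (fun z => (ε + D * (if u ⊙ z < K then 1 else 0)) /
        ((n : ℝ) / l) + R / ((n : ℝ) / l) ^ 2) (D := (ε + D) / ((n : ℝ) / l) +
          R / ((n : ℝ) / l) ^ 2) fun z => by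
        rw [norm_of_nonneg (by split_ifs <;> positivity)]
        gcongr
        split_ifs <;> linarith
    have hind : ∫ o in B, (if u ⊙ W.Z j o < K then (1 : ℝ) else 0) ∂P =
      P.real (B ∩ {o | u ⊙ W.Z j o < K}) := by
      have : (fun o => if u ⊙ W.Z j o < K then (1 : ℝ) else 0) =
        {o | u ⊙ W.Z j o < K}.indicator fun _ => 1 := by
        ext o; simp [indicator]
      rw [this, integral_indicator_const _ (hlow j), measureReal_restrict_apply (hlow j),
        Set.inter_comm]
      simp
    rw [abs_sub_comm, e1, hF]
    dsimp only
    rw [← integral_sub i2.integrableOn i1.integrableOn]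
    refine abs_integral_le_integral_abs.trans ((integral_mono (i2.sub i1).abs.integrableOn
      hI.integrableOn fun o => hpt (W.Z j o)).trans ?_)
    have iind : Integrable (fun o => (if u ⊙ W.Z j o < K then (1 : ℝ) else 0))
      (P.restrict B) := (W.integrable_comp_Z j
        (fun z => (if u ⊙ z < K then (1 : ℝ) else 0)) (D := 1) fun z => by
          split_ifs <;> simp).integrableOn
    rw [integral_add (((integrable_const ε).fun_add (iind.const_mul D)).div_const _)
      (integrable_const _), integral_div, integral_add (integrable_const _) (iind.const_mul D),
      integral_const_mul, hind]
    simp only [integral_const, smul_eq_mul, measureReal_restrict_apply_univ]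
    have hPB : P.real B ≤ 1 := by simp
    have e3 : R * l ^ 2 / (n : ℝ) ^ 2 = R / ((n : ℝ) / l) ^ 2 := by field_simp
    have e4 : l / n * (ε + D * (T j + ε)) = (ε + D * (T j + ε)) / ((n : ℝ) / l) := by field_simp
    rw [e3, e4]
    refine add_le_add (div_le_div_of_nonneg_right (add_le_add ?_ ?_) hr.le) ?_
    · exact mul_le_of_le_one_left hε0.le hPB
    · gcongr
    · exact mul_le_of_le_one_left ✓ hPB
  have total : ∀ n : ℕ, N ≤ n → 0 < n → l * Θ ≤ n → l * (k * Θ) ≤ n →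
    |F n N - F n n| ≤ l * (ε + D * ε) + l * D * ((n : ℝ)⁻¹ * ∑ j ∈ range n, T j) +
      R * l ^ 2 * (n : ℝ)⁻¹ := by
    intro n hNn hn0 hn1 hn2
    have hn0' : (0 : ℝ) < n := ✓
    have h1 := dist_le_Ico_sum_dist (F n) hNn
    simp only [dist_eq] at h1
    refine h1.trans ?_
    have hTn : ∀ j, 0 ≤ T j := fun j => measureReal_nonneg
    calc _ ≤ ∑ j ∈ Ico N n, (l / n * (ε + D * (T j + ε)) + R * l ^ 2 / (n : ℝ) ^ 2) :=
          sum_le_sum fun j hj => step n j (mem_Ico.1 hj).1 (mem_Ico.1 hj).2 hn1 hn2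
      _ ≤ ∑ j ∈ range n, (l / n * (ε + D * (T j + ε)) + R * l ^ 2 / (n : ℝ) ^ 2) := by
        refine Finset.sum_le_sum_of_subset_of_nonneg (fun j hj => ?_) fun j _ _ => ?_
        · exact mem_range.2 (mem_Ico.1 hj).2
        · positivity
      _ = _ := by
        simp only [mul_add, sum_add_distrib, ← mul_sum, sum_const, Finset.card_range, nsmul_eq_mul]
        field_simp
        ring
  have hcast := tendsto_natCast_atTop_atTop (R := ℝ)
  have lim1 : Tendsto (fun n : ℕ => l * (ε + D * ε) +
    l * D * ((n : ℝ)⁻¹ * ∑ j ∈ range n, T j) + R * l ^ 2 * (n : ℝ)⁻¹) atTop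
    (𝓝 (l * (ε + D * ε) + l * D * 0 + R * l ^ 2 * 0)) :=
    (tendsto_const_nhds.add ((hT0.cesaro).const_mul _)).add
      ((tendsto_inv_atTop_zero.comp hcast).const_mul _)
  have lim2 : Tendsto (fun n : ℕ => F n N) atTop (𝓝 ((1 + Θ * l) ^ (-k) * P.real B)) := by
    have hpt : ∀ y : ℝ, Tendsto (fun n : ℕ => laplaceKernel k Θ (n / l) ((n : ℝ) - N) y) atTop
      (𝓝 ((1 + Θ * l) ^ (-k))) := by
      intro y
      have hpos : 1 / l + Θ * (1 - N * (0 : ℝ)) ≠ 0 := by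
        rw [mul_zero, sub_zero, mul_one]
        positivity
      have hc : ContinuousAt (fun t : ℝ => 1 / l + Θ * (1 - N * t)) 0 := by fun_prop
      have h4 := (((continuousAt_const (y := 1 / l).div hc hpos).rpow_const (.inr hk)).mul
        ((continuousAt_id.div hc hpos).mul_const y).neg.rexp).tendsto.comp
        (tendsto_inv_atTop_zero.comp hcast)
      have e : (1 / l) / (1 / l + Θ) = (1 + Θ * l)⁻¹ := by field_simp
      simp only [Pi.mul_apply, Pi.neg_apply, Pi.div_apply, id, mul_zero, sub_zero, mul_one,
        zero_div, zero_mul, neg_zero, Real.exp_zero, e,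
        inv_rpow (✓ : 0 ≤ 1 + Θ * l), ← rpow_neg (✓ : 0 ≤ 1 + Θ * l)] at h4
      refine h4.congr' ?_
      filter_upwards [eventually_gt_atTop 0] with n hn
      have hn' : (0 : ℝ) < n := ✓
      have e6 : 1 / l + Θ * (1 - N * (n : ℝ)⁻¹) = ((n : ℝ) / l + Θ * (n - N)) / n := by field_simp
      simp only [J, laplaceKernel, Function.comp, Pi.mul_apply, Pi.neg_apply, Pi.div_apply, id]
      rw [e6]
      congr 2
      · field_simp
      · congr 2
        field_simp
    have h5 : Tendsto (fun n : ℕ => F n N) atTop (𝓝 (∫ _ in B, (1 + Θ * l) ^ (-k) ∂P)) := by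
      refine tendsto_integral_filter_of_dominated_convergence (fun _ => 1) ?_ ?_
        (integrable_const _) (ae_of_all _ fun o => hpt _)
      · exact Eventually.of_forall fun n => ((measurable_of_countable (J (n / l) (n - N))).comp
          (W.measurable_Z N)).aestronglyMeasurable
      · filter_upwards [eventually_gt_atTop N] with n hn
        have hn' : (N : ℝ) < n := by gcongr
        have hN0 : (0 : ℝ) ≤ N := cast_nonneg N
        have hn0 : (0 : ℝ) < n := by linarith
        exact ae_of_all _ fun o => hkb _ _ _ ✓ (by linarith)
    simpa [mul_comm] using h5
  have ev1 := lim1.eventually (gt_mem_nhds (show _ < l * (ε + D * ε) + κ / 4 by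
    simp only [mul_zero, add_zero]; linarith))
  have ev2 := (Metric.tendsto_nhds.1 lim2) (κ / 4) ✓
  filter_upwards [ev1, ev2, eventually_ge_atTop N, eventually_gt_atTop 0,
    hcast.eventually_ge_atTop (l * Θ), hcast.eventually_ge_atTop (l * (k * Θ))]
    with n h1 h2 h3 h4 h5 h6
  have hn0 : (0 : ℝ) < n := ✓
  have h7 := total n h3 h4 h5 h6
  have e7 : ∀ o, exp (-(l / n * (u ⊙ W.Z n o) ^ (1 - α))) = J (n / l) (n - n) (W.Z n o) := by
    intro o
    simp only [J, laplaceKernel, sub_self, mul_zero, add_zero, one_div_div]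
    rw [div_self ✓, one_rpow, one_mul]
  have h8 : |∫ o in A, exp (-(l / n * (u ⊙ W.Z n o) ^ (1 - α))) ∂P - F n n| ≤ ε := by
    simp_rw [e7]
    refine (norm_setIntegral_sub_le hAm hBm (W.integrable_comp_Z n (J (n / l) (n - n))
      (D := 1) fun z => ?_) fun o => ?_).trans hAB
    · exact hkb _ _ z ✓ (by simp)
    · exact hkb _ _ _ ✓ (by simp)
  have h9 : |P.real B - P.real A| ≤ ε := by
    have := norm_setIntegral_sub_le hBm hAm (integrable_const (1 : ℝ) (μ := P)) (by simp)
    rw [symmDiff_comm] at this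
    simpa using this.trans hAB
  have h10 : |(1 + Θ * l) ^ (-k) * P.real B - (1 + Θ * l) ^ (-k) * P.real A| ≤ ε := by
    rw [← mul_sub, abs_mul, abs_of_nonneg hL0]
    calc _ ≤ 1 * ε := by gcongr
      _ = ε := one_mul ε
  rw [dist_eq] at h2 ⊢
  rw [abs_lt] at h2 ⊢
  rw [abs_le] at h7 h8 h10
  constructor <;> linarith [h2.1, h2.2, h7.1, h7.2, h8.1, h8.2, h10.1, h10.2]

lemma integral_gammaMeasure {a r : ℝ} (ha : 0 < a) (hr : 0 < r) (f : ℝ → ℝ) :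
  ∫ x, f x ∂(gammaMeasure a r) =
    ∫ x in Ioi 0, (r ^ a / Gamma a * x ^ (a - 1) * exp (-(r * x))) * f x := by
  have hm : Measurable (gammaPDF a r) := (measurable_gammaPDFReal a r).ennreal_ofReal
  rw [gammaMeasure, integral_withDensity_eq_integral_toReal_smul hm
    (ae_of_all _ fun x => ofReal_lt_top)]
  rw [← integral_Ici_eq_integral_Ioi, ← integral_indicator measurableSet_Ici]
  congr 1
  ext x
  rw [gammaPDF, toReal_ofReal (gammaPDFReal_nonneg ha hr x), smul_eq_mul, gammaPDFReal]
  by_cases hx : 0 ≤ x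
  · rw [indicator_of_mem (by exact hx), if_pos hx]
  · rw [indicator_of_notMem (by exact hx), if_neg hx, zero_mul]

lemma integral_exp_neg_gammaMeasure {a r l : ℝ} (ha : 0 < a) (hr : 0 < r) (hl : 0 ≤ l) :
  ∫ x, exp (-(l * x)) ∂(gammaMeasure a r) = (1 + r⁻¹ * l) ^ (-a) := by
  rw [integral_gammaMeasure ha hr]
  have h1 : ∀ x : ℝ, (r ^ a / Gamma a * x ^ (a - 1) * exp (-(r * x)))
    * exp (-(l * x)) =
    r ^ a / Gamma a * (x ^ (a - 1) * exp (-((r + l) * x))) := by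
    intro x
    rw [mul_assoc, mul_assoc, ← exp_add]
    ring_nf
  simp_rw [h1]
  rw [integral_const_mul, Real.integral_rpow_mul_exp_neg_mul_Ioi ha (by linarith)]
  have hG := (Real.Gamma_pos_of_pos ha).ne'
  have h2 : 1 + r⁻¹ * l = (r + l) / r := by field_simp
  rw [h2, rpow_neg ✓, div_rpow ✓ hr.le, div_rpow zero_le_one ✓, one_rpow]
  field_simp

lemma gammaMeasure_Iio_zero {a r : ℝ} : gammaMeasure a r (Iio 0) = 0 := by
  rw [gammaMeasure, withDensity_apply _ measurableSet_Iio]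
  exact lintegral_gammaPDF_of_nonpos le_rfl

instance {a r : ℝ} : NullSingletonClass (gammaMeasure a r) := by unfold gammaMeasure; infer_instance

lemma integrable_comp_exp_neg {Ω : Type*} [MeasurableSpace Ω] {Q : Measure Ω}
  [IsProbabilityMeasure Q] {g : Ω → ℝ} (hg : Measurable g) (hg0 : ∀ᵐ o ∂Q, 0 ≤ g o) {f : ℝ → ℝ}
  (hf : Continuous f) : Integrable (fun o => f (exp (-(g o)))) Q := by
  obtain ⟨D, hD⟩ := (isCompact_Icc (a := (0 : ℝ)) (b := 1)).exists_bound_of_continuousOn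
    hf.continuousOn
  refine Integrable.of_bound ((hf.measurable.comp (by fun_prop)).aestronglyMeasurable) D ?_
  filter_upwards [hg0] with o ho using
    hD _ ⟨(exp_pos _).le, exp_le_one_iff.2 (by linarith)⟩

lemma abs_integral_comp_exp_neg_sub_le {Ω : Type*} [MeasurableSpace Ω] {Q : Measure Ω}
  [IsProbabilityMeasure Q] {g : Ω → ℝ} (hg : Measurable g) (hg0 : ∀ᵐ o ∂Q, 0 ≤ g o)
  {f q : ℝ → ℝ} (hf : Continuous f) (hq : Continuous q) {ε : ℝ}
  (h : ∀ x ∈ Icc (0 : ℝ) 1, |q x - f x| < ε) :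
  |∫ o, q (exp (-(g o))) ∂Q - ∫ o, f (exp (-(g o))) ∂Q| ≤ ε := by
  rw [← integral_sub (integrable_comp_exp_neg hg hg0 hq) (integrable_comp_exp_neg hg hg0 hf),
    ← norm_eq_abs]
  refine (norm_integral_le_of_norm_le_const (C := ε) ?_).trans (by simp)
  filter_upwards [hg0] with o ho using (h _ ⟨(exp_pos _).le, exp_le_one_iff.2 (by linarith)⟩).le

/-- Continuity theorem for Laplace transforms at the integers. -/
lemma tendsto_measureReal_le_of_laplace {Ω : Type*} [MeasurableSpace Ω] {Q : Measure Ω}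
  [IsProbabilityMeasure Q] {G : ℕ → Ω → ℝ} (hG : ∀ n, Measurable (G n))
  (hG0 : ∀ n o, 0 ≤ G n o) {μ : Measure ℝ} [IsProbabilityMeasure μ] [NullSingletonClass μ]
  (hμ : μ (Iio 0) = 0)
  (h : ∀ m : ℕ, 0 < m → Tendsto (fun n => ∫ o, exp (-(m * G n o)) ∂Q) atTop
    (𝓝 (∫ x, exp (-(m * x)) ∂μ))) (t : ℝ) :
  Tendsto (fun n => Q.real {o | G n o ≤ t}) atTop (𝓝 (μ.real (Iic t))) := by
  have hem : Measurable fun x : ℝ => exp (-x) := by fun_prop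
  have hGe : ∀ n, Measurable fun o => exp (-(G n o)) := by fun_prop
  have hμ0 : ∀ᵐ x ∂μ, 0 ≤ x := by
    rw [ae_iff]
    simpa [Iio] using hμ
  have hpoly : ∀ q : Polynomial ℝ, Tendsto (fun n => ∫ o, q.eval (exp (-(G n o))) ∂Q) atTop
    (𝓝 (∫ x, q.eval (exp (-x)) ∂μ)) := by
    intro q
    induction q using Polynomial.induction_on' with
    | add q₁ q₂ h₁ h₂ =>
      simp only [Polynomial.eval_add]
      rw [integral_add (integrable_comp_exp_neg measurable_id' hμ0 q₁.continuous)
        (integrable_comp_exp_neg measurable_id' hμ0 q₂.continuous)]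
      refine (h₁.add h₂).congr fun n => ?_
      rw [integral_add (integrable_comp_exp_neg (hG n) (ae_of_all _ (hG0 n)) q₁.continuous)
        (integrable_comp_exp_neg (hG n) (ae_of_all _ (hG0 n)) q₂.continuous)]
    | monomial m b =>
      simp only [Polynomial.eval_monomial]
      simp_rw [integral_const_mul, ← Real.exp_nat_mul]
      refine Tendsto.const_mul b ?_
      rcases Nat.eq_zero_or_pos m with rfl | hm
      · simp
      · simpa only [mul_neg] using h m hm
  have hcont : ∀ f : ℝ → ℝ, Continuous f → Tendsto (fun n => ∫ o, f (exp (-(G n o))) ∂Q) atTop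
    (𝓝 (∫ x, f (exp (-x)) ∂μ)) := by
    intro f hf
    rw [Metric.tendsto_atTop]
    intro ε hε
    obtain ⟨q, hq⟩ := exists_polynomial_near_of_continuousOn 0 1 f hf.continuousOn (ε / 3)
      ✓
    obtain ⟨N, hN⟩ := (Metric.tendsto_atTop.1 (hpoly q)) (ε / 3) ✓
    refine ⟨N, fun n hn => ?_⟩
    have h1 := hN n hn
    have h2 := abs_integral_comp_exp_neg_sub_le (hG n) (ae_of_all Q (hG0 n)) hf q.continuous hq
    have h3 := abs_integral_comp_exp_neg_sub_le measurable_id' hμ0 hf q.continuous hq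
    rw [dist_eq] at h1 ⊢
    rw [abs_le] at h2 h3
    rw [abs_lt] at h1 ⊢
    constructor <;> linarith [h1.1, h1.2, h2.1, h2.2, h3.1, h3.2]
  let L : ℕ → ProbabilityMeasure ℝ := fun n =>
    ⟨Q.map fun o => exp (-(G n o)), Measure.isProbabilityMeasure_map (hGe n).aemeasurable⟩
  let L' : ProbabilityMeasure ℝ :=
    ⟨μ.map fun x => exp (-x), Measure.isProbabilityMeasure_map hem.aemeasurable⟩
  have hL : Tendsto L atTop (𝓝 L') := by
    rw [ProbabilityMeasure.tendsto_iff_forall_integral_tendsto]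
    intro f
    change Tendsto (fun n => ∫ x, f x ∂(Q.map fun o => exp (-(G n o)))) atTop
      (𝓝 (∫ x, f x ∂(μ.map fun x => exp (-x))))
    rw [integral_map hem.aemeasurable f.continuous.aestronglyMeasurable]
    refine (hcont f f.continuous).congr fun n => ?_
    rw [integral_map (hGe n).aemeasurable f.continuous.aestronglyMeasurable]
  have hpre : (fun x : ℝ => exp (-x)) ⁻¹' {exp (-t)} = {t} := by ext x; simp
  have := ProbabilityMeasure.tendsto_measure_of_null_frontier_of_tendsto' hL
    (E := Ici (exp (-t))) (by
      rw [frontier_Ici]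
      change (μ.map fun x => exp (-x)) {exp (-t)} = 0
      rw [Measure.map_apply hem (measurableSet_singleton _), hpre, measure_singleton])
  have h4 : ∀ x : ℝ, exp (-x) ∈ Ici (exp (-t)) ↔ x ≤ t := by simp
  have e1 : (L' : Measure ℝ) (Ici (exp (-t))) = μ (Iic t) := by
    change (μ.map fun x => exp (-x)) _ = _
    rw [Measure.map_apply hem measurableSet_Ici]
    congr 1
    ext x
    exact h4 x
  have e2 : ∀ n, (L n : Measure ℝ) (Ici (exp (-t))) = Q {o | G n o ≤ t} := by
    intro n
    change (Q.map fun o => exp (-(G n o))) _ = _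
    rw [Measure.map_apply (hGe n) measurableSet_Ici]
    congr 1
    ext o
    exact h4 _
  simp only [e1, e2] at this
  exact (tendsto_toReal (measure_ne_top _ _)).comp this

/-- The distribution function of an atomless law is continuous. -/
lemma continuous_measureReal_Iic (L : Measure ℝ) [IsProbabilityMeasure L] [NullSingletonClass L] :
  Continuous fun t => L.real (Iic t) := by
  have h1 : (fun t => L.real (Iic t)) = cdf L := by ext t; rw [cdf_eq_real]
  rw [h1, continuous_iff_continuousAt]
  intro t
  have h2 : Function.leftLim (cdf L) t = cdf L t := by
    have h3 := StieltjesFunction.measure_singleton (cdf L) t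
    rw [measure_cdf, measure_singleton] at h3
    have h4 := (cdf L).mono.leftLim_le (le_refl t)
    have h5 := ENNReal.ofReal_eq_zero.1 h3.symm
    linarith
  rw [continuousAt_iff_continuous_left'_right']
  refine ⟨?_, ((cdf L).right_continuous t).mono Set.Ioi_subset_Ici_self⟩
  have := (cdf L).mono.tendsto_leftLim t
  rw [h2] at this
  exact this

/-- If `T n` converges in law and `V n - T n • v` is negligible, then `V n` converges in law. -/
lemma tendsto_cdfAlong {Ω : Type*} [MeasurableSpace Ω] {Q : Measure Ω} [IsProbabilityMeasure Q]
  [NeZero p] {v : Vec} (hv : ∀ i, 0 < v i) {T : ℕ → Ω → ℝ}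
  {V : ℕ → Ω → Vec} {L : Measure ℝ} [IsProbabilityMeasure L] [NullSingletonClass L]
  (hT : ∀ t, Tendsto (fun n => Q.real {o | T n o ≤ t}) atTop (𝓝 (L.real (Iic t))))
  (hV : ∀ ε : ℝ, 0 < ε → ∀ i,
    Tendsto (fun n => Q.real {o | ε < |V n o i - T n o * v i|}) atTop (𝓝 0))
  (x : Vec) :
  Tendsto (fun n => Q.real {o | ∀ i, V n o i ≤ x i}) atTop (𝓝 (cdfAlong L v x)) := by
  classical
  have hne : (univ : Finset (Fin p)).Nonempty := by simp
  set m : ℝ := univ.inf' hne fun i => x i / v i with hm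
  have hset : ∀ t : ℝ, (∀ i, t * v i ≤ x i) ↔ t ≤ m := by
    intro t
    rw [hm, Finset.le_inf'_iff]
    simp only [mem_univ, true_imp_iff]
    exact forall_congr' fun i => (le_div_iff₀ (hv i)).symm
  have hcdf : cdfAlong L v x = L.real (Iic m) := by
    unfold cdfAlong
    congr 1
    ext t
    exact hset t
  rw [hcdf]
  have hneg : ∀ ε : ℝ, 0 < ε → Tendsto (fun n => ∑ i, Q.real {o | ε * v i < |V n o i - T n o * v i|})
    atTop (𝓝 0) := by
    intro ε hε
    have := tendsto_finsetSum univ fun i _ => hV (ε * v i) (mul_pos hε (hv i)) i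
    simpa using this
  rw [Metric.tendsto_atTop]
  intro e he
  obtain ⟨η, hη, hc⟩ := Metric.continuousAt_iff.1 ((continuous_measureReal_Iic L).continuousAt
    (x := m)) (e / 3) ✓
  have hc1 := hc (x := m + η / 2) (by rw [dist_eq]; ring_nf; rw [abs_of_pos] <;> linarith)
  have hc2 := hc (x := m - η / 2) (by
    rw [dist_eq, sub_sub_cancel_left, abs_neg, abs_of_pos] <;> linarith)
  obtain ⟨N1, h1⟩ := (Metric.tendsto_atTop.1 (hT (m + η / 2))) (e / 3) ✓
  obtain ⟨N2, h2⟩ := (Metric.tendsto_atTop.1 (hT (m - η / 2))) (e / 3) ✓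
  obtain ⟨N3, h3⟩ := (Metric.tendsto_atTop.1 (hneg (η / 2) ✓)) (e / 3) ✓
  refine ⟨max N1 (max N2 N3), fun n hn => ?_⟩
  have g1 := h1 n (by omega)
  have g2 := h2 n (by omega)
  have g3 := h3 n (by omega)
  rw [dist_eq] at *
  set S := ∑ i, Q.real {o | η / 2 * v i < |V n o i - T n o * v i|} with hS
  have hU : Q.real (⋃ i, {o | η / 2 * v i < |V n o i - T n o * v i|}) ≤ S :=
    measureReal_iUnion_fintype_le _
  have hB (A D : Set Ω) (h : ∀ o ∈ A, (∀ i, |V n o i - T n o * v i| ≤ η / 2 * v i) → o ∈ D) :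
    Q.real A ≤ Q.real D + S := by
    refine (measureReal_mono (s₂ := D ∪ ⋃ i, {o | η / 2 * v i < |V n o i - T n o * v i|})
      (fun o ho => ?_) (measure_ne_top _ _)).trans ((measureReal_union_le _ _).trans (by linarith))
    by_contra hcon
    simp only [Set.mem_union, Set.mem_iUnion, not_or, not_exists, mem_ofPred_eq, not_lt] at hcon
    exact hcon.1 (h o ho hcon.2)
  have up := hB {o | ∀ i, V n o i ≤ x i} {o | T n o ≤ m + η / 2} fun o ho hc => by
    have := (hset (T n o - η / 2)).1 fun i => by linarith [(abs_le.1 (hc i)).1, ho i]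
    exact sub_le_iff_le_add.1 this
  have lo := hB {o | T n o ≤ m - η / 2} {o | ∀ i, V n o i ≤ x i} fun o ho hc i => by
    linarith [(hset (T n o + η / 2)).2 (le_sub_iff_add_le.1 ho) i, (abs_le.1 (hc i)).2]
  rw [abs_lt] at *
  constructor <;> linarith [g1.1, g1.2, g2.1, g2.2, g3.1, g3.2, hc1.1, hc1.2, hc2.1, hc2.2]

lemma ae_gammaMeasure_nonneg {k Θ : ℝ} : ∀ᵐ y ∂(gammaMeasure k Θ⁻¹), 0 ≤ y := by
  rw [ae_iff]
  simpa [Iio] using (gammaMeasure_Iio_zero (a := k) (r := Θ⁻¹))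

lemma measurable_rpow_one_div (s : ℝ) : Measurable fun y : ℝ => y ^ (1 / s) := by fun_prop

lemma isProbabilityMeasure_gammaRootLaw {s k Θ : ℝ} (hk : 0 < k) (hΘ : 0 < Θ) :
  IsProbabilityMeasure (gammaRootLaw s k Θ) := by
  have := isProbabilityMeasure_gammaMeasure hk (inv_pos.2 hΘ)
  exact Measure.isProbabilityMeasure_map (measurable_rpow_one_div s).aemeasurable

lemma gammaRootLaw_Iic_of_nonneg {s k Θ t : ℝ} (hs : 0 < s) (ht : 0 ≤ t) :
  gammaRootLaw s k Θ (Iic t) = gammaMeasure k Θ⁻¹ (Iic (t ^ s)) := by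
  rw [gammaRootLaw, Measure.map_apply (measurable_rpow_one_div s) measurableSet_Iic]
  refine measure_congr ?_
  filter_upwards [ae_gammaMeasure_nonneg] with y hy
  refine propext ?_
  change y ^ (1 / s) ≤ t ↔ y ≤ t ^ s
  rw [one_div]
  exact Real.rpow_inv_le_iff_of_pos hy ht hs

lemma gammaRootLaw_Iic_of_neg {s k Θ t : ℝ} (ht : t < 0) : gammaRootLaw s k Θ (Iic t) = 0 := by
  rw [gammaRootLaw, Measure.map_apply (measurable_rpow_one_div s) measurableSet_Iic]
  change gammaMeasure k Θ⁻¹ {y | y ^ (1 / s) ≤ t} = 0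
  have : ∀ᵐ y ∂(gammaMeasure k Θ⁻¹), ¬ y ^ (1 / s) ≤ t := by
    filter_upwards [ae_gammaMeasure_nonneg] with y hy
    have := rpow_nonneg hy (1 / s)
    linarith
  simpa [ae_iff] using this

lemma nullSingletonClass_gammaRootLaw {s k Θ : ℝ} (hs : 0 < s) :
  NullSingletonClass (gammaRootLaw s k Θ) := by
  refine ⟨fun t => ?_⟩
  rw [gammaRootLaw, Measure.map_apply (measurable_rpow_one_div s) (measurableSet_singleton t)]
  refine le_antisymm ((measure_mono_ae ?_).trans
    (measure_singleton (μ := gammaMeasure k Θ⁻¹) (t ^ s)).le) zero_le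
  filter_upwards [ae_gammaMeasure_nonneg] with y hy hyt
  change y ^ (1 / s) = t at hyt
  change y = t ^ s
  rw [← hyt, ← rpow_mul hy, one_div, inv_mul_cancel₀ hs.ne', rpow_one]

lemma tendsto_cond_real_zero {Ω : Type*} [MeasurableSpace Ω] {P : Measure Ω}
  [IsProbabilityMeasure P] {A : Set Ω} (hA : MeasurableSet A) {S : ℕ → Set Ω}
  (hS : Tendsto (fun n => P.real (S n)) atTop (𝓝 0)) :
  Tendsto (fun n => (cond P A).real (S n)) atTop (𝓝 0) := by
  have := hS.const_mul (P.real A)⁻¹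
  rw [mul_zero] at this
  refine squeeze_zero (fun n => measureReal_nonneg) (fun n => ?_) this
  rw [measureReal_def, cond_apply hA, toReal_mul, ENNReal.toReal_inv]
  exact mul_le_left (measureReal_mono Set.inter_subset_right (measure_ne_top _ _))

lemma integral_cond_eq {Ω : Type*} [MeasurableSpace Ω] {P : Measure Ω} {A : Set Ω} {E : Type*}
  [NormedAddCommGroup E] [NormedSpace ℝ E] (f : Ω → E) :
  ∫ o, f o ∂(cond P A) = (P.real A)⁻¹ • ∫ o in A, f o ∂P := by
  rw [ProbabilityTheory.cond, integral_smul_measure, ENNReal.toReal_inv]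
  rfl

lemma tendsto_rpow_div_rpow_zero {a b : ℝ} (hab : a < b) :
  Tendsto (fun n : ℕ => (n : ℝ) ^ a / (n : ℝ) ^ b) atTop (𝓝 0) := by
  have := (tendsto_rpow_neg_atTop (sub_pos.2 hab)).comp (tendsto_natCast_atTop_atTop (R := ℝ))
  refine this.congr' ?_
  filter_upwards [eventually_gt_atTop 0] with n hn
  have : (0 : ℝ) < n := cast_pos.2 hn
  simp only [Function.comp]
  rw [← rpow_sub this]
  ring_nf

theorem measurable_dot_Z (W : MBPM P p) (u : Vec) (n : ℕ) : Measurable fun o => u ⊙ W.Z n o :=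
  (measurable_of_countable fun z : Pop => u ⊙ z).comp (W.measurable_Z n)

theorem exists_measureReal_start_gt_le (W : MBPM P p) (u : Vec) {η : ℝ} (hη : 0 < η) :
  ∃ K : ℝ, 0 < K ∧ P.real {o | K < u ⊙ W.Z 0 o} ≤ η := by
  have h1 : Tendsto (fun K : ℕ => P.real {o | (K : ℝ) < u ⊙ W.Z 0 o}) atTop (𝓝 0) := by
    have := tendsto_measure_iInter_atTop (μ := P) (s := fun K : ℕ => {o | (K : ℝ) < u ⊙ W.Z 0 o})
      (fun K => (measurableSet_lt measurable_const (W.measurable_dot_Z u 0)).nullMeasurableSet)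
      (fun a b hab o (ho : (b : ℝ) < _) => lt_of_le_of_lt (Nat.cast_le.2 hab) ho)
      ⟨0, measure_ne_top _ _⟩
    have he : ⋂ K : ℕ, {o | (K : ℝ) < u ⊙ W.Z 0 o} = ∅ := by
      refine Set.eq_empty_iff_forall_notMem.2 fun o ho => ?_
      obtain ⟨K, hK⟩ := exists_nat_gt (u ⊙ W.Z 0 o)
      have := Set.mem_iInter.1 ho K
      exact lt_asymm this hK
    rw [he, measure_empty] at this
    exact (tendsto_toReal ENNReal.zero_ne_top).comp this
  obtain ⟨K, hK, h2⟩ := ((eventually_gt_atTop 0).and (h1.eventually_le_const hη)).exists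
  exact ⟨K, cast_pos.2 hK, h2⟩

/-- The population vector is asymptotically proportional to `v`, in probability. -/
theorem OneStep.tendsto_measureReal_transversal (h : W.OneStep u C α β ν)
  (huv : W.PerronVectors u v) (hm : W.meanMatrix.IsPrimitive) {N : ℕ → ℝ}
  (hN : Tendsto (fun n : ℕ => (n : ℝ) ^ (max α (β / 2) / (1 - α)) / N n) atTop (𝓝 0))
  (hN0 : ∀ᶠ n in atTop, 0 < N n) {ε : ℝ} (hε : 0 < ε) (i : Fin p) :
  Tendsto (fun n => P.real {o | ε * N n < |transversal u v (W.Z n o) i|}) atTop (𝓝 0) := by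
  obtain ⟨K, hK, hb⟩ := h.exists_transversal_bound huv hm
  have hui := h.u_pos i
  refine Metric.tendsto_atTop.2 fun e he => ?_
  obtain ⟨K₀, hK₀, h0⟩ := W.exists_measureReal_start_gt_le u (half_pos he)
  set B : Set Ω := {o | u ⊙ W.Z 0 o ≤ K₀} with hBdef
  have hB : MeasurableSet[W.history 0] B := W.measurableSet_Z 0 {z | u ⊙ z ≤ K₀}
  have hB' : MeasurableSet B := W.history.le 0 _ hB
  have hlim : Tendsto (fun n : ℕ => K * (1 + K₀) / (ε * u i) *
    ((n : ℝ) ^ (max α (β / 2) / (1 - α)) / N n)) atTop (𝓝 0) := by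
    simpa using hN.const_mul (K * (1 + K₀) / (ε * u i))
  obtain ⟨n₀, hn₀⟩ := eventually_atTop.1
    (((hlim.eventually_lt_const (half_pos he)).and hN0).and (eventually_ge_atTop 1))
  refine ⟨n₀, fun n hn => ?_⟩
  obtain ⟨⟨h1, h2⟩, h3⟩ := hn₀ n hn
  rw [Real.dist_0_eq_abs, abs_of_nonneg measureReal_nonneg]
  set S := {o | ε * N n < |transversal u v (W.Z n o) i|} with hS
  have hx0 : ∫⁻ o in B, ofReal (u ⊙ W.Z 0 o) ∂P ≤ ofReal K₀ := by
    refine (setLIntegral_mono_ae (g := fun _ => ofReal K₀) (by fun_prop)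
      (ae_of_all _ fun o ho => ofReal_le_ofReal ho)).trans ?_
    refine (setLIntegral_const B (ofReal K₀)).le.trans ?_
    exact mul_le_of_le_one_right' prob_le_one
  have hint := hb B hB n h3
  have hmark : ofReal (ε * N n * u i) * P (S ∩ B) ≤
    ∫⁻ o in B, ofReal (weightedNorm u (transversal u v (W.Z n o))) ∂P := by
    have hmeas : Measurable fun o => ofReal (weightedNorm u (transversal u v (W.Z n o))) :=
      (measurable_of_countable fun z : Pop =>
        ofReal (weightedNorm u (transversal u v z))).comp (W.measurable_Z n)
    refine le_trans ?_ (mul_meas_ge_le_lintegral₀ hmeas.aemeasurable (ofReal (ε * N n * u i)))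
    refine mul_le_mul_right ?_ _
    rw [← Measure.restrict_apply' hB']
    refine measure_mono fun o ho => ofReal_le_ofReal ?_
    have h5 : u i * |transversal u v (W.Z n o) i| ≤ weightedNorm u (transversal u v (W.Z n o)) :=
      single_le_sum (f := fun j => u j * |transversal u v (W.Z n o) j|)
        (fun j _ => mul_nonneg (h.u_pos j).le (abs_nonneg _)) (mem_univ i)
    have h6 : ε * N n * u i ≤ |transversal u v (W.Z n o) i| * u i :=
      mul_le_right (le_of_lt ho) hui.le
    linarith
  have hreal : ε * N n * u i * P.real (S ∩ B) ≤
    K * (n : ℝ) ^ (max α (β / 2) / (1 - α)) * (1 + K₀) := by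
    have := hmark.trans (hint.trans (mul_le_mul_right (add_le_add_right hx0 1) _))
    rw [← ENNReal.ofReal_one, ← ofReal_add zero_le_one hK₀.le, ← ofReal_mul ✓] at this
    have := toReal_mono ofReal_ne_top this
    rwa [toReal_mul, toReal_ofReal ✓, toReal_ofReal ✓] at this
  have h7 : P.real (S ∩ B) ≤ K * (1 + K₀) / (ε * u i) *
    ((n : ℝ) ^ (max α (β / 2) / (1 - α)) / N n) := by
    rw [div_mul_div_comm, le_div_iff₀ ✓]
    linarith
  have h8 : P.real S ≤ P.real (S ∩ B) + P.real {o | K₀ < u ⊙ W.Z 0 o} := by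
    refine (measureReal_mono (s₂ := (S ∩ B) ∪ {o | K₀ < u ⊙ W.Z 0 o}) ?_
      (measure_ne_top _ _)).trans (measureReal_union_le _ _)
    intro o ho
    rcases le_or_gt (u ⊙ W.Z 0 o) K₀ with h | h
    exacts [Or.inl ⟨ho, h⟩, Or.inr h]
  linarith

/-- Convergence in law of the population vector from that of its component along `v`. -/
theorem OneStep.tendsto_cond_cdfAlong (h : W.OneStep u C α β ν) (huv : W.PerronVectors u v)
  (hm : W.meanMatrix.IsPrimitive) (hA : P W.Unlimited ≠ 0) {N a : ℕ → ℝ}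
  (hN : Tendsto (fun n : ℕ => (n : ℝ) ^ (max α (β / 2) / (1 - α)) / N n) atTop (𝓝 0))
  (hN0 : ∀ᶠ n in atTop, 0 < N n) {L : Measure ℝ} [IsProbabilityMeasure L] [NullSingletonClass L]
  (hL : ∀ t, Tendsto (fun n => (cond P W.Unlimited).real
    {o | (u ⊙ W.Z n o - a n) / N n ≤ t}) atTop (𝓝 (L.real (Iic t))))
  (x : Vec) :
  Tendsto (fun n => (cond P W.Unlimited).real {o | ∀ i, ((W.Z n o i : ℝ) - v i * a n) / N n ≤ x i})
    atTop (𝓝 (cdfAlong L v x)) := by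
  have := cond_isProbabilityMeasure hA
  have := h.p_pos
  refine tendsto_cdfAlong (V := fun n o i => ((W.Z n o i : ℝ) - v i * a n) / N n)
    huv.2.2.2.1 hL (fun ε hε i => ?_) x
  refine tendsto_cond_real_zero W.measurableSet_unlimited
    ((h.tendsto_measureReal_transversal huv hm hN hN0 hε i).congr' ?_)
  filter_upwards [hN0] with n hn
  congr 1
  ext o
  have : ((W.Z n o i : ℝ) - v i * a n) / N n - (u ⊙ W.Z n o - a n) / N n * v i =
    transversal u v (W.Z n o) i / N n := by
    simp only [transversal, realVec, Pi.sub_apply, Pi.smul_apply, smul_eq_mul]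
    ring
  simp only [mem_ofPred_eq, this, abs_div, abs_of_pos hn, lt_div_iff₀ hn]

/-- The gamma limit. -/
theorem OneStep.tendsto_cdfAlong_gammaRootLaw (h : W.OneStep u C α β ν)
  (huv : W.PerronVectors u v) (hm : W.meanMatrix.IsPrimitive) (hβ : β = 1 + α)
  (hν : ν < 2 * C) (hA : 0 < P W.Unlimited) (x : Vec) :
  Tendsto (fun n : ℕ => (cond P W.Unlimited).real
    {o | ∀ i, (W.Z n o i : ℝ) / (n : ℝ) ^ (1 / (1 - α)) ≤ x i}) atTop
    (𝓝 (cdfAlong (gammaRootLaw (1 - α) ((2 * C - ν * α) / (ν * (1 - α)))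
      (ν * (1 - α) ^ 2 / 2)) v x)) := by
  have hd : W.Diffusive u C α ν := by simpa [hβ] using h.diffusive
  have hs : 0 < 1 - α := sub_pos.2 h.α_lt
  have hν0 := h.ν_pos
  have hα0 := h.α_nonneg
  set k := (2 * C - ν * α) / (ν * (1 - α)) with hk
  set Θ := ν * (1 - α) ^ 2 / 2 with hΘ
  have hk0 : 0 < k := by
    refine div_pos ?_ ✓
    nlinarith
  have hΘ0 : 0 < Θ := ✓
  have := isProbabilityMeasure_gammaRootLaw (s := 1 - α) hk0 hΘ0
  have := nullSingletonClass_gammaRootLaw (k := k) (Θ := Θ) hs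
  have := isProbabilityMeasure_gammaMeasure hk0 (inv_pos.2 hΘ0)
  have := cond_isProbabilityMeasure hA.ne'
  have hAr : P.real W.Unlimited ≠ 0 := (measureReal_ne_zero_iff (measure_ne_top _ _)).2 hA.ne'
  have hx0 : ∀ n o, 0 ≤ u ⊙ W.Z n o := fun n o => dot_nonneg h.u_pos _
  have hG := tendsto_measureReal_le_of_laplace (Q := cond P W.Unlimited)
    (G := fun n o => (u ⊙ W.Z n o) ^ (1 - α) / n) (μ := gammaMeasure k Θ⁻¹)
    (fun n => ((W.measurable_dot_Z u n).pow_const _).div_const _)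
    (fun n o => div_nonneg (rpow_nonneg (hx0 n o) _) (cast_nonneg n))
    gammaMeasure_Iio_zero (fun l hl => by
      have hl' : (0 : ℝ) < l := cast_pos.2 hl
      rw [integral_exp_neg_gammaMeasure hk0 (inv_pos.2 hΘ0) hl'.le, inv_inv]
      have h1 := tendsto_setIntegral_laplace (k := k) h.u_pos hα0 h.α_lt
        (fun z => (h.memLp z).integrable one_le_two) hd hk0.le hν0.le
        (by rw [hk]; field_simp) hl'
      have h2 := h1.const_mul (P.real W.Unlimited)⁻¹
      rw [mul_comm ((1 + _) ^ _), inv_mul_cancel_left₀ hAr] at h2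
      have e : (1 - α) ^ 2 * ν / 2 = Θ := by linarith
      rw [e] at h2
      refine h2.congr fun n => ?_
      rw [integral_cond_eq, smul_eq_mul]
      congr 2
      ext o
      congr 2
      ring)
  refine (h.tendsto_cond_cdfAlong huv hm hA.ne' (a := fun _ => 0)
    (N := fun n => (n : ℝ) ^ (1 / (1 - α)))
    (tendsto_rpow_div_rpow_zero (by gcongr; exact h.max_lt_one))
    ?_ (L := gammaRootLaw (1 - α) k Θ) (fun t => ?_) x).congr fun n => by simp
  · filter_upwards [eventually_gt_atTop 0] with n hn
    exact rpow_pos_of_pos (cast_pos.2 hn) _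
  · rcases lt_or_ge t 0 with ht | ht
    · rw [measureReal_def, gammaRootLaw_Iic_of_neg ht, ENNReal.toReal_zero]
      refine tendsto_const_nhds.congr fun n => ?_
      have : {o | (u ⊙ W.Z n o - 0) / (n : ℝ) ^ (1 / (1 - α)) ≤ t} = ∅ := by
        refine Set.eq_empty_iff_forall_notMem.2 fun o ho => ?_
        have : 0 ≤ (u ⊙ W.Z n o - 0) / (n : ℝ) ^ (1 / (1 - α)) := by
          rw [sub_zero]; exact div_nonneg (hx0 n o) ✓
        exact absurd ho (not_le.2 (ht.trans_le this))
      rw [this, measureReal_empty]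
    · rw [measureReal_def, gammaRootLaw_Iic_of_nonneg hs ht, ← measureReal_def]
      refine (hG (t ^ (1 - α))).congr' ?_
      filter_upwards [eventually_gt_atTop 0] with n hn
      have hn' : (0 : ℝ) < n := cast_pos.2 hn
      congr 1
      ext o
      simp only [mem_ofPred_eq, sub_zero]
      rw [div_le_iff₀ hn', div_le_iff₀ ✓, ← Real.rpow_le_rpow_iff (hx0 n o)
        ✓ hs, mul_rpow ht ✓, ← rpow_mul hn'.le,
        one_div_mul_cancel hs.ne', rpow_one]

/-- Kronecker's lemma for the weights `j + 1`. -/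
lemma tendsto_sum_div_of_tendsto_sum_div {a : ℕ → ℝ} {c : ℝ}
  (h : Tendsto (fun n => ∑ j ∈ range n, a j / (j + 1)) atTop (𝓝 c)) :
  Tendsto (fun n : ℕ => (∑ j ∈ range n, a j) / n) atTop (𝓝 0) := by
  set S : ℕ → ℝ := fun n => ∑ j ∈ range n, a j / (j + 1) with hS
  have h1 : ∀ n : ℕ, ∑ j ∈ range n, a j = n * S n - ∑ j ∈ range n, S j := by
    intro n
    induction n with
    | zero => simp
    | succ n ih =>
      have : S (n + 1) = S n + a n / (n + 1) := sum_range_succ _ _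
      rw [sum_range_succ, ih, sum_range_succ, this]
      push_cast
      field_simp
      ring
  have h2 := h.sub h.cesaro
  rw [sub_self] at h2
  refine h2.congr' ?_
  filter_upwards [eventually_gt_atTop 0] with n hn
  have : (n : ℝ) ≠ 0 := ✓
  rw [h1]
  field_simp

/-- An `L²` bounded martingale converges almost surely. -/
theorem ae_tendsto_sum_of_condExp_eq_zero {Ω : Type*} [mΩ : MeasurableSpace Ω] {P : Measure Ω}
  [IsProbabilityMeasure P] {F : Filtration ℕ mΩ} {ξ : ℕ → Ω → ℝ}
  (hξm : ∀ j, StronglyMeasurable[F (j + 1)] (ξ j)) (hξ : ∀ j, MemLp (ξ j) 2 P)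
  (h0 : ∀ j, P[ξ j | F j] =ᵐ[P] 0) (hs : Summable fun j => ∫ o, ξ j o ^ 2 ∂P) :
  ∀ᵐ o ∂P, ∃ c, Tendsto (fun n => ∑ j ∈ range n, ξ j o) atTop (𝓝 c) := by
  set S : ℕ → Ω → ℝ := fun n o => ∑ j ∈ range n, ξ j o with hS
  have hSL : ∀ n, MemLp (S n) 2 P := fun n => memLp_finsetSum _ fun j _ => hξ j
  have hSm : ∀ n, StronglyMeasurable[F n] (S n) := fun n =>
    Finset.stronglyMeasurable_fun_sum _ fun j hj =>
      (hξm j).mono (F.mono (Nat.succ_le_of_lt (mem_range.1 hj)))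
  have hmul : ∀ (n : ℕ) (g : Ω → ℝ), StronglyMeasurable[F n] g → MemLp g 2 P →
    ∫ o, g o * ξ n o ∂P = 0 := by
    intro n g hg hg2
    have hi : Integrable (g * ξ n) P := hg2.integrable_mul (hξ n)
    have h1 := condExp_mul_of_stronglyMeasurable_left hg hi ((hξ n).integrable one_le_two)
    have h2 := integral_condExp (μ := P) (f := g * ξ n) (F.le n)
    have h3 : ∫ o, (P[g * ξ n | F n]) o ∂P = 0 := by
      refine integral_eq_zero_of_ae (h1.trans ?_)
      filter_upwards [h0 n] with o ho
      simp [ho]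
    rw [← h3, h2]
    rfl
  have hsq : ∀ n, ∫ o, S n o ^ 2 ∂P = ∑ j ∈ range n, ∫ o, ξ j o ^ 2 ∂P := by
    intro n
    induction n with
    | zero => simp [hS]
    | succ n ih =>
      have e : ∀ o, S (n + 1) o ^ 2 = S n o ^ 2 + (2 * (S n o * ξ n o) + ξ n o ^ 2) := by
        intro o
        have : S (n + 1) o = S n o + ξ n o := sum_range_succ _ _
        rw [this]; ring
      simp_rw [e]
      have i1 : Integrable (fun o => 2 * (S n o * ξ n o)) P :=
        ((hSL n).integrable_mul (hξ n)).const_mul 2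
      rw [integral_add (hSL n).integrable_sq (i1.fun_add (hξ n).integrable_sq),
        integral_add i1 (hξ n).integrable_sq, integral_const_mul, hmul n _ (hSm n) (hSL n), ih,
        sum_range_succ]
      ring
  have hsub : Submartingale S F P := by
    refine submartingale_of_setIntegral_le_succ hSm (fun n => (hSL n).integrable one_le_two)
      fun n s hs => ?_
    have e : ∀ o, S (n + 1) o = S n o + ξ n o := fun o => sum_range_succ _ _
    simp_rw [e]
    rw [integral_add ((hSL n).integrable one_le_two).integrableOn
      ((hξ n).integrable one_le_two).integrableOn]
    have := hmul n (s.indicator fun _ => (1 : ℝ)) (stronglyMeasurable_const.indicator hs)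
      ((memLp_const 1).indicator (F.le n _ hs))
    have h5 : ∫ o in s, ξ n o ∂P = 0 := by
      rw [← integral_indicator (F.le n _ hs), ← this]
      congr 1
      ext o
      by_cases h : o ∈ s <;> simp [h]
    rw [h5, add_zero]
  refine hsub.exists_ae_tendsto_of_bdd (R := (1 + ∑' j, ∫ o, ξ j o ^ 2 ∂P).toNNReal) fun n => ?_
  rw [eLpNorm_one_eq_lintegral_enorm, ← ofReal_integral_norm_eq_lintegral_enorm
    ((hSL n).integrable one_le_two)]
  refine ofReal_le_ofReal ?_
  calc ∫ o, ‖S n o‖ ∂P ≤ ∫ o, (1 + S n o ^ 2) ∂P :=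
        integral_mono ((hSL n).integrable one_le_two).norm
          ((integrable_const _).fun_add (hSL n).integrable_sq) fun o => by
            rw [norm_eq_abs, ← sq_abs (S n o)]
            nlinarith [sq_nonneg (|S n o| - 1)]
    _ = 1 + ∑ j ∈ range n, ∫ o, ξ j o ^ 2 ∂P := by
      rw [integral_add (integrable_const _) (hSL n).integrable_sq, hsq]
      simp
    _ ≤ _ := add_le_add_right (hs.sum_le_tsum _ fun j _ => integral_nonneg fun o => sq_nonneg _) 1

open Classical in
theorem condExp_indicator_next (W : MBPM P p) (k : ℕ) {B : Set Ω} (hB : MeasurableSet[W.history k] B)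
  (f : Pop → Pop → ℝ) (hf : ∀ z, Integrable (fun o => f z (W.next z o)) P)
  (h0 : ∀ z, ∫ o, f z (W.next z o) ∂P = 0)
  (hf' : Integrable (B.indicator fun o => f (W.Z k o) (W.Z (k + 1) o)) P) :
  P[B.indicator fun o => f (W.Z k o) (W.Z (k + 1) o) | W.history k] =ᵐ[P] 0 := by
  have id : ∀ z, IdentDistrib (fun o => f z (W.nextAt k z o)) (fun o => f z (W.next z o)) P P :=
    fun z => (W.identDistrib_nextAt k z).comp (measurable_of_countable (f z))
  have e : (B.indicator fun o => f (W.Z k o) (W.Z (k + 1) o)) = fun o =>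
    (fun (b : Pop × Prop) o => if b.2 then f b.1 (W.nextAt k b.1 o) else 0) (W.Z k o, o ∈ B) o := by
    ext o
    simp [indicator, W.Z_succ_eq]
  rw [e] at hf' ⊢
  refine (condExp_random_index (P := P) (W.history.le k) (W.sourceSigma_le (present p k))
    (W.indep_sourceSigma (disjoint_past_present p k))
    (N := fun o => (W.Z k o, o ∈ B))
    ((W.measurable_Z_history k).prodMk (@measurableSet_setOfPred _ (W.history k) _ |>.1 hB))
    (G := fun (b : Pop × Prop) o => if b.2 then f b.1 (W.nextAt k b.1 o) else 0) (fun b => ?_)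
    (fun b => ?_)
    hf').trans (ae_of_all _ fun o => ?_)
  · by_cases hb : b.2
    · simp only [hb, if_true]
      exact (StronglyMeasurable.of_discrete (f := f b.1)).comp_measurable
        (W.measurable_nextAt_present k b.1)
    · simp only [hb, if_false]
      exact stronglyMeasurable_const
  · by_cases hb : b.2
    · simp only [hb, if_true]
      exact (id b.1).integrable_iff.2 (hf b.1)
    · simp [hb]
  · by_cases hb : o ∈ B
    · simp only [hb, if_true, Pi.zero_apply]
      rw [(id _).integral_eq, h0]
    · simp [hb]

/-- A law of large numbers for the fluctuations of a functional of the process. -/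
theorem ae_tendsto_sum_sub_div (W : MBPM P p) {B : Set Ω} (hB : MeasurableSet[W.history 0] B)
  {f g : Pop → ℝ} (hf : ∀ z, MemLp (fun o => f (W.next z o)) 2 P)
  (hg : ∀ z, ∫ o, f (W.next z o) ∂P = f z + g z) {D γ : ℝ} (hγ : γ < 1)
  (hV : ∀ j : ℕ, ∫⁻ o in B, ofReal
    (∫ o', (f (W.next (W.Z j o) o') - f (W.Z j o) - g (W.Z j o)) ^ 2 ∂P) ∂P ≤
      ofReal (D * ((j : ℝ) + 1) ^ γ)) :
  ∀ᵐ o ∂P, o ∈ B → Tendsto (fun n : ℕ =>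
    (∑ j ∈ range n, (f (W.Z (j + 1) o) - f (W.Z j o) - g (W.Z j o))) / n) atTop (𝓝 0) := by
  have hBk : ∀ k, MeasurableSet[W.history k] B := fun k => W.history.mono (Nat.zero_le k) _ hB
  have hB' : MeasurableSet B := W.history.le 0 _ hB
  have hD : ∀ z, MemLp (fun o => f (W.next z o) - f z - g z) 2 P := fun z =>
    ((hf z).sub (memLp_const (f z))).sub (memLp_const (g z))
  set η : ℕ → Ω → ℝ := fun j => B.indicator fun o => f (W.Z (j + 1) o) - f (W.Z j o) - g (W.Z j o)
    with hη
  have hηm : ∀ j, StronglyMeasurable[W.history (j + 1)] (η j) := fun j =>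
    ((((StronglyMeasurable.of_discrete (f := f)).comp_measurable (W.measurable_Z_history (j + 1))).sub
      ((StronglyMeasurable.of_discrete (f := f)).comp_measurable
        ((W.measurable_Z_history j).mono (W.history.mono (le_succ j)) le_rfl))).sub
      ((StronglyMeasurable.of_discrete (f := g)).comp_measurable
        ((W.measurable_Z_history j).mono (W.history.mono (le_succ j)) le_rfl))).indicator
      (hBk (j + 1))
  have hηsq : ∀ j, ∫⁻ o, ofReal (η j o ^ 2) ∂P ≤ ofReal (D * ((j : ℝ) + 1) ^ γ) := by
    intro j
    refine le_trans (le_of_eq ?_) (hV j)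
    have e : (fun o => ofReal (η j o ^ 2)) = B.indicator fun o =>
      ofReal ((f (W.Z (j + 1) o) - f (W.Z j o) - g (W.Z j o)) ^ 2) := by
      ext o
      by_cases h : o ∈ B <;> simp [hη, h]
    rw [e, lintegral_indicator hB', W.setLIntegral_next j (hBk j)
      fun z z' => ofReal ((f z' - f z - g z) ^ 2)]
    refine lintegral_congr fun o => ?_
    rw [ofReal_integral_eq_lintegral_ofReal (hD _).integrable_sq (ae_of_all _ fun _ => sq_nonneg _)]
  have hηL : ∀ j, MemLp (η j) 2 P := by
    intro j
    have hm : AEStronglyMeasurable (η j) P := ((hηm j).mono (W.history.le _)).aestronglyMeasurable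
    rw [memLp_two_iff_integrable_sq hm]
    refine ⟨hm.pow 2, ?_⟩
    rw [hasFiniteIntegral_iff_ofReal (ae_of_all _ fun o => sq_nonneg _)]
    exact (hηsq j).trans_lt ofReal_lt_top
  have hint : ∀ j, ∫ o, η j o ^ 2 ∂P ≤ |D| * ((j : ℝ) + 1) ^ γ := by
    intro j
    have hp : (0 : ℝ) ≤ ((j : ℝ) + 1) ^ γ := ✓
    rw [integral_eq_lintegral_of_nonneg_ae (ae_of_all _ fun o => sq_nonneg _)
      (hηL j).integrable_sq.aestronglyMeasurable]
    refine ENNReal.toReal_le_of_le_ofReal ✓ ((hηsq j).trans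
      (ofReal_le_ofReal (mul_le_right (le_abs_self D) hp)))
  have h0 : ∀ j, P[η j | W.history j] =ᵐ[P] 0 := fun j =>
    W.condExp_indicator_next j (hBk j) (fun z z' => f z' - f z - g z)
      (fun z => (hD z).integrable one_le_two) (fun z => by
        have i1 : Integrable (fun o => f (W.next z o) - f z) P :=
          ((hf z).integrable one_le_two).sub (integrable_const _)
        rw [integral_sub i1 (integrable_const _),
          integral_sub ((hf z).integrable one_le_two) (integrable_const _), hg]
        simp) ((hηL j).integrable one_le_two)
  have hconv := ae_tendsto_sum_of_condExp_eq_zero (F := W.history)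
    (ξ := fun j o => η j o / ((j : ℝ) + 1)) (fun j => by
      simpa only [div_eq_mul_inv] using (hηm j).mul_const ((j : ℝ) + 1)⁻¹)
    (fun j => by simpa only [div_eq_mul_inv] using (hηL j).mul_const _) (fun j => by
      have h1 : (fun o => η j o / ((j : ℝ) + 1)) = ((j : ℝ) + 1)⁻¹ • η j := by
        ext o; simp [div_eq_inv_mul]
      rw [h1]
      refine (condExp_smul _ _ _).trans ?_
      filter_upwards [h0 j] with o ho
      simp [ho]) (by
      have hsum : Summable fun j : ℕ => |D| * ((j + 1 : ℕ) : ℝ) ^ (γ - 2) :=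
        ((summable_nat_add_iff 1).2 (Real.summable_nat_rpow.2 (by linarith))).mul_left _
      refine Summable.of_nonneg_of_le (fun j => integral_nonneg fun o => sq_nonneg _)
        (fun j => ?_) hsum
      have hj : (0 : ℝ) < (j : ℝ) + 1 := ✓
      simp_rw [div_pow]
      rw [integral_div, div_le_iff₀ ✓]
      refine (hint j).trans (le_of_eq ?_)
      push_cast
      rw [rpow_sub hj, rpow_two]
      field_simp)
  filter_upwards [hconv] with o ⟨c, hc⟩ ho
  refine (tendsto_sum_div_of_tendsto_sum_div hc).congr fun n => ?_
  simp only [hη, indicator_of_mem ho]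

lemma abs_one_add_rpow_sub_linear_le {s d : ℝ} (hs0 : 0 ≤ s) (hs : s ≤ 1) (hd : -1 ≤ d) :
  |(1 + d) ^ s - 1 - s * d| ≤ 24 * d ^ 2 := by
  rcases le_or_gt |d| (1 / 2) with h | h
  · have h1 := abs_le.1 (abs_one_add_rpow_sub_le hs0 hs h)
    have h2 : |d| ^ 3 ≤ 1 / 2 * d ^ 2 := by
      rw [pow_succ', sq_abs]
      exact mul_le_right h (sq_nonneg d)
    have h3 : 0 ≤ s * (1 - s) / 2 * d ^ 2 := ✓
    have h4 : s * (1 - s) / 2 * d ^ 2 ≤ 1 * d ^ 2 := mul_le_right (by nlinarith) (sq_nonneg d)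
    rw [abs_le]
    constructor <;> linarith
  · have h1 := abs_le.1 (abs_one_add_rpow_sub_one_le hs0 hs hd)
    have h2 : |s * d| ≤ |d| := by
      rw [abs_mul, abs_of_nonneg hs0]
      exact mul_le_of_le_one_left (abs_nonneg d) hs
    have h3 := abs_le.1 h2
    have h4 : |d| ≤ 2 * d ^ 2 := by
      rw [← sq_abs]
      nlinarith
    rw [abs_le]
    constructor <;> linarith [sq_nonneg d]

theorem tendsto_growing_of_mem_unlimited {o : Ω} (ho : o ∈ W.Unlimited) :
  Tendsto (fun n => W.Z n o) atTop (growing p) :=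
  tendsto_comap_iff.2 ho

namespace OneStep

theorem memLp_rpow_next (h : W.OneStep u C α β ν) (z : Pop) :
  MemLp (fun o => (u ⊙ W.next z o) ^ (1 - α)) 2 P := by
  refine ((memLp_const (1 : ℝ)).add (h.memLp z)).mono
    ((W.measurable_dot_next u z).pow_const _).aestronglyMeasurable
    (ae_of_all _ fun o => ?_)
  have hx := dot_nonneg h.u_pos (W.next z o)
  have h2 := rpow_le_one_add_rpow hx (sub_nonneg.2 h.α_lt.le)
    (show 1 - α ≤ 1 by linarith [h.α_nonneg])
  rw [rpow_one] at h2
  rw [norm_of_nonneg ✓, Pi.add_apply, norm_of_nonneg ✓]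
  exact h2

theorem tendsto_rpow_increment (h : W.OneStep u C α β ν) (hβ : β < 1 + α) :
  Tendsto (fun z => ∫ o, (u ⊙ W.next z o) ^ (1 - α) ∂P - (u ⊙ z) ^ (1 - α))
    (growing p) (𝓝 ((1 - α) * C)) := by
  have hd : W.Diffusive u C α 0 := by simpa [hβ.ne] using h.diffusive
  have t1 := hd.mean.const_mul (1 - α)
  have t2 := hd.sq.const_mul 24
  rw [mul_zero] at t2
  refine tendsto_of_tendsto_of_dist t1 (squeeze_zero' (Eventually.of_forall fun _ => dist_nonneg)
    ?_ t2)
  filter_upwards [h.eventually_pos] with z hz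
  have hs0 : 0 ≤ 1 - α := sub_nonneg.2 h.α_lt.le
  have hs1 : 1 - α ≤ 1 := by linarith [h.α_nonneg]
  set y := (u ⊙ z) ^ (1 - α) with hy
  have hy0 : 0 < y := ✓
  have i1 : Integrable (W.rel u z) P := (hd.memLp z).integrable one_le_two
  have i2 : Integrable (fun o => (u ⊙ W.next z o) ^ (1 - α)) P :=
    (h.memLp_rpow_next z).integrable one_le_two
  have i3 : Integrable (fun o => (u ⊙ W.next z o) ^ (1 - α) - y) P := by fun_prop
  have e : ∫ o, (u ⊙ W.next z o) ^ (1 - α) ∂P - y - (1 - α) * (y * ∫ o, W.rel u z o ∂P) =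
    ∫ o, ((u ⊙ W.next z o) ^ (1 - α) - y - (1 - α) * y * W.rel u z o) ∂P := by
    rw [integral_sub i3 (i1.const_mul _), integral_sub i2 (integrable_const _), integral_const_mul]
    simp only [integral_const, probReal_univ, one_smul]
    ring
  rw [dist_comm, dist_eq, e, ← mul_assoc, ← integral_const_mul, ← norm_eq_abs]
  refine norm_integral_le_of_norm_le ((hd.memLp z).integrable_sq.const_mul _)
    (ae_of_all _ fun o => ?_)
  have h1 := W.neg_one_le_rel h.u_pos hz o
  have h2 := abs_one_add_rpow_sub_linear_le hs0 hs1 h1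
  rw [W.dot_next_eq_rel hz, mul_rpow hz.le (by linarith), ← hy, norm_eq_abs,
    show y * (1 + W.rel u z o) ^ (1 - α) - y - (1 - α) * y * W.rel u z o =
      y * ((1 + W.rel u z o) ^ (1 - α) - 1 - (1 - α) * W.rel u z o) by ring,
    abs_mul, abs_of_pos hy0]
  linarith [mul_le_left h2 hy0.le]

theorem exists_rpow_increment_sq_le (h : W.OneStep u C α β ν) : ∃ K > 0, ∀ z,
  ∫ o, ((u ⊙ W.next z o) ^ (1 - α) - (u ⊙ z) ^ (1 - α) -
    (∫ o, (u ⊙ W.next z o) ^ (1 - α) ∂P - (u ⊙ z) ^ (1 - α))) ^ 2 ∂P ≤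
    K * (1 + (u ⊙ z) ^ (max β (2 * α) - 2 * α)) := by
  refine exists_bound_of_eventually h.u_pos (C := ν + 1 + (C + 1) ^ 2) ?_
    fun z => rpow_nonneg (dot_nonneg h.u_pos z) _
  filter_upwards [h.var.eventually (gt_mem_nhds (lt_add_one ν)),
    h.drift.eventually (gt_mem_nhds (lt_add_one C)),
    h.drift.eventually (lt_mem_nhds h.C_pos),
    (tendsto_dot_growing h.u_pos).eventually_ge_atTop 1] with z c1 c2 c3 hz1
  have hs0 : 0 ≤ 1 - α := sub_nonneg.2 h.α_lt.le
  have hs1 : 1 - α ≤ 1 := by linarith [h.α_nonneg]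
  set x := u ⊙ z with hx
  have hz : 0 < x := by linarith
  set y := x ^ (1 - α) with hy
  have hy0 : 0 < y := ✓
  have hR2 := h.memLp_rel z
  have hN := h.memLp_rpow_next z
  set m := ∫ o, (u ⊙ W.next z o) ^ (1 - α) ∂P with hm
  have hN' : MemLp (fun o => (u ⊙ W.next z o) ^ (1 - α) - y) 2 P := hN.sub (memLp_const _)
  have i2 := hN.integrable one_le_two
  have hmean : ∫ o, ((u ⊙ W.next z o) ^ (1 - α) - y) ∂P = m - y := by
    rw [integral_sub i2 (integrable_const _)]; simp [hm]
  have s1 : ∫ o, ((u ⊙ W.next z o) ^ (1 - α) - y - (m - y)) ^ 2 ∂P ≤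
    ∫ o, ((u ⊙ W.next z o) ^ (1 - α) - y) ^ 2 ∂P := by
    have := variance_eq_integral hN'.aemeasurable
    rw [hmean] at this
    rw [← this]
    exact variance_le_expectation_sq hN'.aestronglyMeasurable
  have s2 : ∫ o, ((u ⊙ W.next z o) ^ (1 - α) - y) ^ 2 ∂P ≤ y ^ 2 * ∫ o, W.rel u z o ^ 2 ∂P := by
    rw [← integral_const_mul]
    refine integral_mono hN'.integrable_sq (hR2.integrable_sq.const_mul _) fun o => ?_
    have h1 := W.neg_one_le_rel h.u_pos hz o
    have h2 := abs_one_add_rpow_sub_one_le hs0 hs1 h1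
    simp only
    rw [W.dot_next_eq_rel hz, mul_rpow hz.le (by linarith), ← hy,
      show y * (1 + W.rel u z o) ^ (1 - α) - y = y * ((1 + W.rel u z o) ^ (1 - α) - 1) by ring,
      mul_pow, ← sq_abs (_ - _), ← sq_abs (W.rel u z o)]
    exact mul_le_left (pow_le_pow_left₀ (abs_nonneg _) h2 2) (sq_nonneg y)
  rw [h.integral_rel_sq] at s2
  have hxα : 0 < x ^ α := ✓
  rw [div_lt_iff₀ ✓] at c1 c2
  have c4 : 0 ≤ u ⬝ᵥ W.h z := by
    rcases div_pos_iff.1 c3 with h | h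
    · exact h.1.le
    · linarith
  have c5 : (u ⬝ᵥ W.h z) ^ 2 ≤ (C + 1) ^ 2 * x ^ (2 * α) := by
    rw [mul_comm 2 α, rpow_mul hz.le, rpow_two, ← mul_pow]
    exact pow_le_pow_left₀ c4 c2.le 2
  have e1 : y ^ 2 / x ^ 2 = x ^ (-(2 * α)) := by
    rw [hy, ← rpow_two, ← rpow_two, ← rpow_mul hz.le, ← rpow_sub hz]
    ring_nf
  have m1 : x ^ β ≤ x ^ max β (2 * α) := rpow_le_rpow_of_exponent_le hz1 (le_max_left _ _)
  have m2 : x ^ (2 * α) ≤ x ^ max β (2 * α) := rpow_le_rpow_of_exponent_le hz1 (le_max_right _ _)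
  have hC := h.C_pos
  have hν := h.ν_pos
  refine s1.trans (s2.trans ?_)
  rw [mul_div_assoc', mul_comm (y ^ 2), mul_div_assoc, e1,
    sub_eq_add_neg (max β (2 * α)), rpow_add hz, ← mul_assoc]
  refine mul_le_right ?_
  nlinarith [mul_le_left m1 (✓ : 0 ≤ ν + 1), mul_le_left m2 (✓ : 0 ≤ (C + 1) ^ 2)]

/-- The almost sure rate of growth. -/
theorem ae_tendsto_rpow_div (h : W.OneStep u C α β ν) (hβ : β < 1 + α) : ∀ᵐ o ∂P, o ∈ W.Unlimited →
  Tendsto (fun n : ℕ => (u ⊙ W.Z n o) ^ (1 - α) / n) atTop (𝓝 ((1 - α) * C)) := by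
  have hs : 0 < 1 - α := sub_pos.2 h.α_lt
  set f : Pop → ℝ := fun z => (u ⊙ z) ^ (1 - α) with hf
  set g : Pop → ℝ := fun z => ∫ o, f (W.next z o) ∂P - f z with hg
  obtain ⟨K₁, hK₁, b₁⟩ := h.exists_first_moment
  obtain ⟨K₂, hK₂, b₂⟩ := h.exists_rpow_increment_sq_le
  set r := max β (2 * α) - 2 * α with hr
  have hr0 : 0 ≤ r := sub_nonneg.2 (le_max_right _ _)
  have hrs : r < 1 - α := by
    have : max β (2 * α) < 1 + α := max_lt hβ (by linarith [h.α_lt])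
    rw [hr]; linarith
  have hr1 : r ≤ 1 := by linarith [h.α_nonneg]
  have main : ∀ k : ℕ, ∀ᵐ o ∂P, o ∈ {o | u ⊙ W.Z 0 o ≤ k} → Tendsto (fun n : ℕ =>
    (∑ j ∈ range n, (f (W.Z (j + 1) o) - f (W.Z j o) - g (W.Z j o))) / n) atTop (𝓝 0) := by
    intro k
    have hB : MeasurableSet[W.history 0] {o | u ⊙ W.Z 0 o ≤ k} :=
      W.measurableSet_Z 0 {z | u ⊙ z ≤ k}
    set B := {o | u ⊙ W.Z 0 o ≤ k} with hBdef
    refine W.ae_tendsto_sum_sub_div hB h.memLp_rpow_next (fun z => by simp [hg, hf])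
      (D := K₂ * (1 + (K₁ * (k + 1) + 1))) (γ := r / (1 - α)) (by rwa [div_lt_one hs]) fun j => ?_
    set T : ℝ := ((j : ℝ) + 1) ^ (1 / (1 - α)) with hT
    have hj : (0 : ℝ) < (j : ℝ) + 1 := ✓
    have hT0 : 0 < T := ✓
    have hTr : T ^ r = ((j : ℝ) + 1) ^ (r / (1 - α)) := by rw [hT, ← rpow_mul hj.le]; ring_nf
    have hT1 : 1 ≤ T := one_le_rpow (by linarith [cast_nonneg (α := ℝ) j]) ✓
    have hTr1 : 1 ≤ T ^ r := one_le_rpow hT1 hr0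
    have hmom : ∫⁻ o in B, ofReal (u ⊙ W.Z j o) ∂P ≤ ofReal (K₁ * (k + T)) := by
      refine (b₁ B hB (j + 1) j (le_succ j) (Nat.succ_le_succ (Nat.zero_le j))).trans ?_
      rw [ofReal_mul hK₁.le, ofReal_add (cast_nonneg k) hT0.le]
      refine mul_le_mul_right (add_le_add ?_ ?_) _
      · refine (setLIntegral_mono' (W.history.le 0 _ hB) (g := fun _ => ofReal k)
          fun o ho => ofReal_le_ofReal ho).trans ?_
        refine (setLIntegral_const B (ofReal k)).le.trans ?_
        exact mul_le_of_le_one_right' prob_le_one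
      · push_cast
        exact mul_le_of_le_one_right' prob_le_one
    calc _ ≤ ∫⁻ o in B, (ofReal (K₂ * T ^ (r - 1)) * ofReal (u ⊙ W.Z j o) +
          ofReal (K₂ * (1 + T ^ r))) ∂P := by
          refine lintegral_mono fun o => ?_
          have hx := dot_nonneg h.u_pos (W.Z j o)
          rw [← ofReal_mul ✓, ← ofReal_add ✓ ✓]
          refine ofReal_le_ofReal ((b₂ _).trans ?_)
          have := mul_le_left (rpow_le_mul_add_rpow hx hT0 hr0 hr1) hK₂.le
          linarith
      _ ≤ ofReal (K₂ * T ^ (r - 1)) * ofReal (K₁ * (k + T)) + ofReal (K₂ * (1 + T ^ r)) := by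
        have hm : Measurable fun o => ofReal (u ⊙ W.Z j o) :=
          (W.measurable_dot_Z u j).ennreal_ofReal
        rw [lintegral_add_right _ measurable_const, lintegral_const_mul _ hm]
        refine add_le_add (mul_le_mul_right hmom _) ?_
        refine (setLIntegral_const B _).le.trans (mul_le_of_le_one_right' prob_le_one)
      _ ≤ _ := by
        rw [← ofReal_mul ✓, ← ofReal_add ✓ ✓, ← hTr]
        refine ofReal_le_ofReal ?_
        have e1 : T ^ (r - 1) * T = T ^ r := by rw [← Real.rpow_add_one hT0.ne']; ring_nf
        have e2 : T ^ (r - 1) ≤ T ^ r := rpow_le_rpow_of_exponent_le hT1 (by linarith)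
        have e3 : T ^ (r - 1) * (K₁ * (k + T)) ≤ K₁ * (k + 1) * T ^ r := by
          have : K₁ * k * T ^ (r - 1) ≤ K₁ * k * T ^ r := by gcongr
          calc _ = K₁ * k * T ^ (r - 1) + K₁ * (T ^ (r - 1) * T) := by ring
            _ ≤ _ := by rw [e1]; linarith
        have e4 := mul_le_left e3 hK₂.le
        have e5 := mul_le_left hTr1 hK₂.le
        linarith
  filter_upwards [ae_all_iff.2 main] with o ho hU
  obtain ⟨k, hk⟩ := exists_nat_ge (u ⊙ W.Z 0 o)
  have t1 := ho k hk
  have t2 : Tendsto (fun n => g (W.Z n o)) atTop (𝓝 ((1 - α) * C)) :=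
    (h.tendsto_rpow_increment hβ).comp (tendsto_growing_of_mem_unlimited hU)
  have t3 : Tendsto (fun n : ℕ => f (W.Z 0 o) / (n : ℝ)) atTop (𝓝 0) :=
    tendsto_const_nhds.div_atTop tendsto_natCast_atTop_atTop
  have t4 := (t1.add t2.cesaro).add t3
  rw [zero_add, add_zero] at t4
  refine t4.congr fun n => ?_
  rw [sum_sub_distrib, sum_range_sub (fun j => f (W.Z j o))]
  ring

end OneStep

/-- Almost sure convergence and bounded second moments give convergence in `L¹`. -/
lemma tendsto_lintegral_abs_of_sq_bounded {Ω : Type*} [MeasurableSpace Ω] {μ : Measure Ω}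
  [IsFiniteMeasure μ] {F : ℕ → Ω → ℝ} (hF : ∀ n, Measurable (F n)) {M : ℝ}
  (hM : ∀ᶠ n in atTop, ∫⁻ o, ofReal (F n o ^ 2) ∂μ ≤ ofReal M)
  (h : ∀ᵐ o ∂μ, Tendsto (fun n => F n o) atTop (𝓝 0)) :
  Tendsto (fun n => ∫⁻ o, ofReal |F n o| ∂μ) atTop (𝓝 0) := by
  refine tendsto_nhds_zero.2 fun ε hε => ?_
  have t1 : Tendsto (fun R : ℝ => ofReal (M / R)) atTop (𝓝 0) := by
    simpa using tendsto_ofReal ((tendsto_const_nhds (x := M)).div_atTop (tendsto_id (α := ℝ)))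
  obtain ⟨R, hR, hR0⟩ := ((tendsto_nhds_zero.1 t1 (ε / 2) (ENNReal.half_pos hε.ne')).and
    (eventually_gt_atTop 0)).exists
  have t2 : Tendsto (fun n => ∫⁻ o, ofReal (min |F n o| R) ∂μ) atTop (𝓝 0) := by
    have := tendsto_lintegral_of_dominated_convergence (μ := μ) (f := fun _ => 0)
      (F := fun n o => ofReal (min |F n o| R)) (fun _ => ofReal R)
      (fun n => ((hF n).abs.min measurable_const).ennreal_ofReal)
      (fun n => ae_of_all _ fun o => ofReal_le_ofReal (min_le_right _ _))
      (by rw [lintegral_const]; finiteness) (by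
        filter_upwards [h] with o ho
        simpa [hR0.le] using tendsto_ofReal (ho.abs.min (tendsto_const_nhds (x := R))))
    simpa using this
  filter_upwards [hM, tendsto_nhds_zero.1 t2 (ε / 2) (ENNReal.half_pos hε.ne')] with n h1 h2
  calc ∫⁻ o, ofReal |F n o| ∂μ ≤ ∫⁻ o, (ofReal (min |F n o| R) +
        ofReal R⁻¹ * ofReal (F n o ^ 2)) ∂μ := by
        refine lintegral_mono fun o => ?_
        rw [← ofReal_mul ✓, ← ofReal_add (le_min (abs_nonneg _) hR0.le) ✓]
        refine ofReal_le_ofReal ?_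
        rcases le_or_gt |F n o| R with h | h
        · rw [min_eq_left h]
          have : 0 ≤ R⁻¹ * F n o ^ 2 := ✓
          linarith
        · rw [min_eq_right h.le, ← sq_abs, inv_mul_eq_div]
          have : |F n o| ≤ |F n o| ^ 2 / R := by rw [le_div_iff₀ hR0]; nlinarith
          linarith
    _ = ∫⁻ o, ofReal (min |F n o| R) ∂μ + ofReal R⁻¹ * ∫⁻ o, ofReal (F n o ^ 2) ∂μ := by
      rw [lintegral_add_left ((hF n).abs.min measurable_const).ennreal_ofReal,
        lintegral_const_mul _ ((hF n).pow_const 2).ennreal_ofReal]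
    _ ≤ ε / 2 + ε / 2 := by
      refine add_le_add h2 ((mul_le_mul_right h1 _).trans (le_trans (le_of_eq ?_) hR))
      rw [← ofReal_mul ✓, inv_mul_eq_div]
    _ = ε := by simp

namespace OneStep

theorem tendsto_setLIntegral_unlimited_inter (h : W.OneStep u C α β ν) (hβ : β < 1 + α) {B : Set Ω}
  (hB : MeasurableSet[W.history 0] B) {k : ℝ}
  (hk : ∀ o ∈ B, u ⊙ W.Z 0 o ≤ k) :
  Tendsto (fun n : ℕ => ∫⁻ o in W.Unlimited ∩ B, ofReal
    |(n : ℝ) ^ (-(1 / (1 - α))) * (u ⊙ W.Z n o) - (C * (1 - α)) ^ (1 / (1 - α))| ∂P)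
    atTop (𝓝 0) := by
  have hs : 0 < 1 - α := sub_pos.2 h.α_lt
  have hC := h.C_pos
  obtain ⟨K, hK, hb⟩ := h.exists_second_moment
  have hBm := W.history.le 0 _ hB
  set c := (C * (1 - α)) ^ (1 / (1 - α)) with hc
  have hc0 : 0 ≤ c := ✓
  refine tendsto_lintegral_abs_of_sq_bounded (M := 2 * (K * (k ^ 2 + 1)) + 2 * c ^ 2)
    (fun n => ((W.measurable_dot_Z u n).const_mul _).sub_const _) ?_ ?_
  · filter_upwards [eventually_ge_atTop 1] with n hn
    have hn0 : (1 : ℝ) ≤ n := by exact_mod_cast hn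
    set N := (n : ℝ) ^ (1 / (1 - α)) with hN
    have hN1 : 1 ≤ N := one_le_rpow hn0 ✓
    have hN2 : (n : ℝ) ^ (2 / (1 - α)) = N ^ 2 := by
      rw [hN, ← rpow_natCast, ← rpow_mul (cast_nonneg n)]
      congr 1; push_cast; ring
    have hmom := hb B hB n n le_rfl hn
    rw [hN2] at hmom
    have h0 : ∫⁻ o in B, ofReal ((u ⊙ W.Z 0 o) ^ 2) ∂P ≤ ofReal (k ^ 2) := by
      refine (setLIntegral_mono' hBm (g := fun _ => ofReal (k ^ 2))
        fun o ho => ofReal_le_ofReal (pow_le_pow_left₀ (dot_nonneg h.u_pos _) (hk o ho) 2)).trans ?_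
      exact (setLIntegral_const B _).le.trans (mul_le_of_le_one_right' prob_le_one)
    have h1 : ∫⁻ o in B, ofReal ((u ⊙ W.Z n o) ^ 2) ∂P ≤ ofReal (K * (k ^ 2 + N ^ 2)) := by
      refine hmom.trans ?_
      rw [ofReal_mul hK.le, ofReal_add (sq_nonneg k) (sq_nonneg N)]
      exact mul_le_mul_right (add_le_add h0 (mul_le_of_le_one_right' prob_le_one)) _
    have hm : Measurable fun o => ofReal ((u ⊙ W.Z n o) ^ 2) :=
      ((W.measurable_dot_Z u n).pow_const 2).ennreal_ofReal
    rw [rpow_neg (cast_nonneg n), ← hN]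
    calc _ ≤ ∫⁻ o in W.Unlimited ∩ B, (ofReal (2 * N⁻¹ ^ 2) *
          ofReal ((u ⊙ W.Z n o) ^ 2) + ofReal (2 * c ^ 2)) ∂P := by
          refine lintegral_mono fun o => ?_
          rw [← ofReal_mul ✓, ← ofReal_add ✓ ✓]
          refine ofReal_le_ofReal ?_
          nlinarith [sq_nonneg (N⁻¹ * (u ⊙ W.Z n o) + c)]
      _ ≤ ∫⁻ o in B, (ofReal (2 * N⁻¹ ^ 2) * ofReal ((u ⊙ W.Z n o) ^ 2) + ofReal (2 * c ^ 2)) ∂P :=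
        lintegral_mono_set Set.inter_subset_right
      _ ≤ ofReal (2 * N⁻¹ ^ 2) * ofReal (K * (k ^ 2 + N ^ 2)) + ofReal (2 * c ^ 2) := by
        rw [lintegral_add_right _ measurable_const, lintegral_const_mul _ hm]
        exact add_le_add (mul_le_mul_right h1 _)
          ((setLIntegral_const B _).le.trans (mul_le_of_le_one_right' prob_le_one))
      _ ≤ _ := by
        rw [← ofReal_mul ✓, ← ofReal_add ✓ ✓]
        refine ofReal_le_ofReal ?_
        have e1 : N⁻¹ ^ 2 * N ^ 2 = 1 := by field_simp
        have e2 : N⁻¹ ^ 2 ≤ 1 := pow_le_one₀ ✓ (inv_le_one_of_one_le₀ hN1)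
        have e3 : N⁻¹ ^ 2 * (K * (k ^ 2 + N ^ 2)) ≤ K * (k ^ 2 + 1) := by
          have : K * k ^ 2 * N⁻¹ ^ 2 ≤ K * k ^ 2 * 1 := by gcongr
          calc _ = K * k ^ 2 * N⁻¹ ^ 2 + K * (N⁻¹ ^ 2 * N ^ 2) := by ring
            _ ≤ _ := by rw [e1]; linarith
        linarith
  · rw [ae_restrict_iff' (W.measurableSet_unlimited.inter hBm)]
    filter_upwards [h.ae_tendsto_rpow_div hβ] with o ho hoA
    have t := (ho hoA.1).rpow_const (p := 1 / (1 - α)) (Or.inr ✓)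
    rw [mul_comm (1 - α) C, ← hc] at t
    have t' := t.sub_const c
    rw [sub_self] at t'
    refine t'.congr fun n => ?_
    have hx := dot_nonneg h.u_pos (W.Z n o)
    rw [div_rpow ✓ (cast_nonneg n), ← rpow_mul hx,
      mul_one_div_cancel hs.ne', rpow_one, rpow_neg (cast_nonneg n)]
    ring

theorem tendsto_setLIntegral_unlimited (h : W.OneStep u C α β ν) (hβ : β < 1 + α)
  (hx0 : ∫⁻ o, ofReal (u ⊙ W.Z 0 o) ∂P ≠ ⊤) :
  Tendsto (fun n : ℕ => ∫⁻ o in W.Unlimited, ofReal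
    |(n : ℝ) ^ (-(1 / (1 - α))) * (u ⊙ W.Z n o) - (C * (1 - α)) ^ (1 / (1 - α))| ∂P)
    atTop (𝓝 0) := by
  have hs : 0 < 1 - α := sub_pos.2 h.α_lt
  have hC := h.C_pos
  obtain ⟨K, hK, hb⟩ := h.exists_first_moment
  set c := (C * (1 - α)) ^ (1 / (1 - α)) with hc
  have hc0 : 0 ≤ c := ✓
  choose k hk0 hk using fun m : ℕ => W.exists_measureReal_start_gt_le u
    (Nat.one_div_pos_of_nat (α := ℝ) (n := m))
  set B : ℕ → Set Ω := fun m => {o | u ⊙ W.Z 0 o ≤ k m} with hBdef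
  have hB : ∀ m, MeasurableSet[W.history 0] (B m) := fun m => W.measurableSet_Z 0 {z | u ⊙ z ≤ k m}
  have hBm : ∀ m, MeasurableSet (B m) := fun m => W.history.le 0 _ (hB m)
  have hP : Tendsto (fun m => P (B m)ᶜ) atTop (𝓝 0) := by
    have : Tendsto (fun m : ℕ => ofReal (1 / ((m : ℝ) + 1))) atTop (𝓝 0) := by
      simpa using tendsto_ofReal tendsto_one_div_add_atTop_nhds_zero_nat
    refine tendsto_of_tendsto_of_tendsto_of_le_of_le tendsto_const_nhds this (fun _ => zero_le)
      fun m => ?_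
    rw [← ofReal_measureReal]
    refine ofReal_le_ofReal (le_trans (le_of_eq ?_) (hk m))
    congr 1
    ext o
    simp [hBdef]
  have hr : Tendsto (fun m => ofReal K * (∫⁻ o in (B m)ᶜ, ofReal (u ⊙ W.Z 0 o) ∂P + P (B m)ᶜ) +
    ofReal c * P (B m)ᶜ) atTop (𝓝 0) := by
    have := (ENNReal.Tendsto.const_mul ((tendsto_setLIntegral_zero hx0 hP).add hP)
      (Or.inr (ofReal_ne_top (r := K)))).add
      (ENNReal.Tendsto.const_mul hP (Or.inr (ofReal_ne_top (r := c))))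
    simpa using this
  refine tendsto_nhds_zero.2 fun ε hε => ?_
  obtain ⟨m, hm⟩ := (tendsto_nhds_zero.1 hr (ε / 2) (ENNReal.half_pos hε.ne')).exists
  filter_upwards [tendsto_nhds_zero.1 (h.tendsto_setLIntegral_unlimited_inter hβ (hB m)
    (k := k m) fun o ho => ho) (ε / 2) (ENNReal.half_pos hε.ne'), eventually_ge_atTop 1] with n h1 hn
  have hn0 : (1 : ℝ) ≤ n := by exact_mod_cast hn
  set N := (n : ℝ) ^ (1 / (1 - α)) with hN
  have hN1 : 1 ≤ N := one_le_rpow hn0 ✓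
  rw [rpow_neg (cast_nonneg n), ← hN] at h1 ⊢
  rw [← lintegral_inter_add_sdiff _ W.Unlimited (hBm m), ← ENNReal.add_halves ε]
  refine add_le_add h1 (le_trans ?_ hm)
  calc _ ≤ ∫⁻ o in (B m)ᶜ, (ofReal N⁻¹ * ofReal (u ⊙ W.Z n o) + ofReal c) ∂P := by
        refine (lintegral_mono_set (fun o ho => ho.2)).trans (lintegral_mono fun o => ?_)
        have hx := dot_nonneg h.u_pos (W.Z n o)
        rw [← ofReal_mul ✓, ← ofReal_add ✓ hc0]
        refine ofReal_le_ofReal ?_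
        have : 0 ≤ N⁻¹ * (u ⊙ W.Z n o) := ✓
        rw [abs_le]
        constructor <;> linarith
    _ = ofReal N⁻¹ * ∫⁻ o in (B m)ᶜ, ofReal (u ⊙ W.Z n o) ∂P + ofReal c * P (B m)ᶜ := by
      rw [lintegral_add_right _ measurable_const,
        lintegral_const_mul _ (W.measurable_dot_Z u n).ennreal_ofReal]
      congr 1
      exact setLIntegral_const _ _
    _ ≤ _ := by
      refine add_le_add ?_ le_rfl
      refine (mul_le_mul_right (hb _ (hB m).compl n n le_rfl hn) _).trans ?_
      rw [mul_left_comm]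
      refine mul_le_mul_right ?_ _
      rw [mul_add, ← mul_assoc, ← ofReal_mul ✓, inv_mul_cancel₀ ✓, ENNReal.ofReal_one, one_mul]
      refine add_le_add (mul_le_of_le_one_left' ?_) le_rfl
      exact ENNReal.ofReal_le_one.2 (inv_le_one_of_one_le₀ hN1)

/-- Convergence in `L¹`. -/
theorem tendsto_eLpNorm (h : W.OneStep u C α β ν) (huv : W.PerronVectors u v)
  (hm : W.meanMatrix.IsPrimitive) (hβ : β < 1 + α)
  (hint : Integrable (fun o => realVec (W.Z 0 o)) P) :
  Tendsto (fun n : ℕ => eLpNorm (fun o => (n : ℝ) ^ (1 / (α - 1)) • realVec (W.Z n o) -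
    (C * (1 - α)) ^ (1 / (1 - α)) • v) 1 (P.restrict W.Unlimited)) atTop (𝓝 0) := by
  have hx0 : ∫⁻ o, ofReal (u ⊙ W.Z 0 o) ∂P ≠ ⊤ := by
    have : Integrable (fun o => u ⊙ W.Z 0 o) P :=
      integrable_finsetSum _ fun i _ => (hint.eval i).const_mul (u i)
    exact ((hasFiniteIntegral_iff_ofReal (ae_of_all _ fun o => dot_nonneg h.u_pos _)).1 this.2).ne
  obtain ⟨K, hK, hb⟩ := h.exists_transversal_bound huv hm
  set c := (C * (1 - α)) ^ (1 / (1 - α)) with hc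
  set D := ∑ i, (u i)⁻¹ with hD
  have hs : 0 < 1 - α := sub_pos.2 h.α_lt
  have hD0 : 0 ≤ D := sum_nonneg fun i _ => (inv_pos.2 (h.u_pos i)).le
  have hnorm : ∀ w : Vec, ‖w‖ ≤ D * weightedNorm u w := fun w => by
    refine (pi_norm_le_iff_of_nonneg (mul_nonneg hD0 (weightedNorm_nonneg h.u_pos w))).2 fun i => ?_
    have h1 : u i * |w i| ≤ weightedNorm u w := single_le_sum
      (f := fun j => u j * |w j|) (fun j _ => mul_nonneg (h.u_pos j).le (abs_nonneg _))
      (mem_univ i)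
    have h2 : (u i)⁻¹ ≤ D := single_le_sum (f := fun j => (u j)⁻¹)
      (fun j _ => (inv_pos.2 (h.u_pos j)).le) (mem_univ i)
    calc ‖w i‖ = (u i)⁻¹ * (u i * |w i|) := by
          rw [inv_mul_cancel_left₀ (h.u_pos i).ne', norm_eq_abs]
      _ ≤ _ := mul_le_mul h2 h1 (mul_nonneg (h.u_pos i).le (abs_nonneg _)) hD0
  have t1 := ENNReal.Tendsto.const_mul (h.tendsto_setLIntegral_unlimited hβ hx0)
    (Or.inr (ofReal_ne_top (r := ‖v‖)))
  have t2 : Tendsto (fun n : ℕ => ofReal (D * K * ((n : ℝ) ^ (max α (β / 2) / (1 - α)) /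
    (n : ℝ) ^ (1 / (1 - α)))) * (1 + ∫⁻ o, ofReal (u ⊙ W.Z 0 o) ∂P))
    atTop (𝓝 0) := by
    have t3 := tendsto_ofReal ((tendsto_rpow_div_rpow_zero (a := max α (β / 2) / (1 - α))
      (b := 1 / (1 - α)) (by gcongr; exact h.max_lt_one)).const_mul (D * K))
    simpa using ENNReal.Tendsto.mul_const t3 (Or.inr (ENNReal.add_ne_top.2 ⟨ENNReal.one_ne_top, hx0⟩))
  have t := t1.add t2
  rw [mul_zero, add_zero] at t
  refine tendsto_of_tendsto_of_tendsto_of_le_of_le' tendsto_const_nhds t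
    (Eventually.of_forall fun _ => zero_le) ?_
  filter_upwards [eventually_ge_atTop 1] with n hn
  have hN : (n : ℝ) ^ (1 / (α - 1)) = (n : ℝ) ^ (-(1 / (1 - α))) := by
    rw [← neg_sub 1 α, one_div_neg_eq_neg_one_div]
  have htm : Measurable fun o => ofReal (weightedNorm u (transversal u v (W.Z n o))) :=
    (measurable_of_countable fun z : Pop =>
      ofReal (weightedNorm u (transversal u v z))).comp (W.measurable_Z n)
  have hdm : Measurable fun o => ofReal
    |(n : ℝ) ^ (-(1 / (1 - α))) * (u ⊙ W.Z n o) - c| :=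
    (((W.measurable_dot_Z u n).const_mul _).sub_const _).abs.ennreal_ofReal
  rw [eLpNorm_one_eq_lintegral_enorm, hN]
  set N := (n : ℝ) ^ (-(1 / (1 - α))) with hNdef
  have hN0 : 0 ≤ N := ✓
  calc _ ≤ ∫⁻ o in W.Unlimited, (ofReal ‖v‖ * ofReal |N * (u ⊙ W.Z n o) - c| + ofReal (D * N) *
              ofReal (weightedNorm u (transversal u v (W.Z n o)))) ∂P := by
        refine lintegral_mono fun o => ?_
        have hw := weightedNorm_nonneg h.u_pos (transversal u v (W.Z n o))
        rw [← ofReal_mul ✓, ← ofReal_mul ✓, ← ofReal_add ✓ ✓, ← ofReal_norm]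
        refine ofReal_le_ofReal ?_
        have e : N • realVec (W.Z n o) - c • v = (N * (u ⊙ W.Z n o) - c) • v +
          N • transversal u v (W.Z n o) := by
          simp only [transversal, smul_sub, sub_smul, smul_smul]
          abel
        rw [e]
        refine (norm_add_le _ _).trans (add_le_add ?_ ?_)
        · rw [norm_smul, norm_eq_abs, mul_comm]
        · rw [norm_smul, norm_of_nonneg hN0]
          have := mul_le_left (hnorm (transversal u v (W.Z n o))) hN0
          linarith
    _ ≤ _ := by
      rw [lintegral_add_left (hdm.const_mul _), lintegral_const_mul _ hdm,
        lintegral_const_mul _ htm]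
      refine add_le_add le_rfl ?_
      refine (mul_le_mul_right ((lintegral_mono_set (Set.subset_univ _)).trans
        (hb Set.univ MeasurableSet.univ n hn)) _).trans (le_of_eq ?_)
      rw [← mul_assoc, ← ofReal_mul ✓, Measure.restrict_univ]
      congr 2
      rw [hNdef, rpow_neg (cast_nonneg n)]
      ring

end OneStep

/-- A positive function which varies like `C x ^ α`, with its first two derivatives `f₁` and `f₂`,
beyond `x₀`. -/
structure PowerLike (f f₁ f₂ : ℝ → ℝ) (α C M x₀ : ℝ) : Prop where
  one_le_M : 1 ≤ M
  one_le_x₀ : 1 ≤ x₀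
  pos : ∀ x, 0 < x → 0 < f x
  deriv : ∀ x, 0 < x → HasDerivAt f (f₁ x) x
  deriv₂ : ∀ x, 0 < x → HasDerivAt f₁ (f₂ x) x
  le : ∀ x, x₀ ≤ x → f x ≤ M * x ^ α
  ge : ∀ x, x₀ ≤ x → x ^ α / M ≤ f x
  bound₁ : ∀ x, x₀ ≤ x → |f₁ x| ≤ M * x ^ α / x
  bound₂ : ∀ x, x₀ ≤ x → |f₂ x| ≤ M * x ^ α / x ^ 2
  le_self : ∀ x, x₀ ≤ x → M * x ^ α ≤ x
  tendsto : Tendsto (fun x => f x / x ^ α) atTop (𝓝 C)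

lemma abs_sub_le_of_deriv_le {g g' : ℝ → ℝ} {a b D : ℝ} (hab : a ≤ b)
  (hg : ∀ x, a ≤ x → x ≤ b → HasDerivAt g (g' x) x) (hD : ∀ x, a ≤ x → x ≤ b → |g' x| ≤ D) :
  |g b - g a| ≤ D * (b - a) := by
  have := (convex_Icc a b).norm_image_sub_le_of_norm_hasDerivWithin_le (f := g) (f' := g')
    (fun x hx => (hg x hx.1 hx.2).hasDerivWithinAt) (fun x hx => hD x hx.1 hx.2)
    (Set.left_mem_Icc.2 hab) (Set.right_mem_Icc.2 hab)
  rwa [norm_eq_abs, norm_eq_abs, abs_of_nonneg (sub_nonneg.2 hab)] at this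

/-- Growth on a lattice and a bound on the second derivative control a function. -/
theorem exists_powerLike {f : ℝ → ℝ} {α C a : ℝ} (hα0 : 0 < α) (hα : α < 1) (hC : 0 < C) (ha : 0 < a)
  (hpos : ∀ x, 0 < x → 0 < f x) (hf : ContDiffOn ℝ 2 f (Ioi 0))
  (hlat : Tendsto (fun k : ℕ => f (k * a) / (k * a) ^ α) atTop (𝓝 C))
  (hf₂ : (fun x => deriv (deriv f) x) =O[atTop] fun x : ℝ => x ^ (α - 2)) :
  ∃ M x₀ : ℝ, PowerLike f (deriv f) (deriv (deriv f)) α C M x₀ := by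
  have hd : ∀ x, 0 < x → HasDerivAt f (deriv f x) x := fun x hx =>
    ((hf.differentiableOn (by norm_num)).differentiableAt (Ioi_mem_nhds hx)).hasDerivAt
  have hd₂ : ∀ x, 0 < x → HasDerivAt (deriv f) (deriv (deriv f) x) x := fun x hx =>
    ((((contDiffOn_succ_iff_deriv_of_isOpen (n := 1) isOpen_Ioi).1 hf).2.2.differentiableOn
      (by norm_num)).differentiableAt (Ioi_mem_nhds hx)).hasDerivAt
  obtain ⟨K, hK, hK₂⟩ := hf₂.exists_pos
  obtain ⟨x₁, hx₁⟩ := eventually_atTop.1 ((hK₂.bound).and (eventually_ge_atTop (max 1 a)))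
  obtain ⟨k₁, hk₁⟩ := eventually_atTop.1 (hlat.eventually_lt_const (lt_add_one C))
  have hceil : Tendsto (fun x : ℝ => ⌈x / a⌉₊) atTop atTop :=
    tendsto_nat_ceil_atTop.comp (tendsto_id.atTop_div_const ha)
  have b₂ : ∀ x, x₁ ≤ x → |deriv (deriv f) x| ≤ K * x ^ (α - 2) := fun x hx => by
    have h1 := (hx₁ x hx).1
    have h2 : 1 ≤ x := (le_max_left _ _).trans (hx₁ x hx).2
    rwa [norm_eq_abs, norm_of_nonneg ✓] at h1
  have key : ∀ᶠ x in atTop, 1 ≤ x ∧ x₁ ≤ x ∧ x ≤ ⌈x / a⌉₊ * a ∧ (⌈x / a⌉₊ : ℝ) * a ≤ x + a ∧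
    |deriv f x| ≤ (3 * (C + 1) + 3 * K) * x ^ (α - 1) := by
    filter_upwards [eventually_ge_atTop x₁, hceil.eventually_ge_atTop (max k₁ 1)] with x hx hk
    have hx1 : 1 ≤ x := (le_max_left _ _).trans (hx₁ x hx).2
    have hxa : a ≤ x := (le_max_right _ _).trans (hx₁ x hx).2
    have hx0 : 0 < x := by linarith
    set k := ⌈x / a⌉₊ with hkdef
    have l1 : x ≤ k * a := (div_le_iff₀ ha).1 (Nat.le_ceil _)
    have l2 : (k : ℝ) * a ≤ x + a := by
      have := (Nat.ceil_lt_add_one (div_nonneg hx0.le ha.le)).le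
      calc (k : ℝ) * a ≤ (x / a + 1) * a := by gcongr
        _ = x + a := by field_simp
    refine ⟨hx1, hx, l1, l2, ?_⟩
    set t := (k : ℝ) * a with ht
    have ht0 : 0 < t := by linarith
    have g : ∀ m : ℕ, k₁ ≤ m → 0 < (m : ℝ) * a → f (m * a) ≤ (C + 1) * (m * a) ^ α := by
      intro m hm hma
      have := (hk₁ m hm).le
      rwa [div_le_iff₀ ✓] at this
    have g1 := g k (le_trans (le_max_left _ _) hk) ht0
    have g2 := g (2 * k) (le_trans (le_max_left _ _) hk |>.trans (by omega)) (by push_cast; linarith)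
    rw [show ((2 * k : ℕ) : ℝ) * a = 2 * t by push_cast; ring] at g2
    obtain ⟨ξ, hξ, hξ'⟩ := exists_hasDerivAt_eq_slope f (deriv f) (show t < 2 * t by linarith)
      (fun y hy => (hd y (ht0.trans_le hy.1)).continuousAt.continuousWithinAt)
      (fun y hy => hd y (ht0.trans hy.1))
    have q1 := hpos t ht0
    have q2 := hpos (2 * t) (by linarith)
    have e1 : (2 * t) ^ α ≤ 2 * t ^ α := by
      rw [mul_rpow zero_le_two ht0.le]
      refine mul_le_right ?_
      simpa using rpow_le_rpow_of_exponent_le one_le_two hα.le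
    have hξb : |deriv f ξ| ≤ 3 * (C + 1) * x ^ (α - 1) := by
      have h3 : |f (2 * t) - f t| ≤ 3 * (C + 1) * t ^ α := by
        have : (C + 1) * (2 * t) ^ α ≤ (C + 1) * (2 * t ^ α) := by gcongr
        rw [abs_le]; constructor <;> linarith
      have h4 : t ^ (α - 1) ≤ x ^ (α - 1) := rpow_le_rpow_of_nonpos hx0 l1 (by linarith)
      rw [hξ', abs_div, show 2 * t - t = t by ring, abs_of_pos ht0, div_le_iff₀ ht0]
      rw [rpow_sub_one ht0.ne', div_le_iff₀ ht0] at h4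
      have := mul_le_left h4 (by linarith : 0 ≤ 3 * (C + 1))
      linarith
    have h5 := abs_sub_le_of_deriv_le (a := x) (b := ξ) (g := deriv f) (D := K * x ^ (α - 2))
      (by linarith [hξ.1]) (fun y hy _ => hd₂ y (hx0.trans_le hy)) fun y hy _ =>
        (b₂ y (hx.trans hy)).trans (mul_le_left (rpow_le_rpow_of_nonpos hx0 hy (by linarith)) hK.le)
    have h6 : x ^ (α - 2) * x = x ^ (α - 1) := by rw [← Real.rpow_add_one hx0.ne']; ring_nf
    have h7 : K * x ^ (α - 2) * (ξ - x) ≤ 3 * K * x ^ (α - 1) := by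
      rw [← h6]
      have : K * x ^ (α - 2) * (ξ - x) ≤ K * x ^ (α - 2) * (3 * x) :=
        mul_le_left (by linarith [hξ.2])
      linarith
    rw [abs_le] at *
    constructor <;> linarith [h5.1, h5.2, hξb.1, hξb.2]
  have hlim : Tendsto (fun x => f x / x ^ α) atTop (𝓝 C) := by
    have t1 : Tendsto (fun x : ℝ => (⌈x / a⌉₊ : ℝ) * a / x) atTop (𝓝 1) := by
      refine ((tendsto_nat_ceil_div_atTop (R := ℝ)).comp (tendsto_id.atTop_div_const ha)).congr' ?_
      filter_upwards [eventually_gt_atTop 0] with x hx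
      simp only [Function.comp, id]
      field_simp
    have t2 := (hlat.comp hceil).mul (t1.rpow_const (p := α) (Or.inr hα0.le))
    rw [one_rpow, mul_one] at t2
    refine tendsto_of_tendsto_of_dist t2 (squeeze_zero' (g := fun x : ℝ =>
      (3 * (C + 1) + 3 * K) * a * x⁻¹) (Eventually.of_forall fun _ => dist_nonneg) ?_
      (by simpa using tendsto_inv_atTop_zero.const_mul ((3 * (C + 1) + 3 * K) * a)))
    obtain ⟨x₂, hx₂⟩ := eventually_atTop.1 key
    filter_upwards [eventually_ge_atTop x₂] with x hx
    obtain ⟨h1, -, h2, h3, -⟩ := hx₂ x hx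
    have hx0 : 0 < x := by linarith
    simp only [Function.comp]
    set t := (⌈x / a⌉₊ : ℝ) * a with ht
    have ht0 : 0 < t := by linarith
    have h4 := abs_sub_le_of_deriv_le (a := x) (b := t) (g := f)
      (D := (3 * (C + 1) + 3 * K) * x ^ (α - 1)) h2
      (fun y hy _ => hd y (hx0.trans_le hy)) fun y hy _ =>
        ((hx₂ y (hx.trans hy)).2.2.2.2).trans (mul_le_left
          (rpow_le_rpow_of_nonpos hx0 hy (by linarith)) ✓)
    have e : f t / t ^ α * (t / x) ^ α - f x / x ^ α = (f t - f x) / x ^ α := by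
      rw [div_rpow ht0.le hx0.le]
      field_simp
    rw [dist_eq, e, abs_div, abs_of_pos (✓ : 0 < x ^ α), div_le_iff₀ ✓]
    refine h4.trans ?_
    rw [rpow_sub_one hx0.ne', div_eq_mul_inv]
    have : (3 * (C + 1) + 3 * K) * (x ^ α * x⁻¹) * (t - x) ≤
      (3 * (C + 1) + 3 * K) * (x ^ α * x⁻¹) * a :=
      mul_le_left (by linarith)
    linarith
  set M := max 1 (max (C + 1) (max (2 / C) (3 * (C + 1) + 3 * K))) with hM
  have m1 : 1 ≤ M := le_max_left _ _
  have m2 : C + 1 ≤ M := (le_max_left _ _).trans (le_max_right _ _)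
  have m3 : 2 / C ≤ M := (le_max_left _ _).trans ((le_max_right _ _).trans (le_max_right _ _))
  have m4 : 3 * (C + 1) + 3 * K ≤ M :=
    (le_max_right _ _).trans ((le_max_right _ _).trans (le_max_right _ _))
  obtain ⟨x₀, hx₀⟩ := eventually_atTop.1 (((key.and (hlim.eventually_lt_const (lt_add_one C))).and
    (hlim.eventually_const_lt (half_lt_self hC))).and
    ((tendsto_rpow_atTop (sub_pos.2 hα)).eventually_ge_atTop M))
  have hx0 : ∀ x, max x₀ 1 ≤ x → 0 < x := fun x hx =>
    zero_lt_one.trans_le ((le_max_right _ _).trans hx)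
  have hx0' : ∀ x, max x₀ 1 ≤ x → x₀ ≤ x := fun x hx => (le_max_left _ _).trans hx
  refine ⟨M, max x₀ 1, m1, le_max_right _ _, hpos, hd, hd₂, fun x hx => ?_, fun x hx => ?_,
    fun x hx => ?_, fun x hx => ?_, fun x hx => ?_, hlim⟩
  · have hp := hx0 x hx
    have h1 := (hx₀ x (hx0' x hx)).1.1.2
    rw [div_lt_iff₀ ✓] at h1
    exact h1.le.trans (mul_le_right m2)
  · have hp := hx0 x hx
    have h1 := (hx₀ x (hx0' x hx)).1.2
    rw [lt_div_iff₀ ✓] at h1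
    refine le_trans ?_ h1.le
    rw [div_le_iff₀ (by linarith)]
    rw [div_le_iff₀ hC] at m3
    have : 0 ≤ x ^ α := ✓
    nlinarith
  · have hp := hx0 x hx
    have h1 := (hx₀ x (hx0' x hx)).1.1.1.2.2.2.2
    rw [rpow_sub_one hp.ne'] at h1
    refine h1.trans ?_
    rw [mul_div_assoc]
    exact mul_le_right m4
  · have hp := hx0 x hx
    have h1 := b₂ x (hx₀ x (hx0' x hx)).1.1.1.2.1
    rw [rpow_sub hp, rpow_two] at h1
    refine h1.trans ?_
    rw [mul_div_assoc]
    exact mul_le_right (by linarith)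
  · have hp := hx0 x hx
    have h1 := (hx₀ x (hx0' x hx)).2
    rw [rpow_sub hp, rpow_one, le_div_iff₀ ✓] at h1
    exact h1

/-- A change of scale `H`, with derivative `H₁`, which advances by about one under
`x ↦ x + f x`. -/
structure Clock (f H H₁ : ℝ → ℝ) (α C K x₀ : ℝ) : Prop where
  one_le_x₀ : 1 ≤ x₀
  K_pos : 0 < K
  deriv : ∀ x, x₀ ≤ x → HasDerivAt H (H₁ x) x
  tendsto : Tendsto (fun x => H₁ x * x ^ α) atTop (𝓝 C⁻¹)
  bound : ∀ x, x₀ ≤ x → |H₁ x| ≤ K / x ^ α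
  lipschitz : ∀ x y y', x₀ ≤ x → x ≤ y → x ≤ y' → |H₁ y - H₁ y'| ≤ K / (x * x ^ α) * |y - y'|
  step : ∀ x, x₀ ≤ x → |H (x + f x) - H x - 1| ≤ K * (x ^ α / x) ^ 2

lemma clock_deriv_algebra {h k h₁ k₁ t r : ℝ} (hh : h ≠ 0) (hk : k ≠ 0) (hr : k = h + h₁ * t + r) :
  (1 / k + k₁ / (2 * k)) - (1 / h + h₁ / 2 * (1 / h - 2 * t / h ^ 2)) =
    (-h * r + h₁ ^ 2 * t ^ 2 + h₁ * t * r) / (k * h ^ 2) +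
      ((k₁ - h₁) * h - h₁ * (k - h)) / (2 * k * h) := by
  field_simp
  subst hr
  ring

lemma clock_deriv_bound {h k h₁ k₁ t r M X x : ℝ} (hM : 1 ≤ M) (hX : 0 < X) (hx : 0 < x)
  (hMX : M * X ≤ x) (hh : h ≤ M * X) (hh' : X / M ≤ h) (hk' : X / M ≤ k)
  (hr : k = h + h₁ * t + r) (ht0 : 0 ≤ t) (ht : t ≤ M * X) (b₁ : |h₁| ≤ M * X / x)
  (bk : |k₁ - h₁| ≤ M * X / x ^ 2 * t) (br : |r| ≤ M * X / x ^ 2 * t ^ 2) :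
  |(1 / k + k₁ / (2 * k)) - (1 / h + h₁ / 2 * (1 / h - 2 * t / h ^ 2))| ≤
    6 * M ^ 7 * X / x ^ 2 := by
  have hM0 : 0 < M := by linarith
  have hh0 : 0 < h := (div_pos hX hM0).trans_le hh'
  have hk0 : 0 < k := (div_pos hX hM0).trans_le hk'
  have ah : |h| ≤ M * X := by rwa [abs_of_pos hh0]
  have ar : |r| ≤ M ^ 3 * X ^ 3 / x ^ 2 := br.trans (by
    calc M * X / x ^ 2 * t ^ 2 ≤ M * X / x ^ 2 * (M * X) ^ 2 := by gcongr
      _ = _ := by ring)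
  have aht : |h₁ * t| ≤ M ^ 2 * X ^ 2 / x := by
    rw [abs_mul, abs_of_nonneg ht0]
    calc |h₁| * t ≤ M * X / x * (M * X) := by gcongr
      _ = _ := by ring
  have e1 : M ^ 2 * X ^ 2 / x ≤ M * X := by
    rw [div_le_iff₀ hx]
    nlinarith [mul_le_left hMX (✓ : 0 ≤ M * X)]
  have n1 : |-h * r + h₁ ^ 2 * t ^ 2 + h₁ * t * r| ≤ 3 * (M ^ 4 * X ^ 4 / x ^ 2) := by
    have a1 : |-h * r| ≤ M ^ 4 * X ^ 4 / x ^ 2 := by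
      rw [abs_mul, abs_neg]
      calc _ ≤ M * X * (M ^ 3 * X ^ 3 / x ^ 2) := by gcongr
        _ = _ := by ring
    have a2 : |h₁ ^ 2 * t ^ 2| ≤ M ^ 4 * X ^ 4 / x ^ 2 := by
      rw [← mul_pow, abs_pow]
      calc _ ≤ (M ^ 2 * X ^ 2 / x) ^ 2 := by gcongr
        _ = _ := by ring
    have a3 : |h₁ * t * r| ≤ M ^ 4 * X ^ 4 / x ^ 2 := by
      rw [abs_mul (h₁ * t) r]
      calc _ ≤ M * X * (M ^ 3 * X ^ 3 / x ^ 2) := mul_le_mul (aht.trans e1) ar (abs_nonneg _) ✓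
        _ = _ := by ring
    have := abs_add_three (-h * r) (h₁ ^ 2 * t ^ 2) (h₁ * t * r)
    linarith
  have n2 : |(k₁ - h₁) * h - h₁ * (k - h)| ≤ 3 * (M ^ 3 * X ^ 3 / x ^ 2) := by
    have a1 : |(k₁ - h₁) * h| ≤ M ^ 3 * X ^ 3 / x ^ 2 := by
      rw [abs_mul]
      calc _ ≤ M * X / x ^ 2 * (M * X) * (M * X) := mul_le_mul (bk.trans
            (mul_le_left ht)) ah (abs_nonneg _) ✓
        _ = _ := by ring
    have a2 : |h₁ * (k - h)| ≤ 2 * (M ^ 3 * X ^ 3 / x ^ 2) := by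
      have a3 : |k - h| ≤ 2 * (M ^ 2 * X ^ 2 / x) := by
        rw [show k - h = h₁ * t + r by rw [hr]; ring]
        have a4 : M ^ 3 * X ^ 3 / x ^ 2 ≤ M ^ 2 * X ^ 2 / x := by
          calc M ^ 3 * X ^ 3 / x ^ 2 = M ^ 2 * X ^ 2 / x * (M * X / x) := by ring
            _ ≤ M ^ 2 * X ^ 2 / x * 1 := mul_le_left ((div_le_one hx).2 hMX)
            _ = _ := mul_one _
        linarith [abs_add_le (h₁ * t) r]
      rw [abs_mul]
      calc _ ≤ M * X / x * (2 * (M ^ 2 * X ^ 2 / x)) := by gcongr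
        _ = _ := by ring
    have := abs_sub ((k₁ - h₁) * h) (h₁ * (k - h))
    linarith
  rw [clock_deriv_algebra hh0.ne' hk0.ne' hr]
  have d1 : X ^ 3 / M ^ 3 ≤ k * h ^ 2 := by
    calc X ^ 3 / M ^ 3 = X / M * (X / M) ^ 2 := by ring
      _ ≤ _ := by gcongr
  have d2 : X ^ 2 / M ^ 2 ≤ 2 * k * h := by
    have := mul_le_mul hk' hh' ✓ hk0.le
    calc X ^ 2 / M ^ 2 = X / M * (X / M) := by ring
      _ ≤ _ := by nlinarith
  refine (abs_add_le _ _).trans ?_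
  rw [abs_div, abs_div, abs_of_pos (✓ : 0 < k * h ^ 2), abs_of_pos (✓ : 0 < 2 * k * h)]
  have f1 := div_le_div₀ ✓ n1 ✓ d1
  have f2 := div_le_div₀ ✓ n2 ✓ d2
  have g1 : 3 * (M ^ 4 * X ^ 4 / x ^ 2) / (X ^ 3 / M ^ 3) = 3 * (M ^ 7 * X / x ^ 2) := by field_simp
  have g2 : 3 * (M ^ 3 * X ^ 3 / x ^ 2) / (X ^ 2 / M ^ 2) = 3 * (M ^ 5 * X / x ^ 2) := by field_simp
  have g3 : M ^ 5 * X / x ^ 2 ≤ M ^ 7 * X / x ^ 2 := by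
    gcongr
    norm_num
  rw [g1] at f1
  rw [g2] at f2
  calc _ ≤ 3 * (M ^ 7 * X / x ^ 2) + 3 * (M ^ 7 * X / x ^ 2) := by linarith
    _ = _ := by ring

theorem PowerLike.exists_clock {f f₁ f₂ : ℝ → ℝ} {α C M x₀ : ℝ} (h : PowerLike f f₁ f₂ α C M x₀)
  (hα0 : 0 < α) (hα : α < 1) (hC : 0 < C) :
  ∃ (H H₁ : ℝ → ℝ) (K : ℝ), Clock f H H₁ α C K x₀ := by
  have hM := h.one_le_M
  have hp : ∀ x, x₀ ≤ x → 0 < x := fun x hx => by linarith [h.one_le_x₀]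
  have hcont : ContinuousOn (fun x => 1 / f x) (Ioi 0) := fun x hx =>
    (continuousAt_const.div (h.deriv x hx).continuousAt (h.pos x hx).ne').continuousWithinAt
  set H : ℝ → ℝ := fun x => (∫ t in (1 : ℝ)..x, 1 / f t) + log (f x) / 2 with hH
  set H₁ : ℝ → ℝ := fun x => 1 / f x + f₁ x / (2 * f x) with hH₁
  have hd : ∀ x, 0 < x → HasDerivAt H (H₁ x) x := fun x hx => by
    have i1 : HasDerivAt (fun x => ∫ t in (1 : ℝ)..x, 1 / f t) (1 / f x) x :=
      intervalIntegral.integral_hasDerivAt_right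
        ((hcont.mono fun y hy => (lt_min one_pos hx).trans_le hy.1).intervalIntegrable)
        (hcont.stronglyMeasurableAtFilter isOpen_Ioi x hx) (hcont.continuousAt (Ioi_mem_nhds hx))
    have i2 := ((h.deriv x hx).log (h.pos x hx).ne').div_const 2
    have e : H₁ x = 1 / f x + f₁ x / f x / 2 := by rw [div_div, mul_comm (f x) 2]
    rw [e]
    exact i1.fun_add i2
  set H₂ : ℝ → ℝ := fun x => -f₁ x / f x ^ 2 + (f₂ x * (2 * f x) - f₁ x * (2 * f₁ x)) / (2 * f x) ^ 2
    with hH₂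
  have hd₂ : ∀ x, 0 < x → HasDerivAt H₁ (H₂ x) x := fun x hx => by
    have i0 := (h.deriv x hx).fun_inv (h.pos x hx).ne'
    have i1 := (h.deriv₂ x hx).fun_div ((h.deriv x hx).const_mul 2)
      (mul_ne_zero two_ne_zero (h.pos x hx).ne')
    simpa only [hH₁, one_div] using i0.fun_add i1
  have b₂ : ∀ x, x₀ ≤ x → |H₂ x| ≤ 2 * M ^ 3 / (x * x ^ α) := fun x hx => by
    have hx0 := hp x hx
    have hX : 0 < x ^ α := ✓
    have hf0 := h.pos x hx0
    have c1 := h.bound₁ x hx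
    have c2 := h.bound₂ x hx
    have c3 := h.ge x hx
    have c4 := h.le x hx
    have c5 := h.le_self x hx
    set X := x ^ α
    have q : X ^ 2 / M ^ 2 ≤ f x ^ 2 := by rw [← div_pow]; exact pow_le_pow_left₀ ✓ c3 2
    have a1 : |-f₁ x / f x ^ 2| ≤ M ^ 3 / (x * X) := by
      rw [abs_div, abs_neg, abs_of_pos (✓ : 0 < f x ^ 2)]
      refine (div_le_div₀ ✓ c1 ✓ q).trans (le_of_eq ?_)
      field_simp
    have a2 : |f₂ x * (2 * f x) - f₁ x * (2 * f₁ x)| ≤ 4 * (M ^ 2 * X ^ 2 / x ^ 2) := by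
      have e1 : |f₂ x * (2 * f x)| ≤ 2 * (M ^ 2 * X ^ 2 / x ^ 2) := by
        rw [abs_mul, abs_of_pos (✓ : 0 < 2 * f x)]
        calc _ ≤ M * X / x ^ 2 * (2 * (M * X)) := by gcongr
          _ = _ := by ring
      have e2 : |f₁ x * (2 * f₁ x)| ≤ 2 * (M ^ 2 * X ^ 2 / x ^ 2) := by
        rw [abs_mul, abs_mul, abs_two]
        calc _ ≤ M * X / x * (2 * (M * X / x)) := by gcongr
          _ = _ := by ring
      linarith [abs_sub (f₂ x * (2 * f x)) (f₁ x * (2 * f₁ x))]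
    have a3 : |(f₂ x * (2 * f x) - f₁ x * (2 * f₁ x)) / (2 * f x) ^ 2| ≤ M ^ 3 / (x * X) := by
      rw [abs_div, abs_of_pos (✓ : 0 < (2 * f x) ^ 2)]
      refine (div_le_div₀ ✓ a2 (d := 4 * (X ^ 2 / M ^ 2)) ✓
        (by linarith [mul_pow 2 (f x) 2])).trans ?_
      calc _ = M ^ 3 / (x * X) * (M * X / x) := by field_simp
        _ ≤ M ^ 3 / (x * X) * 1 := mul_le_left ((div_le_one hx0).2 c5)
        _ = _ := mul_one _
    refine (abs_add_le _ _).trans ((add_le_add a1 a3).trans (le_of_eq ?_))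
    ring
  have small : ∀ x, x₀ ≤ x → |f₁ x / (2 * f x)| ≤ M ^ 2 / x := fun x hx => by
    have hx0 := hp x hx
    have hX : 0 < x ^ α := ✓
    have hf0 := h.pos x hx0
    rw [abs_div, abs_of_pos (✓ : 0 < 2 * f x)]
    refine (div_le_div₀ ✓ (h.bound₁ x hx) (d := x ^ α / M) ✓
      (by linarith [h.ge x hx])).trans (le_of_eq ?_)
    field_simp
  refine ⟨H, H₁, 6 * M ^ 8, h.one_le_x₀, ✓, fun x hx => hd x (hp x hx), ?_,
    fun x hx => ?_, fun x y y' hx hy hy' => ?_, fun x hx => ?_⟩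
  · have t1 : Tendsto (fun x => f₁ x / (2 * f x) * x ^ α) atTop (𝓝 0) := by
      have t2 : Tendsto (fun x : ℝ => M ^ 2 * x ^ (-(1 - α))) atTop (𝓝 0) := by
        simpa using (tendsto_rpow_neg_atTop (sub_pos.2 hα)).const_mul (M ^ 2)
      refine squeeze_zero_norm' ?_ t2
      filter_upwards [eventually_ge_atTop x₀] with x hx
      have hx0 := hp x hx
      rw [norm_mul, norm_eq_abs, norm_of_nonneg ✓, neg_sub, rpow_sub_one hx0.ne']
      refine (mul_le_right (small x hx)).trans (le_of_eq ?_)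
      ring
    have t3 := (h.tendsto.inv₀ hC.ne').add t1
    rw [add_zero] at t3
    refine t3.congr fun x => ?_
    simp only [hH₁, inv_div]
    ring
  · have hx0 := hp x hx
    have hX : 0 < x ^ α := ✓
    have a1 : |1 / f x| ≤ M / x ^ α := by
      rw [abs_of_pos (one_div_pos.2 (h.pos x hx0)), ← one_div_div (x ^ α) M]
      exact one_div_le_one_div_of_le ✓ (h.ge x hx)
    have a2 : M ^ 2 / x ≤ M / x ^ α := by
      rw [div_le_div_iff₀ hx0 hX]
      nlinarith [mul_le_left (h.le_self x hx) (by linarith : 0 ≤ M)]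
    have a3 : M ≤ M ^ 8 := le_self_pow₀ hM (by norm_num)
    have a4 : M / x ^ α + M / x ^ α ≤ 6 * M ^ 8 / x ^ α := by
      rw [← add_div]
      exact div_le_div_of_nonneg_right (by linarith) hX.le
    linarith [abs_add_le (1 / f x) (f₁ x / (2 * f x)), small x hx]
  · have hx0 := hp x hx
    have hK : 2 * M ^ 3 ≤ 6 * M ^ 8 := by
      have : M ^ 3 ≤ M ^ 8 := pow_le_pow_right₀ hM (by norm_num)
      have : 0 < M ^ 3 := ✓
      linarith
    have hb : ∀ w, x ≤ w → |H₂ w| ≤ 6 * M ^ 8 / (x * x ^ α) := fun w hw => by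
      refine (b₂ w (hx.trans hw)).trans (div_le_div₀ ✓ hK ✓ ?_)
      exact mul_le_mul hw (rpow_le_rpow hx0.le hw hα0.le) ✓ (hx0.trans_le hw).le
    have := (convex_Ici x).norm_image_sub_le_of_norm_hasDerivWithin_le (f := H₁) (f' := H₂)
      (fun w hw => (hd₂ w (hx0.trans_le hw)).hasDerivWithinAt) (fun w hw => hb w hw) hy' hy
    exact this
  · have hx0 := hp x hx
    have hX : 0 < x ^ α := ✓
    set X := x ^ α with hXdef
    set a := f x with ha
    have ha0 : 0 < a := h.pos x hx0
    have haM : a ≤ M * X := h.le x hx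
    have b2 : ∀ y, x ≤ y → |f₂ y| ≤ M * X / x ^ 2 := fun y hy => by
      have hy0 := hx0.trans_le hy
      refine (h.bound₂ y (hx.trans hy)).trans ?_
      have := rpow_le_rpow_of_nonpos hx0 hy (by linarith : α - 2 ≤ 0)
      rw [rpow_sub hx0, rpow_sub hy0, rpow_two, rpow_two] at this
      rw [mul_div_assoc, mul_div_assoc]
      exact mul_le_left this (by linarith)
    have bk : ∀ t, 0 ≤ t → |f₁ (x + t) - f₁ x| ≤ M * X / x ^ 2 * t := fun t ht => by
      simpa using abs_sub_le_of_deriv_le (a := x) (b := x + t) (by linarith)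
        (fun y hy _ => h.deriv₂ y (hx0.trans_le hy)) (fun y hy _ => b2 y hy)
    have br : ∀ t, 0 ≤ t → |f (x + t) - a - f₁ x * t| ≤ M * X / x ^ 2 * t ^ 2 := fun t ht => by
      have := abs_sub_le_of_deriv_le (g := fun y => f y - f₁ x * y) (g' := fun y => f₁ y - f₁ x)
        (a := x) (b := x + t) (D := M * X / x ^ 2 * t) (by linarith)
        (fun y hy _ => (h.deriv y (hx0.trans_le hy)).sub
          (by simpa using (hasDerivAt_id y).const_mul (f₁ x))) (fun y hy hy' => by
          have h1 := bk (y - x) (by linarith)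
          rw [add_sub_cancel] at h1
          exact h1.trans (mul_le_left (by linarith)))
      rw [show f (x + t) - a - f₁ x * t = f (x + t) - f₁ x * (x + t) - (f x - f₁ x * x) by
        rw [ha]; ring]
      exact this.trans (le_of_eq (by ring))
    have hF := abs_sub_le_of_deriv_le (a := 0) (b := a) (D := 6 * M ^ 7 * X / x ^ 2) ha0.le
      (g := fun t => H (x + t) - (t / a + f₁ x / 2 * (t / a - t ^ 2 / a ^ 2)))
      (g' := fun t => (1 / f (x + t) + f₁ (x + t) / (2 * f (x + t))) -
        (1 / a + f₁ x / 2 * (1 / a - 2 * t / a ^ 2)))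
      (fun t ht _ => by
        have i1 : HasDerivAt (fun t => H (x + t)) (H₁ (x + t)) t :=
          HasDerivAt.comp_const_add x t (hd (x + t) (by linarith))
        have i2 := (hasDerivAt_id t).div_const a
        have i3 := (hasDerivAt_pow 2 t).div_const (a ^ 2)
        have i4 := i1.fun_sub (i2.fun_add ((i2.fun_sub i3).const_mul (f₁ x / 2)))
        simpa only [id, Nat.cast_ofNat, Nat.add_one_sub_one, pow_one] using i4)
      (fun t ht hta => clock_deriv_bound hM hX hx0 (h.le_self x hx) haM (h.ge x hx)
        ((div_le_div_of_nonneg_right (rpow_le_rpow hx0.le (by linarith) hα0.le)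
          (by linarith)).trans (h.ge (x + t) (by linarith)))
        (show f (x + t) = a + f₁ x * t + (f (x + t) - a - f₁ x * t) by ring) ht
        (hta.trans haM) (h.bound₁ x hx) (bk t ht) (br t ht))
    have e : H (x + a) - (a / a + f₁ x / 2 * (a / a - a ^ 2 / a ^ 2)) -
      (H (x + 0) - (0 / a + f₁ x / 2 * (0 / a - 0 ^ 2 / a ^ 2))) = H (x + a) - H x - 1 := by
      rw [div_self ha0.ne', div_self (pow_ne_zero 2 ha0.ne')]
      simp
      ring
    simp only [e, sub_zero] at hF
    refine hF.trans ?_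
    calc _ ≤ 6 * M ^ 7 * X / x ^ 2 * (M * X) := by gcongr
      _ = _ := by ring

lemma norm_cexp_sub_quadratic_le (y : ℝ) :
  ‖cis y - (1 + y * Complex.I - (y : ℂ) ^ 2 / 2)‖ ≤ 4 * (|y| ^ 2 * min |y| 1) := by
  rcases le_or_gt |y| 1 with h | h
  · have h1 := Complex.exp_bound (x := y * Complex.I) (by simpa using h) (n := 3) (by norm_num)
    simp only [sum_range_succ, Finset.sum_range_zero, Nat.factorial] at h1
    have e : (y * Complex.I) ^ 2 = -(y : ℂ) ^ 2 := by rw [mul_pow, Complex.I_sq]; ring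
    norm_num [e] at h1
    rw [min_eq_left h]
    have h2 : 0 ≤ |y| ^ 3 := ✓
    refine le_trans (le_of_eq ?_) (h1.trans (by linarith [pow_succ |y| 2]))
    congr 1
    ring
  · rw [min_eq_right h.le]
    refine (norm_sub_le _ _).trans ?_
    have h1 : ‖1 + y * Complex.I - (y : ℂ) ^ 2 / 2‖ ≤ 1 + |y| + |y| ^ 2 / 2 := by
      refine (norm_sub_le _ _).trans (add_le_add ((norm_add_le _ _).trans ?_) ?_)
      · simp
      · simp
    rw [Complex.norm_exp_ofReal_mul_I]
    nlinarith

lemma Clock.abs_step_le {f H H₁ : ℝ → ℝ} {α C K x₀ : ℝ} (h : Clock f H H₁ α C K x₀)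
  (hα0 : 0 < α) (hα : α < 1) {x Y : ℝ} (hx : 2 * x₀ ≤ x) (hf0 : 0 ≤ f x) (hfx : f x ≤ x) :
  |H (max Y x₀) - H x - 1 - H₁ (x + f x) * (Y - (x + f x))| ≤
    K * (6 + 8 / (1 - α)) * ((x ^ α / x) ^ 2 + (Y - (x + f x)) ^ 2 / (x * x ^ α)) := by
  have h1 := h.one_le_x₀
  have hK := h.K_pos
  have hs : 0 < 1 - α := sub_pos.2 hα
  have hx0 : 0 < x := by linarith
  have hX : 0 < x ^ α := ✓
  set X := x ^ α with hXdef
  set m := x + f x with hm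
  set ε := Y - m with hε
  have hst := h.step x (by linarith)
  rw [← hm] at hst
  suffices hsuf : |H (max Y x₀) - H m - H₁ m * ε| ≤ K * (6 + 8 / (1 - α)) * (ε ^ 2 / (x * X)) by
    have e : H (max Y x₀) - H x - 1 - H₁ m * ε =
      (H m - H x - 1) + (H (max Y x₀) - H m - H₁ m * ε) := by ring
    rw [e, mul_add]
    refine (abs_add_le _ _).trans (add_le_add (hst.trans ?_) hsuf)
    refine mul_le_right (le_mul_of_one_le_right hK.le ?_) (sq_nonneg _)
    have : 0 < 8 / (1 - α) := ✓
    linarith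
  rcases le_or_gt (x / 2) Y with hY | hY
  · rw [max_eq_left (by linarith)]
    have hseg : ∀ w ∈ Set.uIcc m Y, x / 2 ≤ w ∧ |w - m| ≤ |ε| := fun w hw => by
      refine ⟨?_, Set.abs_sub_left_of_mem_uIcc hw⟩
      have := hw.1
      exact (le_min (by linarith) hY).trans this
    have hmv := (convex_uIcc m Y).norm_image_sub_le_of_norm_hasDerivWithin_le
      (f := fun w => H w - H₁ m * w) (f' := fun w => H₁ w - H₁ m)
      (C := K / (x / 2 * (x / 2) ^ α) * |ε|)
      (fun w hw => ((h.deriv w (by linarith [(hseg w hw).1])).sub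
        (by simpa using (hasDerivAt_id w).const_mul (H₁ m))).hasDerivWithinAt)
      (fun w hw => (h.lipschitz (x / 2) w m (by linarith) (hseg w hw).1 (by linarith)).trans
        (mul_le_left (hseg w hw).2))
      Set.left_mem_uIcc Set.right_mem_uIcc
    have e : H Y - H m - H₁ m * ε = H Y - H₁ m * Y - (H m - H₁ m * m) := by linarith
    rw [e]
    refine hmv.trans ?_
    have e2 : X / 2 ≤ (x / 2) ^ α := by
      rw [div_rpow hx0.le zero_le_two]
      refine div_le_div_of_nonneg_left hX.le ✓ ?_
      simpa using rpow_le_rpow_of_exponent_le one_le_two hα.le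
    have e3 : K / (x / 2 * (x / 2) ^ α) ≤ 4 * K / (x * X) := by
      rw [show 4 * K / (x * X) = K / (x / 2 * (X / 2)) by field_simp; ring]
      exact div_le_div_of_nonneg_left hK.le ✓ (mul_le_left e2)
    rw [norm_eq_abs, ← hε, mul_assoc, ← sq, sq_abs]
    refine (mul_le_right e3 (sq_nonneg ε)).trans ?_
    have : 0 ≤ (2 + 8 / (1 - α)) * K * (ε ^ 2 / (x * X)) := ✓
    linarith [show 4 * K / (x * X) * ε ^ 2 = 4 * K * (ε ^ 2 / (x * X)) by ring]
  · have hεx : x / 2 ≤ |ε| := by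
      rw [abs_sub_comm]; exact (by linarith : x / 2 ≤ m - Y).trans (le_abs_self _)
    have hε2 : x ^ 2 ≤ 4 * ε ^ 2 := by rw [← sq_abs ε]; nlinarith
    have b1 : |H m - H (max Y x₀)| ≤ K * (8 / (1 - α)) * (ε ^ 2 / (x * X)) := by
      have ha0 : 0 < max Y x₀ := ✓
      have hle : max Y x₀ ≤ m := max_le (by linarith) (by linarith)
      have hx₀ : ∀ w ∈ Icc (max Y x₀) m, x₀ ≤ w := fun w hw => (le_max_right _ _).trans hw.1
      have hBd : ∀ w ∈ Icc (max Y x₀) m,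
        HasDerivAt (fun w => K / (1 - α) * w ^ (1 - α)) (K / w ^ α) w := fun w hw => by
        have hw0 : 0 < w := ha0.trans_le hw.1
        have := (Real.hasDerivAt_rpow_const (p := 1 - α) (Or.inl hw0.ne')).const_mul (K / (1 - α))
        rw [show 1 - α - 1 = -α by ring, rpow_neg hw0.le] at this
        rwa [show K / w ^ α = K / (1 - α) * ((1 - α) * (w ^ α)⁻¹) by field_simp]
      have hB := image_norm_le_of_norm_deriv_right_le_deriv_boundary' (a := max Y x₀) (b := m)
        (f := fun w => H w - H (max Y x₀)) (f' := H₁) (B := fun w => K / (1 - α) * w ^ (1 - α))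
        (B' := fun w => K / w ^ α)
        (fun w hw => ((h.deriv w (hx₀ w hw)).continuousAt.sub continuousAt_const).continuousWithinAt)
        (fun w hw => ((h.deriv w (hx₀ w ⟨hw.1, hw.2.le⟩)).sub_const _).hasDerivWithinAt)
        (by simpa using ✓)
        (fun w hw => (hBd w hw).continuousAt.continuousWithinAt)
        (fun w hw => (hBd w ⟨hw.1, hw.2.le⟩).hasDerivWithinAt)
        (fun w hw => h.bound w (hx₀ w ⟨hw.1, hw.2.le⟩)) (Set.right_mem_Icc.2 hle)
      have e1 : m ^ (1 - α) ≤ 2 * x ^ (1 - α) := by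
        refine (rpow_le_rpow (by linarith) (by linarith : m ≤ 2 * x) hs.le).trans ?_
        rw [mul_rpow zero_le_two hx0.le]
        refine mul_le_right ?_
        simpa using rpow_le_rpow_of_exponent_le one_le_two (by linarith : 1 - α ≤ 1)
      rw [Real.rpow_one_sub' hx0.le hs.ne'] at e1
      refine hB.trans ((mul_le_left e1).trans ?_)
      have e2 : x / X ≤ 4 * (ε ^ 2 / (x * X)) := by
        rw [mul_div_assoc', div_le_div_iff₀ hX ✓]
        nlinarith [mul_le_right hε2 hX.le]
      have := mul_le_left e2 (✓ : 0 ≤ 2 * (K / (1 - α)))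
      calc _ = 2 * (K / (1 - α)) * (x / X) := by ring
        _ ≤ _ := this
        _ = _ := by ring
    have b2 : |H₁ m * ε| ≤ K * 2 * (ε ^ 2 / (x * X)) := by
      have e1 : |H₁ m| ≤ K / X := (h.bound m (by linarith)).trans
        (div_le_div_of_nonneg_left hK.le hX (rpow_le_rpow hx0.le (by linarith) hα0.le))
      rw [abs_mul]
      calc _ ≤ K / X * |ε| := by gcongr
        _ ≤ K / X * (2 * (ε ^ 2 / x)) := by
          refine mul_le_left ?_
          rw [mul_div_assoc', le_div_iff₀ hx0, ← sq_abs ε]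
          nlinarith
        _ = _ := by ring
    have b3 := abs_sub (H (max Y x₀) - H m) (H₁ m * ε)
    rw [abs_sub_comm (H (max Y x₀))] at b3
    have : 0 ≤ 4 * K * (ε ^ 2 / (x * X)) := ✓
    linarith

set_option maxHeartbeats 1000000 in
/-- One step of the characteristic function of the process on the scale of a clock. -/
theorem OneStep.charFun_eventually (h : W.OneStep u C α β ν) (hα0 : 0 < α) (hβ : 3 * α - 1 ≤ β)
  (hc : Clock f H H₁ α C K x₀) (hf : ∀ z : Pop, z ≠ 0 → u ⬝ᵥ W.h z = f (u ⊙ z)) :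
  ∃ K' > 0, ∀ η : ℝ, 0 < η → ∃ R > 0, ∀ᶠ z in growing p, ∀ φ : ℝ,
    ‖∫ o, cis (φ * (H (max (u ⊙ W.next z o) x₀) - H (max (u ⊙ z) x₀) - 1)) ∂P -
      (1 - φ ^ 2 * (ν / C ^ 2 * ((u ⊙ z) ^ β / ((u ⊙ z) ^ α) ^ 2)) / 2 : ℝ)‖ ≤
    |φ| * K' * ((u ⊙ z) ^ β / (u ⊙ z * (u ⊙ z) ^ α)) + φ ^ 2 * ((u ⊙ z) ^ β / ((u ⊙ z) ^ α) ^ 2) *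
      (η + R * |φ| * ((u ⊙ z) ^ (β / 2) / (u ⊙ z) ^ α)) := by
  have hK := hc.K_pos
  have hν := h.ν_pos
  have hC := h.C_pos
  have hs : 0 < 1 - α := sub_pos.2 h.α_lt
  have hx₁ := hc.one_le_x₀
  set K₁ := K * (6 + 8 / (1 - α)) with hK₁
  have hK₁0 : 0 < K₁ := ✓
  have hxt := tendsto_dot_growing h.u_pos
  have hfx : Tendsto (fun z => u ⬝ᵥ W.h z / (u ⊙ z)) (growing p) (𝓝 0) := by
    have := h.drift.mul ((tendsto_rpow_neg_atTop hs).comp hxt)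
    rw [mul_zero] at this
    refine this.congr' ?_
    filter_upwards [h.eventually_pos] with z hz
    simp only [Function.comp]
    rw [neg_sub, rpow_sub_one hz.ne']
    have := rpow_pos_of_pos hz α
    field_simp
  have hL : Tendsto (fun z => H₁ (u ⊙ z + u ⬝ᵥ W.h z) * (u ⊙ z) ^ α) (growing p) (𝓝 C⁻¹) := by
    have t2 := hfx.const_mul K
    rw [mul_zero] at t2
    refine tendsto_of_tendsto_of_dist (hc.tendsto.comp hxt)
      (squeeze_zero' (Eventually.of_forall fun _ => dist_nonneg) ?_ t2)
    filter_upwards [hxt.eventually_ge_atTop x₀, h.drift.eventually (lt_mem_nhds hC)] with z hz hd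
    have hz0 : 0 < u ⊙ z := by linarith
    have hX := rpow_pos_of_pos hz0 α
    have hd0 : 0 < u ⬝ᵥ W.h z := by rwa [lt_div_iff₀ hX, zero_mul] at hd
    have := hc.lipschitz _ _ _ hz le_rfl (le_add_of_nonneg_right hd0.le)
    rw [sub_add_cancel_left, abs_neg, abs_of_pos hd0] at this
    simp only [Function.comp]
    rw [dist_eq, ← sub_mul, abs_mul, abs_of_pos hX]
    refine (mul_le_right this hX.le).trans (le_of_eq ?_)
    field_simp
  refine ⟨K₁ * (1 + (ν + 1)), ✓, fun η hη => ?_⟩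
  obtain ⟨l, hl, hlin⟩ := h.lindeberg (η / (8 * K ^ 2)) ✓
  refine ⟨4 * K ^ 3 * l * (ν + 1), ✓, ?_⟩
  have hLv := (((hL.pow 2).mul h.var).sub_const (C⁻¹ ^ 2 * ν)).abs
  rw [sub_self, abs_zero] at hLv
  filter_upwards [hlin, hLv.eventually (gt_mem_nhds hη), hxt.eventually_ge_atTop (2 * x₀),
    h.var.eventually (gt_mem_nhds (lt_add_one ν)), h.drift.eventually (lt_mem_nhds hC),
    hfx.eventually (gt_mem_nhds one_pos)] with z c1 c2 hz c3 c4 c5 φ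
  have hm2 := (h.memLp z).sub (memLp_const (u ⊙ z + u ⬝ᵥ W.h z))
  have hz00 : z ≠ 0 := by
    rintro rfl
    have : u ⊙ (0 : Pop) = 0 := by simp [realVec, dotProduct]
    linarith
  have hfz := hf z hz00
  have hmean := h.mean z
  have hYm := W.measurable_dot_next u z
  have hHm : Measurable fun o => H (max (u ⊙ W.next z o) x₀) :=
    (measurable_of_countable fun z : Pop => H (max (u ⊙ z) x₀)).comp (W.measurable_next z)
  set x := u ⊙ z with hx
  set d := u ⬝ᵥ W.h z with hd
  set Y : Ω → ℝ := fun o => u ⊙ W.next z o with hY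
  have hx0 : 0 < x := by linarith
  set X := x ^ α with hX
  have hX0 : 0 < X := ✓
  have hd0 : 0 < d := by rwa [lt_div_iff₀ hX0, zero_mul] at c4
  rw [div_lt_iff₀ hx0, one_mul] at c5
  set L := H₁ (x + d) with hLdef
  have hLK : |L| ≤ K / X := (hc.bound _ (by linarith)).trans
    (div_le_div_of_nonneg_left hK.le hX0 (rpow_le_rpow hx0.le (by linarith) hα0.le))
  set ε : Ω → ℝ := fun o => Y o - (x + d) with hε
  have hm2' : MemLp ε 2 P := hm2
  have hεi : Integrable ε P := hm2'.integrable one_le_two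
  have hε2i : Integrable (fun o => ε o ^ 2) P := hm2'.integrable_sq
  have hε0 : ∫ o, ε o ∂P = 0 := by
    rw [hε, integral_sub ((h.memLp z).integrable one_le_two) (integrable_const _), hmean]
    simp
  set m₂ := ∫ o, ε o ^ 2 ∂P with hm₂
  have hm₂0 : 0 ≤ m₂ := ✓
  rw [div_lt_iff₀ ✓] at c3
  set S : Set Ω := {o | l * x ^ (β / 2) < |ε o|} with hS
  have hεm : Measurable ε := by fun_prop
  have hSm : MeasurableSet S := measurableSet_lt measurable_const hεm.abs
  have hTi : Integrable (S.indicator fun o => ε o ^ 2) P := by fun_prop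
  set g : Ω → ℂ := fun o => cis (φ * (H (max (Y o) x₀) - H (max x x₀) - 1))
    with hg
  have hgi : Integrable g P := Integrable.of_bound
    ((Complex.measurable_ofReal.comp (((hHm.sub_const _).sub_const _).const_mul φ)).mul_const
      _).cexp.aestronglyMeasurable 1
    (ae_of_all _ fun o => (Complex.norm_exp_ofReal_mul_I _).le)
  set a := φ * L with ha
  set q : Ω → ℂ := fun o => 1 + (a * ε o : ℝ) * Complex.I - ((a * ε o : ℝ) : ℂ) ^ 2 / 2 with hq
  have hqe : ∀ o, q o = 1 + (Complex.I * a * (ε o : ℂ) + -(a ^ 2 / 2) * ((ε o ^ 2 : ℝ) : ℂ)) :=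
    fun o => by simp only [hq]; push_cast; ring
  have hq1 : Integrable (fun o => Complex.I * a * (ε o : ℂ)) P := hεi.ofReal.const_mul _
  have hq2 : Integrable (fun o => -((a : ℂ) ^ 2 / 2) * ((ε o ^ 2 : ℝ) : ℂ)) P :=
    hε2i.ofReal.const_mul _
  have hqi : Integrable q P := by
    rw [show q = _ from funext hqe]
    exact (integrable_const _).add (hq1.fun_add hq2)
  have hqint : ∫ o, q o ∂P = ((1 - a ^ 2 * m₂ / 2 : ℝ) : ℂ) := by
    simp_rw [hqe]
    rw [integral_add (integrable_const _) (hq1.fun_add hq2), integral_add hq1 hq2,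
      integral_const_mul, integral_const_mul, integral_complex_ofReal, integral_complex_ofReal, hε0,
      ← hm₂]
    simp
    ring
  have hX2 : (X / x) ^ 2 ≤ x ^ β / (x * X) := by
    have e1 : X ^ 3 ≤ x ^ β * x := by
      rw [hX, ← rpow_natCast, ← rpow_mul hx0.le, ← Real.rpow_add_one hx0.ne']
      exact rpow_le_rpow_of_exponent_le (by linarith) (by push_cast; linarith)
    rw [div_pow, div_le_div_iff₀ ✓ ✓]
    nlinarith [mul_le_left e1 hx0.le]
  have hpt : ∀ o, ‖g o - q o‖ ≤ |φ| * K₁ * (X / x) ^ 2 + |φ| * K₁ / (x * X) * ε o ^ 2 +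
    4 * (|a| ^ 3 * (l * x ^ (β / 2)) * ε o ^ 2 +
      |a| ^ 2 * S.indicator (fun o => ε o ^ 2) o) := fun o => by
    have b1 : ‖g o - cis (a * ε o)‖ ≤
      |φ| * (K₁ * ((X / x) ^ 2 + ε o ^ 2 / (x * X))) := by
      have e1 := hc.abs_step_le hα0 h.α_lt (x := x) (Y := Y o) hz (by rw [← hfz]; exact hd0.le)
        (by rw [← hfz]; exact c5.le)
      rw [← hfz] at e1
      rw [hg]
      dsimp only
      have e2 : ∀ s t : ℝ, ‖cis s - cis t‖ ≤ |s - t| := fun s t => by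
          have e3 : cis s - cis t = cis t * (Complex.exp (Complex.I * (s - t : ℝ)) - 1) := by
            rw [mul_sub, ← Complex.exp_add]; push_cast; ring_nf
          rw [e3, norm_mul, Complex.norm_exp_ofReal_mul_I, one_mul]
          exact Real.norm_exp_I_mul_ofReal_sub_one_le
      refine (e2 _ _).trans ?_
      rw [ha, show φ * (H (max (Y o) x₀) - H (max x x₀) - 1) - φ * L * ε o =
        φ * (H (max (Y o) x₀) - H x - 1 - L * ε o) by
          rw [max_eq_left (by linarith : x₀ ≤ x)]; ring, abs_mul]
      exact mul_le_left e1 (abs_nonneg _)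
    have b2 : ‖cis (a * ε o) - q o‖ ≤ 4 * (|a| ^ 3 * (l * x ^ (β / 2)) * ε o ^ 2 +
      |a| ^ 2 * S.indicator (fun o => ε o ^ 2) o) := by
      refine (norm_cexp_sub_quadratic_le _).trans (mul_le_left ?_ zero_le_four)
      rw [abs_mul, mul_pow, sq_abs (ε o)]
      by_cases ho : o ∈ S
      · rw [indicator_of_mem ho]
        have : 0 ≤ |a| ^ 3 * (l * x ^ (β / 2)) * ε o ^ 2 := ✓
        refine le_trans (mul_le_left (min_le_right _ _)) ?_
        linarith
      · rw [indicator_of_notMem ho]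
        have ho' : |ε o| ≤ l * x ^ (β / 2) := not_lt.1 ho
        refine le_trans (mul_le_left (min_le_left _ _)) ?_
        calc _ = |a| ^ 3 * ε o ^ 2 * |ε o| := by ring
          _ ≤ |a| ^ 3 * ε o ^ 2 * (l * x ^ (β / 2)) := by gcongr
          _ = _ := by ring
    refine (norm_sub_le_norm_sub_add_norm_sub _ _ _).trans ((add_le_add b1 b2).trans (le_of_eq ?_))
    ring
  have hbound : ‖∫ o, g o ∂P - ((1 - a ^ 2 * m₂ / 2 : ℝ) : ℂ)‖ ≤ |φ| * K₁ * (X / x) ^ 2 +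
    |φ| * K₁ / (x * X) * m₂ + 4 * (|a| ^ 3 * (l * x ^ (β / 2)) * m₂ +
      |a| ^ 2 * ∫ o in S, ε o ^ 2 ∂P) := by
    rw [← hqint, ← integral_sub hgi hqi]
    have i1 := (integrable_const (|φ| * K₁ * (X / x) ^ 2) (μ := P)).fun_add
      (hε2i.const_mul (|φ| * K₁ / (x * X)))
    have i2 := ((hε2i.const_mul (|a| ^ 3 * (l * x ^ (β / 2)))).fun_add
      (hTi.const_mul (|a| ^ 2))).const_mul 4
    refine (norm_integral_le_of_norm_le (i1.fun_add i2) (ae_of_all _ hpt)).trans (le_of_eq ?_)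
    rw [integral_add i1 i2, integral_add (integrable_const _) (hε2i.const_mul _),
      integral_const_mul (4 : ℝ), integral_add (hε2i.const_mul _) (hTi.const_mul _)]
    simp only [integral_const_mul, integral_const, probReal_univ, one_smul, integral_indicator hSm]
    rw [hm₂]
  have ha1 : |a| ≤ |φ| * (K / X) := by rw [ha, abs_mul]; exact mul_le_left hLK (abs_nonneg _)
  have hc1 : ∫ o in S, ε o ^ 2 ∂P ≤ η / (8 * K ^ 2) * x ^ β := c1
  have t1 : |φ| * K₁ * (X / x) ^ 2 ≤ |φ| * K₁ * (x ^ β / (x * X)) := by gcongr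
  have t2 : |φ| * K₁ / (x * X) * m₂ ≤ |φ| * K₁ * (ν + 1) * (x ^ β / (x * X)) := by
    refine (mul_le_left c3.le).trans (le_of_eq ?_)
    ring
  have t3 : |a| ^ 3 * (l * x ^ (β / 2)) * m₂ ≤ φ ^ 2 * (x ^ β / X ^ 2) *
    (K ^ 3 * l * (ν + 1) * |φ| * (x ^ (β / 2) / X)) := by
    have := pow_le_pow_left₀ (abs_nonneg a) ha1 3
    calc _ ≤ (|φ| * (K / X)) ^ 3 * (l * x ^ (β / 2)) * ((ν + 1) * x ^ β) := by gcongr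
      _ = _ := by rw [← sq_abs φ]; ring
  have t4 : |a| ^ 2 * ∫ o in S, ε o ^ 2 ∂P ≤ φ ^ 2 * (x ^ β / X ^ 2) * (η / 8) := by
    have := pow_le_pow_left₀ (abs_nonneg a) ha1 2
    calc _ ≤ (|φ| * (K / X)) ^ 2 * (η / (8 * K ^ 2) * x ^ β) := by gcongr
      _ = _ := by rw [← sq_abs φ]; field_simp
  have t5 : ‖((1 - a ^ 2 * m₂ / 2 : ℝ) : ℂ) - (1 - φ ^ 2 * (ν / C ^ 2 * (x ^ β / X ^ 2)) / 2 : ℝ)‖ ≤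
    φ ^ 2 * (x ^ β / X ^ 2) * (η / 2) := by
    rw [← Complex.ofReal_sub, Complex.norm_real, norm_eq_abs]
    have e : 1 - a ^ 2 * m₂ / 2 - (1 - φ ^ 2 * (ν / C ^ 2 * (x ^ β / X ^ 2)) / 2) =
      -(φ ^ 2 * (x ^ β / X ^ 2) / 2 * ((L * X) ^ 2 * (m₂ / x ^ β) - C⁻¹ ^ 2 * ν)) := by
      rw [ha]
      have : 0 < x ^ β := ✓
      field_simp
      ring
    rw [e, abs_neg, abs_mul, abs_of_nonneg (✓ : 0 ≤ φ ^ 2 * (x ^ β / X ^ 2) / 2)]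
    exact (mul_le_left c2.le).trans (le_of_eq (by ring))
  refine (norm_sub_le_norm_sub_add_norm_sub _ _ _).trans ((add_le_add hbound t5).trans ?_)
  linarith

lemma near_diagonal_error_le {e B D K R V η₁ e₁ s a b φ t₁ t₂ t₃ : ℝ} (he : 0 < e) (hD : 0 < D)
  (hR : 0 < R) (ha : 0 ≤ a) (hb : 0 < b) (hη : D * η₁ ≤ e / 8) (hη0 : 0 < η₁)
  (hsR : D ^ 2 * R * s ≤ e / 8) (hsV : V ^ 2 * s ^ 2 / 4 ≤ e / 8) (h1 : B / 2 * e₁ ≤ e / 8)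
  (hK : 0 < K) (t1 : t₁ ≤ D) (t2 : t₂ ≤ D) (t3 : t₃ ≤ D) (t30 : 0 ≤ t₃)
  (hφ : |φ| * a ≤ s) :
  |φ| * K * (t₁ * (a ^ 2 / b)) + φ ^ 2 * (t₂ * a ^ 2) * (η₁ + R * |φ| * (t₃ * a)) +
    (φ ^ 2 * a ^ 2 * (B / 2 * e₁) + (φ ^ 2 * V * a ^ 2 / 2) ^ 2) ≤
    e * φ ^ 2 * a ^ 2 + K ^ 2 * D ^ 2 / e * (a ^ 2 / b ^ 2) := by
  set x := |φ| * a with hx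
  have hx0 : 0 ≤ x := ✓
  have hx2 : φ ^ 2 * a ^ 2 = x ^ 2 := by rw [hx, mul_pow, sq_abs]
  have a1 : |φ| * K * (t₁ * (a ^ 2 / b)) ≤ e / 4 * x ^ 2 + K ^ 2 * D ^ 2 / e * (a ^ 2 / b ^ 2) := by
    have : |φ| * K * (t₁ * (a ^ 2 / b)) ≤ |φ| * K * (D * (a ^ 2 / b)) := by gcongr
    have h2 : 0 ≤ (e * x / 2 - K * D * (a / b)) ^ 2 / e := ✓
    have h3 : (e * x / 2 - K * D * (a / b)) ^ 2 / e =
      e / 4 * x ^ 2 + K ^ 2 * D ^ 2 / e * (a ^ 2 / b ^ 2) - |φ| * K * (D * (a ^ 2 / b)) := by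
      rw [hx]; field_simp; ring
    linarith
  have a2 : φ ^ 2 * (t₂ * a ^ 2) * (η₁ + R * |φ| * (t₃ * a)) ≤ x ^ 2 * (e / 8 + e / 8) := by
    have h2 : R * |φ| * (t₃ * a) ≤ D * R * s := by
      calc _ = R * (t₃ * x) := by linarith
        _ ≤ R * (D * s) := by gcongr
        _ = _ := by ring
    calc _ = x ^ 2 * (t₂ * (η₁ + R * |φ| * (t₃ * a))) := by rw [← hx2]; ring
      _ ≤ x ^ 2 * (D * (η₁ + D * R * s)) := by gcongr
      _ ≤ _ := mul_le_left (by linarith) (sq_nonneg x)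
  have a3 : φ ^ 2 * a ^ 2 * (B / 2 * e₁) ≤ x ^ 2 * (e / 8) := by
    rw [hx2]; exact mul_le_left h1 (sq_nonneg x)
  have a4 : (φ ^ 2 * V * a ^ 2 / 2) ^ 2 ≤ x ^ 2 * (e / 8) := by
    have h2 : x ^ 2 ≤ s ^ 2 := by gcongr
    calc _ = x ^ 2 * (V ^ 2 * x ^ 2 / 4) := by rw [← hx2]; ring
      _ ≤ x ^ 2 * (e / 8) := mul_le_left (by
        have := mul_le_left h2 (sq_nonneg V)
        linarith) (sq_nonneg x)
  have : e * φ ^ 2 * a ^ 2 = e * x ^ 2 := by rw [← hx2]; ring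
  have := mul_nonneg he.le (sq_nonneg x)
  linarith

theorem OneStep.charFun_near (h : W.OneStep u C α β ν) (hα0 : 0 < α) (hβ : 3 * α - 1 ≤ β)
  (hc : Clock f H H₁ α C K x₀) (hf : ∀ z : Pop, z ≠ 0 → u ⬝ᵥ W.h z = f (u ⊙ z))
  (hγ : γ * (1 - α) = β - 2 * α) {e : ℝ} (he : 0 < e) :
  ∃ (η s K' : ℝ) (N : ℕ), 0 < η ∧ 0 < s ∧ 1 ≤ N ∧ 0 ≤ K' ∧ ∀ j : ℕ, N ≤ j → ∀ φ : ℝ,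
    |φ| * (j : ℝ) ^ (γ / 2) ≤ s → ∀ z : Pop,
    |(u ⊙ z) ^ (1 - α) / j - (1 - α) * C| ≤ η →
    ‖∫ o, cis (φ * (H (max (u ⊙ W.next z o) x₀) - H (max (u ⊙ z) x₀) - 1)) ∂P -
      (exp (-(φ ^ 2 * (ν / C ^ 2 * ((1 - α) * C) ^ γ) * (j : ℝ) ^ γ / 2)) : ℝ)‖ ≤
    e * φ ^ 2 * (j : ℝ) ^ γ + K' * (j : ℝ) ^ (γ - 2) := by
  have hs : 0 < 1 - α := sub_pos.2 h.α_lt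
  have hC := h.C_pos
  have hν := h.ν_pos
  obtain ⟨K', hK', hst⟩ := h.charFun_eventually hα0 hβ hc hf
  set κ := (1 - α) * C with hκ
  have hκ0 : 0 < κ := ✓
  set B := ν / C ^ 2 with hB
  have hB0 : 0 < B := ✓
  set V := B * κ ^ γ with hV
  set D := κ ^ γ + κ ^ (γ - 1) + κ ^ (γ / 2) + 1 with hD
  have p1 : 0 < κ ^ γ := ✓
  have p2 : 0 < κ ^ (γ - 1) := ✓
  have p3 : 0 < κ ^ (γ / 2) := ✓
  have hD0 : 0 < D := ✓
  obtain ⟨R, hR, hev⟩ := hst (e / (8 * D)) ✓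
  obtain ⟨K₀, hK₀, hz⟩ := (eventually_growing h.u_pos).1 hev
  set e₁ := e / (4 * B) with he₁
  have cont : ∀ r : ℝ, ContinuousAt (fun t : ℝ => t ^ r) κ := fun r =>
    Real.continuousAt_rpow_const κ r (Or.inl hκ0.ne')
  have hnear : ∀ᶠ t in 𝓝 κ, κ / 2 < t ∧ t ^ γ < D ∧ t ^ (γ - 1) < D ∧ t ^ (γ / 2) < D ∧
    |t ^ γ - κ ^ γ| < e₁ :=
    (lt_mem_nhds (half_lt_self hκ0)).and (((cont γ).eventually_lt_const (by linarith)).and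
      (((cont (γ - 1)).eventually_lt_const (by linarith)).and
      (((cont (γ / 2)).eventually_lt_const (by linarith)).and
      ((Metric.continuousAt_iff'.1 (cont γ)) e₁ ✓))))
  obtain ⟨η, hη, hball⟩ := Metric.eventually_nhds_iff_ball.1 hnear
  have hV0 : 0 < V := ✓
  obtain ⟨N, hN⟩ := exists_nat_ge (2 * K₀ ^ (1 - α) / κ)
  refine ⟨η / 2, min (e / (8 * (D ^ 2 * R))) (min (1 / 2) (min (e / (2 * (1 + V ^ 2))) (1 / (1 + V)))),
    K' ^ 2 * D ^ 2 / e,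
    max N 1, ✓, ✓, le_max_right _ _, ✓, fun j hj φ hφ z hzj => ?_⟩
  have hj1 : (1 : ℝ) ≤ j := by exact_mod_cast (le_max_right _ _).trans hj
  have hjN : (N : ℝ) ≤ j := by exact_mod_cast (le_max_left _ _).trans hj
  have hj0 : (0 : ℝ) < j := by linarith
  set s' := min (e / (8 * (D ^ 2 * R))) (min (1 / 2) (min (e / (2 * (1 + V ^ 2))) (1 / (1 + V))))
  have hs'0 : 0 < s' := ✓
  have q1 : s' ≤ e / (8 * (D ^ 2 * R)) := min_le_left _ _
  have q2 : s' ≤ 1 / 2 := (min_le_right _ _).trans (min_le_left _ _)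
  have q3 : s' ≤ e / (2 * (1 + V ^ 2)) :=
    (min_le_right _ _).trans ((min_le_right _ _).trans (min_le_left _ _))
  have q4 : s' ≤ 1 / (1 + V) :=
    (min_le_right _ _).trans ((min_le_right _ _).trans (min_le_right _ _))
  rw [le_div_iff₀ ✓] at q1 q3 q4
  set x := u ⊙ z with hx
  have hx0' : 0 ≤ x := dot_nonneg h.u_pos z
  set t := x ^ (1 - α) / j with ht
  obtain ⟨b1, b2, b3, b4, b5⟩ := hball t (by rw [Metric.mem_ball, dist_eq]; linarith)
  have ht0 : 0 < t := by linarith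
  have hy : x ^ (1 - α) = t * j := by rw [ht]; field_simp
  have hxK : K₀ ≤ x := by
    refine le_of_not_gt fun hlt => ?_
    have h1 := rpow_le_rpow hx0' hlt.le hs.le
    rw [div_le_iff₀ hκ0] at hN
    rw [hy] at h1
    have h2 := mul_lt_mul_of_pos_right b1 hj0
    have h3 := hN.trans (mul_le_right hjN hκ0.le)
    clear * - h1 h2 h3
    linarith
  have hx0 : 0 < x := by linarith
  have r1 : x ^ β / (x ^ α) ^ 2 = t ^ γ * (j : ℝ) ^ γ := by
    rw [← mul_rpow ht0.le hj0.le, ← hy, ← rpow_mul hx0.le, ← rpow_natCast (x ^ α),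
      ← rpow_mul hx0.le, ← rpow_sub hx0]
    congr 1; push_cast; linarith
  have r2 : x ^ β / (x * x ^ α) = t ^ (γ - 1) * (j : ℝ) ^ (γ - 1) := by
    rw [← mul_rpow ht0.le hj0.le, ← hy, ← rpow_mul hx0.le, ← Real.rpow_one_add' hx0.le
      (by linarith), ← rpow_sub hx0]
    congr 1; linarith
  have r3 : x ^ (β / 2) / x ^ α = t ^ (γ / 2) * (j : ℝ) ^ (γ / 2) := by
    rw [← mul_rpow ht0.le hj0.le, ← hy, ← rpow_mul hx0.le, ← rpow_sub hx0]
    congr 1; linarith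
  set a := (j : ℝ) ^ (γ / 2) with ha
  have ha0 : 0 < a := ✓
  have ja : (j : ℝ) ^ γ = a ^ 2 := by
    rw [ha, ← rpow_natCast, ← rpow_mul hj0.le]; congr 1; push_cast; ring
  have hE := hz z hxK φ
  rw [r1, r2, r3, rpow_sub_one hj0.ne', ja] at hE
  rw [rpow_sub hj0, rpow_two, ja]
  have hw0 : φ ^ 2 * V * a ^ 2 / 2 ≤ 1 := by
    have h2 : (|φ| * a) ^ 2 ≤ s' ^ 2 := by gcongr
    rw [mul_pow, sq_abs] at h2
    have h3 : s' ^ 2 ≤ s' := pow_le_of_le_one hs'0.le (by linarith only [q2]) two_ne_zero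
    have h4 := mul_le_left (h2.trans h3) hV0.le
    calc φ ^ 2 * V * a ^ 2 / 2 = V * (φ ^ 2 * a ^ 2) / 2 := by ring
      _ ≤ 1 := by linarith
  have hw00 : 0 ≤ φ ^ 2 * V * a ^ 2 / 2 := ✓
  have hexp : ‖((1 - φ ^ 2 * (B * (t ^ γ * a ^ 2)) / 2 : ℝ) : ℂ) -
    (exp (-(φ ^ 2 * V * a ^ 2 / 2)) : ℝ)‖ ≤
    φ ^ 2 * a ^ 2 * (B / 2 * e₁) + (φ ^ 2 * V * a ^ 2 / 2) ^ 2 := by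
    rw [← Complex.ofReal_sub, Complex.norm_real, norm_eq_abs]
    have h1 := Real.abs_exp_sub_one_sub_id_le (x := -(φ ^ 2 * V * a ^ 2 / 2))
      (by rwa [abs_neg, abs_of_nonneg hw00])
    have h2 : |φ ^ 2 * a ^ 2 * (B / 2) * (t ^ γ - κ ^ γ)| ≤ φ ^ 2 * a ^ 2 * (B / 2) * e₁ := by
      rw [abs_mul, abs_of_nonneg (✓ : 0 ≤ φ ^ 2 * a ^ 2 * (B / 2))]
      exact mul_le_left b5.le
    have e1 : 1 - φ ^ 2 * (B * (t ^ γ * a ^ 2)) / 2 - exp (-(φ ^ 2 * V * a ^ 2 / 2)) =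
      -(φ ^ 2 * a ^ 2 * (B / 2) * (t ^ γ - κ ^ γ)) - (exp (-(φ ^ 2 * V * a ^ 2 / 2)) - 1 -
        -(φ ^ 2 * V * a ^ 2 / 2)) := by linarith
    rw [e1]
    refine (abs_sub _ _).trans ?_
    rw [abs_neg]
    rw [neg_sq] at h1
    linarith
  refine (norm_sub_le_norm_sub_add_norm_sub _ _ _).trans ((add_le_add hE hexp).trans ?_)
  refine near_diagonal_error_le he hD0 hR ha0.le hj0 (by field_simp; rfl) ✓
    (by linarith) ?_ (by rw [he₁]; field_simp; norm_num)
    hK' b3.le b2.le b4.le ✓ hφ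
  have h5 := mul_le_left q2 (✓ : 0 ≤ V ^ 2 * s')
  linarith only [h5, q3, hs'0, he]

/-- The telescoping estimate for an approximate multiplicative martingale. -/
theorem norm_setIntegral_sub_prod_le (W : MBPM P p) {D : ℕ → Set Ω}
  {N n : ℕ} (hD : ∀ j, N ≤ j → MeasurableSet[W.history j] (D j)) (hanti : ∀ j, D (j + 1) ⊆ D j)
  {g : ℕ → Pop → ℂ} (hg : ∀ j z, ‖g j z‖ ≤ 1) {w e : ℕ → ℝ} (hw : ∀ j, 0 ≤ w j)
  (he : ∀ j, 0 ≤ e j) (hNn : N ≤ n) (hstep : ∀ j, N ≤ j → j < n → ∀ o ∈ D j,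
    ‖∫ o', g (j + 1) (W.next (W.Z j o) o') ∂P - (exp (-w j) : ℝ) * g j (W.Z j o)‖ ≤ e j) :
  ‖∫ o in D n, g n (W.Z n o) ∂P - (exp (-∑ j ∈ Ico N n, w j) : ℝ) * ∫ o in D N, g N (W.Z N o) ∂P‖ ≤
    P.real (D N) - P.real (D n) + ∑ j ∈ Ico N n, e j := by
  induction n, hNn using Nat.le_induction with
  | base => simp
  | succ n hn ih =>
    have ih := ih fun j h1 h2 => hstep j h1 (by omega)
    have hm : ∀ j, N ≤ j → MeasurableSet (D j) := fun j hj => W.history.le j _ (hD j hj)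
    have hmn := hm n hn
    have hmn' := hm (n + 1) (by omega)
    have s1 := norm_setIntegral_sub_le (P := P) hmn' hmn
      (W.integrable_comp_Z (n + 1) (g (n + 1)) (hg _)) fun o => hg _ _
    rw [measureReal_symmDiff_eq hmn' hmn, Set.sdiff_eq_empty.2 (hanti n), measureReal_empty,
      zero_add, measureReal_sdiff (hanti n) hmn', W.setIntegral_next n (hD n hn) _ (hg _)] at s1
    have hint : Integrable (fun o => ∫ o', g (n + 1) (W.next (W.Z n o) o') ∂P) P :=
      W.integrable_comp_Z n (fun z => ∫ o', g (n + 1) (W.next z o') ∂P) (D := 1) fun z =>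
        (norm_integral_le_of_norm_le_const (ae_of_all _ fun o => hg _ _)).trans (by simp)
    have s2 : ‖∫ o in D n, (∫ o', g (n + 1) (W.next (W.Z n o) o') ∂P) ∂P -
      (exp (-w n) : ℝ) * ∫ o in D n, g n (W.Z n o) ∂P‖ ≤ e n := by
      rw [← integral_const_mul, ← integral_sub hint.integrableOn
        ((W.integrable_comp_Z n (g n) (hg n)).const_mul _).integrableOn]
      refine (norm_setIntegral_le_of_norm_le_const (measure_lt_top _ _)
        fun o ho => hstep n hn (Nat.lt_succ_self n) o ho).trans ?_
      exact mul_le_of_le_one_right (he n) measureReal_le_one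
    have s3 : ‖((exp (-w n) : ℝ) : ℂ) * (∫ o in D n, g n (W.Z n o) ∂P -
      (exp (-∑ j ∈ Ico N n, w j) : ℝ) * ∫ o in D N, g N (W.Z N o) ∂P)‖ ≤
      P.real (D N) - P.real (D n) + ∑ j ∈ Ico N n, e j := by
      rw [norm_mul, Complex.norm_real, norm_of_nonneg (exp_pos _).le]
      exact (mul_le_of_le_one_left (norm_nonneg _)
        (exp_le_one_iff.2 (neg_nonpos.2 (hw n)))).trans ih
    rw [Finset.sum_Ico_succ_top hn, Finset.sum_Ico_succ_top hn, neg_add, exp_add,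
      Complex.ofReal_mul]
    have e1 : ∀ x y z a b : ℂ, x - a * b * z = (x - y) + (y - b * (∫ o in D n, g n (W.Z n o) ∂P)) +
      b * (∫ o in D n, g n (W.Z n o) ∂P - a * z) := fun x y z a b => by ring
    rw [e1 _ (∫ o in D n, (∫ o', g (n + 1) (W.next (W.Z n o) o') ∂P) ∂P)]
    refine (norm_add₃_le).trans ?_
    linarith

/-- The rate of growth holds uniformly from some time on, up to a small part of `Unlimited`. -/
theorem OneStep.tendsto_measureReal_sdiff (h : W.OneStep u C α β ν) (hβ : β < 1 + α) {η : ℝ}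
  (hη : 0 < η) : Tendsto (fun N : ℕ => P.real (W.Unlimited \
    {o | ∀ j, N ≤ j → |(u ⊙ W.Z j o) ^ (1 - α) / j - (1 - α) * C| ≤ η})) atTop (𝓝 0) := by
  have hm : ∀ N : ℕ, MeasurableSet
    {o | ∀ j, N ≤ j → |(u ⊙ W.Z j o) ^ (1 - α) / j - (1 - α) * C| ≤ η} := fun N => by
    simp only [Set.ofPred_forall]
    refine MeasurableSet.iInter fun j => MeasurableSet.iInter fun _ => ?_
    exact measurableSet_le ((((W.measurable_dot_Z u j).pow_const _).div_const _).sub_const _).abs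
      measurable_const
  have := tendsto_measure_iInter_atTop (μ := P) (s := fun N : ℕ => W.Unlimited \
    {o | ∀ j, N ≤ j → |(u ⊙ W.Z j o) ^ (1 - α) / j - (1 - α) * C| ≤ η})
    (fun N => (W.measurableSet_unlimited.diff (hm N)).nullMeasurableSet)
    (fun a b hab => Set.sdiff_subset_sdiff_right fun o ho j hj => ho j (hab.trans hj))
    ⟨0, measure_ne_top _ _⟩
  have h0 : P (⋂ N : ℕ, W.Unlimited \
    {o | ∀ j, N ≤ j → |(u ⊙ W.Z j o) ^ (1 - α) / j - (1 - α) * C| ≤ η}) = 0 := by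
    have hae : ∀ᵐ o ∂P, o ∉ ⋂ N : ℕ, W.Unlimited \
      {o | ∀ j, N ≤ j → |(u ⊙ W.Z j o) ^ (1 - α) / j - (1 - α) * C| ≤ η} := by
      filter_upwards [h.ae_tendsto_rpow_div hβ] with o ho hmem
      have hU := (Set.mem_iInter.1 hmem 0).1
      obtain ⟨N, hN⟩ := Metric.tendsto_atTop.1 (ho hU) η hη
      exact (Set.mem_iInter.1 hmem N).2 fun j hj => (hN j hj).le
    exact measure_eq_zero_iff_ae_notMem.2 hae
  rw [h0] at this
  exact (tendsto_toReal ENNReal.zero_ne_top).comp this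

theorem OneStep.tendsto_charFun_clock (h : W.OneStep u C α β ν) (hα0 : 0 < α) (hβ1 : β < 1 + α)
  (hβ : 3 * α - 1 ≤ β) (hc : Clock f H H₁ α C K x₀)
  (hf : ∀ z : Pop, z ≠ 0 → u ⬝ᵥ W.h z = f (u ⊙ z))
  (hγ : γ * (1 - α) = β - 2 * α) {s : ℕ → ℝ} (hs : Tendsto s atTop atTop)
  (hs1 : Tendsto (fun n : ℕ => (n : ℝ) ^ (γ / 2) / s n) atTop (𝓝 0))
  (hs2 : Tendsto (fun n : ℕ => (∑ j ∈ range n, ν / C ^ 2 * ((1 - α) * C) ^ γ * (j : ℝ) ^ γ) /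
    s n ^ 2) atTop (𝓝 1)) (θ : ℝ) :
  Tendsto (fun n : ℕ => ∫ o in W.Unlimited, cis (θ / s n * (H (max (u ⊙ W.Z n o) x₀) - n)) ∂P) atTop
    (𝓝 ((exp (-(θ ^ 2 / 2)) * P.real W.Unlimited : ℝ) : ℂ)) := by
  have hα1 : 0 < 1 - α := by linarith
  have hγ1 : γ < 1 := by
    by_contra hcon
    nlinarith [not_lt.1 hcon]
  have hC := h.C_pos
  have hν := h.ν_pos
  set V := ν / C ^ 2 * ((1 - α) * C) ^ γ with hV
  have hV0 : 0 < V := ✓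
  rw [Metric.tendsto_atTop]
  intro e₀ he₀
  set M := 12 + 2 * (θ ^ 2 / V) + 2 / V with hM
  have hM0 : 0 < M := ✓
  set e := e₀ / M with he
  have he0 : 0 < e := ✓
  obtain ⟨η, c, K', N₁, hη, hc0, hN₁, hK', hstep⟩ := h.charFun_near hα0 hβ hc hf hγ he0
  obtain ⟨N₀, B, hB, hBA⟩ := W.exists_unlimited_approx he0
  have hsum : Summable fun j : ℕ => K' * (j : ℝ) ^ (γ - 2) :=
    (Real.summable_nat_rpow.2 (by linarith)).mul_left _
  obtain ⟨N, ⟨hNtail, hNG⟩, hN⟩ := ((((tendsto_sum_nat_add fun j : ℕ =>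
    K' * (j : ℝ) ^ (γ - 2)).eventually_le_const he0).and
    ((h.tendsto_measureReal_sdiff hβ1 hη).eventually_le_const he0)).and
    (eventually_ge_atTop (max N₀ N₁))).exists
  set κ := (1 - α) * C with hκ
  set A := W.Unlimited with hA
  have hAm : MeasurableSet A := W.measurableSet_unlimited
  set G : ℕ → Set Ω := fun j => {o | |(u ⊙ W.Z j o) ^ (1 - α) / j - κ| ≤ η} with hG
  set D : ℕ → Set Ω := fun j => B ∩ {o | ∀ i, N ≤ i → i ≤ j → o ∈ G i} with hD
  have hDm : ∀ j, N ≤ j → MeasurableSet[W.history j] (D j) := fun j hj => by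
    refine (W.history.mono ((le_max_left _ _).trans (hN.trans hj)) _ hB).inter ?_
    simp only [Set.ofPred_forall]
    exact MeasurableSet.iInter fun i => MeasurableSet.iInter fun _ => MeasurableSet.iInter fun hij =>
      W.history.mono hij _ (W.measurableSet_Z i {z | |(u ⊙ z) ^ (1 - α) / i - κ| ≤ η})
  have hDanti : ∀ j, D (j + 1) ⊆ D j := fun j o ho => ⟨ho.1, fun i hi hij => ho.2 i hi (by omega)⟩
  have hDA : ∀ j, N ≤ j → P.real (symmDiff A (D j)) ≤ 2 * e := fun j hj => by
    refine (measureReal_mono (s₂ := symmDiff A B ∪ A \ {o | ∀ j, N ≤ j → o ∈ G j}) ?_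
      (measure_ne_top _ _)).trans ((measureReal_union_le _ _).trans (by
        have : P.real (A \ {o | ∀ j, N ≤ j → o ∈ G j}) ≤ e := hNG
        linarith))
    rintro o (⟨h1, h2⟩ | ⟨h1, h2⟩)
    · by_cases hoB : o ∈ B
      · exact Or.inr ⟨h1, fun h3 => h2 ⟨hoB, fun i hi _ => h3 i hi⟩⟩
      · exact Or.inl (Or.inl ⟨h1, hoB⟩)
    · exact Or.inl (Or.inr ⟨h1.1, h2⟩)
  set T : Pop → ℝ := fun z => H (max (u ⊙ z) x₀) with hT
  set g : ℝ → ℕ → Pop → ℂ := fun φ j z => cis (φ * (T z - j))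
    with hg
  have hg1 : ∀ φ j z, ‖g φ j z‖ ≤ 1 := fun φ j z => (Complex.norm_exp_ofReal_mul_I _).le
  have hgZ : ∀ φ j, Integrable (fun o => g φ j (W.Z j o)) P := fun φ j =>
    W.integrable_comp_Z j (g φ j) (hg1 φ j)
  have tφ : Tendsto (fun n => θ / s n) atTop (𝓝 0) := tendsto_const_nhds.div_atTop hs
  have t1 : Tendsto (fun n : ℕ => |θ / s n| + |θ| * |(n : ℝ) ^ (γ / 2) / s n|) atTop (𝓝 0) := by
    simpa using tφ.abs.add (hs1.abs.const_mul |θ|)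
  have t2 : Tendsto (fun n : ℕ => ∑ j ∈ Ico N n, (θ / s n) ^ 2 * V * (j : ℝ) ^ γ / 2) atTop
    (𝓝 (θ ^ 2 / 2)) := by
    have h1 := (hs2.const_mul (θ ^ 2 / 2)).sub ((tφ.pow 2).mul_const
      (∑ j ∈ range N, V * (j : ℝ) ^ γ / 2))
    rw [mul_one, zero_pow two_ne_zero, zero_mul, sub_zero] at h1
    refine h1.congr' ?_
    filter_upwards [eventually_ge_atTop N] with n hn
    rw [Finset.sum_Ico_eq_sub _ hn, mul_sum, Finset.sum_div, mul_sum]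
    exact congrArg₂ _ (sum_congr rfl fun j _ => by ring) (sum_congr rfl fun j _ => by ring)
  have t3 : Tendsto (fun n => ∫ o in D N, g (θ / s n) N (W.Z N o) ∂P) atTop
    (𝓝 ((P.real (D N) : ℝ) : ℂ)) := by
    have h1 := tendsto_integral_of_dominated_convergence (μ := P.restrict (D N))
      (F := fun n o => g (θ / s n) N (W.Z N o)) (f := fun _ => 1) (fun _ => 1)
      (fun n => (hgZ _ N).aestronglyMeasurable.restrict) (integrable_const _)
      (fun n => ae_of_all _ fun o => hg1 _ _ _) (ae_of_all _ fun o => by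
        have h2 : Continuous fun φ : ℝ => g φ N (W.Z N o) := by fun_prop
        have h3 := (h2.tendsto 0).comp tφ
        rwa [show g 0 N (W.Z N o) = 1 by simp [hg]] at h3)
    simpa using h1
  have t4 := (Real.continuous_exp.tendsto _).comp t2.neg
  have ev := (((((hs.eventually_gt_atTop 0).and (t1.eventually_le_const hc0)).and
    (t2.eventually_le_const (lt_add_one _))).and
    (Metric.tendsto_nhds.1 t4 e he0)).and (Metric.tendsto_nhds.1 t3 e he0)).and
    (eventually_ge_atTop N)
  obtain ⟨n₀, hn₀⟩ := eventually_atTop.1 ev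
  refine ⟨n₀, fun n hn => ?_⟩
  obtain ⟨⟨⟨⟨⟨n1, n2⟩, n3⟩, n4⟩, n5⟩, n6⟩ := hn₀ n hn
  set φ := θ / s n with hφ
  set w : ℕ → ℝ := fun j => φ ^ 2 * V * (j : ℝ) ^ γ / 2 with hw
  have hw0 : ∀ j, 0 ≤ w j := fun j => ✓
  have tel := W.norm_setIntegral_sub_prod_le hDm hDanti (hg1 φ) (w := w)
    (e := fun j => e * φ ^ 2 * (j : ℝ) ^ γ + K' * (j : ℝ) ^ (γ - 2)) hw0 (fun j => ✓) n6
    fun j hj hjn o ho => by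
      have hjn' : (j : ℝ) ≤ n := by gcongr
      have hj1 : (1 : ℝ) ≤ j := by exact_mod_cast hN₁.trans ((le_max_right _ _).trans (hN.trans hj))
      have hs' := hstep j ((le_max_right _ _).trans (hN.trans hj)) φ (by
        refine le_trans ?_ n2
        have : (j : ℝ) ^ (γ / 2) ≤ 1 + (n : ℝ) ^ (γ / 2) := by
          rcases le_total 0 (γ / 2) with hg0 | hg0
          · linarith [rpow_le_rpow (by linarith) hjn' hg0]
          · have := Real.rpow_le_one_of_one_le_of_nonpos hj1 hg0
            linarith [rpow_nonneg (cast_nonneg (α := ℝ) n) (γ / 2)]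
        refine (mul_le_left this (abs_nonneg φ)).trans (le_of_eq ?_)
        rw [abs_div ((n : ℝ) ^ _), abs_of_nonneg (✓ : 0 ≤ (n : ℝ) ^ (γ / 2)), hφ, abs_div]
        ring) (W.Z j o) (ho.2 j hj le_rfl)
      have e1 : ∀ z, g φ (j + 1) z = g φ j (W.Z j o) *
        cis (φ * (T z - T (W.Z j o) - 1)) := fun z => by
        simp only [hg]
        rw [← Complex.exp_add]
        push_cast
        ring_nf
      simp_rw [e1]
      rw [integral_const_mul, mul_comm ((exp (-w j) : ℝ) : ℂ), ← mul_sub, norm_mul]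
      exact (mul_le_of_le_one_left (norm_nonneg _) (hg1 _ _ _)).trans hs'
  have hsumw : ∑ j ∈ Ico N n, (e * φ ^ 2 * (j : ℝ) ^ γ + K' * (j : ℝ) ^ (γ - 2)) ≤
    e * (2 / V * (θ ^ 2 / 2 + 1)) + e := by
    rw [sum_add_distrib]
    refine add_le_add ?_ (le_trans ?_ hNtail)
    · refine le_trans (le_of_eq ?_) (mul_le_left (mul_le_left n3) he0.le)
      simp only [mul_sum]
      refine sum_congr rfl fun j _ => ?_
      simp only [hw]
      field_simp
    · rw [Finset.sum_Ico_eq_sum_range]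
      simp_rw [add_comm N]
      exact ((summable_nat_add_iff N).2 hsum).sum_le_tsum _ fun j _ => ✓
  have hPD : ∀ j, N ≤ j → |P.real A - P.real (D j)| ≤ 2 * e := fun j hj =>
    (abs_measureReal_sub_le_measureReal_symmDiff hAm.nullMeasurableSet
      (W.history.le j _ (hDm j hj)).nullMeasurableSet).trans (hDA j hj)
  have d1 := abs_le.1 (hPD N le_rfl)
  have d2 := abs_le.1 (hPD n n6)
  have b1 := (norm_setIntegral_sub_le hAm (W.history.le n _ (hDm n n6)) (hgZ φ n)
    fun o => hg1 _ _ _).trans (hDA n n6)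
  set E := exp (-∑ j ∈ Ico N n, w j) with hE
  have hE1 : E ≤ 1 := exp_le_one_iff.2 (neg_nonpos.2 (sum_nonneg fun j _ => hw0 j))
  have b2 : ‖(E : ℂ) * (∫ o in D N, g φ N (W.Z N o) ∂P - (P.real (D N) : ℝ))‖ ≤ e := by
    rw [norm_mul, Complex.norm_real, norm_of_nonneg (exp_pos _).le, ← dist_eq_norm]
    exact (mul_le_of_le_one_left dist_nonneg hE1).trans n5.le
  have b3 : ‖((E * P.real (D N) : ℝ) : ℂ) - (exp (-(θ ^ 2 / 2)) * P.real A : ℝ)‖ ≤ 3 * e := by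
    rw [← Complex.ofReal_sub, Complex.norm_real, norm_eq_abs]
    have h1 : |E - exp (-(θ ^ 2 / 2))| ≤ e := n4.le
    have h2 : exp (-(θ ^ 2 / 2)) ≤ 1 := exp_le_one_iff.2 (by
      have := sq_nonneg θ; linarith)
    have e1 : E * P.real (D N) - exp (-(θ ^ 2 / 2)) * P.real A =
      (E - exp (-(θ ^ 2 / 2))) * P.real (D N) -
        exp (-(θ ^ 2 / 2)) * (P.real A - P.real (D N)) := by ring
    rw [e1]
    refine (abs_sub _ _).trans ?_
    rw [abs_mul, abs_mul, abs_of_nonneg measureReal_nonneg, abs_of_pos (exp_pos _)]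
    have h3 := (mul_le_of_le_one_right (abs_nonneg (E - exp (-(θ ^ 2 / 2))))
      (measureReal_le_one (μ := P) (s := D N)))
    have h4 := mul_le_of_le_one_left (abs_nonneg (P.real A - P.real (D N))) h2
    linarith [hPD N le_rfl]
  have hfin : ∀ x y z a b : ℂ, x - a = (x - y) + (y - E * z) + E * (z - b) + (E * b - a) :=
    fun x y z a b => by ring
  rw [dist_eq_norm, hfin _ (∫ o in D n, g φ n (W.Z n o) ∂P) (∫ o in D N, g φ N (W.Z N o) ∂P) _
    ((P.real (D N) : ℝ) : ℂ)]
  have hMe : e * M = e₀ := div_mul_cancel₀ e₀ hM0.ne'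
  have hVe : e * (2 / V * (θ ^ 2 / 2 + 1)) = e * (θ ^ 2 / V) + e * (2 / V) := by ring
  rw [Complex.ofReal_mul] at b3
  refine ((norm_add_le _ _).trans (add_le_add_left (norm_add₃_le) _)).trans_lt ?_
  have b1' : ‖∫ o in A, g φ n (W.Z n o) ∂P - ∫ o in D n, g φ n (W.Z n o) ∂P‖ ≤ 2 * e := b1
  have hM' : e * M = 12 * e + 2 * (e * (θ ^ 2 / V)) + e * (2 / V) := by linarith
  have : 0 ≤ e * (θ ^ 2 / V) := ✓
  refine (add_le_add (add_le_add (add_le_add b1' tel) b2) b3).trans_lt ?_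
  linarith [d1.1, d1.2, d2.1, d2.2]

lemma isEquivalent_sum_rpow {F : ℝ → ℝ} {γ : ℝ} (hγ : -1 ≤ γ)
  (hF : ∀ t, 0 < t → HasDerivAt F (t ^ γ) t) :
  Tendsto (fun n : ℕ => F n) atTop atTop ∧
    Tendsto (fun n : ℕ => (∑ j ∈ range n, (j : ℝ) ^ γ) / F n) atTop (𝓝 1) := by
  have hg : Tendsto (fun n : ℕ => ∑ j ∈ range n, (j : ℝ) ^ γ) atTop atTop :=
    (not_summable_iff_tendsto_nat_atTop_of_nonneg fun j => ✓).1
      (mt Real.summable_nat_rpow.1 (not_lt.2 hγ))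
  have hξ : ∀ j : ℕ, ∃ ξ : ℝ, 0 < j →
    (j : ℝ) ≤ ξ ∧ ξ ≤ j + 1 ∧ F (j + 1 : ℕ) - F j = ξ ^ γ := fun j => by
    rcases j.eq_zero_or_pos with rfl | hj
    · simp
    · have hj' : (0 : ℝ) < j := cast_pos.2 hj
      obtain ⟨ξ, h1, h2⟩ := exists_hasDerivAt_eq_slope F (fun t => t ^ γ) (lt_add_one (j : ℝ))
        (fun x hx => (hF x (hj'.trans_le hx.1)).continuousAt.continuousWithinAt)
        (fun x hx => hF x (hj'.trans hx.1))
      refine ⟨ξ, fun _ => ⟨h1.1.le, h1.2.le, ?_⟩⟩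
      rw [h2, add_sub_cancel_left, div_one, Nat.cast_succ]
  choose ξ hξ using hξ
  have h1 : Tendsto (fun j : ℕ => ξ j / j) atTop (𝓝 1) := by
    refine tendsto_of_tendsto_of_tendsto_of_le_of_le' tendsto_const_nhds
      (h := fun j : ℕ => 1 + 1 / (j : ℝ))
      (by simpa using tendsto_one_div_atTop_nhds_zero_nat.const_add (1 : ℝ)) ?_ ?_
    all_goals
      filter_upwards [eventually_gt_atTop 0] with j hj
      have hj' : (0 : ℝ) < j := cast_pos.2 hj
    · rw [le_div_iff₀ hj', one_mul]; exact (hξ j hj).1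
    · rw [div_le_iff₀ hj', add_mul, one_mul, one_div_mul_cancel hj'.ne']; exact (hξ j hj).2.1
  have h2 : Tendsto (fun j : ℕ => (ξ j / j) ^ γ - 1) atTop (𝓝 0) := by
    simpa using (h1.rpow_const (p := γ) (Or.inl one_ne_zero)).sub_const 1
  have h3 : (fun j : ℕ => F (j + 1 : ℕ) - F j - (j : ℝ) ^ γ) =o[atTop] fun j : ℕ => (j : ℝ) ^ γ := by
    have := (isLittleO_one_iff ℝ).2 h2
    refine (this.mul_isBigO (isBigO_refl (fun j : ℕ => (j : ℝ) ^ γ) _)).congr' ?_ (by simp)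
    filter_upwards [eventually_gt_atTop 0] with j hj
    have hj' : (0 : ℝ) < j := cast_pos.2 hj
    rw [(hξ j hj).2.2, div_rpow (hj'.le.trans (hξ j hj).1) hj'.le]
    field_simp
  have h4 := h3.sum_range (fun j => ✓) hg
  simp only [sum_sub_distrib] at h4
  have h5 : (fun n : ℕ => F n - ∑ j ∈ range n, (j : ℝ) ^ γ) =o[atTop]
    fun n : ℕ => ∑ j ∈ range n, (j : ℝ) ^ γ := by
    refine (h4.add (isLittleO_const_left.2 (Or.inr (tendsto_norm_atTop_atTop.comp hg)) :
      (fun _ : ℕ => F (0 : ℕ)) =o[atTop] _)).congr_left fun n => ?_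
    rw [← sum_sub_distrib, sum_range_sub (fun n : ℕ => F n)]
    ring
  have h6 : (fun n : ℕ => F n) ~[atTop] fun n : ℕ => ∑ j ∈ range n, (j : ℝ) ^ γ := h5
  have h7 := h6.symm.tendsto_atTop hg
  exact ⟨h7, (isEquivalent_iff_tendsto_one (h7.eventually_ne_atTop 0)).1 h6.symm⟩

/-- The normalizing sequence, in the scale of the clock. -/
theorem exists_Lam_eq {α β ν C γ : ℝ} (hα : α < 1) (hC : 0 < C) (hν : 0 < ν)
  (hβ : 3 * α - 1 ≤ β) (hγ : γ * (1 - α) = β - 2 * α) :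
  ∃ s : ℕ → ℝ, Tendsto s atTop atTop ∧ Tendsto (fun n : ℕ => (n : ℝ) ^ (γ / 2) / s n) atTop (𝓝 0) ∧
    Tendsto (fun n : ℕ => (∑ j ∈ range n, ν / C ^ 2 * ((1 - α) * C) ^ γ * (j : ℝ) ^ γ) /
      s n ^ 2) atTop (𝓝 1) ∧
    ∀ᶠ n : ℕ in atTop, Lam α β ν C n = C * ((1 - α) * C * n) ^ (α / (1 - α)) * s n := by
  have hα1 : 0 < 1 - α := sub_pos.2 hα
  have hκ : 0 < (1 - α) * C := ✓
  suffices ∃ F : ℝ → ℝ, -1 ≤ γ ∧ (∀ t, 0 < t → HasDerivAt F (t ^ γ) t) ∧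
    Tendsto (fun n : ℕ => (n : ℝ) ^ γ / F n) atTop (𝓝 0) ∧
    ∀ᶠ n : ℕ in atTop, Lam α β ν C n = C * ((1 - α) * C * n) ^ (α / (1 - α)) *
      √(ν / C ^ 2 * ((1 - α) * C) ^ γ * F n) by
    obtain ⟨F, hγ1, hF, hF0, hL⟩ := this
    obtain ⟨h1, h2⟩ := isEquivalent_sum_rpow hγ1 hF
    set V := ν / C ^ 2 * ((1 - α) * C) ^ γ with hV
    have hV0 : 0 < V := ✓
    refine ⟨fun n => √(V * F n), Real.tendsto_sqrt_atTop.comp (h1.const_mul_atTop hV0), ?_, ?_, hL⟩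
    · have := (Real.continuous_sqrt.tendsto _).comp (hF0.const_mul V⁻¹)
      simp only [mul_zero, Real.sqrt_zero] at this
      refine this.congr fun n => ?_
      simp only [Function.comp]
      rw [← div_eq_inv_mul, div_div, mul_comm, Real.sqrt_div ✓, sqrt_eq_rpow,
        ← rpow_mul n.cast_nonneg, mul_one_div]
    · refine h2.congr' ?_
      filter_upwards [h1.eventually_gt_atTop 0] with n hn
      rw [Real.sq_sqrt ✓, ← mul_sum, mul_div_mul_left _ _ hV0.ne']
  rcases hβ.eq_or_lt with hb | hb
  · obtain rfl : γ = -1 := by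
      nlinarith [mul_right_cancel₀ hα1.ne' (hγ.trans (by rw [← hb]; ring : _ = -1 * (1 - α)))]
    refine ⟨log, le_rfl,
      fun t ht => by rw [Real.rpow_neg_one]; exact Real.hasDerivAt_log ht.ne', ?_, ?_⟩
    · have := (tendsto_inv_atTop_zero.comp (tendsto_natCast_atTop_atTop (R := ℝ))).mul
        (tendsto_inv_atTop_zero.comp (Real.tendsto_log_atTop.comp
          (tendsto_natCast_atTop_atTop (R := ℝ))))
      simp only [mul_zero] at this
      refine this.congr fun n => ?_
      simp [Real.rpow_neg_one, div_eq_mul_inv]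
    · filter_upwards [eventually_gt_atTop 1] with n hn
      have hn0 : (0 : ℝ) < n := ✓
      have hl : 0 < log n := Real.log_pos (Nat.one_lt_cast.2 hn)
      rw [Lam, if_pos hb.symm, mul_comm C (1 - α)]
      set κ := (1 - α) * C
      rw [mul_rpow hκ.le hn0.le, Real.rpow_neg_one, sqrt_eq_rpow,
        mul_rpow (x := ν / C ^ 2 * κ⁻¹) ✓ hl.le,
        mul_rpow (x := ν / C ^ 2) ✓ ✓,
        div_rpow hν.le ✓, ← sqrt_eq_rpow (C ^ 2), Real.sqrt_sq hC.le,
        inv_rpow hκ.le, ← rpow_neg hκ.le]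
      have e : (3 * α - 1) / (2 * (1 - α)) = α / (1 - α) + -(1 / 2) := by field_simp; ring
      rw [e, rpow_add hκ]
      field_simp
  · have hγ1 : -1 < γ := by
      by_contra hcon
      nlinarith [not_lt.1 hcon]
    have hγ2 : 0 < γ + 1 := by linarith
    have hden : 0 < β - 3 * α + 1 := by linarith
    refine ⟨fun t => t ^ (γ + 1) / (γ + 1), hγ1.le, fun t ht => ?_, ?_, ?_⟩
    · have := (Real.hasDerivAt_rpow_const (p := γ + 1) (Or.inl ht.ne')).div_const (γ + 1)
      rwa [add_sub_cancel_right, mul_div_cancel_left₀ _ hγ2.ne'] at this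
    · have := (tendsto_rpow_div_rpow_zero (lt_add_one γ)).const_mul (γ + 1)
      rw [mul_zero] at this
      refine this.congr fun n => ?_
      rw [div_div_eq_mul_div]
      ring
    · filter_upwards [eventually_gt_atTop 0] with n hn
      have hn0 : (0 : ℝ) < n := cast_pos.2 hn
      rw [Lam, if_neg hb.ne', ← sqrt_eq_rpow, Real.sqrt_eq_iff_mul_self_eq ✓ ✓,
        mul_mul_mul_comm _ (√ _), Real.mul_self_sqrt ✓]
      have e1 : β / (1 - α) = γ + 2 * (α / (1 - α)) := by field_simp; linarith
      have e2 : (β - α + 1) / (1 - α) = γ + 1 + 2 * (α / (1 - α)) := by field_simp; linarith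
      have e3 : γ + 1 = (β - 3 * α + 1) / (1 - α) := by field_simp; linarith
      have e4 : ∀ x : ℝ, 0 < x → x ^ (2 * (α / (1 - α))) = x ^ (α / (1 - α)) * x ^ (α / (1 - α)) :=
        fun x hx => by rw [two_mul, rpow_add hx]
      rw [e1, e2, rpow_add hC, rpow_add (✓ : 0 < (1 - α) * n),
        rpow_add (✓ : 0 < (1 - α) * n), rpow_one, e4 _ hC,
        e4 _ (✓ : 0 < (1 - α) * n), rpow_add hn0, rpow_one,
        show (1 - α) * C * n = C * ((1 - α) * n) by ring, mul_comm (1 - α) C,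
        mul_rpow hC.le hα1.le (z := γ), mul_rpow hα1.le hn0.le (z := γ),
        mul_rpow hC.le (✓ : 0 ≤ (1 - α) * n)]
      have e5 : (γ + 1)⁻¹ = (1 - α) * (β - 3 * α + 1)⁻¹ := by rw [e3, inv_div, div_eq_mul_inv]
      rw [div_eq_mul_inv _ (γ + 1), e5]
      field_simp

/-- The solution of the drift recursion follows the clock. -/
theorem PowerLike.driftSeq_clock {f f₁ f₂ H H₁ : ℝ → ℝ} {α C M K x₀ x₁ : ℝ} (hα : α < 1) (hC : 0 < C)
  (h : PowerLike f f₁ f₂ α C M x₀) (hc : Clock f H H₁ α C K x₁) :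
  Tendsto (driftSeq f) atTop atTop ∧
    Tendsto (fun n : ℕ => driftSeq f n ^ (1 - α) / n) atTop (𝓝 ((1 - α) * C)) ∧
    ∃ l, Tendsto (fun n : ℕ => H (driftSeq f n) - n) atTop (𝓝 l) := by
  have hα1 : 0 < 1 - α := sub_pos.2 hα
  set a := driftSeq f with ha
  have hs : ∀ n, a (n + 1) = a n + f (a n) := fun n => rfl
  have h0 : ∀ n, 0 < a n := fun n => by
    induction n with
    | zero => exact one_pos
    | succ n ih => rw [hs]; exact add_pos ih (h.pos _ ih)
  have hm : Monotone a := monotone_nat_of_le_succ fun n => by rw [hs]; linarith [h.pos _ (h0 n)]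
  have h1 : Tendsto a atTop atTop := by
    refine (tendsto_atTop_of_monotone hm).resolve_right ?_
    rintro ⟨l, hl⟩
    have hl0 : 0 < l := (h0 0).trans_le (hm.ge_of_tendsto hl 0)
    have h2 : Tendsto (fun n => f (a n)) atTop (𝓝 (l - l)) :=
      ((hl.comp (tendsto_add_atTop_nat 1)).sub hl).congr fun n => by
        simp only [Function.comp, hs]; ring
    have h3 := tendsto_nhds_unique h2 ((h.deriv l hl0).continuousAt.tendsto.comp hl)
    linarith [h.pos l hl0]
  have hfa : Tendsto (fun n => f (a n) / a n ^ α) atTop (𝓝 C) := h.tendsto.comp h1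
  have hra : Tendsto (fun n => f (a n) / a n) atTop (𝓝 0) := by
    have := hfa.mul ((tendsto_rpow_neg_atTop hα1).comp h1)
    rw [mul_zero] at this
    refine this.congr fun n => ?_
    simp only [Function.comp]
    rw [neg_sub, rpow_sub_one (h0 n).ne']
    have := rpow_pos_of_pos (h0 n) α
    field_simp
  have hinc : Tendsto (fun n => a (n + 1) ^ (1 - α) - a n ^ (1 - α)) atTop (𝓝 ((1 - α) * C)) := by
    have hd := hasDerivAt_iff_tendsto_slope_zero.1
      (Real.hasDerivAt_rpow_const (x := 1) (p := 1 - α) (Or.inl one_ne_zero))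
    simp only [one_rpow, mul_one, smul_eq_mul] at hd
    have hd' := (hd.comp (tendsto_nhdsWithin_iff.2 ⟨hra, Eventually.of_forall fun n =>
      (div_pos (h.pos _ (h0 n)) (h0 n)).ne'⟩)).mul hfa
    refine hd'.congr fun n => ?_
    have p1 := h.pos _ (h0 n)
    have p2 := h0 n
    have p3 := rpow_pos_of_pos p2 α
    have e : a n + f (a n) = a n * (1 + f (a n) / a n) := by field_simp
    simp only [Function.comp]
    rw [hs, e, mul_rpow p2.le ✓, rpow_sub p2, rpow_one]
    field_simp
  have h2 : Tendsto (fun n : ℕ => a n ^ (1 - α) / n) atTop (𝓝 ((1 - α) * C)) := by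
    have h3 := hinc.cesaro.add ((tendsto_natCast_atTop_atTop (R := ℝ)).inv_tendsto_atTop.mul_const
      (a 0 ^ (1 - α)))
    rw [zero_mul, add_zero] at h3
    refine h3.congr fun n => ?_
    rw [sum_range_sub (fun n => a n ^ (1 - α)), Pi.inv_apply]
    ring
  refine ⟨h1, h2, ?_⟩
  have hO : (fun n => H (a (n + 1)) - H (a n) - 1) =O[atTop] fun n : ℕ => (n : ℝ) ^ (-2 : ℝ) := by
    have h3 : (fun n => H (a (n + 1)) - H (a n) - 1) =O[atTop] fun n => (a n ^ α / a n) ^ 2 :=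
      IsBigO.of_bound K ((h1.eventually_ge_atTop x₁).mono fun n hn => by
        rw [norm_eq_abs, norm_of_nonneg (sq_nonneg _), hs]
        exact hc.step _ hn)
    have h4 : Tendsto (fun n : ℕ => (a n ^ α / a n) ^ 2 / (n : ℝ) ^ (-2 : ℝ)) atTop
      (𝓝 (((1 - α) * C)⁻¹ ^ 2)) := by
      refine ((h2.inv₀ ✓).pow 2).congr fun n => ?_
      rw [rpow_neg n.cast_nonneg, div_inv_eq_mul, rpow_two, ← mul_pow,
        rpow_sub (h0 n), rpow_one, inv_div, div_div_eq_mul_div, div_mul_eq_mul_div, mul_comm]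
    refine h3.trans (isBigO_of_div_tendsto_nhds ?_ _ h4)
    filter_upwards [eventually_gt_atTop 0] with n hn h5
    exact absurd h5 (rpow_pos_of_pos (cast_pos.2 hn) _).ne'
  have hsum := (summable_of_isBigO_nat (Real.summable_nat_rpow.2 (by norm_num)) hO).hasSum.tendsto_sum_nat
  refine ⟨_, (hsum.add_const (H (a 0))).congr fun n => ?_⟩
  rw [sum_sub_distrib, sum_range_sub (fun n => H (a n))]
  simp
  ring

/-- The secant slopes of the clock at nearby points. -/
theorem Clock.tendsto_slope {f H H₁ : ℝ → ℝ} {α C K x₀ κ : ℝ} {x a : ℕ → ℝ}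
  (hc : Clock f H H₁ α C K x₀) (hα : α < 1) (hC : 0 < C) (hκ : 0 < κ)
  (hx : Tendsto x atTop atTop) (ha : Tendsto a atTop atTop)
  (hx' : Tendsto (fun n => x n ^ (1 - α) / n) atTop (𝓝 κ))
  (ha' : Tendsto (fun n => a n ^ (1 - α) / n) atTop (𝓝 κ)) :
  Tendsto (fun n : ℕ => if x n = a n then 1 else
    (x n - a n) / ((H (x n) - H (a n)) * (C * (κ * n) ^ (α / (1 - α))))) atTop (𝓝 1) ∧
  ∀ᶠ n in atTop, x n ≠ a n → H (x n) ≠ H (a n) := by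
  have hα1 : 0 < 1 - α := sub_pos.2 hα
  have hξ : ∀ n, ∃ ξ, min (x n) (a n) ≤ ξ ∧ ξ ≤ max (x n) (a n) ∧
    (x₀ ≤ min (x n) (a n) → H (x n) - H (a n) = H₁ ξ * (x n - a n)) := fun n => by
    wlog hle : a n ≤ x n generalizing x a
    · obtain ⟨ξ, h1, h2, h3⟩ := this ha hx ha' hx' (le_of_not_ge hle)
      exact ⟨ξ, min_comm (a n) _ ▸ h1, max_comm (a n) _ ▸ h2, fun h => by
        linarith [h3 (min_comm (a n) (x n) ▸ h)]⟩
    rw [min_eq_right hle, max_eq_left hle]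
    rcases hle.eq_or_lt with he | hlt
    · exact ⟨a n, le_rfl, hle, fun _ => by rw [he]; ring⟩
    · by_cases h0 : x₀ ≤ a n
      · obtain ⟨ξ, h1, h2⟩ := exists_hasDerivAt_eq_slope H H₁ hlt
          (fun y hy => (hc.deriv y (h0.trans hy.1)).continuousAt.continuousWithinAt)
          (fun y hy => hc.deriv y (h0.trans hy.1.le))
        refine ⟨ξ, h1.1.le, h1.2.le, fun _ => ?_⟩
        rw [h2, div_mul_cancel₀ _ (sub_pos.2 hlt).ne']
      · exact ⟨a n, le_rfl, hle, fun h => absurd h h0⟩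
  choose ξ hξ using hξ
  have hmin : Tendsto (fun n => min (x n) (a n)) atTop atTop := tendsto_atTop.2 fun b => by
    filter_upwards [hx.eventually_ge_atTop b, ha.eventually_ge_atTop b] with n h1 h2 using le_min h1 h2
  have hξt : Tendsto ξ atTop atTop := tendsto_atTop_mono (fun n => (hξ n).1) hmin
  have hξ' : Tendsto (fun n => ξ n ^ (1 - α) / n) atTop (𝓝 κ) := by
    refine tendsto_of_tendsto_of_tendsto_of_le_of_le'
      (g := fun n : ℕ => min (x n ^ (1 - α) / n) (a n ^ (1 - α) / n))
      (h := fun n : ℕ => max (x n ^ (1 - α) / n) (a n ^ (1 - α) / n))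
      (by simpa using hx'.min ha') (by simpa using hx'.max ha') ?_ ?_
    all_goals
      filter_upwards [hmin.eventually_gt_atTop 0] with n hn
      have hx0 := hn.trans_le (min_le_left _ _)
      have ha0 := hn.trans_le (min_le_right _ _)
    · rcases min_choice (x n) (a n) with h | h
      · exact (min_le_left _ _).trans (by gcongr; exact h ▸ (hξ n).1)
      · exact (min_le_right _ _).trans (by gcongr; exact h ▸ (hξ n).1)
    · have h0 := (hn.trans_le (hξ n).1).le
      rcases max_choice (x n) (a n) with h | h
      · exact le_trans (by gcongr; exact h ▸ (hξ n).2.1) (le_max_left _ _)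
      · exact le_trans (by gcongr; exact h ▸ (hξ n).2.1) (le_max_right _ _)
  have hR : Tendsto (fun n : ℕ => H₁ (ξ n) * (C * (κ * n) ^ (α / (1 - α)))) atTop (𝓝 1) := by
    have h1 := ((hξ'.div_const κ).rpow_const (p := α / (1 - α)) (Or.inl ✓)).inv₀
      ✓
    have h2 := ((hc.tendsto.comp hξt).mul h1).mul_const C
    rw [div_self hκ.ne', one_rpow, inv_one, mul_one, inv_mul_cancel₀ hC.ne'] at h2
    refine h2.congr' ?_
    filter_upwards [hξt.eventually_gt_atTop 0, eventually_gt_atTop 0] with n hn hn0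
    have hn0 : (0 : ℝ) < n := cast_pos.2 hn0
    have e : ((ξ n) ^ (1 - α) / n / κ) ^ (α / (1 - α)) = ξ n ^ α / (κ * n) ^ (α / (1 - α)) := by
      rw [div_div, div_rpow ✓ ✓, ← rpow_mul hn.le, mul_div_cancel₀ _ hα1.ne', mul_comm κ]
    have p := rpow_pos_of_pos hn α
    simp only [Function.comp]
    rw [e]
    field_simp
  have hev : ∀ᶠ n in atTop, H (x n) - H (a n) = H₁ (ξ n) * (x n - a n) ∧
    H₁ (ξ n) * (C * (κ * n) ^ (α / (1 - α))) ≠ 0 := by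
    filter_upwards [hmin.eventually_ge_atTop x₀, hR.eventually_ne one_ne_zero] with n h1 h2
    exact ⟨(hξ n).2.2 h1, h2⟩
  constructor
  · have := hR.inv₀ one_ne_zero
    rw [inv_one] at this
    refine (Tendsto.if' (p := fun n => x n = a n) tendsto_const_nhds this).congr' ?_
    filter_upwards [hev] with n ⟨h1, h2⟩
    split_ifs with h
    · rfl
    · have h3 : x n - a n ≠ 0 := sub_ne_zero.2 h
      rw [h1, mul_right_comm, div_mul_cancel_right₀ h3]
  · filter_upwards [hev] with n ⟨h1, h2⟩ h3
    rw [← sub_ne_zero, h1]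
    exact mul_ne_zero (left_ne_zero_of_mul h2) (sub_ne_zero.2 h3)

/-- The central limit theorem. -/
theorem OneStep.tendsto_cdfAlong_gaussianReal (h : W.OneStep u C α β ν)
  (huv : W.PerronVectors u v) (hm : W.meanMatrix.IsPrimitive) (hα0 : 0 < α) (hβ1 : β < 1 + α)
  (hβ : 3 * α - 1 ≤ β) (hA : 0 < P W.Unlimited) (hpos : ∀ x, 0 < x → 0 < f x)
  (hsm : ContDiffOn ℝ 2 f (Ioi 0))
  (hf : ∀ z : Pop, z ≠ 0 → u ⬝ᵥ W.h z = f (u ⊙ z))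
  (hf₂ : (fun x => deriv (deriv f) x) =O[atTop] fun x : ℝ => x ^ (α - 2)) (x : Vec) :
  Tendsto (fun n : ℕ => (cond P W.Unlimited).real
    {o | ∀ i, ((W.Z n o i : ℝ) - v i * driftSeq f n) / Lam α β ν C n ≤ x i}) atTop
    (𝓝 (cdfAlong (gaussianReal 0 1) v x)) := by
  have hC := h.C_pos
  have hα1 : 0 < 1 - α := by linarith
  have := cond_isProbabilityMeasure hA.ne'
  have hAr : P.real W.Unlimited ≠ 0 := (measureReal_ne_zero_iff (measure_ne_top _ _)).2 hA.ne'
  have hlat : ∃ a : ℝ, 0 < a ∧ Tendsto (fun k : ℕ => f (k * a) / (k * a) ^ α) atTop (𝓝 C) := by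
    have := h.p_pos
    refine ⟨u 0, h.u_pos 0, ?_⟩
    have hz : ∀ k : ℕ, u ⊙ (Pi.single (0 : Fin p) k : Pop) = k * u 0 := fun k => by
      have : realVec (Pi.single (0 : Fin p) k : Pop) = Pi.single 0 (k : ℝ) := by
        ext i; by_cases hi : i = 0 <;> simp [realVec, hi]
      rw [this, dotProduct_single, mul_comm]
    have hg : Tendsto (fun k : ℕ => (Pi.single (0 : Fin p) k : Pop)) atTop (growing p) := by
      refine tendsto_comap_iff.2 (tendsto_atTop_mono (fun k => ?_) tendsto_natCast_atTop_atTop)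
      have := norm_le_pi_norm (realVec (Pi.single (0 : Fin p) k : Pop)) 0
      simpa [realVec] using this
    refine (h.drift.comp hg).congr' ?_
    filter_upwards [eventually_gt_atTop 0] with k hk
    have : (Pi.single (0 : Fin p) k : Pop) ≠ 0 := by simpa using hk.ne'
    simp only [Function.comp, hf _ this, hz]
  obtain ⟨a₀, ha₀, hlat⟩ := hlat
  obtain ⟨M, x₁, hP⟩ := exists_powerLike hα0 h.α_lt hC ha₀ hpos hsm hlat hf₂
  obtain ⟨H, H₁, K, hc⟩ := hP.exists_clock hα0 h.α_lt hC
  obtain ⟨ha1, ha2, l, ha3⟩ := hP.driftSeq_clock h.α_lt hC hc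
  have hγ : (β - 2 * α) / (1 - α) * (1 - α) = β - 2 * α := div_mul_cancel₀ _ hα1.ne'
  obtain ⟨s, hs, hs1, hs2, hL⟩ := exists_Lam_eq h.α_lt hC h.ν_pos hβ hγ
  set Q := cond P W.Unlimited with hQ
  set a := driftSeq f
  set x' : ℕ → Ω → ℝ := fun n o => u ⊙ W.Z n o with hx'
  set D : ℕ → ℝ := fun n => C * ((1 - α) * C * n) ^ (α / (1 - α)) with hD
  have hmeas : ∀ (n : ℕ) (g : ℝ → ℝ), AEMeasurable (fun o => g (x' n o)) Q := fun n g =>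
    ((measurable_of_countable fun z : Pop => g (u ⊙ z)).comp (W.measurable_Z n)).aemeasurable
  set U : ℕ → Ω → ℝ := fun n o => (H (max (x' n o) x₁) - n) / s n with hU
  have hUd : TendstoInDistribution U atTop (fun t : ℝ => t) (fun _ => Q) (gaussianReal 0 1) := by
    refine ⟨fun n => hmeas n fun t => (H (max t x₁) - n) / s n, aemeasurable_id, ?_⟩
    refine ProbabilityMeasure.tendsto_iff_tendsto_charFun.2 fun t => ?_
    have h1 := (h.tendsto_charFun_clock hα0 hβ1 hβ hc hf hγ hs hs1 hs2 t).const_smul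
      (P.real W.Unlimited)⁻¹
    have e : charFun (gaussianReal 0 1) t = (P.real W.Unlimited)⁻¹ •
      ((exp (-(t ^ 2 / 2)) * P.real W.Unlimited : ℝ) : ℂ) := by
      rw [charFun_gaussianReal, Complex.real_smul, mul_comm (exp _), ← Complex.ofReal_mul (_)⁻¹,
        inv_mul_cancel_left₀ hAr]
      simp
    simp only [ProbabilityMeasure.coe_mk, Measure.map_id', e]
    refine h1.congr fun n => ?_
    rw [charFun_apply_real, integral_map (hmeas n fun t => (H (max t x₁) - n) / s n) (by fun_prop),
      integral_cond_eq]
    congr 2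
    ext o
    change _ = Complex.exp (t * ((H (max (u ⊙ W.Z n o) x₁) - n) / s n : ℝ) * Complex.I)
    push_cast
    ring_nf
  have hae : ∀ᵐ o ∂Q, Tendsto (fun n => x' n o) atTop atTop ∧
    Tendsto (fun n : ℕ => x' n o ^ (1 - α) / n) atTop (𝓝 ((1 - α) * C)) := by
    have h1 : ∀ᵐ o ∂Q, o ∈ W.Unlimited := ae_cond_mem W.measurableSet_unlimited
    have h2 : ∀ᵐ o ∂Q, _ := cond_absolutelyContinuous.ae_le (h.ae_tendsto_rpow_div hβ1)
    filter_upwards [h1, h2] with o h3 h4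
    exact ⟨(tendsto_dot_growing h.u_pos).comp (tendsto_growing_of_mem_unlimited h3), h4 h3⟩
  set r : ℕ → ℝ → ℝ := fun n t => if t = a n then 1 else (t - a n) / ((H t - H (a n)) * D n) with hr
  have hb : Tendsto (fun n => (H (a n) - n) / s n) atTop (𝓝 0) := ha3.div_atTop hs
  have hr1 : ∀ᵐ o ∂Q, Tendsto (fun n => r n (x' n o)) atTop (𝓝 1) ∧
    Tendsto (fun n => (x' n o - a n) / Lam α β ν C n - r n (x' n o) * U n o) atTop (𝓝 0) := by
    filter_upwards [hae] with o ⟨h1, h2⟩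
    obtain ⟨h3, h4⟩ := hc.tendsto_slope h.α_lt hC ✓ h1 ha1 h2 ha2
    refine ⟨h3, ?_⟩
    have h5 := (h3.mul hb).neg
    rw [mul_zero, neg_zero] at h5
    refine h5.congr' ?_
    filter_upwards [h4, hL, h1.eventually_ge_atTop x₁, hs.eventually_gt_atTop 0,
      eventually_gt_atTop 0] with n h6 h7 h8 h9 h10
    have h10 : (0 : ℝ) < n := cast_pos.2 h10
    have hD0 : 0 < D n := ✓
    have hs0 := h9.ne'
    simp only [hU, hr, h7, max_eq_left h8]
    change _ = (x' n o - a n) / (D n * s n) - _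
    split_ifs with he
    · rw [he]; simp
    · have h11 := sub_ne_zero.2 (h6 he)
      change -((x' n o - a n) / ((H (x' n o) - H (a n)) * D n) * _) = _
      field_simp
      ring
  have hmeas' : ∀ n, AEMeasurable (fun o => (r n (x' n o),
    (x' n o - a n) / Lam α β ν C n - r n (x' n o) * U n o)) Q := fun n =>
    (hmeas n (r n)).prodMk (hmeas n fun t => (t - a n) / Lam α β ν C n - r n t *
      ((H (max t x₁) - n) / s n))
  have hpair := hUd.continuous_comp_prodMk_of_tendstoInMeasure_const
    (g := fun q : ℝ × ℝ × ℝ => q.2.1 * q.1 + q.2.2) (by fun_prop)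
    (Y := fun n o => (r n (x' n o), (x' n o - a n) / Lam α β ν C n - r n (x' n o) * U n o))
    (c := ((1 : ℝ), (0 : ℝ)))
    (tendstoInMeasure_of_tendsto_ae (fun n => (hmeas' n).aestronglyMeasurable) (by
      filter_upwards [hr1] with o ho
      exact ho.1.prodMk_nhds ho.2)) hmeas'
  have := nullSingletonClass_gaussianReal (μ := 0) (one_ne_zero (α := NNReal))
  refine h.tendsto_cond_cdfAlong huv hm hA.ne' ?_ ?_ (L := gaussianReal 0 1) (fun t => ?_) x
  · have hκ : ((1 - α) * C) ^ (α / (1 - α)) ≠ 0 := ✓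
    have h1 : Tendsto (fun n : ℕ => (n : ℝ) ^ (max α (β / 2) / (1 - α)) /
      ((n : ℝ) ^ (α / (1 - α)) * s n))
      atTop (𝓝 0) := by
      rcases le_total α (β / 2) with hle | hle
      · refine hs1.congr' ?_
        filter_upwards [eventually_gt_atTop 0] with n hn
        rw [max_eq_right hle, ← div_div, ← rpow_sub (cast_pos.2 hn)]
        congr 2
        field_simp
      · refine hs.inv_tendsto_atTop.congr' ?_
        filter_upwards [eventually_gt_atTop 0] with n hn
        rw [max_eq_left hle, ← div_div, div_self (rpow_pos_of_pos (cast_pos.2 hn) _).ne',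
          one_div, Pi.inv_apply]
    have h2 := h1.div_const (C * ((1 - α) * C) ^ (α / (1 - α)))
    rw [zero_div] at h2
    refine h2.congr' ?_
    filter_upwards [hL] with n hn
    rw [hn, mul_rpow ✓ n.cast_nonneg, div_div]
    ring_nf
  · filter_upwards [hL, hs.eventually_gt_atTop 0, eventually_gt_atTop 0] with n h1 h2 h3
    have h3 : (0 : ℝ) < n := cast_pos.2 h3
    rw [h1]
    positivity
  · have hmain := ProbabilityMeasure.tendsto_measure_of_null_frontier_of_tendsto' hpair.tendsto
      (E := Iic t) (by simp)
    simp only [ProbabilityMeasure.coe_mk, one_mul, add_zero, Measure.map_id'] at hmain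
    have h1 := (tendsto_toReal (measure_ne_top _ _)).comp hmain
    refine h1.congr fun n => ?_
    simp only [Function.comp]
    rw [Measure.map_apply_of_aemeasurable (hpair.forall_aemeasurable n) measurableSet_Iic,
      measureReal_def]
    congr 2
    ext o
    simp [hx']

end MBPM

end

theorem theorem3 {Ω : Type*} [MeasurableSpace Ω] (P : Measure Ω) [IsProbabilityMeasure P]
    (p : ℕ) (W : MBPM P p) (u v : Fin p → ℝ)
    (hmom : W.FiniteSecondMoments)
    (hA : W.HypothesisA) (huv : W.PerronVectors u v) (hB : W.HypothesisB)
    (hgrow : W.CanGrow)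
    -- the process is not almost surely identically zero
    (hnontriv : ¬ ∀ᵐ ω ∂P, ∀ n, W.Z n ω = 0)
    -- the mean migration in direction `u` is a positive `C²` function of the size in direction `u`
    (hbar : ℝ → ℝ) (hbar_pos : ∀ x, 0 < x → 0 < hbar x)
    (hbar_smooth : ContDiffOn ℝ 2 hbar (Set.Ioi 0))
    (hbar_eq : ∀ z : Fin p → ℕ, z ≠ 0 → u ⬝ᵥ W.h z = hbar (u ⬝ᵥ realVec z))
    -- (i)
    (α : ℝ) (hα : α < 1) (c : Fin p → ℝ) (hc : 0 < u ⬝ᵥ c)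
    (hi : ∀ i, (fun z => W.h z i - c i * (u ⬝ᵥ realVec z) ^ α)
      =o[growing p] fun z => (u ⬝ᵥ realVec z) ^ α)
    -- (ii)
    (β ν : ℝ) (hβ : β ≤ 1 + α) (hν : 0 < ν)
    (hii : (fun z => W.sigmaSq u z - ν * (u ⬝ᵥ realVec z) ^ β)
      =o[growing p] fun z => (u ⬝ᵥ realVec z) ^ β)
    -- (iii)
    (δ : ℝ) (hδ : 0 < δ) (hδ' : δ ≤ 1)
    (hiii_int : ∀ i, ∀ᶠ z in growing p,
      Integrable (fun ω => |(W.M 0 z ω i : ℝ) - W.h z i| ^ (2 + δ)) P)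
    (hiii_size : ∀ i, (fun z => ∫ ω, |(z i : ℝ) + (W.M 0 z ω i : ℝ)| ^ (1 + δ / 2) ∂P)
      =O[growing p] fun z => (W.sigmaSq u z) ^ (1 + δ / 2))
    (hiii_dev : ∀ i, (fun z => ∫ ω, |(W.M 0 z ω i : ℝ) - W.h z i| ^ (2 + δ) ∂P)
      =O[growing p] fun z => (W.sigmaSq u z) ^ (1 + δ / 2))
    -- (iv)
    (δ₁ : ℝ) (hδ₁ : δ₁ < 1)
    (hiv : ∀ i, (fun z => |W.h z i|) =O[growing p] fun z => (u ⬝ᵥ realVec z) ^ δ₁)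
    -- (v)
    (α' : ℝ) (hα' : 1 < α') (hα'' : α' ≤ 2) (δ₂ : ℝ) (hδ₂ : δ₂ < 1)
    (hv_size : ∀ i, (fun z => (z i : ℝ) + W.h z i)
      =O[growing p] fun z => (u ⬝ᵥ realVec z) ^ (δ₂ * α'))
    (hv_dev : ∀ i, (fun z => ∫ ω, |(W.M 0 z ω i : ℝ) - W.h z i| ^ α' ∂P)
      =O[growing p] fun z => (u ⬝ᵥ realVec z) ^ (δ₂ * α')) :
    -- a)
    (β = 1 + α → ν < 2 * (u ⬝ᵥ c) →
      0 < P W.Unlimited ∧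
      ∀ x : Fin p → ℝ,
        Tendsto (fun n : ℕ => (cond P W.Unlimited).real
            {ω | ∀ i, (W.Z n ω i : ℝ) / (n : ℝ) ^ (1 / (1 - α)) ≤ x i}) atTop
          (𝓝 (cdfAlong (gammaRootLaw (1 - α)
            ((2 * (u ⬝ᵥ c) - ν * α) / (ν * (1 - α))) (ν * (1 - α) ^ 2 / 2)) v x))) ∧
    -- b)
    (0 < α → β < α + 1 →
      0 < P W.Unlimited ∧
      -- convergence in `L¹`
      (Integrable (fun ω => realVec (W.Z 0 ω)) P →
        Tendsto (fun n : ℕ => eLpNorm (fun ω => (n : ℝ) ^ (1 / (α - 1)) • realVec (W.Z n ω) -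
            ((u ⬝ᵥ c) * (1 - α)) ^ (1 / (1 - α)) • v) 1 (P.restrict W.Unlimited)) atTop (𝓝 0)) ∧
      -- asymptotic normality
      ((fun x => deriv (deriv hbar) x) =O[atTop] (fun x : ℝ => x ^ (α - 2)) →
        3 * α - 1 ≤ β → max δ₁ δ₂ ≤ (β - α + 1) / 2 →
        ∀ x : Fin p → ℝ,
          Tendsto (fun n : ℕ => (cond P W.Unlimited).real
              {ω | ∀ i, ((W.Z n ω i : ℝ) - v i * driftSeq hbar n) /
                Lam α β ν (u ⬝ᵥ c) n ≤ x i}) atTop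
            (𝓝 (cdfAlong (gaussianReal 0 1) v x)))) := by
  have hdrift : ∀ z : Fin p → ℕ, z ≠ 0 → 0 < u ⬝ᵥ W.h z := fun z hz => by
    obtain ⟨i, hi⟩ := Function.ne_iff.1 hz
    rw [hbar_eq z hz]
    refine hbar_pos _ (Finset.sum_pos' (fun j _ => mul_nonneg (huv.2.2.1 j).le (Nat.cast_nonneg _))
      ⟨i, Finset.mem_univ i, mul_pos (huv.2.2.1 i) (Nat.cast_pos.2 (Nat.pos_of_ne_zero hi))⟩)
  have h := MBPM.oneStep hmom huv hdrift hα hc hi hβ hν hii hδ hδ'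
    (W.eventually_migrationBounds huv.2.2.1 hδ hii hiii_int hiii_size hiii_dev)
  refine ⟨fun hb hlt => ?_, fun hα0 hb => ?_⟩
  · have hU := h.measure_unlimited_pos (by simpa [hb] using h.diffusive) hlt hnontriv
    exact ⟨hU, h.tendsto_cdfAlong_gammaRootLaw huv hA.1 hb hlt hU⟩
  · rw [add_comm] at hb
    have hU := h.measure_unlimited_pos (by simpa [hb.ne] using h.diffusive) (by linarith) hnontriv
    exact ⟨hU, h.tendsto_eLpNorm huv hA.1 hb, fun hf₂ hb3 _ x =>
      h.tendsto_cdfAlong_gaussianReal huv hA.1 hα0 hb hb3 hU hbar_pos hbar_smooth hbar_eq hf₂ x⟩
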